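/- Let $n\ge 1$ and let $Z$ be a complex contact manifold of complex dimension $2n+1$, i.e. a (Hausdorff, second countable) complex manifold with an open cover $\{U_i\}$, holomorphic $1$-forms $\theta_i$ on $U_i$ with $\theta_i\wedge(d\theta_i)^n\neq 0$ everywhere, and nowhere zero holomorphic functions $f_{ij}$ on $U_i\cap U_j$ with $\theta_i=f_{ij}\theta_j$. Let $E=\{f_{ij}\}$ be the contact line bundle, $L=E^{-1}$ the holomorphic line bundle with fibre coordinates $z_i$ over $U_i$ satisfying $z_i=f_{ij}^{-1}z_j$, let $\mathscr U(Z)=\mathrm{Tot}(L^\times)$ be the total space of $L$ without its zero section, $\pi:\mathscr U(Z)\to Z$ the projection, and let $\vartheta$ be the global holomorphic $1$-form on $\mathscr U(Z)$ equal to $z_i\,\pi^*\theta_i$ over $U_i$. Then $\pi:\mathscr U(Z)\to Z$ is a holomorphic principal $\mathbb C^\times$-bundle, and $L$ admits smooth Hermitian structures. For every smooth Hermitian structure on $L$, with norm $\|\cdot\|$, the unit circle bundle $Q=\{u\in L:\|u\|=1\}$ carries a structure of smooth manifold of dimension $4n+3$ for which $u\mapsto(u/\|u\|,\,t(u))$,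 $t(u)=\log\|u\|$, is a diffeomorphism $\mathscr U(Z)\cong Q\times\mathbb R$; $\pi_Q=\pi|_Q:Q\to Z$ is a smooth principal $\mathrm U(1)$-bundle, and the following hold. (A) There is an almost contact metric $3$-structure $(g_Q,\Phi_\alpha,\xi_\alpha,\eta_\alpha)$, $\alpha=1,2,3$, on $Q$, that is, a Riemannian metric, endomorphism fields, vector fields and $1$-forms with $\Phi_\alpha^2=-\mathrm{Id}+\eta_\alpha\otimes\xi_\alpha$, $\eta_\alpha(\xi_\alpha)=1$, and, for all cyclic permutations $(\alpha,\beta,\gamma)$ of $(1,2,3)$, $\Phi_\alpha\Phi_\beta-\eta_\beta\otimes\xi_\alpha=-\Phi_\beta\Phi_\alpha+\eta_\alpha\otimes\xi_\beta=\Phi_\gamma$, $\Phi_\alpha\xi_\beta=-\Phi_\beta\xi_\alpha=\xi_\gamma$, $\eta_\alpha\circ\Phi_\beta=-\eta_\beta\circ\Phi_\alpha=\eta_\gamma$, and $g_Q(\xi_\alpha,\cdot)=\eta_\alpha$, $g_Q(\Phi_\alpha X,\Phi_\alpha Y)=g_Q(X,Y)-\eta_\alpha(X)\eta_\alpha(Y)$,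 such that: (1) $[\Phi_1,\Phi_1]+2\,d\eta_1\otimes\xi_1=0$ (normality), the flow of $\xi_1$ is the action of $\mathrm U(1)$, whose orbits are the fibres of $\pi_Q$ (so $Z=Q/\mathscr F_{\xi_1}$), and $\mathscr L_{\xi_1}g_Q=0$; (2) $\eta_2\wedge(d\eta_2)^{2n+1}=\eta_3\wedge(d\eta_3)^{2n+1}$, and this form vanishes nowhere; (3) $d\eta_\alpha=g_Q(\Phi_\alpha\cdot,\cdot)$ for $\alpha=2,3$ (contact metric structures); (4) $\eta_2+\sqrt{-1}\,\eta_3=\vartheta|_Q$. (B) Under $\mathscr U(Z)\cong Q\times\mathbb R$, the formulas $\mathbb I_\alpha(X)=\Phi_\alpha(X)-\eta_\alpha(X)\frac{d}{dt}$ for $X\in TQ$, $\mathbb I_\alpha(\frac{d}{dt})=\xi_\alpha$, and $g_{\mathscr U}=e^{t}(g_Q+dt\otimes dt)$ define an almost hyperhermitian structure $(g_{\mathscr U},\mathbb I_1,\mathbb I_2,\mathbb I_3)$ on $\mathscr U(Z)$: smooth, $\mathbb I_\alpha^2=-\mathrm{Id}$, $\mathbb I_\alpha\mathbb I_\beta=-\mathbb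 I_\beta\mathbb I_\alpha=\mathbb I_\gamma$ for cyclic $(\alpha,\beta,\gamma)$, and $g_{\mathscr U}$ is invariant under each $\mathbb I_\alpha$. Moreover: (1) $\mathbb I_1$ is the natural complex structure of $\mathscr U(Z)$, and $[\mathbb I_1,\mathbb I_1]=0$; (2) $\omega_\alpha=g_{\mathscr U}(\mathbb I_\alpha\cdot,\cdot)$, $\alpha=2,3$, are symplectic forms; (3) $\Upsilon=\omega_2+\sqrt{-1}\,\omega_3=d\vartheta$, and it is a holomorphic symplectic form on $(\mathscr U(Z),\mathbb I_1)$. -/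

import Mathlib

open Bundle Manifold Set Complex
open scoped Manifold ContDiff Topology ComplexConjugate

noncomputable section

/-! ### Differential forms on manifolds (without boundary) -/

section Forms

variable {𝕜 : Type*} [NontriviallyNormedField 𝕜]
  {F : Type*} [NormedAddCommGroup F] [NormedSpace 𝕜 F]
  {H : Type*} [TopologicalSpace H] (I : ModelWithCorners 𝕜 F H)
  {M : Type*} [TopologicalSpace M] [ChartedSpace H M]
  {V : Type*} [NormedAddCommGroup V] [NormedSpace 𝕜 V] {k : ℕ}

/-- The expression of a `k`-form `α` in the preferred chart at `x₀`, i.e. the pull-back of `α` under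
the inverse of the chart. -/
def formInChart (α : ∀ x : M, TangentSpace I x [⋀^Fin k]→L[𝕜] V) (x₀ : M) (y : F) :
    F [⋀^Fin k]→L[𝕜] V :=
  (α ((extChartAt I x₀).symm y)).compContinuousLinearMap
    (mfderiv 𝓘(𝕜, F) I (extChartAt I x₀).symm y)

/-- The `k`-form `α` is of class `C^r` on the open set `s`: its expression in every preferred chart
is of class `C^r`. Over `ℂ` and for `r = ω` these are the holomorphic `k`-forms. -/
def IsSmoothFormOn (r : ℕ∞ω) (α : ∀ x : M, TangentSpace I x [⋀^Fin k]→L[𝕜] V) (s : Set M) : Prop :=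
  ∀ x₀ : M, ContDiffOn 𝕜 r (formInChart I α x₀)
    ((extChartAt I x₀).target ∩ (extChartAt I x₀).symm ⁻¹' s)

/-- The exterior derivative of a `k`-form on a manifold, computed in the preferred chart at each
point. For a `1`-form, `dα(X, Y) = X(α(Y)) - Y(α(X)) - α([X, Y])`. -/
def extDerivForm (α : ∀ x : M, TangentSpace I x [⋀^Fin k]→L[𝕜] V) (x : M) :
    TangentSpace I x [⋀^Fin (k + 1)]→L[𝕜] V :=
  (extDeriv (formInChart I α x) (extChartAt I x x)).compContinuousLinearMap
    (mfderiv I 𝓘(𝕜, F) (extChartAt I x) x)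

/-- A field of covectors seen as an alternating `1`-form. -/
def oneForm (α : ∀ x : M, TangentSpace I x →L[𝕜] V) (x : M) : TangentSpace I x [⋀^Fin 1]→L[𝕜] V :=
  ContinuousAlternatingMap.ofSubsingleton 𝕜 (TangentSpace I x) V (0 : Fin 1) (α x)

/-- The exterior derivative of a `1`-form, as a function of two tangent vectors. -/
def dOne (α : ∀ x : M, TangentSpace I x →L[𝕜] V) (x : M) (X Y : TangentSpace I x) : V :=
  extDerivForm I (oneForm I α) x ![X, Y]

/-- A symplectic form (over `ℝ`, with `r = ∞`), or a holomorphic symplectic form (over `ℂ`, with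
`r = ω`): a closed nondegenerate `2`-form of class `C^r`. -/
structure IsSymplecticForm (r : ℕ∞ω) (α : ∀ x : M, TangentSpace I x [⋀^Fin 2]→L[𝕜] 𝕜) : Prop where
  smooth : IsSmoothFormOn I r α univ
  closed : ∀ x, extDerivForm I α x = 0
  nondegenerate : ∀ x (X : TangentSpace I x), (∀ Y : TangentSpace I x, α x ![X, Y] = 0) → X = 0

end Forms

/-- The `(2m+1)`-form `η ∧ β ^ m`, for a linear form `η` and an alternating bilinear form `β`:
`(η ∧ β ^ m)(v) = (1 / 2 ^ m) ∑ σ, sign σ * η (v (σ 0)) * ∏ k, β (v (σ (2k+1)), v (σ (2k+2)))`. -/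
def wedgePow {𝕜 V : Type*} [Field 𝕜] (η : V → 𝕜) (β : V → V → 𝕜) (m : ℕ)
    (v : Fin (2 * m + 1) → V) : 𝕜 :=
  ((2 : 𝕜) ^ m)⁻¹ * ∑ σ : Equiv.Perm (Fin (2 * m + 1)),
    ((Equiv.Perm.sign σ : ℤ) : 𝕜) * η (v (σ 0)) *
      ∏ k : Fin m, β (v (σ ⟨2 * k + 1, by omega⟩)) (v (σ ⟨2 * k + 2, by omega⟩))

/-! ### Tensor fields on real manifolds -/

section Tensors

variable {F : Type*} [NormedAddCommGroup F] [NormedSpace ℝ F]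
  {H : Type*} [TopologicalSpace H] (I : ModelWithCorners ℝ F H)
  {M : Type*} [TopologicalSpace M] [ChartedSpace H M]

/-- Smoothness of a vector field. -/
def IsSmoothVF [IsManifold I ∞ M] (X : ∀ x : M, TangentSpace I x) : Prop :=
  ContMDiff I I.tangent ∞ (fun x => (⟨x, X x⟩ : TangentBundle I M))

/-- Smoothness of a field of endomorphisms of the tangent spaces. -/
def IsSmoothEnd [IsManifold I ∞ M] (A : ∀ x : M, TangentSpace I x →L[ℝ] TangentSpace I x) : Prop :=
  ContMDiff I (I.prod 𝓘(ℝ, F →L[ℝ] F)) ∞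
    (fun x => TotalSpace.mk' (F →L[ℝ] F)
      (E := fun x : M => TangentSpace I x →L[ℝ] TangentSpace I x) x (A x))

/-- The bracket `[A, A]` of a field of endomorphisms with itself, evaluated on vector fields:
`[A, A](X, Y) = 2 ([AX, AY] + A²[X, Y] - A[AX, Y] - A[X, AY])`. -/
def nijenhuis (A : ∀ x : M, TangentSpace I x →L[ℝ] TangentSpace I x)
    (X Y : ∀ x : M, TangentSpace I x) (x : M) : TangentSpace I x :=
  (2 : ℝ) • (VectorField.mlieBracket I (fun y => A y (X y)) (fun y => A y (Y y)) x
    + A x (A x (VectorField.mlieBracket I X Y x))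
    - A x (VectorField.mlieBracket I (fun y => A y (X y)) Y x)
    - A x (VectorField.mlieBracket I X (fun y => A y (Y y)) x))

variable (M) in
/-- A smooth Riemannian metric on the manifold `M`. -/
abbrev RiemMetric [IsManifold I ∞ M] :=
  ContMDiffRiemannianMetric (E := fun x : M => TangentSpace I x) I ∞ F

variable {I} in
/-- `𝓛_ξ g = 0`, i.e. `ξ(g(X, Y)) = g([ξ, X], Y) + g(X, [ξ, Y])` for all vector fields. -/
def RiemMetric.IsKilling [IsManifold I ∞ M] (g : RiemMetric I M) (ξ : ∀ x : M, TangentSpace I x) :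
    Prop :=
  ∀ X Y : ∀ x : M, TangentSpace I x, IsSmoothVF I X → IsSmoothVF I Y → ∀ x : M,
    mfderiv I 𝓘(ℝ, ℝ) (fun y => g.inner y (X y) (Y y)) x (ξ x) =
      g.inner x (VectorField.mlieBracket I ξ X x) (Y x)
        + g.inner x (X x) (VectorField.mlieBracket I ξ Y x)

variable (M) in
/-- An almost contact metric 3-structure `(g, Φ_α, ξ_α, η_α)`. The indices `1, 2, 3` are
`0, 1, 2 : Fin 3`; the cyclic permutations of `(1, 2, 3)` are the triples `(α, α + 1, α + 2)`. -/
structure AlmostContactMetric3Structure [IsManifold I ∞ M] where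
  g : RiemMetric I M
  Φ : Fin 3 → ∀ x : M, TangentSpace I x →L[ℝ] TangentSpace I x
  ξ : Fin 3 → ∀ x : M, TangentSpace I x
  η : Fin 3 → ∀ x : M, TangentSpace I x →L[ℝ] ℝ
  smooth_Φ : ∀ α, IsSmoothEnd I (Φ α)
  smooth_ξ : ∀ α, IsSmoothVF I (ξ α)
  smooth_η : ∀ α, IsSmoothFormOn I ∞ (oneForm I (η α)) univ
  η_ξ : ∀ α x, η α x (ξ α x) = 1
  Φ_Φ_self : ∀ α x X, Φ α x (Φ α x X) = -X + η α x X • ξ α x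
  Φ_Φ : ∀ α x X, Φ α x (Φ (α + 1) x X) - η (α + 1) x X • ξ α x = Φ (α + 2) x X
  Φ_Φ' : ∀ α x X, -Φ (α + 1) x (Φ α x X) + η α x X • ξ (α + 1) x = Φ (α + 2) x X
  Φ_ξ : ∀ α x, Φ α x (ξ (α + 1) x) = ξ (α + 2) x
  Φ_ξ' : ∀ α x, -Φ (α + 1) x (ξ α x) = ξ (α + 2) x
  η_Φ : ∀ α x X, η α x (Φ (α + 1) x X) = η (α + 2) x X
  η_Φ' : ∀ α x X, -η (α + 1) x (Φ α x X) = η (α + 2) x X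
  g_ξ : ∀ α x X, g.inner x (ξ α x) X = η α x X
  g_Φ : ∀ α x X Y, g.inner x (Φ α x X) (Φ α x Y) = g.inner x X Y - η α x X * η α x Y

variable {I} in
/-- Normality of the `α`-th almost contact structure: `[Φ, Φ] + 2 dη ⊗ ξ = 0`. -/
def AlmostContactMetric3Structure.IsNormal [IsManifold I ∞ M]
    (S : AlmostContactMetric3Structure I M) (α : Fin 3) : Prop :=
  ∀ X Y : ∀ x : M, TangentSpace I x, IsSmoothVF I X → IsSmoothVF I Y → ∀ x : M,
    nijenhuis I (S.Φ α) X Y x + (2 * dOne I (S.η α) x (X x) (Y x)) • S.ξ α x = 0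

variable {I} in
/-- `(g, Φ_α, ξ_α, η_α)` is a contact metric structure on a manifold of dimension `2m + 1`:
`η ∧ (dη) ^ m` vanishes nowhere and `dη = g(Φ ⊗ Id)` (the remaining requirements hold for every
almost contact metric 3-structure). -/
def AlmostContactMetric3Structure.IsContactMetric [IsManifold I ∞ M]
    (S : AlmostContactMetric3Structure I M) (m : ℕ) (α : Fin 3) : Prop :=
  (∀ x, wedgePow (S.η α x) (dOne I (S.η α) x) m ≠ 0) ∧
    ∀ x X Y, dOne I (S.η α) x X Y = S.g.inner x (S.Φ α x X) Y

variable (M) in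
/-- An almost hyperhermitian structure `(g, I_1, I_2, I_3)`; the indices `1, 2, 3` are
`0, 1, 2 : Fin 3`. -/
structure AlmostHyperhermitianStructure [IsManifold I ∞ M] where
  g : RiemMetric I M
  J : Fin 3 → ∀ x : M, TangentSpace I x →L[ℝ] TangentSpace I x
  smooth_J : ∀ α, IsSmoothEnd I (J α)
  J_J_self : ∀ α x X, J α x (J α x X) = -X
  J_J : ∀ α x X, J α x (J (α + 1) x X) = J (α + 2) x X
  J_J' : ∀ α x X, -J (α + 1) x (J α x X) = J (α + 2) x X
  g_J : ∀ α x X Y, g.inner x (J α x X) (J α x Y) = g.inner x X Y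

end Tensors

/-! ### Principal bundles -/

/-- `p : P → B`, with the action of `G` on `P`, is a (locally trivial) principal `G`-bundle of
class `C^r` over `𝕜`. -/
def IsPrincipalBundle {𝕜 : Type*} [NontriviallyNormedField 𝕜]
    {F₁ F₂ F₃ : Type*} [NormedAddCommGroup F₁] [NormedSpace 𝕜 F₁] [NormedAddCommGroup F₂]
    [NormedSpace 𝕜 F₂] [NormedAddCommGroup F₃] [NormedSpace 𝕜 F₃]
    {H₁ H₂ H₃ : Type*} [TopologicalSpace H₁] [TopologicalSpace H₂] [TopologicalSpace H₃]
    (IG : ModelWithCorners 𝕜 F₁ H₁) (IP : ModelWithCorners 𝕜 F₂ H₂) (IB : ModelWithCorners 𝕜 F₃ H₃)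
    (r : ℕ∞ω) (G : Type*) [Group G] [TopologicalSpace G] [ChartedSpace H₁ G]
    {P B : Type*} [TopologicalSpace P] [ChartedSpace H₂ P] [TopologicalSpace B] [ChartedSpace H₃ B]
    [MulAction G P] (p : P → B) : Prop :=
  ContMDiff (IG.prod IP) IP r (fun x : G × P => x.1 • x.2) ∧
  ContMDiff IP IB r p ∧
  ∀ b : B, ∃ (V : Set B) (e : OpenPartialHomeomorph P (B × G)), IsOpen V ∧ b ∈ V ∧
    e.source = p ⁻¹' V ∧ e.target = V ×ˢ univ ∧
    ContMDiffOn IP (IB.prod IG) r e e.source ∧ ContMDiffOn (IB.prod IG) IP r e.symm e.target ∧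
    ∀ x ∈ e.source, (e x).1 = p x ∧ ∀ c : G, e (c • x) = (p x, c * (e x).2)

/-! ### Complex contact manifolds and the bundle `L^×` -/

section Contact

variable {n : ℕ} {E : Type*} [NormedAddCommGroup E] [NormedSpace ℂ E]
  {Z : Type*} [TopologicalSpace Z] [ChartedSpace E Z]

universe w

variable (n E Z) in
/-- A complex contact structure on the complex manifold `Z` (of dimension `2n+1`): an open cover
`U_i`, holomorphic `1`-forms `θ_i` on `U_i` with `θ_i ∧ (dθ_i)^n ≠ 0`, and nowhere zero holomorphic
functions `f_ij` on `U_i ∩ U_j` with `θ_i = f_ij θ_j`. (The values of `θ_i` and `f_ij` outside of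
these open sets are irrelevant.) -/
structure ComplexContactStructure where
  ι : Type w
  U : ι → Set Z
  isOpen_U : ∀ i, IsOpen (U i)
  cover : ∀ x, ∃ i, x ∈ U i
  θ : ι → ∀ x : Z, TangentSpace 𝓘(ℂ, E) x →L[ℂ] ℂ
  holomorphic_θ : ∀ i, IsSmoothFormOn 𝓘(ℂ, E) ω (oneForm 𝓘(ℂ, E) (θ i)) (U i)
  contact : ∀ i, ∀ x ∈ U i, wedgePow (θ i x) (dOne 𝓘(ℂ, E) (θ i) x) n ≠ 0
  f : ι → ι → Z → ℂ
  holomorphic_f : ∀ i j, ContMDiffOn 𝓘(ℂ, E) 𝓘(ℂ, ℂ) ω (f i j) (U i ∩ U j)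
  f_ne_zero : ∀ i j, ∀ x ∈ U i ∩ U j, f i j x ≠ 0
  θ_eq : ∀ i j, ∀ x ∈ U i ∩ U j, θ i x = f i j x • θ j x

namespace ComplexContactStructure

variable (C : ComplexContactStructure.{w} n E Z)

theorem θ_ne_zero {i : C.ι} {x : Z} (hx : x ∈ C.U i) : C.θ i x ≠ 0 := by
  intro h
  apply C.contact i x hx
  funext v
  simp [wedgePow, h]

theorem exists_θ_ne_zero {i : C.ι} {x : Z} (hx : x ∈ C.U i) :
    ∃ v : TangentSpace 𝓘(ℂ, E) x, C.θ i x v ≠ 0 := by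
  by_contra! h
  exact C.θ_ne_zero hx (ContinuousLinearMap.ext h)

theorem θ_apply {i j : C.ι} {x : Z} (hi : x ∈ C.U i) (hj : x ∈ C.U j)
    (v : TangentSpace 𝓘(ℂ, E) x) : C.θ i x v = C.f i j x * C.θ j x v := by
  rw [C.θ_eq i j x ⟨hi, hj⟩]; rfl

theorem f_self {i : C.ι} {x : Z} (hx : x ∈ C.U i) : C.f i i x = 1 := by
  obtain ⟨v, hv⟩ := C.exists_θ_ne_zero hx
  exact mul_right_cancel₀ hv (by rw [← C.θ_apply hx hx, one_mul])

theorem f_mul {i j k : C.ι} {x : Z} (hi : x ∈ C.U i) (hj : x ∈ C.U j) (hk : x ∈ C.U k) :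
    C.f j k x * C.f i j x = C.f i k x := by
  obtain ⟨v, hv⟩ := C.exists_θ_ne_zero hk
  refine mul_right_cancel₀ hv ?_
  rw [← C.θ_apply hi hk, C.θ_apply hi hj, C.θ_apply hj hk]
  ring

/-- The line bundle `L = E⁻¹` dual to the contact line bundle `E = {f_ij}`. Its transition functions
are `g_ij = f_ij⁻¹`, i.e. the fibre coordinates satisfy `z_i = g_ij z_j`, that is `z_j = f_ij z_i`. -/
def core : VectorBundleCore ℂ Z ℂ C.ι where
  baseSet := C.U
  isOpen_baseSet := C.isOpen_U
  indexAt x := (C.cover x).choose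
  mem_baseSet_at x := (C.cover x).choose_spec
  coordChange i j x := C.f i j x • ContinuousLinearMap.id ℂ ℂ
  coordChange_self i x hx v := by simp [C.f_self hx]
  continuousOn_coordChange i j := (C.holomorphic_f i j).continuousOn.smul continuousOn_const
  coordChange_comp i j k x hx v := by
    simp [← C.f_mul hx.1.1 hx.1.2 hx.2, mul_assoc]

instance : C.core.IsContMDiff 𝓘(ℂ, E) ω where
  contMDiffOn_coordChange i j :=
    (C.holomorphic_f i j).smul contMDiffOn_const

/-- The fibres of `L`. -/
abbrev L : Z → Type := C.core.Fiber

/-- The total space of `L`. -/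
abbrev TotL : Type _ := TotalSpace ℂ C.L

/-- The fibre coordinate of `p ∈ L` in the distinguished trivialization at its base point. -/
def fibreCoord (p : C.TotL) : ℂ := p.2

theorem localTriv_snd {i : C.ι} (p : C.TotL) :
    (C.core.localTriv i p).2 = C.f (C.core.indexAt p.1) i p.1 * C.fibreCoord p := rfl

theorem isOpen_ne_zero : IsOpen {p : C.TotL | p.2 ≠ 0} := by
  rw [isOpen_iff_mem_nhds]
  intro p hp
  let i := C.core.indexAt p.1
  have hopen := (C.core.localTriv i).continuousOn_toFun.isOpen_inter_preimage
    (C.core.localTriv i).open_source (isOpen_univ.prod (isOpen_compl_singleton (x := (0 : ℂ))))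
  refine Filter.mem_of_superset (hopen.mem_nhds ⟨?_, trivial, ?_⟩) ?_
  · exact C.core.mem_baseSet_at p.1
  · intro h
    refine mul_ne_zero (C.f_ne_zero i i p.1 ?_) hp ((C.localTriv_snd (i := i) p).symm.trans h)
    exact ⟨C.core.mem_baseSet_at p.1, C.core.mem_baseSet_at p.1⟩
  · rintro q ⟨-, -, hq⟩ h0
    apply hq
    change (C.core.localTriv i q).2 = 0
    rw [C.localTriv_snd q]
    have h1 : C.fibreCoord q = 0 := h0
    rw [h1, mul_zero]

/-- The total space of `L^×`, i.e. `L` without its zero section, as an open subset of `Tot(L)`. -/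
def LTimes : TopologicalSpace.Opens C.TotL := ⟨{p | p.2 ≠ 0}, C.isOpen_ne_zero⟩

/-- `𝓤(Z) = Tot(L^×)`. -/
abbrev UZ : Type _ := C.LTimes

end ComplexContactStructure

variable (E) in
/-- The model of `Tot(L)` as a complex manifold. -/
abbrev modelC : ModelWithCorners ℂ (E × ℂ) (ModelProd E ℂ) := 𝓘(ℂ, E).prod 𝓘(ℂ, ℂ)

variable (E) in
/-- The model of `Tot(L)` as a real manifold (with the same charts). -/
abbrev modelR : ModelWithCorners ℝ (E × ℂ) (ModelProd E ℂ) := 𝓘(ℝ, E).prod 𝓘(ℝ, ℂ)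

/-- A complex manifold is a smooth real manifold, with the same charts. -/
theorem isManifold_modelR (M : Type*) [TopologicalSpace M] [ChartedSpace (ModelProd E ℂ) M]
    [IsManifold (modelC E) ω M] : IsManifold (modelR E) ∞ M := by
  refine isManifold_of_contDiffOn (modelR E) ∞ M fun e e' he he' => ?_
  have h := ((contDiffGroupoid ω (modelC E)).compatible he he').1
  have h2 : ContDiffOn ℂ ω (modelC E ∘ (e.symm ≫ₕ e') ∘ (modelC E).symm)
    ((modelC E).symm ⁻¹' (e.symm ≫ₕ e').source ∩ range (modelC E)) := h
  exact (h2.restrict_scalars ℝ).of_le le_top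

namespace ComplexContactStructure

variable (C : ComplexContactStructure.{w} n E Z)

instance [IsManifold 𝓘(ℂ, E) ω Z] : IsManifold (modelR E) ∞ C.UZ := isManifold_modelR _

/-- The bundle projection `π : Tot(L^×) → Z`. -/
def proj (u : C.UZ) : Z := u.1.1

/-- The fibre coordinate `z_i` on `L^×` over `U_i`. -/
def z (i : C.ι) (u : C.UZ) : ℂ := (C.core.localTriv i u.1).2

/-- The natural action of `ℂ^×` on `L^×`. -/
instance : MulAction ℂˣ C.UZ where
  smul c u := ⟨⟨u.1.1, (c : ℂ) • u.1.2⟩, smul_ne_zero c.ne_zero u.2⟩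
  one_smul u := by
    refine Subtype.ext ?_
    change (⟨u.1.1, ((1 : ℂˣ) : ℂ) • u.1.2⟩ : C.TotL) = u.1
    rw [Units.val_one, one_smul]
  mul_smul c d u := by
    refine Subtype.ext ?_
    change (⟨u.1.1, ((c * d : ℂˣ) : ℂ) • u.1.2⟩ : C.TotL) = ⟨u.1.1, (c : ℂ) • (d : ℂ) • u.1.2⟩
    rw [Units.val_mul, mul_smul]

/-- The holomorphic `1`-form `ϑ` on `Tot(L^×)`, equal to `z_i π^*θ_i` over `U_i`
(see `vartheta_eq`). -/
def vartheta (u : C.UZ) : TangentSpace (modelC E) u →L[ℂ] ℂ :=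
  C.fibreCoord u.1 • (C.θ (C.core.indexAt (C.proj u)) (C.proj u)).comp
    (mfderiv (modelC E) 𝓘(ℂ, E) C.proj u)

theorem vartheta_eq (i : C.ι) (u : C.UZ) (hu : C.proj u ∈ C.U i)
    (X : TangentSpace (modelC E) u) :
    C.vartheta u X = C.z i u * C.θ i (C.proj u) (mfderiv (modelC E) 𝓘(ℂ, E) C.proj u X) := by
  have h := C.θ_apply (C.core.mem_baseSet_at (C.proj u)) hu
    (mfderiv (modelC E) 𝓘(ℂ, E) C.proj u X)
  have h2 : C.z i u = C.f (C.core.indexAt (C.proj u)) i (C.proj u) * C.fibreCoord u.1 := rfl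
  rw [h2]
  refine (congrArg (C.fibreCoord u.1 * ·) h).trans ?_
  ring

/-- The natural complex structure of the complex manifold `Tot(L^×)`: in the holomorphic charts it
is the multiplication by `√-1`. -/
def naturalJ (u : C.UZ) : TangentSpace (modelR E) u →L[ℝ] TangentSpace (modelR E) u :=
  (Complex.I • ContinuousLinearMap.id ℝ (E × ℂ) : (E × ℂ) →L[ℝ] (E × ℂ))

/-- A (smooth) Hermitian structure on the line bundle `L`. -/
structure HermitianMetric where
  inner : ∀ x : Z, C.L x →ₗ⋆[ℂ] C.L x →ₗ[ℂ] ℂ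
  conj_symm : ∀ x v w, conj (inner x v w) = inner x w v
  pos : ∀ x v, v ≠ 0 → 0 < (inner x v v).re
  smooth : ContMDiff (modelR E) 𝓘(ℝ, ℝ) ∞ (fun p : C.TotL => (inner p.1 p.2 p.2).re)

namespace HermitianMetric

variable {C} (h : C.HermitianMetric)

/-- The norm `‖u‖` of `u ∈ L^×`. -/
def norm (u : C.UZ) : ℝ := Real.sqrt (h.inner u.1.1 u.1.2 u.1.2).re

theorem norm_pos (u : C.UZ) : 0 < h.norm u := Real.sqrt_pos.2 (h.pos _ _ u.2)

theorem norm_smul (c : ℂˣ) (u : C.UZ) : h.norm (c • u) = ‖(c : ℂ)‖ * h.norm u := by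
  have h1 : h.inner u.1.1 ((c : ℂ) • u.1.2) ((c : ℂ) • u.1.2)
      = ((‖(c : ℂ)‖ ^ 2 : ℝ) : ℂ) * h.inner u.1.1 u.1.2 u.1.2 := by
    rw [map_smul, map_smulₛₗ, LinearMap.smul_apply, smul_eq_mul, smul_eq_mul, ← mul_assoc,
      Complex.mul_conj']
    push_cast
    rfl
  change Real.sqrt (h.inner u.1.1 ((c : ℂ) • u.1.2) ((c : ℂ) • u.1.2)).re = _
  rw [h1, Complex.re_ofReal_mul, Real.sqrt_mul (by positivity),
    Real.sqrt_sq (by positivity)]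
  rfl

/-- The unit circle bundle `Q(L)`. -/
def Q : Type _ := {u : C.UZ // h.norm u = 1}

instance : TopologicalSpace h.Q := inferInstanceAs (TopologicalSpace {u : C.UZ // h.norm u = 1})

/-- The inclusion `Q(L) → Tot(L^×)`. -/
def incl (q : h.Q) : C.UZ := q.1

/-- The projection `π_Q : Q(L) → Z`. -/
def projQ (q : h.Q) : Z := C.proj (h.incl q)

/-- The natural action of `U(1)` on `Q(L)`. -/
instance : MulAction Circle h.Q where
  smul c q := ⟨Circle.toUnits c • q.1, by
    rw [h.norm_smul, q.2, mul_one]; exact Circle.norm_coe c⟩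
  one_smul q := Subtype.ext (by
    change Circle.toUnits 1 • q.1 = q.1
    rw [map_one, one_smul])
  mul_smul c d q := Subtype.ext (by
    change Circle.toUnits (c * d) • q.1 = Circle.toUnits c • Circle.toUnits d • q.1
    rw [map_mul, mul_smul])

/-- The radial projection `u ↦ u / ‖u‖`. -/
def normalize (u : C.UZ) : h.Q :=
  ⟨Units.mk0 ((h.norm u)⁻¹ : ℂ) (inv_ne_zero (by exact_mod_cast (h.norm_pos u).ne')) • u, by
    rw [h.norm_smul, Units.val_mk0, norm_inv, Complex.norm_real, Real.norm_eq_abs,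
      abs_of_pos (h.norm_pos u), inv_mul_cancel₀ (h.norm_pos u).ne']⟩

/-- The function `t(u) = log ‖u‖`. -/
def t (u : C.UZ) : ℝ := Real.log (h.norm u)

/-- The `1`-form `dt` on `Tot(L^×)`. -/
def dt (u : C.UZ) : TangentSpace (modelR E) u →L[ℝ] ℝ := mfderiv (modelR E) 𝓘(ℝ, ℝ) h.t u

end HermitianMetric

end ComplexContactStructure
end Contact

end

/-!
The form `Υ = dϑ` is `dz_i ∧ θ_i + z_i dθ_i` over `U_i`, and its nondegeneracy is the contact condition
(`eq_zero_of_wedgePow_ne_zero`). Let `J` be the complex structure of `L^×`, `r = ‖u‖`, `t = log r`,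
and let `ε` be the Euler field of the fibres, which satisfies `Re Υ(ε, ·) = Re ϑ` and `dt(ε) = 1`. The
theorem amounts to the construction of a metric `g` on `L^×` such that

* `g` is Hermitian for `J`, and `Re Υ = g(J₂·, ·)` for an almost complex structure `J₂` which
  anticommutes with `J`;
* `g` is homogeneous of degree one under dilations, invariant under the circle, and `g(ε, ·) = r dt`.

With `J₃ = J J₂`, this is a hyperhermitian cone.

*The metric.* Let `R` be the field with `Re Υ(R, ·) = -dt`. The vectors `ε` and `R` span over `ℂ` a
complement of the common complex kernel of `dt` and `Re ϑ`, on which a Hermitian metric of `Z` is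
positive definite. So there is a `J`-Hermitian metric `G` for which `ε`, `R` and this kernel are
orthogonal, and the lengths of `ε` and `R` can be chosen such that the endomorphism `A` with
`G(A·, ·) = Re Υ` maps the span of `ε` and `R` to itself with `A² = -1`. The polar decomposition of `A`
gives `g = G(√(-A²)·, ·)`, the geometric mean of the forms `G` and `G(A·, A·)` (`formMean`), and `J₂`
is its orthogonal part. The geometric mean is the only solution of its defining equation among the
positive definite forms (`SymplecticData.Good.metric_unique`), and all properties of `g` follow from
this: the transforms of `g` under `J`, under `J₂` and under the action of `ℂ^×` solve the same equation
(`metric_J`, `metric_J₂_J₂`, `IsPullback.metric_eq`). It depends smoothly on the data because matrix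
square roots do (`ContDiffAt.matrix_sqrt`). The metric on `Z` and the Hermitian structure on `L` come
from partitions of unity.

*The circle bundle.* The charts of `Q` replace the fibre coordinate in the charts of `L^×` by its
argument. On the unit sphere of a hyperhermitian cone, the projections of `J_α` and `J_α ε` to the
tangent spaces and the forms `-dt ∘ J_α` are an almost contact metric 3-structure
(`IsHyperhermitianCone.isAlmostContactMetric3`). As `g(ε, ·) = r dt`, the forms `η₂` and `η₃` are the
real and imaginary parts of `ϑ`, so that their differentials are the restrictions of `Re Υ` and
`Im Υ`, which are the fundamental forms of the structure. The homogeneity of `g` and `J_α` under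
dilations gives the formulas in polar coordinates.

*Volume forms.* At each point, the unit quaternion `(1 + i + j + k) / 2` gives a rotation `ψ` of the
tangent space which permutes the three structures cyclically. It multiplies the forms `η_α ∧ (g(Φ_α·, ·))^m`
by `det ψ`, and since they do not vanish, `(det ψ)³ = 1`
(`IsAlmostContactMetric3.wedgePow_eq`).

*Normality and Killing field.* In a holomorphic chart of `L^×`, the bundle `Q` is a real hypersurface
of a complex vector space, and the transversal field `ε` is linear. The derivative of the equation
`dG ∘ Φ₁ = √-1 dG + η₁ ε` for its embedding `G` yields the normality
(`nijenhuis_add_dOne_smul_eq_zero`). In the charts of `Q`, the circle acts by translations, which are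
isometries; hence the metric has constant components along `ξ₁`, which is a Killing field.
-/

/-! ### Geometric means of positive definite matrices and forms -/

section MatrixMean

open scoped MatrixOrder Matrix.Norms.L2Operator

variable {N : Type*} [Fintype N] [DecidableEq N]

/-- The derivative `X ↦ X P + P X` of the squaring map on matrices. -/
noncomputable def sylvester (P : Matrix N N ℝ) : Matrix N N ℝ →L[ℝ] Matrix N N ℝ :=
  (ContinuousLinearMap.mul ℝ (Matrix N N ℝ) P) + (ContinuousLinearMap.mul ℝ (Matrix N N ℝ)).flip P

/-- If `P X + X P = 0`, then `Xᴴ P X` and `X P Xᴴ` have opposite traces, so both traces vanish. -/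
theorem sylvester_injective {P : Matrix N N ℝ} (hP : P.PosDef) :
    Function.Injective (sylvester P) := by
  rw [injective_iff_map_eq_zero]
  intro X hX
  have hX' : P * X + X * P = 0 := hX
  have h1 : (X.conjTranspose * P * X).PosSemidef := hP.posSemidef.conjTranspose_mul_mul_same X
  have h2 : (X * P * X.conjTranspose).PosSemidef := hP.posSemidef.mul_mul_conjTranspose_same X
  have h3 : (X.conjTranspose * P * X).trace + (X * P * X.conjTranspose).trace = 0 := by
    rw [Matrix.trace_mul_comm (X * P), ← Matrix.trace_add, Matrix.mul_assoc, ← Matrix.mul_add, hX',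
      Matrix.mul_zero, Matrix.trace_zero]
  have h4 : (X.conjTranspose * P * X).trace = 0 := by
    linarith [h1.trace_nonneg, h2.trace_nonneg]
  have h5 : X.conjTranspose * P * X = 0 := (h1.trace_eq_zero_iff).1 h4
  ext i j
  by_contra hne
  have hv : X.mulVec (Pi.single j 1) ≠ 0 := by
    intro h
    apply hne
    have := congrFun h i
    simpa using this
  have := hP.dotProduct_mulVec_pos hv
  have h6 : star (X.mulVec (Pi.single j 1)) ⬝ᵥ P.mulVec (X.mulVec (Pi.single j 1))
      = star (Pi.single j (1 : ℝ)) ⬝ᵥ (X.conjTranspose * P * X).mulVec (Pi.single j 1) := by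
    simp only [Matrix.star_mulVec, Matrix.mulVec_mulVec, Matrix.dotProduct_mulVec,
      Matrix.vecMul_vecMul, Matrix.mul_assoc]
  rw [h6, h5] at this
  simp at this

/-- The square root of matrices is smooth at positive definite ones, by the inverse function theorem
for the squaring map. -/
theorem ContDiffAt.matrix_sqrt {X : Type*} [NormedAddCommGroup X] [NormedSpace ℝ X]
    {f : X → Matrix N N ℝ} {x : X} (hf : ContDiffAt ℝ ∞ f x)
    (hpos : ∀ᶠ y in 𝓝 x, (f y).PosSemidef) (hx : (f x).PosDef) :
    ContDiffAt ℝ ∞ (fun y => CFC.sqrt (f y)) x := by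
  set P := CFC.sqrt (f x) with hPdef
  have hfx : (0 : Matrix N N ℝ) ≤ f x := hx.posSemidef.nonneg
  have hP : P.PosDef := by
    rw [← Matrix.isStrictlyPositive_iff_posDef] at hx ⊢
    exact hx.sqrt
  have hPP : P * P = f x := CFC.sqrt_mul_sqrt_self _ hfx
  let e : Matrix N N ℝ ≃L[ℝ] Matrix N N ℝ := ContinuousLinearEquiv.ofBijective (sylvester P)
    (LinearMap.ker_eq_bot.2 (sylvester_injective hP))
    (LinearMap.range_eq_top.2
      ((LinearMap.injective_iff_surjective (f := (sylvester P).toLinearMap)).1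
        (sylvester_injective hP)))
  have hsq : ContDiff ℝ ∞ (fun Y : Matrix N N ℝ => Y * Y) := contDiff_id.mul contDiff_id
  have hd : HasFDerivAt (fun Y : Matrix N N ℝ => Y * Y) (e : Matrix N N ℝ →L[ℝ] Matrix N N ℝ) P := by
    have := (hasFDerivAt_id (𝕜 := ℝ) P).mul' (hasFDerivAt_id P)
    refine this.congr_fderiv ?_
    ext1 Y
    simp [e, sylvester]
  have hs : HasStrictFDerivAt (fun Y : Matrix N N ℝ => Y * Y)
      (e : Matrix N N ℝ →L[ℝ] Matrix N N ℝ) P :=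
    hsq.contDiffAt.hasStrictFDerivAt' hd (by simp)
  have hinv : ContDiffAt ℝ ∞ (hsq.contDiffAt.localInverse hd (by simp)) (P * P) :=
    hsq.contDiffAt.to_localInverse hd (by simp)
  have hcont : ContinuousAt (fun y => CFC.sqrt (f y)) x := by
    have h0 := (CFC.continuousOn_sqrt (A := Matrix N N ℝ)) (f x) hfx
    have h1 : Filter.Tendsto f (𝓝 x) (𝓝[{a | 0 ≤ a}] (f x)) :=
      tendsto_nhdsWithin_iff.2 ⟨hf.continuousAt, hpos.mono fun y hy => hy.nonneg⟩
    exact h0.tendsto.comp h1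
  -- continuity of the square root puts it on the branch of the local inverse of the squaring map
  have hl : ∀ᶠ Y in 𝓝 P, hsq.contDiffAt.localInverse hd (by simp) (Y * Y) = Y :=
    hs.eventually_left_inverse
  have h2 := hcont.eventually hl
  have h3 : ContDiffAt ℝ ∞ (fun y => hsq.contDiffAt.localInverse hd (by simp) (f y)) x := by
    rw [hPP] at hinv
    exact hinv.comp x hf
  refine h3.congr_of_eventuallyEq ?_
  filter_upwards [h2, hpos] with y hy hy'
  rw [CFC.sqrt_mul_sqrt_self _ hy'.nonneg] at hy
  exact hy.symm

/-- The geometric mean of two positive definite matrices, the positive definite solution `K` of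
`K G⁻¹ K = S`. -/
noncomputable def matMean (G S : Matrix N N ℝ) : Matrix N N ℝ :=
  CFC.sqrt G * CFC.sqrt ((CFC.sqrt G)⁻¹ * S * (CFC.sqrt G)⁻¹) * CFC.sqrt G

theorem Matrix.PosDef.sqrt {G : Matrix N N ℝ} (hG : G.PosDef) : (CFC.sqrt G).PosDef := by
  rw [← Matrix.isStrictlyPositive_iff_posDef] at hG ⊢
  exact hG.sqrt

theorem Matrix.PosDef.conj_same {G S : Matrix N N ℝ} (hG : G.PosDef) (hS : S.PosDef) :
    (G * S * G).PosDef := by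
  have := hS.mul_mul_conjTranspose_same (B := G)
    (Matrix.vecMul_injective_of_isUnit hG.isUnit)
  rwa [hG.isHermitian.eq] at this

theorem matMean_posDef {G S : Matrix N N ℝ} (hG : G.PosDef) (hS : S.PosDef) :
    (matMean G S).PosDef :=
  hG.sqrt.conj_same (hG.sqrt.inv.conj_same hS).sqrt

theorem matMean_spec {G S : Matrix N N ℝ} (hG : G.PosDef) (hS : S.PosDef) :
    matMean G S * G⁻¹ * matMean G S = S := by
  have hu : IsUnit (CFC.sqrt G).det := (Matrix.isUnit_iff_isUnit_det _).1 hG.sqrt.isUnit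
  have h1 : CFC.sqrt G * CFC.sqrt G = G := CFC.sqrt_mul_sqrt_self _ hG.posSemidef.nonneg
  have h2 : G⁻¹ = (CFC.sqrt G)⁻¹ * (CFC.sqrt G)⁻¹ := by
    conv_lhs => rw [← h1, Matrix.mul_inv_rev]
  have h3 := CFC.sqrt_mul_sqrt_self ((CFC.sqrt G)⁻¹ * S * (CFC.sqrt G)⁻¹)
    (hG.sqrt.inv.conj_same hS).posSemidef.nonneg
  rw [matMean, h2]
  set g := CFC.sqrt G
  set s := CFC.sqrt (g⁻¹ * S * g⁻¹)
  calc g * s * g * (g⁻¹ * g⁻¹) * (g * s * g)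
      = g * s * (g * g⁻¹) * (g⁻¹ * g) * s * g := by simp only [Matrix.mul_assoc]
    _ = g * (s * s) * g := by
        rw [Matrix.mul_nonsing_inv _ hu, Matrix.nonsing_inv_mul _ hu]
        simp only [Matrix.mul_assoc, Matrix.mul_one]
    _ = (g * g⁻¹) * S * (g⁻¹ * g) := by rw [h3]; simp only [Matrix.mul_assoc]
    _ = S := by rw [Matrix.mul_nonsing_inv _ hu, Matrix.nonsing_inv_mul _ hu, Matrix.one_mul,
        Matrix.mul_one]

theorem matMean_unique {G S K : Matrix N N ℝ} (hG : G.PosDef)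
    (hK : K.PosDef) (h : K * G⁻¹ * K = S) : K = matMean G S := by
  have hu : IsUnit (CFC.sqrt G).det := (Matrix.isUnit_iff_isUnit_det _).1 hG.sqrt.isUnit
  have h1 : CFC.sqrt G * CFC.sqrt G = G := CFC.sqrt_mul_sqrt_self _ hG.posSemidef.nonneg
  have h2 : G⁻¹ = (CFC.sqrt G)⁻¹ * (CFC.sqrt G)⁻¹ := by
    conv_lhs => rw [← h1, Matrix.mul_inv_rev]
  have h3 := hG.sqrt.inv.conj_same hK
  have h4 : CFC.sqrt ((CFC.sqrt G)⁻¹ * S * (CFC.sqrt G)⁻¹)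
      = (CFC.sqrt G)⁻¹ * K * (CFC.sqrt G)⁻¹ := by
    refine CFC.sqrt_unique ?_ h3.posSemidef.nonneg
    rw [← h, h2]
    simp only [Matrix.mul_assoc]
  rw [matMean, h4]
  set g := CFC.sqrt G
  calc K = (g * g⁻¹) * K * (g⁻¹ * g) := by
        rw [Matrix.mul_nonsing_inv _ hu, Matrix.nonsing_inv_mul _ hu, Matrix.one_mul,
          Matrix.mul_one]
    _ = _ := by simp only [Matrix.mul_assoc]

theorem ContDiffAt.matMean {X : Type*} [NormedAddCommGroup X] [NormedSpace ℝ X]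
    {f k : X → Matrix N N ℝ} {x : X} (hf : ContDiffAt ℝ ∞ f x) (hk : ContDiffAt ℝ ∞ k x)
    (hfpos : ∀ᶠ y in 𝓝 x, (f y).PosDef) (hkpos : ∀ᶠ y in 𝓝 x, (k y).PosDef) :
    ContDiffAt ℝ ∞ (fun y => matMean (f y) (k y)) x := by
  have h1 := hf.matrix_sqrt (hfpos.mono fun y hy => hy.posSemidef) hfpos.self_of_nhds
  have hu := hfpos.self_of_nhds.sqrt.isUnit
  have h2 : ContDiffAt ℝ ∞ (fun y => (CFC.sqrt (f y))⁻¹) x := by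
    have h3 : (fun y => (CFC.sqrt (f y))⁻¹) = fun y => Ring.inverse (CFC.sqrt (f y)) := by
      funext y; exact Matrix.nonsing_inv_eq_ringInverse _
    rw [h3]
    obtain ⟨u, hu⟩ := hu
    have := contDiffAt_ringInverse (n := ∞) ℝ u
    rw [hu] at this
    exact this.comp x h1
  have h4 := ((h2.mul hk).mul h2).matrix_sqrt
    (by filter_upwards [hfpos, hkpos] with y hy hy'
        exact (hy.sqrt.inv.conj_same hy').posSemidef)
    (hfpos.self_of_nhds.sqrt.inv.conj_same hkpos.self_of_nhds)
  exact (h1.mul h4).mul h1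

end MatrixMean

section FormMean

theorem LinearMap.contDiff_of_finite {A B : Type*} [NormedAddCommGroup A] [NormedSpace ℝ A]
    [FiniteDimensional ℝ A] [NormedAddCommGroup B] [NormedSpace ℝ B] (f : A →ₗ[ℝ] B) :
    ContDiff ℝ ∞ f :=
  (LinearMap.toContinuousLinearMap f).contDiff

variable {V : Type*} [NormedAddCommGroup V] [NormedSpace ℝ V]

/-- A continuous bilinear form that is symmetric and positive definite. -/
structure IsPosForm (G : V →L[ℝ] V →L[ℝ] ℝ) : Prop where
  symm : ∀ x y, G x y = G y x
  pos : ∀ x, x ≠ 0 → 0 < G x x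

theorem IsPosForm.nondegenerate {G : V →L[ℝ] V →L[ℝ] ℝ} (hG : IsPosForm G) (x : V)
    (h : ∀ y, G x y = 0) : x = 0 := by
  by_contra hx
  exact (hG.pos x hx).ne' (h x)

theorem IsPosForm.ext {G : V →L[ℝ] V →L[ℝ] ℝ} (hG : IsPosForm G) {x x' : V}
    (h : ∀ y, G x y = G x' y) : x = x' := by
  refine sub_eq_zero.1 (hG.nondegenerate _ fun y => ?_)
  rw [map_sub, sub_apply, h, sub_self]

variable [FiniteDimensional ℝ V]

theorem isInvertible_of_nondegenerate {w : V →L[ℝ] V →L[ℝ] ℝ}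
    (h : ∀ x, (∀ y, w x y = 0) → x = 0) : w.IsInvertible := by
  have hinj : Function.Injective w := by
    rw [injective_iff_map_eq_zero]
    intro x hx
    exact h x fun y => by rw [hx]; rfl
  have hfin : Module.finrank ℝ V = Module.finrank ℝ (V →L[ℝ] ℝ) := by
    rw [← (LinearMap.toContinuousLinearMap (𝕜 := ℝ) (E := V) (F' := ℝ)).finrank_eq]
    exact (Subspace.dual_finrank_eq (K := ℝ) (V := V)).symm
  have hsurj : Function.Surjective w :=
    (LinearMap.injective_iff_surjective_of_finrank_eq_finrank (f := w.toLinearMap) hfin).1 hinj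
  exact ⟨ContinuousLinearEquiv.ofBijective w (LinearMap.ker_eq_bot.2 hinj)
    (LinearMap.range_eq_top.2 hsurj), by ext; rfl⟩

variable (V) in
/-- The basis of `V` used to represent bilinear forms by matrices. -/
noncomputable abbrev formBasis : Module.Basis (Fin (Module.finrank ℝ V)) ℝ V := Module.finBasis ℝ V

variable (V) in
/-- The matrix of a continuous bilinear form, as a linear equivalence. -/
noncomputable def formMatₗ : (V →L[ℝ] V →L[ℝ] ℝ) ≃ₗ[ℝ]
    Matrix (Fin (Module.finrank ℝ V)) (Fin (Module.finrank ℝ V)) ℝ :=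
  (LinearMap.toContinuousLinearMap.symm ≪≫ₗ
    (LinearMap.toContinuousLinearMap (𝕜 := ℝ) (E := V) (F' := ℝ)).symm.congrRight) ≪≫ₗ
      LinearMap.toMatrix₂ (formBasis V) (formBasis V)

theorem formMatₗ_apply (β : V →L[ℝ] V →L[ℝ] ℝ) (i j) :
    formMatₗ V β i j = β (formBasis V i) (formBasis V j) := by
  simp only [formMatₗ, LinearEquiv.trans_apply, LinearMap.toMatrix₂_apply]
  rfl

theorem formMatₗ_dotProduct (β : V →L[ℝ] V →L[ℝ] ℝ) (x y : V) :
    β x y = (formBasis V).repr x ⬝ᵥ (formMatₗ V β).mulVec ((formBasis V).repr y) := by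
  conv_lhs => rw [← (formBasis V).sum_repr x, ← (formBasis V).sum_repr y]
  simp only [map_sum, map_smul, sum_apply, smul_apply,
    smul_eq_mul, dotProduct, Matrix.mulVec, formMatₗ_apply, Finset.mul_sum]
  rw [Finset.sum_comm]
  refine Finset.sum_congr rfl fun i _ => Finset.sum_congr rfl fun j _ => ?_
  ring

theorem formMatₗ_posDef_iff (β : V →L[ℝ] V →L[ℝ] ℝ) :
    (formMatₗ V β).PosDef ↔ IsPosForm β := by
  constructor
  · intro h
    have hs : ∀ i j, formMatₗ V β i j = formMatₗ V β j i := fun i j => by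
      conv_lhs => rw [← h.isHermitian.eq]
      rfl
    refine ⟨fun x y => ?_, fun x hx => ?_⟩
    · rw [formMatₗ_dotProduct, formMatₗ_dotProduct, Matrix.dotProduct_mulVec, dotProduct_comm,
        ← Matrix.mulVec_transpose]
      congr 2
      ext i j
      exact hs _ _
    · rw [formMatₗ_dotProduct]
      refine h.dotProduct_mulVec_pos fun h0 => hx ?_
      exact (formBasis V).repr.map_eq_zero_iff.1 (DFunLike.coe_injective h0)
  · intro h
    refine Matrix.PosDef.of_dotProduct_mulVec_pos ?_ fun x hx => ?_
    · ext i j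
      change formMatₗ V β j i = _
      rw [formMatₗ_apply, formMatₗ_apply, h.symm]
    · have := h.pos ((formBasis V).equivFun.symm x)
        (fun h0 => hx ((formBasis V).equivFun.symm.map_eq_zero_iff.1 h0))
      rw [formMatₗ_dotProduct] at this
      have hr : ⇑((formBasis V).repr ((formBasis V).equivFun.symm x)) = x :=
        (formBasis V).equivFun.apply_symm_apply x
      rw [hr] at this
      exact this

theorem formMatₗ_comp (β : V →L[ℝ] V →L[ℝ] ℝ) (P : V →L[ℝ] V) :
    formMatₗ V (β ∘L P) =
      (LinearMap.toMatrix (formBasis V) (formBasis V) P.toLinearMap).transpose * formMatₗ V β := by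
  ext i j
  rw [formMatₗ_apply, Matrix.mul_apply]
  simp only [ContinuousLinearMap.comp_apply, Matrix.transpose_apply, LinearMap.toMatrix_apply,
    formMatₗ_apply]
  conv_lhs => rw [← (formBasis V).sum_repr (P (formBasis V i))]
  simp only [map_sum, map_smul, sum_apply, smul_apply,
    smul_eq_mul]
  rfl

/-- The geometric mean of two positive definite forms. -/
noncomputable def formMean (G S : V →L[ℝ] V →L[ℝ] ℝ) : V →L[ℝ] V →L[ℝ] ℝ :=
  (formMatₗ V).symm (matMean (formMatₗ V G) (formMatₗ V S))

theorem formMean_isPosForm {G S : V →L[ℝ] V →L[ℝ] ℝ} (hG : IsPosForm G) (hS : IsPosForm S) :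
    IsPosForm (formMean G S) := by
  rw [← formMatₗ_posDef_iff, formMean, LinearEquiv.apply_symm_apply]
  exact matMean_posDef ((formMatₗ_posDef_iff G).2 hG) ((formMatₗ_posDef_iff S).2 hS)

/-- The geometric mean is characterized by `K = G P` and `S = K P` for an endomorphism `P`. -/
theorem formMean_spec {G S : V →L[ℝ] V →L[ℝ] ℝ} (hG : IsPosForm G) (hS : IsPosForm S) :
    ∃ P : V →L[ℝ] V, formMean G S = G ∘L P ∧ S = formMean G S ∘L P := by
  have hGm := (formMatₗ_posDef_iff G).2 hG
  have hSm := (formMatₗ_posDef_iff S).2 hS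
  have hu : IsUnit (formMatₗ V G).det := (Matrix.isUnit_iff_isUnit_det _).1 hGm.isUnit
  let P : V →L[ℝ] V := LinearMap.toContinuousLinearMap (Matrix.toLin (formBasis V) (formBasis V)
    (matMean (formMatₗ V G) (formMatₗ V S) * (formMatₗ V G)⁻¹).transpose)
  have hP : (LinearMap.toMatrix (formBasis V) (formBasis V) P.toLinearMap).transpose =
      matMean (formMatₗ V G) (formMatₗ V S) * (formMatₗ V G)⁻¹ := by
    simp [P, LinearMap.toMatrix_toLin]
  refine ⟨P, ?_, ?_⟩
  · apply (formMatₗ V).injective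
    rw [formMatₗ_comp, hP, formMean, LinearEquiv.apply_symm_apply, Matrix.mul_assoc,
      Matrix.nonsing_inv_mul _ hu, Matrix.mul_one]
  · apply (formMatₗ V).injective
    rw [formMatₗ_comp, hP, formMean, LinearEquiv.apply_symm_apply, matMean_spec hGm hSm]

theorem formMean_unique {G S K : V →L[ℝ] V →L[ℝ] ℝ} (hG : IsPosForm G) (hK : IsPosForm K)
    {P : V →L[ℝ] V} (h1 : K = G ∘L P) (h2 : S = K ∘L P) : K = formMean G S := by
  have hGm := (formMatₗ_posDef_iff G).2 hG
  have hKm := (formMatₗ_posDef_iff K).2 hK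
  have hu : IsUnit (formMatₗ V G).det := (Matrix.isUnit_iff_isUnit_det _).1 hGm.isUnit
  apply (formMatₗ V).injective
  rw [formMean, LinearEquiv.apply_symm_apply]
  refine matMean_unique hGm hKm ?_
  have e1 := congrArg (formMatₗ V) h1
  have e2 := congrArg (formMatₗ V) h2
  rw [formMatₗ_comp] at e1 e2
  rw [e2]
  congr 1
  rw [e1, Matrix.mul_assoc, Matrix.mul_nonsing_inv _ hu, Matrix.mul_one]

section

open scoped Matrix.Norms.L2Operator

set_option synthInstance.maxHeartbeats 400000

variable (V) in
theorem contDiff_formMatₗ : ContDiff ℝ ∞ (formMatₗ V) :=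
  LinearMap.contDiff_of_finite (A := V →L[ℝ] V →L[ℝ] ℝ)
    (B := Matrix (Fin (Module.finrank ℝ V)) (Fin (Module.finrank ℝ V)) ℝ) (formMatₗ V).toLinearMap

variable (V) in
theorem contDiff_formMatₗ_symm : ContDiff ℝ ∞ (formMatₗ V).symm :=
  LinearMap.contDiff_of_finite (B := V →L[ℝ] V →L[ℝ] ℝ)
    (A := Matrix (Fin (Module.finrank ℝ V)) (Fin (Module.finrank ℝ V)) ℝ)
    (formMatₗ V).symm.toLinearMap

theorem ContDiffAt.formMean {X : Type*} [NormedAddCommGroup X] [NormedSpace ℝ X]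
    {f k : X → V →L[ℝ] V →L[ℝ] ℝ} {x : X} (hf : ContDiffAt ℝ ∞ f x) (hk : ContDiffAt ℝ ∞ k x)
    (hfpos : ∀ᶠ y in 𝓝 x, IsPosForm (f y)) (hkpos : ∀ᶠ y in 𝓝 x, IsPosForm (k y)) :
    ContDiffAt ℝ ∞ (fun y => formMean (f y) (k y)) x :=
  (contDiff_formMatₗ_symm V).contDiffAt.comp x
    (((contDiff_formMatₗ V).contDiffAt.comp x hf).matMean
      ((contDiff_formMatₗ V).contDiffAt.comp x hk)
      (hfpos.mono fun y hy => (formMatₗ_posDef_iff _).2 hy)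
      (hkpos.mono fun y hy => (formMatₗ_posDef_iff _).2 hy))

end

end FormMean

/-! ### Compatible metrics of complex symplectic vector spaces -/

section AdaptedMetric

variable {V : Type*} [NormedAddCommGroup V] [NormedSpace ℝ V]

theorem form_neg_left (G : V →L[ℝ] V →L[ℝ] ℝ) (x y : V) : G (-x) y = -G x y := by
  rw [map_neg]; rfl

/-- The pullback of a bilinear form under a linear map. -/
noncomputable def formPull {W : Type*} [NormedAddCommGroup W] [NormedSpace ℝ W]
    (G : V →L[ℝ] V →L[ℝ] ℝ) (L : W →L[ℝ] V) : W →L[ℝ] W →L[ℝ] ℝ :=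
  (ContinuousLinearMap.compL ℝ W V ℝ).flip L ∘L G ∘L L

theorem formPull_apply {W : Type*} [NormedAddCommGroup W] [NormedSpace ℝ W]
    (G : V →L[ℝ] V →L[ℝ] ℝ) (L : W →L[ℝ] V) (x y : W) : formPull G L x y = G (L x) (L y) := rfl

variable (V) in
/-- The pointwise data on `Tot(L^×)` from which the hyperhermitian structure is made: `r = ‖u‖`,
`τ = dt`, `β = Re ϑ`, `w = Re dϑ`, a Hermitian metric `k` transverse to the fibres, and the complex
structure `J`. The form `k` is degenerate along the fibres. -/
structure SymplecticData where
  r : ℝ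
  τ : V →L[ℝ] ℝ
  β : V →L[ℝ] ℝ
  w : V →L[ℝ] V →L[ℝ] ℝ
  k : V →L[ℝ] V →L[ℝ] ℝ
  J : V →L[ℝ] V

namespace SymplecticData

variable (d : SymplecticData V)

/-- The Euler vector: `w(ε, ·) = β`. -/
noncomputable def eps : V := d.w.inverse d.β

/-- The vector `R` with `w(R, ·) = -τ`. -/
noncomputable def reeb : V := -d.w.inverse d.τ

/-- The projection along the complex span of `ε` and `R`, onto the common complex kernel of `τ` and
`β`. -/
noncomputable def proj : V →L[ℝ] V :=
  ContinuousLinearMap.id ℝ V - d.τ.smulRight d.eps + (d.τ ∘L d.J).smulRight (d.J d.eps)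
    - d.β.smulRight d.reeb + (d.β ∘L d.J).smulRight (d.J d.reeb)

/-- The Hermitian form for which `ε`, `R` and the image of `proj` are orthogonal. -/
noncomputable def base : V →L[ℝ] V →L[ℝ] ℝ :=
  d.r • (d.τ.smulRight d.τ + (d.τ ∘L d.J).smulRight (d.τ ∘L d.J))
    + d.r⁻¹ • (d.β.smulRight d.β + (d.β ∘L d.J).smulRight (d.β ∘L d.J))
    + d.r • formPull d.k d.proj

/-- The endomorphism representing `w` with respect to the base form. -/
noncomputable def endo : V →L[ℝ] V := d.base.inverse ∘L d.w

/-- The form `(X, Y) ↦ G(AX, AY)`, for the base form `G` and the endomorphism `A`. -/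
noncomputable def square : V →L[ℝ] V →L[ℝ] ℝ :=
  formPull d.base d.endo

/-- The compatible metric: the geometric mean of `G` and `G(A·, A·)`, i.e. `G(√(-A²)·, ·)`. -/
noncomputable def metric [FiniteDimensional ℝ V] : V →L[ℝ] V →L[ℝ] ℝ := formMean d.base d.square

/-- The almost complex structure given by the polar decomposition of `w`. -/
noncomputable def J₂ [FiniteDimensional ℝ V] : V →L[ℝ] V := d.metric.inverse ∘L d.w

theorem proj_apply (x : V) : d.proj x = x - d.τ x • d.eps + d.τ (d.J x) • d.J d.eps
    - d.β x • d.reeb + d.β (d.J x) • d.J d.reeb := rfl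

theorem base_apply (x y : V) : d.base x y =
    d.r * (d.τ x * d.τ y + d.τ (d.J x) * d.τ (d.J y))
      + d.r⁻¹ * (d.β x * d.β y + d.β (d.J x) * d.β (d.J y))
      + d.r * d.k (d.proj x) (d.proj y) := rfl

theorem square_apply (x y : V) : d.square x y = d.base (d.endo x) (d.endo y) := rfl

/-- The conditions on the data which make the construction of the metric work: `w` is the real part of
a complex symplectic form, `ε` and `Jε` are dual to `τ` and `-τ ∘ J`, and `k` is a Hermitian form
whose kernel is spanned by `ε` and `Jε`. -/
structure Good : Prop where
  r_pos : 0 < d.r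
  J_J : ∀ x, d.J (d.J x) = -x
  alt : ∀ x y, d.w x y = -d.w y x
  nondeg : ∀ x, (∀ y, d.w x y = 0) → x = 0
  w_J : ∀ x y, d.w (d.J x) (d.J y) = -d.w x y
  τ_eps : d.τ d.eps = 1
  τ_J_eps : d.τ (d.J d.eps) = 0
  k_symm : ∀ x y, d.k x y = d.k y x
  k_nonneg : ∀ x, 0 ≤ d.k x x
  k_J : ∀ x y, d.k (d.J x) (d.J y) = d.k x y
  k_ker : ∀ x, d.k x x = 0 → ∃ a b : ℝ, x = a • d.eps + b • d.J d.eps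

namespace Good

variable {d} [FiniteDimensional ℝ V] (h : d.Good)
include h

theorem w_eps (x : V) : d.w d.eps x = d.β x := by
  have := (isInvertible_of_nondegenerate h.nondeg).self_apply_inverse d.β
  exact DFunLike.congr_fun this x

theorem w_reeb (x : V) : d.w d.reeb x = -d.τ x := by
  have := (isInvertible_of_nondegenerate h.nondeg).self_apply_inverse d.τ
  rw [reeb, form_neg_left]
  exact congrArg _ (DFunLike.congr_fun this x)

theorem w_ext {x x' : V} (hx : ∀ y, d.w x y = d.w x' y) : x = x' := by
  refine sub_eq_zero.1 (h.nondeg _ fun y => ?_)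
  rw [map_sub, sub_apply, hx, sub_self]

theorem w_self (x : V) : d.w x x = 0 := by linarith [h.alt x x]

theorem w_J_left (x y : V) : d.w (d.J x) y = d.w x (d.J y) := by
  have := h.w_J x (d.J y)
  rw [h.J_J, map_neg] at this
  linarith

theorem w_J_self (x : V) : d.w x (d.J x) = 0 := by
  linarith [h.w_J_left x x, h.alt (d.J x) x]

theorem β_eps : d.β d.eps = 0 := by rw [← h.w_eps, h.w_self]

theorem β_J_eps : d.β (d.J d.eps) = 0 := by rw [← h.w_eps, h.w_J_self]

theorem τ_reeb : d.τ d.reeb = 0 := by linarith [h.w_reeb d.reeb, h.w_self d.reeb]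

theorem τ_J_reeb : d.τ (d.J d.reeb) = 0 := by
  linarith [h.w_reeb (d.J d.reeb), h.w_J_self d.reeb]

theorem β_reeb : d.β d.reeb = 1 := by
  rw [← h.w_eps, h.alt, h.w_reeb, h.τ_eps, neg_neg]

theorem β_J_reeb : d.β (d.J d.reeb) = 0 := by
  rw [← h.w_eps, h.alt, h.w_J_left, h.w_reeb, h.τ_J_eps, neg_neg]

theorem proj_eps : d.proj d.eps = 0 := by
  rw [proj_apply, h.τ_eps, h.τ_J_eps, h.β_eps, h.β_J_eps]; module

theorem proj_reeb : d.proj d.reeb = 0 := by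
  rw [proj_apply, h.τ_reeb, h.τ_J_reeb, h.β_reeb, h.β_J_reeb]; module

theorem proj_J (x : V) : d.proj (d.J x) = d.J (d.proj x) := by
  simp only [proj_apply, h.J_J, map_add, map_sub, map_smul, map_neg]; module

theorem base_J (x y : V) : d.base (d.J x) (d.J y) = d.base x y := by
  simp only [base_apply, h.J_J, h.proj_J, h.k_J, map_neg]; ring

/-- If `x` is isotropic for the base form, then `proj x = x`, so that `x` is in the kernel of `k`, i.e. in
the span of `ε` and `Jε`; there it is determined by the values of `τ` and `τ ∘ J`. -/
theorem base_pos : IsPosForm d.base where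
  symm x y := by simp only [base_apply, h.k_symm (d.proj x)]; ring
  pos x hx := by
    have hr := h.r_pos
    have hri := inv_pos.2 hr
    by_contra hcon
    rw [base_apply] at hcon
    have hk := h.k_nonneg (d.proj x)
    have e1 : 0 ≤ d.r * (d.τ x * d.τ x + d.τ (d.J x) * d.τ (d.J x)) :=
      mul_nonneg hr.le (add_nonneg (mul_self_nonneg _) (mul_self_nonneg _))
    have e2 : 0 ≤ d.r⁻¹ * (d.β x * d.β x + d.β (d.J x) * d.β (d.J x)) :=
      mul_nonneg hri.le (add_nonneg (mul_self_nonneg _) (mul_self_nonneg _))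
    have e3 : 0 ≤ d.r * d.k (d.proj x) (d.proj x) := mul_nonneg hr.le hk
    have f1 : d.r * (d.τ x * d.τ x + d.τ (d.J x) * d.τ (d.J x)) = 0 := by linarith
    have f2 : d.r⁻¹ * (d.β x * d.β x + d.β (d.J x) * d.β (d.J x)) = 0 := by linarith
    have f3 : d.r * d.k (d.proj x) (d.proj x) = 0 := by linarith
    have g1 := (mul_eq_zero.1 f1).resolve_left hr.ne'
    have g2 := (mul_eq_zero.1 f2).resolve_left hri.ne'
    have g3 := (mul_eq_zero.1 f3).resolve_left hr.ne'
    have a1 := (mul_self_add_mul_self_eq_zero.1 g1)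
    have a2 := (mul_self_add_mul_self_eq_zero.1 g2)
    have hp : d.proj x = x := by rw [proj_apply, a1.1, a1.2, a2.1, a2.2]; module
    rw [hp] at g3
    obtain ⟨a, b, hab⟩ := h.k_ker x g3
    have b1 : a = 0 := by
      have := a1.1
      rw [hab, map_add, map_smul, map_smul, h.τ_eps, h.τ_J_eps] at this
      simpa using this
    have b2 : b = 0 := by
      have := a1.2
      rw [hab, map_add, map_smul, map_smul, h.J_J, map_add, map_smul, map_smul, map_neg, h.τ_eps,
        h.τ_J_eps] at this
      simpa using this
    exact hx (by rw [hab, b1, b2]; simp)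

theorem base_eps (x : V) : d.base d.eps x = d.r * d.τ x := by
  simp only [base_apply, h.τ_eps, h.τ_J_eps, h.β_eps, h.β_J_eps, h.proj_eps, map_zero, zero_apply]
  ring

theorem base_reeb (x : V) : d.base d.reeb x = d.r⁻¹ * d.β x := by
  simp only [base_apply, h.τ_reeb, h.τ_J_reeb, h.β_reeb, h.β_J_reeb, h.proj_reeb, map_zero,
    zero_apply]
  ring

theorem base_endo (x y : V) : d.base (d.endo x) y = d.w x y := by
  have := (isInvertible_of_nondegenerate h.base_pos.nondegenerate).self_apply_inverse (d.w x)
  exact DFunLike.congr_fun this y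

theorem endo_eps : d.endo d.eps = d.r • d.reeb := by
  refine h.base_pos.ext fun y => ?_
  rw [h.base_endo, h.w_eps, map_smul, smul_apply, h.base_reeb, smul_eq_mul, ← mul_assoc,
    mul_inv_cancel₀ h.r_pos.ne', one_mul]

/-- `A` is antilinear, because `w` is the real part of a complex bilinear form while the base form is
Hermitian. -/
theorem endo_J (x : V) : d.endo (d.J x) = -d.J (d.endo x) := by
  refine h.base_pos.ext fun y => ?_
  have : d.base (d.J (d.endo x)) y = -d.base (d.endo x) (d.J y) := by
    rw [← h.base_J (d.endo x), h.J_J, map_neg, neg_neg]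
  rw [h.base_endo, form_neg_left, this, h.base_endo, neg_neg, h.w_J_left]

theorem square_eq (x y : V) : d.square x y = -d.w (d.endo x) y := by
  rw [square_apply, h.base_pos.symm, h.base_endo, h.alt]

theorem endo_injective {x : V} (hx : d.endo x = 0) : x = 0 := by
  refine h.nondeg x fun y => ?_
  rw [← h.base_endo, hx, map_zero, zero_apply]

theorem square_pos : IsPosForm d.square where
  symm x y := by rw [square_apply, square_apply, h.base_pos.symm]
  pos x hx := h.base_pos.pos _ fun h0 => hx (h.endo_injective h0)

theorem square_J (x y : V) : d.square (d.J x) (d.J y) = d.square x y := by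
  rw [square_apply, h.endo_J, h.endo_J, map_neg, form_neg_left, neg_neg, h.base_J,
    square_apply]

theorem metric_pos : IsPosForm d.metric := formMean_isPosForm h.base_pos h.square_pos

/-- The endomorphism `P = √(-A²)` which relates the base form, the metric and the square. -/
theorem exists_sqrt : ∃ P : V →L[ℝ] V, (∀ x y, d.metric x y = d.base (P x) y) ∧
    ∀ x y, d.square x y = d.metric (P x) y := by
  obtain ⟨P, h1, h2⟩ := formMean_spec h.base_pos h.square_pos
  exact ⟨P, fun x y => congrArg (fun f : V →L[ℝ] V →L[ℝ] ℝ => f x y) h1,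
    fun x y => congrArg (fun f : V →L[ℝ] V →L[ℝ] ℝ => f x y) h2⟩

/-- The characterization of the metric from which all its symmetries follow: a form which solves the
same equation is equal to it. -/
theorem metric_unique {K : V →L[ℝ] V →L[ℝ] ℝ} (hK : IsPosForm K) {P : V →L[ℝ] V}
    (h1 : ∀ x y, K x y = d.base (P x) y) (h2 : ∀ x y, d.square x y = K (P x) y) : K = d.metric :=
  formMean_unique (P := P) h.base_pos hK
    (ContinuousLinearMap.ext fun x => ContinuousLinearMap.ext fun y => h1 x y)
    (ContinuousLinearMap.ext fun x => ContinuousLinearMap.ext fun y => h2 x y)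

/-- The scale factors `r` and `r⁻¹` of the base form are chosen such that `-A²ε = ε`; the positive
operator `√(-A²)` then fixes `ε`, so that the metric agrees with the base form there. -/
theorem metric_eps (x : V) : d.metric d.eps x = d.r * d.τ x := by
  obtain ⟨P, h1, h2⟩ := h.exists_sqrt
  have hPP : P (P d.eps) = d.eps := by
    refine h.base_pos.ext fun y => ?_
    rw [← h1, ← h2, h.square_eq, h.endo_eps, map_smul, smul_apply, h.w_reeb, h.base_eps, smul_eq_mul]
    ring
  -- `P ε - ε` is an eigenvector of the positive operator `P` for the eigenvalue `-1`
  have hP : P d.eps - d.eps = 0 := by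
    by_contra hne
    have e1 := h.metric_pos.pos _ hne
    have e2 := h.base_pos.pos _ hne
    rw [h1] at e1
    have : P (P d.eps - d.eps) = -(P d.eps - d.eps) := by rw [map_sub, hPP]; abel
    rw [this, form_neg_left] at e1
    linarith
  rw [h1, sub_eq_zero.1 hP, h.base_eps]

/-- The metric is Hermitian for `J`: its transform under `J` solves the same equation. -/
theorem metric_J (x y : V) : d.metric (d.J x) (d.J y) = d.metric x y := by
  obtain ⟨P, h1, h2⟩ := h.exists_sqrt
  obtain ⟨K, hK⟩ : ∃ K : V →L[ℝ] V →L[ℝ] ℝ, ∀ x y, K x y = d.metric (d.J x) (d.J y) :=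
    ⟨formPull d.metric d.J, fun _ _ => rfl⟩
  have hJ : ∀ x, d.J x = 0 → x = 0 := fun x hx => by
    rw [← neg_eq_zero, ← h.J_J, hx, map_zero]
  obtain ⟨Q, hQ⟩ : ∃ Q : V →L[ℝ] V, ∀ x, Q x = -d.J (P (d.J x)) :=
    ⟨-(d.J ∘L P ∘L d.J), fun _ => rfl⟩
  have hKpos : IsPosForm K :=
    ⟨fun x y => by rw [hK, hK, h.metric_pos.symm],
      fun x hx => by rw [hK]; exact h.metric_pos.pos _ fun h0 => hx (hJ x h0)⟩
  have := h.metric_unique hKpos (P := Q)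
    (fun x y => by
      rw [hK, h1, hQ, ← h.base_J (-d.J (P (d.J x))), (d.J).map_neg, h.J_J, neg_neg])
    (fun x y => by
      rw [hK, hQ, (d.J).map_neg, h.J_J, neg_neg, ← h2, h.square_J])
  rw [← hK, this]

theorem metric_J₂ (x y : V) : d.metric (d.J₂ x) y = d.w x y := by
  have := (isInvertible_of_nondegenerate h.metric_pos.nondegenerate).self_apply_inverse (d.w x)
  exact DFunLike.congr_fun this y

/-- `J₂` is an isometry, because the transform of the metric under `J₂` solves the same equation as the
metric, with `-A J₂` in the place of `√(-A²)`. -/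
theorem metric_J₂_J₂ (x y : V) : d.metric (d.J₂ x) (d.J₂ y) = d.metric x y := by
  obtain ⟨P, h1, h2⟩ := h.exists_sqrt
  obtain ⟨K, hK⟩ : ∃ K : V →L[ℝ] V →L[ℝ] ℝ, ∀ x y, K x y = d.metric (d.J₂ x) (d.J₂ y) :=
    ⟨formPull d.metric d.J₂, fun _ _ => rfl⟩
  have hJ : ∀ x, d.J₂ x = 0 → x = 0 := fun x hx => h.nondeg x fun y => by
    rw [← h.metric_J₂, hx, map_zero, zero_apply]
  have hPinj : ∀ x x', P x = P x' → x = x' := fun x x' hx => h.metric_pos.ext fun y => by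
    rw [h1, h1, hx]
  have hPJ : ∀ x, P (d.J₂ x) = d.endo x := fun x => h.base_pos.ext fun y => by
    rw [← h1, h.metric_J₂, h.base_endo]
  have hPP : ∀ x, P (P x) = -d.endo (d.endo x) := fun x => h.base_pos.ext fun y => by
    rw [← h1, ← h2, h.square_eq, form_neg_left, h.base_endo]
  have hJAJ : ∀ x, d.J₂ (d.endo (d.J₂ x)) = -d.endo x := fun x => hPinj _ _ (by
    rw [hPJ, map_neg, ← hPJ x, hPP, neg_neg])
  obtain ⟨Q, hQ⟩ : ∃ Q : V →L[ℝ] V, ∀ x, Q x = -d.endo (d.J₂ x) :=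
    ⟨-(d.endo ∘L d.J₂), fun _ => rfl⟩
  have hKpos : IsPosForm K :=
    ⟨fun x y => by rw [hK, hK, h.metric_pos.symm],
      fun x hx => by rw [hK]; exact h.metric_pos.pos _ fun h0 => hx (hJ x h0)⟩
  have := h.metric_unique hKpos (P := Q)
    (fun x y => by
      rw [hK, h.metric_J₂, hQ, form_neg_left, h.base_endo, ← h.alt, ← h.metric_J₂,
        ← h.metric_J₂ y, h.metric_pos.symm])
    (fun x y => by
      rw [hK, hQ, (d.J₂).map_neg, hJAJ, neg_neg, h.square_eq, h.metric_pos.symm, h.metric_J₂,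
        h.alt y])
  rw [← hK, this]

theorem J₂_J₂ (x : V) : d.J₂ (d.J₂ x) = -x := by
  refine h.metric_pos.ext fun y => ?_
  rw [h.metric_J₂, h.alt, ← h.metric_J₂, h.metric_J₂_J₂, form_neg_left, h.metric_pos.symm]

/-- `J₂` anticommutes with `J`, since `w` is the real part of a complex bilinear form. -/
theorem J₂_J (x : V) : d.J₂ (d.J x) = -d.J (d.J₂ x) := by
  refine h.metric_pos.ext fun y => ?_
  have : d.metric (d.J (d.J₂ x)) y = -d.metric (d.J₂ x) (d.J y) := by
    rw [← h.metric_J (d.J₂ x), h.J_J, map_neg, neg_neg]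
  rw [h.metric_J₂, form_neg_left, this, h.metric_J₂, neg_neg, h.w_J_left]

end Good

/-! ### Naturality of the compatible metric -/

section Natural

variable {d} [FiniteDimensional ℝ V]
  {W : Type*} [NormedAddCommGroup W] [NormedSpace ℝ W] [FiniteDimensional ℝ W]

/-- The data `d'` is the pullback of `d` under the linear isomorphism `L`, after the multiplication
of the complex symplectic form by `a + b √-1`, whose modulus is `s`. -/
structure IsPullback (d' : SymplecticData W) (d : SymplecticData V) (L : W ≃L[ℝ] V) (s a b : ℝ) :
    Prop where
  s_pos : 0 < s
  sq : a ^ 2 + b ^ 2 = s ^ 2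
  r_eq : d'.r = s * d.r
  τ_eq : ∀ x, d'.τ x = d.τ (L x)
  w_eq : ∀ x y, d'.w x y = a * d.w (L x) (L y) + b * d.w (d.J (L x)) (L y)
  β_eq : ∀ x, d'.β x = a * d.β (L x) + b * d.β (d.J (L x))
  k_eq : ∀ x y, d'.k x y = d.k (L x) (L y)
  J_eq : ∀ x, L (d'.J x) = d.J (L x)

namespace IsPullback

variable {d' : SymplecticData W} {L : W ≃L[ℝ] V} {s a b : ℝ} (p : d'.IsPullback d L s a b)
  (h : d.Good) (h' : d'.Good)
include p

theorem inv_sq : (s ^ 2)⁻¹ * (a ^ 2 + b ^ 2) = 1 := by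
  rw [p.sq, inv_mul_cancel₀ (pow_ne_zero _ p.s_pos.ne')]

include h h'

theorem map_eps : L d'.eps = d.eps := by
  have : L.symm d.eps = d'.eps := h'.w_ext fun y => by
    rw [p.w_eq, h'.w_eps, p.β_eq, L.apply_symm_apply, h.w_eps, h.w_J_left, h.w_eps]
  rw [← this, L.apply_symm_apply]

/-- The vectors `R` correspond up to the inverse `(a - b J) / s²` of `a + b J`. -/
theorem map_reeb : s ^ 2 • L d'.reeb = a • d.reeb - b • d.J d.reeb := by
  have hs : s ^ 2 ≠ 0 := pow_ne_zero _ p.s_pos.ne'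
  have : L.symm ((s ^ 2)⁻¹ • (a • d.reeb - b • d.J d.reeb)) = d'.reeb := h'.w_ext fun y => by
    rw [p.w_eq, h'.w_reeb, p.τ_eq, L.apply_symm_apply]
    simp only [map_smul, map_sub, h.J_J, smul_apply, sub_apply, smul_eq_mul, h.w_reeb, h.w_J_left,
      form_neg_left]
    linear_combination (-d.τ (L y)) * p.inv_sq
  rw [← this, L.apply_symm_apply, smul_smul, mul_inv_cancel₀ hs, one_smul]

theorem map_proj (x : W) : L (d'.proj x) = d.proj (L x) := by
  have hs : s ^ 2 ≠ 0 := pow_ne_zero _ p.s_pos.ne'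
  have e1 := p.map_eps h h'
  have e2 : L d'.reeb = (s ^ 2)⁻¹ • (a • d.reeb - b • d.J d.reeb) := by
    rw [← p.map_reeb h h', smul_smul, inv_mul_cancel₀ hs, one_smul]
  rw [proj_apply, proj_apply]
  simp only [map_add, map_sub, map_smul, p.J_eq, e1, e2, p.τ_eq, p.β_eq, h.J_J, map_neg,
    smul_sub, smul_smul]
  have f1 : (a * d.β (L x) + b * d.β (d.J (L x))) * ((s ^ 2)⁻¹ * a)
      + (a * d.β (d.J (L x)) + b * -d.β (L x)) * ((s ^ 2)⁻¹ * -b) = d.β (L x) := by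
    linear_combination (d.β (L x)) * p.inv_sq
  have f2 : (a * d.β (L x) + b * d.β (d.J (L x))) * ((s ^ 2)⁻¹ * b)
      + (a * d.β (d.J (L x)) + b * -d.β (L x)) * ((s ^ 2)⁻¹ * a) = d.β (d.J (L x)) := by
    linear_combination (d.β (d.J (L x))) * p.inv_sq
  linear_combination (norm := module) -(f1 • d.reeb) + f2 • d.J d.reeb

theorem base_eq (x y : W) : d'.base x y = s * d.base (L x) (L y) := by
  rw [base_apply, base_apply, p.r_eq, p.k_eq, p.map_proj h h', p.map_proj h h']
  simp only [p.τ_eq, p.β_eq, p.J_eq, h.J_J, map_neg]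
  have hs : s ≠ 0 := p.s_pos.ne'
  have hr : d.r ≠ 0 := h.r_pos.ne'
  field_simp
  linear_combination (d.β (L x) * d.β (L y) + d.β (d.J (L x)) * d.β (d.J (L y))) * p.sq

theorem map_endo (x : W) : s • L (d'.endo x) = d.endo (a • L x + b • d.J (L x)) := by
  refine h.base_pos.ext fun y => ?_
  have := p.base_eq h h' (d'.endo x) (L.symm y)
  rw [h'.base_endo, p.w_eq, L.apply_symm_apply] at this
  rw [h.base_endo]
  simp only [map_smul, smul_apply, smul_eq_mul, map_add, add_apply]
  exact this.symm

theorem square_eq (x y : W) : d'.square x y = s * d.square (L x) (L y) := by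
  have hs : s ≠ 0 := p.s_pos.ne'
  have h1 : d.square (a • L x + b • d.J (L x)) (a • L y + b • d.J (L y))
      = s ^ 2 * d.square (L x) (L y) := by
    have e1 := h.square_J (L x) (L y)
    have e2 := h.square_J (L x) (d.J (L y))
    rw [h.J_J] at e2
    simp only [map_smul, smul_apply, smul_eq_mul, map_add, add_apply, map_neg, e1] at e2 ⊢
    linear_combination (d.square (L x) (L y)) * p.sq - a * b * e2
  rw [square_apply, p.base_eq h h']
  have h2 : d.square (a • L x + b • d.J (L x)) (a • L y + b • d.J (L y))
      = s ^ 2 * d.base (L (d'.endo x)) (L (d'.endo y)) := by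
    rw [square_apply, ← p.map_endo h h', ← p.map_endo h h']
    simp only [map_smul, smul_apply, smul_eq_mul]
    ring
  rw [h1] at h2
  rw [mul_left_cancel₀ (pow_ne_zero 2 hs) h2]

/-- By the uniqueness of the metric, which is insensitive to the phase of `a + b √-1`: the metrics
correspond up to the factor `s`. -/
theorem metric_eq (x y : W) : d'.metric x y = s * d.metric (L x) (L y) := by
  obtain ⟨P, h1, h2⟩ := h.exists_sqrt
  obtain ⟨K, hK⟩ : ∃ K : W →L[ℝ] W →L[ℝ] ℝ, ∀ x y, K x y = s * d.metric (L x) (L y) :=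
    ⟨s • formPull d.metric (L : W →L[ℝ] V), fun _ _ => rfl⟩
  obtain ⟨Q, hQ⟩ : ∃ Q : W →L[ℝ] W, ∀ x, L (Q x) = P (L x) :=
    ⟨(L.symm : V →L[ℝ] W) ∘L P ∘L (L : W →L[ℝ] V), fun x => L.apply_symm_apply _⟩
  have hKpos : IsPosForm K :=
    ⟨fun x y => by rw [hK, hK, h.metric_pos.symm],
      fun x hx => by
        rw [hK]
        exact mul_pos p.s_pos (h.metric_pos.pos _ fun h0 => hx (L.map_eq_zero_iff.1 h0))⟩
  rw [← hK, h'.metric_unique hKpos (P := Q)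
    (fun x y => by rw [hK, p.base_eq h h', hQ, h1])
    (fun x y => by rw [hK, p.square_eq h h', hQ, h2])]

theorem map_J₂ (x : W) : s • L (d'.J₂ x) = a • d.J₂ (L x) + b • d.J₂ (d.J (L x)) := by
  refine h.metric_pos.ext fun y => ?_
  have := p.metric_eq h h' (d'.J₂ x) (L.symm y)
  rw [h'.metric_J₂, p.w_eq, L.apply_symm_apply] at this
  simp only [map_smul, smul_apply, smul_eq_mul, map_add, add_apply, h.metric_J₂]
  exact this.symm

end IsPullback

end Natural

/-! ### Smooth dependence of the compatible metric on the data -/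

section Smooth

variable [FiniteDimensional ℝ V] {X : Type*} [NormedAddCommGroup X] [NormedSpace ℝ X]

theorem _root_.ContDiffAt.form_inverse {f : X → V →L[ℝ] V →L[ℝ] ℝ} {x : X}
    (hf : ContDiffAt ℝ ∞ f x) (h : (f x).IsInvertible) :
    ContDiffAt ℝ ∞ (fun y => (f y).inverse) x :=
  h.contDiffAt_map_inverse.comp x hf

set_option synthInstance.maxHeartbeats 400000 in
omit [FiniteDimensional ℝ V] in
theorem _root_.ContDiffAt.formPull {W : Type*} [NormedAddCommGroup W] [NormedSpace ℝ W]
    {f : X → V →L[ℝ] V →L[ℝ] ℝ} {L : X → W →L[ℝ] V} {x : X}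
    (hf : ContDiffAt ℝ ∞ f x) (hL : ContDiffAt ℝ ∞ L x) :
    ContDiffAt ℝ ∞ (fun y => formPull (f y) (L y)) x := by
  have h0 : ContDiff ℝ ∞ (fun L : W →L[ℝ] V => (ContinuousLinearMap.compL ℝ W V ℝ).flip L) := by
    fun_prop
  have h1 := h0.contDiffAt.comp x hL
  exact h1.clm_comp (hf.clm_comp hL)

/-- Smoothness of a family of symplectic data. -/
structure SmoothAt (d : X → SymplecticData V) (x : X) : Prop where
  r : ContDiffAt ℝ ∞ (fun y => (d y).r) x
  τ : ContDiffAt ℝ ∞ (fun y => (d y).τ) x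
  β : ContDiffAt ℝ ∞ (fun y => (d y).β) x
  w : ContDiffAt ℝ ∞ (fun y => (d y).w) x
  k : ContDiffAt ℝ ∞ (fun y => (d y).k) x
  J : ContDiffAt ℝ ∞ (fun y => (d y).J) x
  good : ∀ᶠ y in 𝓝 x, (d y).Good

namespace SmoothAt

variable {d : X → SymplecticData V} {x : X} (h : SmoothAt d x)
include h

theorem w_inverse : ContDiffAt ℝ ∞ (fun y => (d y).w.inverse) x :=
  h.w.form_inverse (isInvertible_of_nondegenerate h.good.self_of_nhds.nondeg)

theorem proj : ContDiffAt ℝ ∞ (fun y => (d y).proj) x := by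
  have h1 : ContDiffAt ℝ ∞ (fun y => (d y).eps) x := h.w_inverse.clm_apply h.β
  have h2 : ContDiffAt ℝ ∞ (fun y => (d y).reeb) x := (h.w_inverse.clm_apply h.τ).neg
  exact (((contDiffAt_const.sub (h.τ.smulRight h1)).add
    ((h.τ.clm_comp h.J).smulRight (h.J.clm_apply h1))).sub (h.β.smulRight h2)).add
    ((h.β.clm_comp h.J).smulRight (h.J.clm_apply h2))

theorem base : ContDiffAt ℝ ∞ (fun y => (d y).base) x := by
  have h1 := h.τ.clm_comp h.J
  have h2 := h.β.clm_comp h.J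
  exact ((h.r.smul ((h.τ.smulRight h.τ).add (h1.smulRight h1))).add
    ((h.r.inv h.good.self_of_nhds.r_pos.ne').smul
      ((h.β.smulRight h.β).add (h2.smulRight h2)))).add
    (h.r.smul (h.k.formPull h.proj))

theorem endo : ContDiffAt ℝ ∞ (fun y => (d y).endo) x :=
  (h.base.form_inverse
    (isInvertible_of_nondegenerate h.good.self_of_nhds.base_pos.nondegenerate)).clm_comp h.w

theorem metric : ContDiffAt ℝ ∞ (fun y => (d y).metric) x :=
  h.base.formMean (h.base.formPull h.endo) (h.good.mono fun _ hy => hy.base_pos)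
    (h.good.mono fun _ hy => hy.square_pos)

theorem J₂ : ContDiffAt ℝ ∞ (fun y => (d y).J₂) x :=
  (h.metric.form_inverse
    (isInvertible_of_nondegenerate h.good.self_of_nhds.metric_pos.nondegenerate)).clm_comp h.w

end SmoothAt

end Smooth

end SymplecticData

end AdaptedMetric

/-! ### The form `η ∧ β ^ m` in linear algebra -/

section WedgePower

variable {𝕜 V : Type*} [Field 𝕜] [AddCommGroup V] [Module 𝕜 V]

/-- The positions other than `0` come in the pairs `(2k+1, 2k+2)` of arguments of the factors `β`. -/
theorem exists_pair_index {m : ℕ} (p : Fin (2 * m + 1)) (hp : p ≠ 0) :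
    ∃ k : Fin m, p = ⟨2 * k + 1, by omega⟩ ∨ p = ⟨2 * k + 2, by omega⟩ := by
  have hp' : p.1 ≠ 0 := fun h => hp (Fin.ext h)
  exact ⟨⟨(p.1 - 1) / 2, by omega⟩, by simp only [Fin.ext_iff]; omega⟩

/-- The multilinear form `η ⊗ β ⊗ ⋯ ⊗ β`, of which `η ∧ β ^ m` is a multiple of the
alternatization. -/
def tensorPow (η : V →ₗ[𝕜] 𝕜) (β : V →ₗ[𝕜] V →ₗ[𝕜] 𝕜) (m : ℕ) (v : Fin (2 * m + 1) → V) : 𝕜 :=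
  η (v 0) * ∏ k : Fin m, β (v ⟨2 * k + 1, by omega⟩) (v ⟨2 * k + 2, by omega⟩)

theorem tensorPow_update (η : V →ₗ[𝕜] 𝕜) (β : V →ₗ[𝕜] V →ₗ[𝕜] 𝕜) (m : ℕ) (v : Fin (2 * m + 1) → V)
    (i : Fin (2 * m + 1)) :
    ∃ l : V →ₗ[𝕜] 𝕜, ∀ x, tensorPow η β m (Function.update v i x) = l x := by
  simp only [tensorPow]
  by_cases hi : i = 0
  · subst hi
    refine ⟨(∏ k : Fin m, β (v ⟨2 * k + 1, by omega⟩) (v ⟨2 * k + 2, by omega⟩)) • η, fun x => ?_⟩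
    rw [Function.update_self, LinearMap.smul_apply, smul_eq_mul, mul_comm]
    congr 1
  · have hi' : (i : ℕ) ≠ 0 := fun h => hi (Fin.ext h)
    obtain ⟨k, hk⟩ : ∃ k : Fin m, (i : ℕ) = 2 * k + 1 ∨ (i : ℕ) = 2 * k + 2 :=
      ⟨⟨((i : ℕ) - 1) / 2, by omega⟩, by simp only; omega⟩
    have hother : ∀ x, ∏ l ∈ Finset.univ.erase k, β (Function.update v i x ⟨2 * l + 1, by omega⟩)
        (Function.update v i x ⟨2 * l + 2, by omega⟩) = ∏ l ∈ Finset.univ.erase k,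
          β (v ⟨2 * l + 1, by omega⟩) (v ⟨2 * l + 2, by omega⟩) := fun x => by
      refine Finset.prod_congr rfl fun l hl => ?_
      have hlk : (l : ℕ) ≠ k := fun h => Finset.ne_of_mem_erase hl (Fin.ext h)
      rw [Function.update_of_ne, Function.update_of_ne] <;>
      · intro h
        have := congrArg Fin.val h
        simp only at this
        omega
    have h0 : ∀ x, Function.update v i x 0 = v 0 := fun x => Function.update_of_ne (Ne.symm hi) _ _
    have main : ∃ l : V →ₗ[𝕜] 𝕜, ∀ x, β (Function.update v i x ⟨2 * k + 1, by omega⟩)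
        (Function.update v i x ⟨2 * k + 2, by omega⟩) = l x := by
      rcases hk with hk | hk
      · refine ⟨β.flip (v ⟨2 * k + 2, by omega⟩), fun x => ?_⟩
        have : i = ⟨2 * k + 1, by omega⟩ := Fin.ext hk
        rw [← this, Function.update_self, Function.update_of_ne, LinearMap.flip_apply]
        intro h
        have := congrArg Fin.val h
        simp only at this
        omega
      · refine ⟨β (v ⟨2 * k + 1, by omega⟩), fun x => ?_⟩
        have : i = ⟨2 * k + 2, by omega⟩ := Fin.ext hk
        rw [← this, Function.update_self, Function.update_of_ne]
        intro h
        have := congrArg Fin.val h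
        simp only at this
        omega
    obtain ⟨l, hl⟩ := main
    refine ⟨(η (v 0) * ∏ l ∈ Finset.univ.erase k,
          β (v ⟨2 * l + 1, by omega⟩) (v ⟨2 * l + 2, by omega⟩)) • l, fun x => ?_⟩
    rw [← Finset.mul_prod_erase _ _ (Finset.mem_univ k), hother, h0, hl, LinearMap.smul_apply,
      smul_eq_mul]
    ring

/-- The alternating form `η ∧ β ^ m` on a vector space. -/
def wedgeAlt (η : V →ₗ[𝕜] 𝕜) (β : V →ₗ[𝕜] V →ₗ[𝕜] 𝕜) (m : ℕ) :
    V [⋀^Fin (2 * m + 1)]→ₗ[𝕜] 𝕜 :=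
  ((2 : 𝕜) ^ m)⁻¹ • MultilinearMap.alternatization (MultilinearMap.mk'
(tensorPow η β m)
    (fun v i x y => by
      obtain ⟨l, hl⟩ := tensorPow_update η β m v i
      rw [hl, hl, hl, map_add])
    (fun v i c x => by
      obtain ⟨l, hl⟩ := tensorPow_update η β m v i
      rw [hl, hl, map_smul]))

theorem wedgeAlt_apply (η : V →ₗ[𝕜] 𝕜) (β : V →ₗ[𝕜] V →ₗ[𝕜] 𝕜) (m : ℕ)
    (v : Fin (2 * m + 1) → V) :
    wedgeAlt η β m v = wedgePow η (fun x y => β x y) m v := by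
  simp only [wedgeAlt, wedgePow, AlternatingMap.smul_apply, MultilinearMap.alternatization_apply,
    smul_eq_mul]
  congr 1
  refine Finset.sum_congr rfl fun σ _ => ?_
  rw [MultilinearMap.domDomCongr_apply, Units.smul_def, zsmul_eq_mul, mul_assoc]
  rfl

/-- The form `η ∧ β ^ m` vanishes on a vector `a` such that `η a = 0` and `β a` is a multiple of `η`:
in the sum over permutations, the terms cancel in pairs by the exchange of the argument of `η` with
the partner of `a`. -/
theorem wedgePow_eq_zero_of_contraction (η : V → 𝕜) (β : V → V → 𝕜)
    (hβ : ∀ x y, β x y = -β y x) (m : ℕ) {a : V} {c : 𝕜} (ha : η a = 0)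
    (hc : ∀ y, β a y = c * η y) (v : Fin (2 * m + 1) → V) (j : Fin (2 * m + 1)) (hj : v j = a) :
    wedgePow η β m v = 0 := by
  -- the partner of the position `p` in the product of the factors `β`
  obtain ⟨q, hq1, hq2⟩ : ∃ q : Fin (2 * m + 1) → Fin (2 * m + 1),
      (∀ k : Fin m, q ⟨2 * k + 1, by omega⟩ = ⟨2 * k + 2, by omega⟩) ∧
      (∀ k : Fin m, q ⟨2 * k + 2, by omega⟩ = ⟨2 * k + 1, by omega⟩) := by
    refine ⟨fun p => if h : p.1 = 0 then p else if h' : p.1 % 2 = 1 then ⟨p.1 + 1, by omega⟩ else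
      ⟨p.1 - 1, by omega⟩, fun k => ?_, fun k => ?_⟩
    · simp only
      rw [dif_neg (by simp), dif_pos (by omega)]
    · simp only
      rw [dif_neg (by simp), dif_neg (by omega)]
      rfl
  have hq0 : ∀ p, p ≠ 0 → q p ≠ 0 := fun p hp => by
    obtain ⟨k, rfl | rfl⟩ := exists_pair_index p hp
    · rw [hq1]; simp [Fin.ext_iff]
    · rw [hq2]; simp [Fin.ext_iff]
  have hqp : ∀ p, p ≠ 0 → q p ≠ p := fun p hp => by
    obtain ⟨k, rfl | rfl⟩ := exists_pair_index p hp
    · rw [hq1]; simp [Fin.ext_iff]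
    · rw [hq2]; simp [Fin.ext_iff]
  rw [wedgePow]
  refine mul_eq_zero_of_right _ (Finset.sum_involution
    (fun σ _ => if σ.symm j = 0 then σ else σ * Equiv.swap 0 (q (σ.symm j))) ?_ ?_
    (fun _ _ => Finset.mem_univ _) ?_)
  · intro σ _
    obtain ⟨p, hp⟩ : ∃ p, p = σ.symm j := ⟨_, rfl⟩
    have hσp : σ p = j := by rw [hp, Equiv.apply_symm_apply]
    rw [← hp]
    split_ifs with h0
    · rw [h0] at hσp
      rw [hσp, hj, ha]; ring
    · have h1 := hq0 p h0
      have hsp : (σ * Equiv.swap 0 (q p)) p = σ p := by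
        rw [Equiv.Perm.mul_apply, Equiv.swap_apply_of_ne_of_ne h0 (hqp p h0).symm]
      have hs0 : (σ * Equiv.swap 0 (q p)) 0 = σ (q p) := by
        rw [Equiv.Perm.mul_apply, Equiv.swap_apply_left]
      have hsq : (σ * Equiv.swap 0 (q p)) (q p) = σ 0 := by
        rw [Equiv.Perm.mul_apply, Equiv.swap_apply_right]
      have hso : ∀ l, l ≠ 0 → l ≠ q p → (σ * Equiv.swap 0 (q p)) l = σ l := fun l h2 h3 => by
        rw [Equiv.Perm.mul_apply, Equiv.swap_apply_of_ne_of_ne h2 h3]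
      obtain ⟨k, hk⟩ := exists_pair_index p h0
      have hother : ∀ l ∈ Finset.univ.erase k,
          β (v ((σ * Equiv.swap 0 (q p)) ⟨2 * l + 1, by omega⟩))
            (v ((σ * Equiv.swap 0 (q p)) ⟨2 * l + 2, by omega⟩)) =
          β (v (σ ⟨2 * l + 1, by omega⟩)) (v (σ ⟨2 * l + 2, by omega⟩)) := fun l hl => by
        have hlk : (l : ℕ) ≠ k := fun h => Finset.ne_of_mem_erase hl (Fin.ext h)
        have hq' : q p = ⟨2 * k + 2, by omega⟩ ∨ q p = ⟨2 * k + 1, by omega⟩ := by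
          rcases hk with rfl | rfl
          · exact Or.inl (hq1 k)
          · exact Or.inr (hq2 k)
        rw [hso, hso]
        all_goals first
          | (rcases hq' with h | h <;> rw [h] <;> simp only [ne_eq, Fin.mk.injEq] <;> omega)
          | (simp only [ne_eq, Fin.ext_iff]; simp)
      rw [← Finset.mul_prod_erase _ _ (Finset.mem_univ k),
        ← Finset.mul_prod_erase _ (fun k : Fin m =>
          β (v ((σ * Equiv.swap 0 (q p)) ⟨2 * k + 1, by omega⟩))
            (v ((σ * Equiv.swap 0 (q p)) ⟨2 * k + 2, by omega⟩))) (Finset.mem_univ k),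
        Finset.prod_congr rfl hother, hs0, Equiv.Perm.sign_mul, Equiv.Perm.sign_swap h1.symm]
      have hfac : η (v (σ 0)) * β (v (σ ⟨2 * k + 1, by omega⟩)) (v (σ ⟨2 * k + 2, by omega⟩)) =
          η (v (σ (q p))) * β (v ((σ * Equiv.swap 0 (q p)) ⟨2 * k + 1, by omega⟩))
            (v ((σ * Equiv.swap 0 (q p)) ⟨2 * k + 2, by omega⟩)) := by
        rcases hk with rfl | rfl
        · rw [hq1] at hsp hsq ⊢
          rw [hsp, hsq, hσp, hj, hc, hc]; ring
        · rw [hq2] at hsp hsq ⊢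
          rw [hsp, hsq, hσp, hj, hβ _ a, hβ _ a, hc, hc]; ring
      rw [mul_neg_one, Units.val_neg, Int.cast_neg]
      linear_combination ((Equiv.Perm.sign σ : ℤ) : 𝕜) * (∏ l ∈ Finset.univ.erase k,
        β (v (σ ⟨2 * l + 1, by omega⟩)) (v (σ ⟨2 * l + 2, by omega⟩))) * hfac
  · intro σ _ hne
    split_ifs with h0
    · exfalso
      apply hne
      have : σ 0 = j := by rw [← h0, Equiv.apply_symm_apply]
      rw [this, hj, ha]; ring
    · intro h
      rw [mul_eq_left, Equiv.swap_eq_one_iff] at h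
      exact hq0 _ h0 h.symm
  · intro σ _
    by_cases h0 : σ.symm j = 0
    · simp [h0]
    · have h1 : (σ * Equiv.swap 0 (q (σ.symm j))).symm j = σ.symm j := by
        rw [Equiv.symm_apply_eq, Equiv.Perm.mul_apply,
          Equiv.swap_apply_of_ne_of_ne h0 (hqp _ h0).symm, Equiv.apply_symm_apply]
      simp only [h0, if_false, h1]
      rw [mul_assoc, Equiv.swap_mul_self, mul_one]

/-- On a space of dimension `2m+1`, if `η ∧ β ^ m ≠ 0` then `β` is nondegenerate modulo `η`
on the kernel of `η`. -/
theorem eq_zero_of_wedgePow_ne_zero [FiniteDimensional 𝕜 V] {m : ℕ}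
    (hV : Module.finrank 𝕜 V = 2 * m + 1) (η : V →ₗ[𝕜] 𝕜) (β : V →ₗ[𝕜] V →ₗ[𝕜] 𝕜)
    (hβ : ∀ x y, β x y = -β y x) (hne : wedgePow η (fun x y => β x y) m ≠ 0) {a : V} {c : 𝕜}
    (ha : η a = 0) (hc : ∀ y, β a y = c * η y) : a = 0 := by
  by_contra ha0
  apply hne
  funext v
  rw [← wedgeAlt_apply]
  by_cases hv : LinearIndependent 𝕜 v
  · let b := basisOfLinearIndependentOfCardEqFinrank hv (by rw [hV, Fintype.card_fin])
    have hb : ∀ i, b i = v i := fun i => by simp [b]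
    have hsum : ∑ i, b.repr a i • v i = a := by
      simp_rw [← hb]; exact b.sum_repr a
    obtain ⟨j, hj⟩ : ∃ j, b.repr a j ≠ 0 := by
      by_contra! h
      exact ha0 (by rw [← hsum]; simp [h])
    have h1 : wedgeAlt η β m (Function.update v j a) = b.repr a j * wedgeAlt η β m v := by
      conv_lhs => rw [← hsum]
      rw [AlternatingMap.map_update_sum, Finset.sum_eq_single j]
      · rw [AlternatingMap.map_update_smul, Function.update_eq_self, smul_eq_mul]
      · intro i _ hij
        rw [AlternatingMap.map_update_smul, AlternatingMap.map_update_self _ _ hij.symm, smul_zero]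
      · simp
    rw [wedgeAlt_apply, wedgePow_eq_zero_of_contraction η (fun x y => β x y) hβ m ha hc _ j
      (Function.update_self _ _ _)] at h1
    exact (mul_eq_zero.1 h1.symm).resolve_left hj
  · exact AlternatingMap.map_linearDependent _ _ hv

/-- In top degree the forms `η ∧ β ^ m` and `η' ∧ β' ^ m`, for `η = ψ^*η'` and `β = ψ^*β'`, differ by
the factor `det ψ`. -/
theorem wedgePow_eq_det_mul [FiniteDimensional 𝕜 V] {m : ℕ}
    (hV : Module.finrank 𝕜 V = 2 * m + 1) {η η' : V →ₗ[𝕜] 𝕜} {β β' : V →ₗ[𝕜] V →ₗ[𝕜] 𝕜}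
    (ψ : V →ₗ[𝕜] V) (h1 : ∀ x, η' (ψ x) = η x) (h2 : ∀ x y, β' (ψ x) (ψ y) = β x y)
    (v : Fin (2 * m + 1) → V) :
    wedgePow η (fun x y => β x y) m v = LinearMap.det ψ * wedgePow η' (fun x y => β' x y) m v := by
  let b := Module.finBasisOfFinrankEq 𝕜 V hV
  have h3 : wedgePow η (fun x y => β x y) m v = wedgeAlt η' β' m (ψ ∘ v) := by
    rw [wedgeAlt_apply]
    simp only [wedgePow, Function.comp, h1, h2]
  rw [h3, ← wedgeAlt_apply, (wedgeAlt η' β' m).eq_smul_basis_det b, AlternatingMap.smul_apply,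
    AlternatingMap.smul_apply, Module.Basis.det_comp, smul_eq_mul, smul_eq_mul]
  ring

/-- The signs of the products of factors of a Darboux basis: the terms of `η ∧ β ^ m`, evaluated
at such a basis, are nonnegative. -/
theorem sign_mul_prod_nonneg {m : ℕ} (τ : Equiv.Perm (Fin m × Fin 2))
    (B : Fin m × Fin 2 → Fin m × Fin 2 → ℝ)
    (h0 : ∀ k l b c, k ≠ l → B (k, b) (l, c) = 0)
    (h1 : ∀ k, B (k, 0) (k, 1) = 1) (h2 : ∀ k, B (k, 1) (k, 0) = -1) :
    0 ≤ ((Equiv.Perm.sign τ : ℤ) : ℝ) * ∏ k, B (τ (k, 0)) (τ (k, 1)) := by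
  by_cases hP : ∏ k, B (τ (k, 0)) (τ (k, 1)) = 0
  · rw [hP, mul_zero]
  replace hP := Finset.prod_ne_zero_iff.1 hP
  have e1 : ∀ k, (τ (k, 0)).1 = (τ (k, 1)).1 := fun k => by
    by_contra h
    exact hP k (Finset.mem_univ _) (h0 _ _ _ _ h)
  have e2 : ∀ k, (τ (k, 0)).2 ≠ (τ (k, 1)).2 := fun k h => by
    have : τ (k, 0) = τ (k, 1) := Prod.ext (e1 k) h
    simpa using τ.injective this
  -- `τ` permutes the pairs by `ρ`, and the members of each pair by `s`
  let s : Fin m → Equiv.Perm (Fin 2) := fun k => Equiv.swap 0 (τ (k, 0)).2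
  have e3 : ∀ k b, (τ (k, b)).2 = s k b := fun k b => by
    have := e2 k
    fin_cases b
    · simp [s]
    · simp only [s, Fin.mk_one]
      generalize (τ (k, 0)).2 = i at *
      generalize (τ (k, 1)).2 = j at *
      revert this
      fin_cases i <;> fin_cases j <;> simp
  have e4 : ∀ k b, (τ (k, b)).1 = (τ (k, 0)).1 := fun k b => by
    fin_cases b
    · rfl
    · exact (e1 k).symm
  have hρ : Function.Surjective fun k => (τ (k, 0)).1 := fun l => by
    obtain ⟨⟨k, b⟩, hkb⟩ := τ.surjective (l, 0)
    exact ⟨k, by simp only; rw [← e4 k b, hkb]⟩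
  let ρ : Equiv.Perm (Fin m) := Equiv.ofBijective _ (Finite.surjective_iff_bijective.1 hρ)
  have e5 : τ = Equiv.prodCongrLeft (fun _ => ρ) * Equiv.prodCongrRight s := by
    ext1 ⟨k, b⟩
    refine Prod.ext ?_ ?_
    · simp [e4 k b, ρ]
    · simp [e3 k b]
  have e6 : ∀ k, B (τ (k, 0)) (τ (k, 1)) = ((Equiv.Perm.sign (s k) : ℤ) : ℝ) := fun k => by
    have f0 : τ (k, 0) = (ρ k, s k 0) := Prod.ext rfl (e3 k 0)
    have f1 : τ (k, 1) = (ρ k, s k 1) := Prod.ext (e1 k).symm (e3 k 1)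
    have f2 : s k = 1 ∨ s k = Equiv.swap 0 1 := by
      simp only [s]
      generalize (τ (k, 0)).2 = i
      fin_cases i
      · left; exact Equiv.swap_self _
      · right; rfl
    rw [f0, f1]
    rcases f2 with h | h <;> rw [h]
    · simpa using h1 (ρ k)
    · simpa [Equiv.Perm.sign_swap] using h2 (ρ k)
  have e7 : Equiv.Perm.sign τ = ∏ k, Equiv.Perm.sign (s k) := by
    rw [e5, Equiv.Perm.sign_mul, Equiv.Perm.sign_prodCongrRight, Equiv.Perm.sign_prodCongrLeft]
    simp
  rw [Finset.prod_congr rfl fun k _ => e6 k, e7, Units.coe_prod, Int.cast_prod,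
    ← Finset.prod_mul_distrib]
  exact Finset.prod_nonneg fun k _ => mul_self_nonneg _
end WedgePower

/-! ### Almost contact metric structures on a vector space -/

section ContactMetric

variable {V : Type*} [AddCommGroup V] [Module ℝ V] {m : ℕ}

/-- The conditions on an almost contact metric structure, at a point. -/
structure IsAlmostContactMetric (g : V →ₗ[ℝ] V →ₗ[ℝ] ℝ) (Φ : V →ₗ[ℝ] V) (ξ : V)
    (η : V →ₗ[ℝ] ℝ) : Prop where
  symm : ∀ x y, g x y = g y x
  pos : ∀ x, x ≠ 0 → 0 < g x x
  Φ_Φ : ∀ x, Φ (Φ x) = -x + η x • ξ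
  η_ξ : η ξ = 1
  g_ξ : ∀ x, g ξ x = η x
  g_Φ : ∀ x y, g (Φ x) (Φ y) = g x y - η x * η y

namespace IsAlmostContactMetric

variable {g : V →ₗ[ℝ] V →ₗ[ℝ] ℝ} {Φ : V →ₗ[ℝ] V} {ξ : V} {η : V →ₗ[ℝ] ℝ}
  (h : IsAlmostContactMetric g Φ ξ η)
include h

theorem Φ_ξ : Φ ξ = 0 := by
  by_contra h0
  have := h.pos _ h0
  rw [h.g_Φ, h.g_ξ, h.η_ξ] at this
  norm_num at this

theorem η_Φ (x : V) : η (Φ x) = 0 := by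
  have h1 := h.Φ_Φ (Φ x)
  rw [h.Φ_Φ x, map_add, map_neg, map_smul, h.Φ_ξ, smul_zero, add_zero, left_eq_add] at h1
  have h2 := congrArg η h1
  rw [map_smul, h.η_ξ, map_zero, smul_eq_mul, mul_one] at h2
  exact h2

theorem g_Φ_left (x y : V) : g (Φ x) y = -g x (Φ y) := by
  have h1 := h.g_Φ (Φ x) y
  rw [h.η_Φ, zero_mul, sub_zero, h.Φ_Φ] at h1
  simp only [map_add, map_neg, map_smul, LinearMap.add_apply, LinearMap.neg_apply,
    LinearMap.smul_apply, h.g_ξ, h.η_Φ] at h1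
  rw [← h1]; simp

/-- Unitary families in the kernel of `η`. -/
theorem exists_unitary_family [FiniteDimensional ℝ V] (hV : Module.finrank ℝ V = 2 * m + 1)
    (k : ℕ) (hk : k ≤ m) : ∃ e : Fin k → V, (∀ i, η (e i) = 0) ∧
      (∀ i j, g (e i) (e j) = if i = j then 1 else 0) ∧ ∀ i j, g (Φ (e i)) (e j) = 0 := by
  induction k with
  | zero => exact ⟨fun i => i.elim0, fun i => i.elim0, fun i => i.elim0, fun i => i.elim0⟩
  | succ k ih =>
    obtain ⟨e, h1, h2, h3⟩ := ih (by omega)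
    let f : V →ₗ[ℝ] (ℝ × (Fin k → ℝ) × (Fin k → ℝ)) :=
      η.prod ((LinearMap.pi fun i => g (e i)).prod (LinearMap.pi fun i => g (Φ (e i))))
    -- the conditions on the next vector are `2k + 1` linear equations in dimension `2m + 1`
    have hf : LinearMap.ker f ≠ ⊥ := LinearMap.ker_ne_bot_of_finrank_lt (by
      simp only [Module.finrank_prod, Module.finrank_fin_fun, Module.finrank_self, hV]
      omega)
    obtain ⟨x, hx, hx0⟩ := (Submodule.ne_bot_iff _).1 hf
    have hx' : f x = 0 := hx
    have x1 : η x = 0 := congrArg Prod.fst hx'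
    have x2 : ∀ i, g (e i) x = 0 := fun i => congrFun (congrArg (fun p => p.2.1) hx') i
    have x3 : ∀ i, g (Φ (e i)) x = 0 := fun i => congrFun (congrArg (fun p => p.2.2) hx') i
    have hp := h.pos x hx0
    obtain ⟨c, hc⟩ : ∃ c : ℝ, c * c * g x x = 1 := by
      refine ⟨(Real.sqrt (g x x))⁻¹, ?_⟩
      rw [← mul_inv, Real.mul_self_sqrt hp.le, inv_mul_cancel₀ hp.ne']
    have hself : g (Φ x) x = 0 := by linarith [h.g_Φ_left x x, h.symm (Φ x) x]
    refine ⟨Fin.snoc e (c • x), ?_, ?_, ?_⟩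
    · intro i
      refine Fin.lastCases ?_ (fun i => ?_) i
      · simp [x1]
      · simp [h1]
    · intro i j
      refine Fin.lastCases ?_ (fun i => ?_) i <;> refine Fin.lastCases ?_ (fun j => ?_) j
      · simp only [Fin.snoc_last, map_smul, LinearMap.smul_apply, smul_eq_mul, if_true]
        linarith
      · simp [h.symm x, x2, (Fin.castSucc_lt_last j).ne']
      · simp [x2, (Fin.castSucc_lt_last i).ne]
      · simp [h2]
    · intro i j
      refine Fin.lastCases ?_ (fun i => ?_) i <;> refine Fin.lastCases ?_ (fun j => ?_) j
      · simp [hself]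
      · simp [h.g_Φ_left x, h.symm x, x3]
      · simp [x3]
      · simp [h3]

/-- The form `η ∧ g(Φ·, ·) ^ m` is nonzero: its value at the basis `ξ, e₁, Φe₁, …, e_m, Φe_m` is a
sum of nonnegative terms, and the term of the identity permutation is positive. -/
theorem wedgePow_ne_zero [FiniteDimensional ℝ V] (hV : Module.finrank ℝ V = 2 * m + 1) :
    wedgePow η (fun x y => g (Φ x) y) m ≠ 0 := by
  obtain ⟨e, h1, h2, h3⟩ := h.exists_unitary_family hV m le_rfl
  let ix : Option (Fin m × Fin 2) ≃ Fin (2 * m + 1) :=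
    (Equiv.optionCongr (finProdFinEquiv.trans (finCongr (mul_comm m 2)))).trans
      (finSuccEquiv (2 * m)).symm
  have ix0 : ix none = 0 := rfl
  have ix1 : ∀ k : Fin m, ix (some (k, 0)) = ⟨2 * k + 1, by omega⟩ := fun k => by
    apply Fin.ext
    simp [ix]
  have ix2 : ∀ k : Fin m, ix (some (k, 1)) = ⟨2 * k + 2, by omega⟩ := fun k => by
    apply Fin.ext
    simp [ix]
    omega
  let w : Fin m × Fin 2 → V := fun p => if p.2 = 0 then e p.1 else Φ (e p.1)
  let w' : Option (Fin m × Fin 2) → V := fun p => p.elim ξ w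
  have hηw : ∀ p, η (w p) = 0 := fun p => by
    simp only [w]
    split_ifs
    · exact h1 _
    · exact h.η_Φ _
  have hη : ∀ p, η (w' p) = if p = none then 1 else 0 := fun p => by
    cases p with
    | none => exact h.η_ξ
    | some p => exact hηw p
  have gΦΦ : ∀ i j, g (Φ (e i)) (Φ (e j)) = if i = j then 1 else 0 := fun i j => by
    rw [h.g_Φ, h1, h2]; simp
  have gΦ2 : ∀ i j, g (Φ (Φ (e i))) (e j) = - if i = j then 1 else 0 := fun i j => by
    rw [h.g_Φ_left, gΦΦ]
  have gΦ3 : ∀ i j, g (Φ (Φ (e i))) (Φ (e j)) = 0 := fun i j => by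
    rw [h.g_Φ, h.η_Φ, h3]; simp
  have hterm : ∀ σ : Equiv.Perm (Fin (2 * m + 1)),
      ((Equiv.Perm.sign σ : ℤ) : ℝ) * η ((w' ∘ ix.symm) (σ 0)) *
        ∏ k : Fin m, g (Φ ((w' ∘ ix.symm) (σ ⟨2 * k + 1, by omega⟩)))
          ((w' ∘ ix.symm) (σ ⟨2 * k + 2, by omega⟩)) =
      ((Equiv.Perm.sign (ix.symm.permCongr σ) : ℤ) : ℝ) * η (w' (ix.symm.permCongr σ none)) *
        ∏ k : Fin m, g (Φ (w' (ix.symm.permCongr σ (some (k, 0)))))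
          (w' (ix.symm.permCongr σ (some (k, 1)))) := fun σ => by
    rw [Equiv.Perm.sign_permCongr]
    simp only [Equiv.permCongr_apply, Equiv.symm_symm, ix0, ix1, ix2, Function.comp]
  have hnonneg : ∀ σ : Equiv.Perm (Option (Fin m × Fin 2)),
      0 ≤ ((Equiv.Perm.sign σ : ℤ) : ℝ) * η (w' (σ none)) *
        ∏ k : Fin m, g (Φ (w' (σ (some (k, 0))))) (w' (σ (some (k, 1)))) := fun σ => by
    by_cases hσ : σ none = none
    · obtain ⟨τ, rfl⟩ : ∃ τ, σ = Equiv.optionCongr τ := by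
        refine ⟨Equiv.removeNone σ, ?_⟩
        ext1 p
        cases p with
        | none => simp [hσ]
        | some p =>
          have : σ (some p) ≠ none := fun h => by
            have := σ.injective (h.trans hσ.symm)
            simp at this
          rw [Equiv.optionCongr_apply, Option.map_some, Equiv.removeNone_some]
          exact Option.ne_none_iff_exists'.1 this
      have := sign_mul_prod_nonneg τ (fun p q => g (Φ (w p)) (w q)) (fun k l b c hkl => by
          fin_cases b <;> fin_cases c <;> simp [w, h3, gΦΦ, gΦ2, gΦ3, hkl])
        (fun k => by simp [w, gΦΦ]) (fun k => by simp [w, gΦ2])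
      rw [hη]
      simpa [w', Equiv.optionCongr_sign] using this
    · rw [hη, if_neg hσ]; simp
  intro h0
  have hval := congrFun h0 (w' ∘ ix.symm)
  rw [wedgePow, Pi.zero_apply, mul_eq_zero] at hval
  have hsum := hval.resolve_left (by positivity)
  simp only [hterm] at hsum
  rw [Finset.sum_eq_zero_iff_of_nonneg (fun σ _ => hnonneg _)] at hsum
  have h4 := hsum 1 (Finset.mem_univ _)
  have h5 : ix.symm.permCongr 1 = 1 := by ext1 p; simp
  rw [h5, hη] at h4
  simp [w', w, gΦΦ] at h4

end IsAlmostContactMetric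

/-- The rotation `ψ` which permutes three compatible almost contact metric structures `(A, p, x)`,
`(B, q, y)`, `(C, r, z)` cyclically satisfies `g(Bψu, ψv) = g(Au, v)`. -/
theorem rotation_isometry {g : V →ₗ[ℝ] V →ₗ[ℝ] ℝ} {A B C : V →ₗ[ℝ] V} {p q r : V}
    {x y z : V →ₗ[ℝ] ℝ} (hA : IsAlmostContactMetric g A p x) (hB : IsAlmostContactMetric g B q y)
    (hC : IsAlmostContactMetric g C r z)
    (AB : ∀ u, A (B u) = C u + y u • p) (BA : ∀ u, B (A u) = -C u + x u • q)
    (BC : ∀ u, B (C u) = A u + z u • q) (CB : ∀ u, C (B u) = -A u + y u • r)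
    (CA : ∀ u, C (A u) = B u + x u • r) (AC : ∀ u, A (C u) = -B u + z u • p)
    (Aq : A q = r) (Bp : B p = -r) (Br : B r = p) (Cq : C q = -p) (Cp : C p = q) (Ar : A r = -q)
    {ψ : V → V} (hψ : ∀ u, ∃ h, x h = 0 ∧ y h = 0 ∧ z h = 0 ∧ u = h + (x u • p + y u • q + z u • r) ∧
      ψ u = (2⁻¹ : ℝ) • (h + A h + B h + C h) + (x u • q + y u • r + z u • p)) :
    (∀ u, y (ψ u) = x u) ∧ ∀ u v, g (B (ψ u)) (ψ v) = g (A u) v := by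
  have xq : x q = 0 := by
    have := hC.g_Φ_left p p
    rw [Cp, hA.symm, hA.g_ξ] at this; linarith
  have yr : y r = 0 := by
    have := hA.g_Φ_left q q
    rw [Aq, hA.symm, hB.g_ξ] at this; linarith
  have zp : z p = 0 := by
    have := hB.g_Φ_left r r
    rw [Br, hA.symm, hC.g_ξ] at this; linarith
  have xr : x r = 0 := by rw [← hA.g_ξ, hA.symm, hC.g_ξ, zp]
  have yp : y p = 0 := by rw [← hB.g_ξ, hA.symm, hA.g_ξ, xq]
  have zq : z q = 0 := by rw [← hC.g_ξ, hA.symm, hB.g_ξ, yr]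
  have xB : ∀ h, z h = 0 → x (B h) = 0 := fun h hh => by
    have := hB.g_Φ_left p h
    rw [Bp, hA.g_ξ, map_neg, LinearMap.neg_apply, hC.g_ξ, hh] at this; linarith
  have xC : ∀ h, y h = 0 → x (C h) = 0 := fun h hh => by
    have := hC.g_Φ_left p h
    rw [Cp, hA.g_ξ, hB.g_ξ, hh] at this; linarith
  have yA : ∀ h, z h = 0 → y (A h) = 0 := fun h hh => by
    have := hA.g_Φ_left q h
    rw [Aq, hB.g_ξ, hC.g_ξ, hh] at this; linarith
  have yC : ∀ h, x h = 0 → y (C h) = 0 := fun h hh => by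
    have := hC.g_Φ_left q h
    rw [Cq, hB.g_ξ, map_neg, LinearMap.neg_apply, hA.g_ξ, hh] at this; linarith
  have zA : ∀ h, y h = 0 → z (A h) = 0 := fun h hh => by
    have := hA.g_Φ_left r h
    rw [Ar, hC.g_ξ, map_neg, LinearMap.neg_apply, hB.g_ξ, hh] at this; linarith
  have zB : ∀ h, x h = 0 → z (B h) = 0 := fun h hh => by
    have := hB.g_Φ_left r h
    rw [Br, hC.g_ξ, hA.g_ξ, hh] at this; linarith
  refine ⟨fun u => ?_, fun u v => ?_⟩
  · obtain ⟨h, h1, h2, h3, h4, h5⟩ := hψ u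
    rw [h5]
    simp only [map_add, map_smul, smul_eq_mul, h2, yA h h3, hB.η_Φ, yC h h1, hB.η_ξ, yr, yp]
    ring
  · obtain ⟨h, h1, h2, h3, h4, h5⟩ := hψ u
    obtain ⟨k, k1, k2, k3, k4, k5⟩ := hψ v
    -- the left side, expanded in horizontal and vertical parts
    have e1 : B (ψ u) = (2⁻¹ : ℝ) • (-h + A h + B h - C h) + (y u • p - z u • r) := by
      rw [h5]
      simp only [map_add, map_smul, BA, hB.Φ_Φ, BC, hB.Φ_ξ, Br, Bp, h1, h2, h3]
      module
    have e2 : A u = A h + (y u • r - z u • q) := by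
      conv_lhs => rw [h4]
      simp only [map_add, map_smul, hA.Φ_ξ, Aq, Ar]
      module
    have gp : ∀ u, g u p = x u := fun u => by rw [hA.symm, hA.g_ξ]
    have gq : ∀ u, g u q = y u := fun u => by rw [hA.symm, hB.g_ξ]
    have gr : ∀ u, g u r = z u := fun u => by rw [hA.symm, hC.g_ξ]
    have f1 : ∀ u, g h (A u) = -g (A h) u := fun u => by rw [hA.g_Φ_left, neg_neg]
    have f2 : ∀ u, g h (B u) = -g (B h) u := fun u => by rw [hB.g_Φ_left, neg_neg]
    have f3 : ∀ u, g h (C u) = -g (C h) u := fun u => by rw [hC.g_Φ_left, neg_neg]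
    have g1 : g (A h) (B k) = g (C h) k := by
      rw [← neg_eq_iff_eq_neg.2 (hB.g_Φ_left (A h) k), BA, h1]; simp
    have g2 : g (A h) (C k) = -g (B h) k := by
      rw [← neg_eq_iff_eq_neg.2 (hC.g_Φ_left (A h) k), CA, h1]; simp
    have g3 : g (B h) (A k) = -g (C h) k := by
      rw [← neg_eq_iff_eq_neg.2 (hA.g_Φ_left (B h) k), AB, h2]; simp
    have g4 : g (B h) (C k) = g (A h) k := by
      rw [← neg_eq_iff_eq_neg.2 (hC.g_Φ_left (B h) k), CB, h2]; simp
    have g5 : g (C h) (A k) = g (B h) k := by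
      rw [← neg_eq_iff_eq_neg.2 (hA.g_Φ_left (C h) k), AC, h3]; simp
    have g6 : g (C h) (B k) = -g (A h) k := by
      rw [← neg_eq_iff_eq_neg.2 (hB.g_Φ_left (C h) k), BC, h3]; simp
    rw [e1, e2, k5]
    conv_rhs => rw [k4]
    simp only [map_add, map_sub, map_neg, map_smul, LinearMap.add_apply, LinearMap.sub_apply,
      LinearMap.neg_apply, LinearMap.smul_apply, smul_eq_mul, hA.g_ξ, hB.g_ξ, hC.g_ξ, gp, gq, gr,
      hA.g_Φ, hB.g_Φ, hC.g_Φ, f1, f2, f3, g1, g2, g3, g4, g5, g6, h1, h2, h3, k1, k2, k3,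
      hA.η_Φ, hB.η_Φ, hC.η_Φ, hA.η_ξ, hB.η_ξ, hC.η_ξ, xq, yr, zp, xr, yp, zq,
      xB h h3, xC h h2, yA h h3, yC h h1, zA h h2, zB h h1,
      xB k k3, xC k k2, zA k k2, zB k k1]
    ring

/-- The conditions on an almost contact metric 3-structure, at a point. -/
structure IsAlmostContactMetric3 (g : V →ₗ[ℝ] V →ₗ[ℝ] ℝ) (Φ : Fin 3 → V →ₗ[ℝ] V) (ξ : Fin 3 → V)
    (η : Fin 3 → V →ₗ[ℝ] ℝ) : Prop where
  acm : ∀ α, IsAlmostContactMetric g (Φ α) (ξ α) (η α)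
  Φ_Φ : ∀ α x, Φ α (Φ (α + 1) x) - η (α + 1) x • ξ α = Φ (α + 2) x
  Φ_Φ' : ∀ α x, -Φ (α + 1) (Φ α x) + η α x • ξ (α + 1) = Φ (α + 2) x
  Φ_ξ : ∀ α, Φ α (ξ (α + 1)) = ξ (α + 2)
  Φ_ξ' : ∀ α, -Φ (α + 1) (ξ α) = ξ (α + 2)

namespace IsAlmostContactMetric3

variable {g : V →ₗ[ℝ] V →ₗ[ℝ] ℝ} {Φ : Fin 3 → V →ₗ[ℝ] V} {ξ : Fin 3 → V} {η : Fin 3 → V →ₗ[ℝ] ℝ}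
  (h : IsAlmostContactMetric3 g Φ ξ η)
include h

/-- The rotation which permutes the three almost contact structures cyclically: it permutes the `ξ_α`,
and acts on their orthogonal complement by the unit quaternion `(1 + i + j + k) / 2`. -/
theorem exists_rotation : ∃ ψ : V →ₗ[ℝ] V, (∀ α x, η (α + 1) (ψ x) = η α x) ∧
    ∀ α x y, g (Φ (α + 1) (ψ x)) (ψ y) = g (Φ α x) y := by
  have i1 : ∀ α : Fin 3, α + 1 + 1 = α + 2 := by decide
  have i2 : ∀ α : Fin 3, α + 1 + 2 = α := by decide
  have i3 : ∀ α : Fin 3, α + 2 + 1 = α := by decide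
  have i4 : ∀ α : Fin 3, α + 2 + 2 = α + 1 := by decide
  have hp : ∀ α x, Φ α (Φ (α + 1) x) = Φ (α + 2) x + η (α + 1) x • ξ α := fun α x => by
    rw [← h.Φ_Φ, sub_add_cancel]
  have hm : ∀ α x, Φ (α + 1) (Φ α x) = -Φ (α + 2) x + η α x • ξ (α + 1) := fun α x => by
    rw [← h.Φ_Φ']; abel
  have hξ : ∀ α, Φ (α + 1) (ξ α) = -ξ (α + 2) := fun α => by rw [← h.Φ_ξ', neg_neg]
  have hηξ : ∀ α, η α (ξ (α + 1)) = 0 ∧ η (α + 1) (ξ α) = 0 := fun α => by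
    have e1 := (h.acm (α + 2)).g_Φ_left (ξ α) (ξ α)
    have e2 := h.Φ_ξ (α + 2)
    rw [i3, i4] at e2
    rw [e2, (h.acm α).g_ξ, (h.acm (α + 1)).g_ξ] at e1
    have e3 : η (α + 1) (ξ α) = η α (ξ (α + 1)) := by
      rw [← (h.acm (α + 1)).g_ξ, (h.acm α).symm, (h.acm α).g_ξ]
    constructor <;> linarith
  -- `hor` is the projection onto the common kernel of the `η_α`, on which the rotation acts as the unit
  -- quaternion `(1 + i + j + k) / 2`, while it permutes the vectors `ξ_α`
  let hor : V →ₗ[ℝ] V := LinearMap.id - ∑ β, (η β).smulRight (ξ β)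
  let ψ : V →ₗ[ℝ] V := (2⁻¹ : ℝ) • (hor + ∑ β, Φ β ∘ₗ hor) + ∑ β, (η β).smulRight (ξ (β + 1))
  have hhor : ∀ u, hor u = u - (η 0 u • ξ 0 + η 1 u • ξ 1 + η 2 u • ξ 2) := fun u => by
    simp [hor, Fin.sum_univ_three]
  have hψ : ∀ u, ψ u = (2⁻¹ : ℝ) • (hor u + (Φ 0 (hor u) + Φ 1 (hor u) + Φ 2 (hor u)))
      + (η 0 u • ξ 1 + η 1 u • ξ 2 + η 2 u • ξ 0) := fun u => by
    simp [ψ, Fin.sum_univ_three]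
  have hη : ∀ α u, η α (hor u) = 0 := fun α u => by
    have a0 := hηξ 0
    have a1 := hηξ 1
    have a2 := hηξ 2
    have b0 := (h.acm 0).η_ξ
    have b1 := (h.acm 1).η_ξ
    have b2 := (h.acm 2).η_ξ
    simp only [Fin.isValue, zero_add, show (1 + 1 : Fin 3) = 2 from rfl,
      show (2 + 1 : Fin 3) = 0 from rfl] at a0 a1 a2
    rw [hhor]
    fin_cases α <;> simp [a0.1, a0.2, a1.1, a1.2, a2.1, a2.2, b0, b1, b2]
  have key : ∀ α, (∀ u, η (α + 1) (ψ u) = η α u) ∧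
      ∀ u v, g (Φ (α + 1) (ψ u)) (ψ v) = g (Φ α u) v := fun α => by
    have hp1 := hp (α + 1)
    have hp2 := hp (α + 2)
    have hm1 := hm (α + 1)
    have hm2 := hm (α + 2)
    have hq1 := h.Φ_ξ (α + 1)
    have hq2 := h.Φ_ξ (α + 2)
    have hξ1 := hξ (α + 1)
    have hξ2 := hξ (α + 2)
    simp only [i1, i2, i3, i4] at hp1 hp2 hm1 hm2 hq1 hq2 hξ1 hξ2
    refine rotation_isometry (h.acm α) (h.acm (α + 1)) (h.acm (α + 2)) (hp α) (hm α) hp1 hm1 hp2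
      hm2 (h.Φ_ξ α) (hξ α) hq1 hξ1 hq2 hξ2 fun u => ⟨hor u, hη _ u, hη _ u, hη _ u, ?_, ?_⟩
    · rw [hhor]
      fin_cases α
      · simp
      · simp only [Fin.mk_one, show (1 + 1 : Fin 3) = 2 from rfl, show (1 + 2 : Fin 3) = 0 from rfl]
        abel
      · simp only [Fin.reduceFinMk, show (2 + 1 : Fin 3) = 0 from rfl,
          show (2 + 2 : Fin 3) = 1 from rfl]
        abel
    · rw [hψ]
      fin_cases α
      · simp only [Fin.zero_eta, zero_add]; module
      · simp only [Fin.mk_one, show (1 + 1 : Fin 3) = 2 from rfl, show (1 + 2 : Fin 3) = 0 from rfl]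
        module
      · simp only [Fin.reduceFinMk, show (2 + 1 : Fin 3) = 0 from rfl,
          show (2 + 2 : Fin 3) = 1 from rfl]
        module
  exact ⟨ψ, fun α => (key α).1, fun α => (key α).2⟩

/-- The three forms `η_α ∧ g(Φ_α·, ·) ^ m` agree: they are permuted cyclically by the rotation, whose
determinant `d` therefore satisfies `d³ = 1`. -/
theorem wedgePow_eq [FiniteDimensional ℝ V] (hV : Module.finrank ℝ V = 2 * m + 1) :
    wedgePow (η 1) (fun x y => g (Φ 1 x) y) m = wedgePow (η 2) (fun x y => g (Φ 2 x) y) m := by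
  obtain ⟨ψ, h1, h2⟩ := h.exists_rotation
  have key : ∀ α v, wedgePow (η α) (fun x y => g (Φ α x) y) m v =
      LinearMap.det ψ * wedgePow (η (α + 1)) (fun x y => g (Φ (α + 1) x) y) m v := fun α v =>
    wedgePow_eq_det_mul hV (β := g ∘ₗ Φ α) (β' := g ∘ₗ Φ (α + 1)) ψ (h1 α) (h2 α) v
  obtain ⟨v, hv⟩ := Function.ne_iff.1 ((h.acm 1).wedgePow_ne_zero hV)
  have e1 := key 1 v
  rw [show (1 + 1 : Fin 3) = 2 from rfl, key 2 v, show (2 + 1 : Fin 3) = 0 from rfl, key 0 v,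
    show (0 + 1 : Fin 3) = 1 from rfl, ← mul_assoc, ← mul_assoc, eq_comm, mul_eq_right₀ hv] at e1
  have e2 : LinearMap.det ψ = 1 := by
    -- `d³ - 1 = (d - 1)(d² + d + 1)`, whose last factor is positive
    have : (LinearMap.det ψ - 1) * ((LinearMap.det ψ + 1 / 2) ^ 2 + 3 / 4) = 0 := by
      linear_combination e1
    rcases mul_eq_zero.1 this with h | h
    · linarith
    · nlinarith [sq_nonneg (LinearMap.det ψ + 1 / 2)]
  funext v
  have := key 1 v
  rwa [e2, one_mul] at this

end IsAlmostContactMetric3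

end ContactMetric

/-! ### Charts, frames and pullbacks of differential forms -/

section Frames

variable {𝕜 : Type*} [NontriviallyNormedField 𝕜]
  {F : Type*} [NormedAddCommGroup F] [NormedSpace 𝕜 F]
  {H : Type*} [TopologicalSpace H] (I : ModelWithCorners 𝕜 F H) [I.Boundaryless]
  {M : Type*} [TopologicalSpace M] [ChartedSpace H M] [IsManifold I 1 M]

theorem mdifferentiableAt_extChartAt_symm {x₀ : M} {y : F} (hy : y ∈ (extChartAt I x₀).target) :
    MDifferentiableAt 𝓘(𝕜, F) I (extChartAt I x₀).symm y := by
  have := mdifferentiableWithinAt_extChartAt_symm (I := I) hy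
  rwa [I.range_eq_univ, mdifferentiableWithinAt_univ] at this

theorem mdifferentiableAt_extChartAt' {x₀ p : M} (hp : p ∈ (extChartAt I x₀).source) :
    MDifferentiableAt I 𝓘(𝕜, F) (extChartAt I x₀) p :=
  mdifferentiableAt_extChartAt (by rwa [extChartAt_source] at hp)

theorem mfderiv_symm_mfderiv {x₀ : M} {y : F} (hy : y ∈ (extChartAt I x₀).target)
    (v : TangentSpace I ((extChartAt I x₀).symm y)) :
    mfderiv 𝓘(𝕜, F) I (extChartAt I x₀).symm y
      (mfderiv I 𝓘(𝕜, F) (extChartAt I x₀) ((extChartAt I x₀).symm y) v) = v := by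
  have := mfderivWithin_extChartAt_symm_comp_mfderiv_extChartAt (I := I) hy
  rw [I.range_eq_univ, mfderivWithin_univ] at this
  exact DFunLike.congr_fun this v

theorem mfderiv_mfderiv_symm {x₀ : M} {y : F} (hy : y ∈ (extChartAt I x₀).target) (v : F) :
    mfderiv I 𝓘(𝕜, F) (extChartAt I x₀) ((extChartAt I x₀).symm y)
      (mfderiv 𝓘(𝕜, F) I (extChartAt I x₀).symm y v) = v := by
  have := mfderiv_extChartAt_comp_mfderivWithin_extChartAt_symm (I := I) hy
  rw [I.range_eq_univ, mfderivWithin_univ] at this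
  exact DFunLike.congr_fun this v

theorem mfderiv_symm_mfderiv' {x₀ p : M} (hp : p ∈ (extChartAt I x₀).source)
    (v : TangentSpace I p) :
    (mfderiv 𝓘(𝕜, F) I (extChartAt I x₀).symm (extChartAt I x₀ p)
      (mfderiv I 𝓘(𝕜, F) (extChartAt I x₀) p v) : F) = v := by
  have := mfderivWithin_extChartAt_symm_comp_mfderiv_extChartAt' (I := I) hp
  rw [I.range_eq_univ, mfderivWithin_univ] at this
  exact DFunLike.congr_fun this v

theorem mfderiv_extChartAt_self_apply (x : M) (v : TangentSpace I x) :
    mfderiv I 𝓘(𝕜, F) (extChartAt I x) x v = v := by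
  rw [mfderiv_extChartAt_self]; rfl

theorem mfderiv_extChartAt_symm_self_apply (x : M) (v : F) :
    (mfderiv 𝓘(𝕜, F) I (extChartAt I x).symm (extChartAt I x x) v : F) = v := by
  have := mfderiv_symm_mfderiv' I (mem_extChartAt_source (I := I) x) v
  exact (congrArg (mfderiv 𝓘(𝕜, F) I (extChartAt I x).symm (extChartAt I x x))
    (mfderiv_extChartAt_self_apply I x v)).symm.trans this

end Frames

section FormPullback

variable {𝕜 : Type*} [NontriviallyNormedField 𝕜]
  {F : Type*} [NormedAddCommGroup F] [NormedSpace 𝕜 F]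
  {H : Type*} [TopologicalSpace H] (I : ModelWithCorners 𝕜 F H) [I.Boundaryless]
  {M : Type*} [TopologicalSpace M] [ChartedSpace H M] [IsManifold I 1 M]
  {F' : Type*} [NormedAddCommGroup F'] [NormedSpace 𝕜 F']
  {H' : Type*} [TopologicalSpace H'] (J : ModelWithCorners 𝕜 F' H') [J.Boundaryless]
  {N : Type*} [TopologicalSpace N] [ChartedSpace H' N] [IsManifold J 1 N]
  {V : Type*} [NormedAddCommGroup V] [NormedSpace 𝕜 V] {k : ℕ}

/-- The pullback of a differential form under a map of manifolds. -/
noncomputable def pullbackForm (f : N → M) (α : ∀ x : M, TangentSpace I x [⋀^Fin k]→L[𝕜] V) (x : N) :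
    TangentSpace J x [⋀^Fin k]→L[𝕜] V :=
  (α (f x)).compContinuousLinearMap (mfderiv J I f x)

omit [I.Boundaryless] [IsManifold I 1 M] in
theorem form_apply_congr (α : ∀ x : M, TangentSpace I x [⋀^Fin k]→L[𝕜] V) {p q : M} (h : p = q)
    {v w : Fin k → F} (hv : v = w) : α p v = α q w := by
  subst h; subst hv; rfl

/-- A form is determined by its expression in a chart. -/
theorem formInChart_apply_mfderiv (α : ∀ x : M, TangentSpace I x [⋀^Fin k]→L[𝕜] V) {x₀ p : M}
    (hp : p ∈ (extChartAt I x₀).source) (v : Fin k → TangentSpace I p) :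
    formInChart I α x₀ (extChartAt I x₀ p)
      (fun i => mfderiv I 𝓘(𝕜, F) (extChartAt I x₀) p (v i)) = α p v :=
  form_apply_congr I α ((extChartAt I x₀).left_inv hp)
    (funext fun i => mfderiv_symm_mfderiv' I hp (v i))

theorem formInChart_self_apply (α : ∀ x : M, TangentSpace I x [⋀^Fin k]→L[𝕜] V) (x : M)
    (v : Fin k → F) : formInChart I α x (extChartAt I x x) v = α x v := by
  have := formInChart_apply_mfderiv I α (mem_extChartAt_source (I := I) x) v
  rw [← this]
  congr 1
  exact funext fun i => (mfderiv_extChartAt_self_apply I x (v i)).symm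

theorem formInChart_pullbackForm (f : N → M) (α : ∀ x : M, TangentSpace I x [⋀^Fin k]→L[𝕜] V)
    {x₀ : N} {y₀ : M} {y : F'} (hy : y ∈ (extChartAt J x₀).target)
    (hfy : f ((extChartAt J x₀).symm y) ∈ (extChartAt I y₀).source)
    (hf : MDifferentiableAt J I f ((extChartAt J x₀).symm y)) :
    formInChart J (pullbackForm I J f α) x₀ y =
      (formInChart I α y₀ (extChartAt I y₀ (f ((extChartAt J x₀).symm y)))).compContinuousLinearMap
        (fderiv 𝕜 (extChartAt I y₀ ∘ f ∘ (extChartAt J x₀).symm) y) := by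
  have h1 : mfderiv 𝓘(𝕜, F') 𝓘(𝕜, F) (extChartAt I y₀ ∘ f ∘ (extChartAt J x₀).symm) y =
      (mfderiv I 𝓘(𝕜, F) (extChartAt I y₀) (f ((extChartAt J x₀).symm y))).comp
        ((mfderiv J I f ((extChartAt J x₀).symm y)).comp
          (mfderiv 𝓘(𝕜, F') J (extChartAt J x₀).symm y)) := by
    rw [mfderiv_comp y (mdifferentiableAt_extChartAt' I hfy)
      (hf.comp y (mdifferentiableAt_extChartAt_symm J hy)),
      mfderiv_comp y hf (mdifferentiableAt_extChartAt_symm J hy)]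
    rfl
  rw [mfderiv_eq_fderiv] at h1
  ext v
  rw [h1]
  exact (formInChart_apply_mfderiv I α hfy
    (fun i => mfderiv J I f _ (mfderiv 𝓘(𝕜, F') J (extChartAt J x₀).symm y (v i)))).symm

/-- The exterior derivative commutes with pullbacks. -/
theorem extDerivForm_pullbackForm {r : ℕ∞ω} (hr : minSmoothness 𝕜 2 ≤ r) {f : N → M}
    (α : ∀ x : M, TangentSpace I x [⋀^Fin k]→L[𝕜] V) {x : N} (hf : ContMDiffAt J I r f x)
    (hα : DifferentiableAt 𝕜 (formInChart I α (f x)) (extChartAt I (f x) (f x))) :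
    extDerivForm J (pullbackForm I J f α) x = pullbackForm I J f (extDerivForm I α) x := by
  have hr1 : (1 : ℕ∞ω) ≤ r := le_trans (by exact_mod_cast one_le_two) (le_minSmoothness.trans hr)
  have hx := mem_extChartAt_source (I := J) x
  have hev : ∀ᶠ p in 𝓝 x, MDifferentiableAt J I f p := by
    have h1 := (contMDiffAt_iff_contMDiffAt_nhds (by simp)).1 (hf.of_le hr1)
    exact h1.mono fun p hp => hp.mdifferentiableAt (by simp)
  have hsrc : ∀ᶠ p in 𝓝 x, f p ∈ (extChartAt I (f x)).source :=
    hf.continuousAt.eventually (extChartAt_source_mem_nhds (I := I) (f x))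
  have hsymm : Filter.Tendsto (extChartAt J x).symm (𝓝 (extChartAt J x x)) (𝓝 x) := by
    have := (continuousAt_extChartAt_symm (I := J) x).tendsto
    rwa [extChartAt_to_inv] at this
  have hF : ContDiffAt 𝕜 r (extChartAt I (f x) ∘ f ∘ (extChartAt J x).symm) (extChartAt J x x) := by
    have := (contMDiffAt_iff.1 hf).2
    rwa [J.range_eq_univ, contDiffWithinAt_univ] at this
  have h1 : formInChart J (pullbackForm I J f α) x =ᶠ[𝓝 (extChartAt J x x)] fun y =>
      (formInChart I α (f x) ((extChartAt I (f x) ∘ f ∘ (extChartAt J x).symm) y)).compContinuousLinearMap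
        (fderiv 𝕜 (extChartAt I (f x) ∘ f ∘ (extChartAt J x).symm) y) := by
    filter_upwards [hsymm.eventually hev, hsymm.eventually hsrc,
      extChartAt_target_mem_nhds (I := J) x] with y h1 h2 h3
    exact formInChart_pullbackForm I J f α h3 h2 h1
  have h2 : (extChartAt I (f x) ∘ f ∘ (extChartAt J x).symm) (extChartAt J x x)
      = extChartAt I (f x) (f x) := by
    simp only [Function.comp_apply, extChartAt_to_inv]
  rw [extDerivForm, h1.extDeriv_eq, extDeriv_pullback (by rw [h2]; exact hα) hF hr, h2]
  have h3 : fderiv 𝕜 (extChartAt I (f x) ∘ f ∘ (extChartAt J x).symm) (extChartAt J x x) =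
      mfderiv J I f x := by
    have := hev.self_of_nhds.mfderiv
    rw [this, J.range_eq_univ, fderivWithin_univ]
    rfl
  have h4 := mfderiv_extChartAt_self (I := J) (x := x)
  have h5 := mfderiv_extChartAt_self (I := I) (x := f x)
  ext v
  rw [pullbackForm, extDerivForm, h3, h4, h5]
  rfl

end FormPullback

/-! ### The exterior derivative in charts -/

section FormCharts

variable {𝕜 : Type*} [NontriviallyNormedField 𝕜]
  {F : Type*} [NormedAddCommGroup F] [NormedSpace 𝕜 F]
  {H : Type*} [TopologicalSpace H] (I : ModelWithCorners 𝕜 F H) [I.Boundaryless]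
  {M : Type*} [TopologicalSpace M] [ChartedSpace H M]
  {V : Type*} [NormedAddCommGroup V] [NormedSpace 𝕜 V] {k : ℕ}

/-- A family of linear maps on a finite-dimensional space is `C^n` at a point if all of its
applications are. -/
theorem contDiffAt_clm_apply {𝕜 D E G : Type*} [NontriviallyNormedField 𝕜] [CompleteSpace 𝕜]
    [NormedAddCommGroup D] [NormedSpace 𝕜 D] [NormedAddCommGroup E] [NormedSpace 𝕜 E]
    [FiniteDimensional 𝕜 E] [NormedAddCommGroup G] [NormedSpace 𝕜 G] {r : ℕ∞ω}
    {f : D → E →L[𝕜] G} {x : D} (h : ∀ v, ContDiffAt 𝕜 r (fun y => f y v) x) :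
    ContDiffAt 𝕜 r f x := by
  have hd : Module.finrank 𝕜 E = Module.finrank 𝕜 (Fin (Module.finrank 𝕜 E) → 𝕜) :=
    (Module.finrank_fin_fun 𝕜).symm
  let e₁ := ContinuousLinearEquiv.ofFinrankEq hd
  let e₂ := (e₁.arrowCongr (1 : G ≃L[𝕜] G)).trans (ContinuousLinearEquiv.piRing _)
  rw [← Function.id_comp f, ← e₂.symm_comp_self]
  exact e₂.symm.contDiff.contDiffAt.comp x (contDiffAt_pi.mpr fun i => h _)

theorem isOpen_target_inter_preimage (x₀ : M) {s : Set M} (hs : IsOpen s) :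
    IsOpen ((extChartAt I x₀).target ∩ (extChartAt I x₀).symm ⁻¹' s) :=
  (continuousOn_extChartAt_symm (I := I) x₀).isOpen_inter_preimage (isOpen_extChartAt_target x₀) hs

theorem IsSmoothFormOn.contDiffAt {r : ℕ∞ω} {α : ∀ x : M, TangentSpace I x [⋀^Fin k]→L[𝕜] V}
    {s : Set M} (hα : IsSmoothFormOn I r α s) (hs : IsOpen s) {x₀ : M} {y : F}
    (hy : y ∈ (extChartAt I x₀).target) (hys : (extChartAt I x₀).symm y ∈ s) :
    ContDiffAt 𝕜 r (formInChart I α x₀) y :=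
  (hα x₀).contDiffAt ((isOpen_target_inter_preimage I x₀ hs).mem_nhds ⟨hy, hys⟩)

theorem IsSmoothFormOn.contDiffAt_self {r : ℕ∞ω} {α : ∀ x : M, TangentSpace I x [⋀^Fin k]→L[𝕜] V}
    {s : Set M} (hα : IsSmoothFormOn I r α s) (hs : IsOpen s) {x : M} (hx : x ∈ s) :
    ContDiffAt 𝕜 r (formInChart I α x) (extChartAt I x x) :=
  hα.contDiffAt I hs (mem_extChartAt_target x) (by rwa [extChartAt_to_inv])

theorem isSmoothFormOn_univ_iff {r : ℕ∞ω} {α : ∀ x : M, TangentSpace I x [⋀^Fin k]→L[𝕜] V} :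
    IsSmoothFormOn I r α univ ↔
      ∀ x₀, ∀ y ∈ (extChartAt I x₀).target, ContDiffAt 𝕜 r (formInChart I α x₀) y :=
  ⟨fun h _ _ hy => h.contDiffAt I isOpen_univ hy (mem_univ _),
    fun h _ y hy => (h _ y hy.1).contDiffWithinAt⟩

/-- On the model space, the exterior derivative of a form is the usual one. -/
theorem extDerivForm_model (α : ∀ y : F, TangentSpace 𝓘(𝕜, F) y [⋀^Fin k]→L[𝕜] V) (y : F) :
    extDerivForm 𝓘(𝕜, F) α y = extDeriv (fun y => (α y : F [⋀^Fin k]→L[𝕜] V)) y := by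
  have h1 : formInChart 𝓘(𝕜, F) α y = fun y => (α y : F [⋀^Fin k]→L[𝕜] V) := by
    funext z
    ext v
    refine form_apply_congr 𝓘(𝕜, F) α rfl (funext fun i => ?_)
    have : ((extChartAt 𝓘(𝕜, F) y).symm : F → F) = id := by
      rw [extChartAt_model_space_eq_id]; rfl
    rw [this]
    exact DFunLike.congr_fun (mfderiv_id (I := 𝓘(𝕜, F)) (x := z)) (v i)
  rw [extDerivForm, h1]
  ext v
  have h2 : (fun i => mfderiv 𝓘(𝕜, F) 𝓘(𝕜, F) (extChartAt 𝓘(𝕜, F) y) y (v i)) = v :=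
    funext fun i => mfderiv_extChartAt_self_apply 𝓘(𝕜, F) y (v i)
  have h3 : extChartAt 𝓘(𝕜, F) y y = y := by rw [extChartAt_model_space_eq_id]; rfl
  refine (congrArg (extDeriv (fun y => (α y : F [⋀^Fin k]→L[𝕜] V))
    (extChartAt 𝓘(𝕜, F) y y)) h2).trans ?_
  rw [h3]
  rfl

/-- The exterior derivative can be computed in any chart. -/
theorem formInChart_extDerivForm {r : ℕ∞ω} [IsManifold I r M] [IsManifold I 1 M]
    (hr : minSmoothness 𝕜 2 ≤ r) (α : ∀ x : M, TangentSpace I x [⋀^Fin k]→L[𝕜] V) {x₀ : M} {y : F}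
    (hy : y ∈ (extChartAt I x₀).target)
    (hα : DifferentiableAt 𝕜 (formInChart I α ((extChartAt I x₀).symm y))
      (extChartAt I ((extChartAt I x₀).symm y) ((extChartAt I x₀).symm y))) :
    formInChart I (extDerivForm I α) x₀ y = extDeriv (formInChart I α x₀) y := by
  have h := extDerivForm_pullbackForm I 𝓘(𝕜, F) hr (f := (extChartAt I x₀).symm) α (x := y)
    ((contMDiffOn_extChartAt_symm (n := r) x₀).contMDiffAt ((isOpen_extChartAt_target x₀).mem_nhds hy))
    hα
  exact h.symm.trans (extDerivForm_model (formInChart I α x₀) y)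

theorem IsSmoothFormOn.formInChart_extDerivForm {r : ℕ∞ω} [IsManifold I r M] [IsManifold I 1 M]
    (hr : minSmoothness 𝕜 2 ≤ r) {α : ∀ x : M, TangentSpace I x [⋀^Fin k]→L[𝕜] V} {s : Set M}
    (hα : IsSmoothFormOn I r α s) (hs : IsOpen s) {x₀ : M} {y : F}
    (hy : y ∈ (extChartAt I x₀).target) (hys : (extChartAt I x₀).symm y ∈ s) :
    formInChart I (extDerivForm I α) x₀ y = extDeriv (formInChart I α x₀) y :=
  _root_.formInChart_extDerivForm I hr α hy ((hα.contDiffAt_self I hs hys).differentiableAt (by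
    rintro rfl
    exact absurd (le_minSmoothness.trans hr) (by simp)))

set_option synthInstance.maxHeartbeats 200000 in
theorem _root_.ContDiffAt.extDeriv {E : Type*} [NormedAddCommGroup E] [NormedSpace 𝕜 E] {r s : ℕ∞ω}
    {α : E → E [⋀^Fin k]→L[𝕜] V} {y : E} (hα : ContDiffAt 𝕜 r α y) (hrs : s + 1 ≤ r) :
    ContDiffAt 𝕜 s (extDeriv α) y := by
  have h : ContDiff 𝕜 s fun f : E →L[𝕜] E [⋀^Fin k]→L[𝕜] V =>
      ContinuousAlternatingMap.alternatizeUncurryFin f := by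
    unfold ContinuousAlternatingMap.alternatizeUncurryFin
    fun_prop
  exact h.contDiffAt.comp y (hα.fderiv_right hrs)

theorem IsSmoothFormOn.extDerivForm {r : ℕ∞ω} [IsManifold I r M] [IsManifold I 1 M]
    (hr : minSmoothness 𝕜 2 ≤ r) (hr' : r + 1 ≤ r)
    {α : ∀ x : M, TangentSpace I x [⋀^Fin k]→L[𝕜] V} {s : Set M}
    (hα : IsSmoothFormOn I r α s) (hs : IsOpen s) : IsSmoothFormOn I r (extDerivForm I α) s := by
  rintro x₀ y ⟨hy, hys⟩
  have h1 : formInChart I (_root_.extDerivForm I α) x₀ =ᶠ[𝓝 y] extDeriv (formInChart I α x₀) := by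
    filter_upwards [(isOpen_target_inter_preimage I x₀ hs).mem_nhds ⟨hy, hys⟩] with z hz
    exact hα.formInChart_extDerivForm I hr hs hz.1 hz.2
  exact (((hα.contDiffAt I hs hy hys).extDeriv hr').congr_of_eventuallyEq h1).contDiffWithinAt

theorem IsSmoothFormOn.extDerivForm_extDerivForm {r : ℕ∞ω} [IsManifold I r M] [IsManifold I 1 M]
    (hr : minSmoothness 𝕜 2 ≤ r)
    {α : ∀ x : M, TangentSpace I x [⋀^Fin k]→L[𝕜] V} {s : Set M}
    (hα : IsSmoothFormOn I r α s) (hs : IsOpen s) {x : M} (hx : x ∈ s) :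
    _root_.extDerivForm I (_root_.extDerivForm I α) x = 0 := by
  have h1 : formInChart I (_root_.extDerivForm I α) x =ᶠ[𝓝 (extChartAt I x x)]
      extDeriv (formInChart I α x) := by
    filter_upwards [(isOpen_target_inter_preimage I x hs).mem_nhds
      ⟨mem_extChartAt_target x, by rwa [mem_preimage, extChartAt_to_inv]⟩] with z hz
    exact hα.formInChart_extDerivForm I hr hs hz.1 hz.2
  rw [_root_.extDerivForm, h1.extDeriv_eq, extDeriv_extDeriv_apply (hα.contDiffAt_self I hs hx) hr]
  rfl

end FormCharts

/-! ### Differential forms of degree one -/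

section OneForms

variable {𝕜 : Type*} [RCLike 𝕜]
  {F : Type*} [NormedAddCommGroup F] [NormedSpace 𝕜 F] [FiniteDimensional 𝕜 F]
  {H : Type*} [TopologicalSpace H] (I : ModelWithCorners 𝕜 F H)
  {M : Type*} [TopologicalSpace M] [ChartedSpace H M]

/-- The expression of a field of covectors in the preferred chart at `x₀`. -/
noncomputable def covectorInChart (α : ∀ x : M, TangentSpace I x →L[𝕜] 𝕜) (x₀ : M) (y : F) : F →L[𝕜] 𝕜 :=
  (α ((extChartAt I x₀).symm y)).comp (mfderiv 𝓘(𝕜, F) I (extChartAt I x₀).symm y)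

variable (𝕜 F) in
/-- Covectors as alternating `1`-forms. -/
noncomputable def oneFormCLM : (F →L[𝕜] 𝕜) →L[𝕜] F [⋀^Fin 1]→L[𝕜] 𝕜 :=
  LinearMap.toContinuousLinearMap
    { toFun := fun l => ContinuousAlternatingMap.ofSubsingleton 𝕜 F 𝕜 (0 : Fin 1) l
      map_add' := fun _ _ => rfl
      map_smul' := fun _ _ => rfl }

theorem formInChart_oneForm (α : ∀ x : M, TangentSpace I x →L[𝕜] 𝕜) (x₀ : M) :
    formInChart I (oneForm I α) x₀ = fun y => oneFormCLM 𝕜 F (covectorInChart I α x₀ y) := rfl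

theorem contDiffAt_formInChart_oneForm {r : ℕ∞ω} {α : ∀ x : M, TangentSpace I x →L[𝕜] 𝕜} {x₀ : M}
    {y : F} : ContDiffAt 𝕜 r (formInChart I (oneForm I α) x₀) y ↔
      ContDiffAt 𝕜 r (covectorInChart I α x₀) y := by
  refine ⟨fun h => ?_, fun h => (oneFormCLM 𝕜 F).contDiff.contDiffAt.comp y h⟩
  refine contDiffAt_clm_apply fun v => ?_
  exact (ContinuousAlternatingMap.apply 𝕜 F 𝕜 (fun _ : Fin 1 => v)).contDiff.contDiffAt.comp y h

/-- The exterior derivative of a `1`-form, in terms of the derivative of its components. -/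
theorem extDeriv_oneFormCLM {a : F → F →L[𝕜] 𝕜} {y : F} (ha : DifferentiableAt 𝕜 a y) (v w : F) :
    extDeriv (fun y => oneFormCLM 𝕜 F (a y)) y ![v, w] = fderiv 𝕜 a y v w - fderiv 𝕜 a y w v := by
  have hd : DifferentiableAt 𝕜 (fun y => oneFormCLM 𝕜 F (a y)) y :=
    (oneFormCLM 𝕜 F).differentiableAt.comp y ha
  rw [extDeriv_apply hd]
  have h : ∀ w : F, (fun y => a y w) = fun y => (a y) ((fun _ => w) y) := fun _ => rfl
  have h2 : ∀ v w : F, fderiv 𝕜 (fun y => a y w) y v = fderiv 𝕜 a y v w := fun v w => by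
    rw [fderiv_clm_apply ha (differentiableAt_const _)]
    simp
  rw [Fin.sum_univ_two, ← h2, ← h2]
  simp only [Fin.isValue, Fin.val_zero, pow_zero, one_smul, Fin.val_one, pow_one, neg_smul,
    ← sub_eq_add_neg]
  rfl

end OneForms

/-! ### Real parts of complex differential forms -/

section RealForms

variable {F : Type*} [NormedAddCommGroup F] [NormedSpace ℂ F] {k : ℕ}

variable (F k) in
/-- The real part of an alternating form, as a real linear map. -/
noncomputable def reForm : (F [⋀^Fin k]→L[ℂ] ℂ) →L[ℝ] F [⋀^Fin k]→L[ℝ] ℝ :=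
  (Complex.reCLM.compContinuousAlternatingMapCLM ℝ F ℂ ℝ (Fin k)) ∘L
    (ContinuousAlternatingMap.restrictScalarsCLM ℝ)

theorem reForm_apply (α : F [⋀^Fin k]→L[ℂ] ℂ) (v : Fin k → F) : reForm F k α v = (α v).re := rfl

theorem extDeriv_reForm {α : F → F [⋀^Fin k]→L[ℂ] ℂ} {y : F} (hα : DifferentiableAt ℂ α y) :
    extDeriv (fun y => reForm F k (α y)) y = reForm F (k + 1) (extDeriv α y) := by
  have hd : DifferentiableAt ℝ (fun y => reForm F k (α y)) y :=
    (reForm F k).differentiableAt.comp y (hα.restrictScalars ℝ)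
  ext v
  rw [extDeriv_apply hd, reForm_apply, extDeriv_apply hα, Complex.re_sum]
  refine Finset.sum_congr rfl fun i _ => ?_
  have h1 : HasFDerivAt (fun z => α z (i.removeNth v)) (fderiv ℂ (fun z => α z (i.removeNth v)) y) y := by
    have : DifferentiableAt ℂ (fun z => α z (i.removeNth v)) y :=
      (ContinuousAlternatingMap.apply ℂ F ℂ (i.removeNth v)).differentiableAt.comp y hα
    exact this.hasFDerivAt
  have h2 := (Complex.reCLM.hasFDerivAt).comp y (h1.restrictScalars ℝ)
  have h3 : (fun z => reForm F k (α z) (i.removeNth v)) = Complex.reCLM ∘ fun z => α z (i.removeNth v) :=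
    rfl
  rw [h3, h2.fderiv]
  rcases Nat.even_or_odd i.val with h | h <;> simp [h.neg_one_pow]

end RealForms

/-! ### Tensor fields in charts -/

section TensorCharts

variable {F : Type*} [NormedAddCommGroup F] [NormedSpace ℝ F]
  {H : Type*} [TopologicalSpace H] (I : ModelWithCorners ℝ F H) [I.Boundaryless]
  {M : Type*} [TopologicalSpace M] [ChartedSpace H M]

theorem contMDiffAt_iff_contDiffAt_comp_symm [IsManifold I ∞ M] {G : Type*} [NormedAddCommGroup G]
    [NormedSpace ℝ G] {f : M → G} {x : M} :
    ContMDiffAt I 𝓘(ℝ, G) ∞ f x ↔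
      ContDiffAt ℝ ∞ (f ∘ (extChartAt I x).symm) (extChartAt I x x) := by
  refine ⟨fun h => ?_, fun h => ?_⟩
  · have := (contMDiffAt_iff.1 h).2
    rwa [I.range_eq_univ, contDiffWithinAt_univ] at this
  · have h1 : ContMDiffAt I 𝓘(ℝ, G) ∞ (f ∘ (extChartAt I x).symm ∘ extChartAt I x) x :=
      h.contMDiffAt.comp x contMDiffAt_extChartAt
    refine h1.congr_of_eventuallyEq ?_
    filter_upwards [extChartAt_source_mem_nhds (I := I) x] with p hp
    simp only [Function.comp_apply, (extChartAt I x).left_inv hp]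

theorem mfderiv_eq_fderiv_comp_symm {G : Type*} [NormedAddCommGroup G]
    [NormedSpace ℝ G] {f : M → G} {x : M} (hf : MDifferentiableAt I 𝓘(ℝ, G) f x) (v : F) :
    mfderiv I 𝓘(ℝ, G) f x v = fderiv ℝ (f ∘ (extChartAt I x).symm) (extChartAt I x x) v := by
  rw [hf.mfderiv, I.range_eq_univ, fderivWithin_univ]
  rfl

/-- The expression of a vector field in the preferred chart at `x₀`. -/
noncomputable def vfInChart (X : ∀ x : M, TangentSpace I x) (x₀ : M) (y : F) : F :=
  mfderiv I 𝓘(ℝ, F) (extChartAt I x₀) ((extChartAt I x₀).symm y) (X ((extChartAt I x₀).symm y))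

/-- The expression of a field of endomorphisms in the preferred chart at `x₀`. -/
noncomputable def endInChart (A : ∀ x : M, TangentSpace I x →L[ℝ] TangentSpace I x) (x₀ : M) (y : F) :
    F →L[ℝ] F :=
  (mfderiv I 𝓘(ℝ, F) (extChartAt I x₀) ((extChartAt I x₀).symm y)).comp
    ((A ((extChartAt I x₀).symm y)).comp (mfderiv 𝓘(ℝ, F) I (extChartAt I x₀).symm y))

/-- The expression of a field of bilinear forms in the preferred chart at `x₀`. -/
noncomputable def bilInChart (g : ∀ x : M, TangentSpace I x →L[ℝ] TangentSpace I x →L[ℝ] ℝ) (x₀ : M)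
    (y : F) : F →L[ℝ] F →L[ℝ] ℝ :=
  formPull (V := F) (g ((extChartAt I x₀).symm y)) (mfderiv 𝓘(ℝ, F) I (extChartAt I x₀).symm y)

theorem bilInChart_apply (g : ∀ x : M, TangentSpace I x →L[ℝ] TangentSpace I x →L[ℝ] ℝ) (x₀ : M)
    (y v w : F) : bilInChart I g x₀ y v w = g ((extChartAt I x₀).symm y)
      (mfderiv 𝓘(ℝ, F) I (extChartAt I x₀).symm y v)
      (mfderiv 𝓘(ℝ, F) I (extChartAt I x₀).symm y w) := rfl

variable [IsManifold I ∞ M]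

theorem isSmoothVF_iff (X : ∀ x : M, TangentSpace I x) : IsSmoothVF I X ↔
    ∀ x, ContDiffAt ℝ ∞ (vfInChart I X x) (extChartAt I x x) := by
  refine forall_congr' fun x₀ => ?_
  rw [contMDiffAt_section, contMDiffAt_iff_contDiffAt_comp_symm]
  suffices h : _ =ᶠ[𝓝 (extChartAt I x₀ x₀)] _ from
    ⟨fun h' => h'.congr_of_eventuallyEq h.symm, fun h' => h'.congr_of_eventuallyEq h⟩
  filter_upwards [extChartAt_target_mem_nhds (I := I) x₀] with y hy
  have hp : (extChartAt I x₀).symm y ∈ (chartAt H x₀).source := by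
    rw [← extChartAt_source (I := I)]; exact (extChartAt I x₀).map_target hy
  have h1 := TangentBundle.continuousLinearMapAt_trivializationAt (I := I) hp
  refine Eq.trans ?_ (DFunLike.congr_fun h1 (X ((extChartAt I x₀).symm y)))
  rw [Trivialization.continuousLinearMapAt_apply, Trivialization.coe_linearMapAt_of_mem _
    (by simpa using hp)]
  rfl

theorem isSmoothEnd_iff (A : ∀ x : M, TangentSpace I x →L[ℝ] TangentSpace I x) :
    IsSmoothEnd I A ↔ ∀ x, ContDiffAt ℝ ∞ (endInChart I A x) (extChartAt I x x) := by
  refine forall_congr' fun x₀ => ?_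
  rw [contMDiffAt_hom_bundle]
  refine (and_iff_right contMDiffAt_id).trans ?_
  rw [contMDiffAt_iff_contDiffAt_comp_symm]
  suffices h : _ =ᶠ[𝓝 (extChartAt I x₀ x₀)] _ from
    ⟨fun h' => h'.congr_of_eventuallyEq h.symm, fun h' => h'.congr_of_eventuallyEq h⟩
  filter_upwards [extChartAt_target_mem_nhds (I := I) x₀] with y hy
  have hp : (extChartAt I x₀).symm y ∈ (chartAt H x₀).source := by
    rw [← extChartAt_source (I := I)]; exact (extChartAt I x₀).map_target hy
  have h1 := TangentBundle.continuousLinearMapAt_trivializationAt (I := I) hp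
  have h2 := TangentBundle.symmL_trivializationAt (I := I) hp
  rw [I.range_eq_univ, mfderivWithin_univ, (extChartAt I x₀).right_inv hy] at h2
  simp only [Function.comp_apply, ContinuousLinearMap.inCoordinates]
  rw [h1, h2]
  rfl

theorem isSmoothBil_of_contDiffAt
    (g : ∀ x : M, TangentSpace I x →L[ℝ] TangentSpace I x →L[ℝ] ℝ)
    (hg : ∀ x, ContDiffAt ℝ ∞ (bilInChart I g x) (extChartAt I x x)) :
    ContMDiff I (I.prod 𝓘(ℝ, F →L[ℝ] F →L[ℝ] ℝ)) ∞
    (fun b => TotalSpace.mk' (F →L[ℝ] F →L[ℝ] ℝ)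
      (E := fun x : M => TangentSpace I x →L[ℝ] TangentSpace I x →L[ℝ] ℝ) b (g b)) := by
  intro x₀
  rw [contMDiffAt_hom_bundle]
  refine ⟨contMDiffAt_id, ?_⟩
  rw [contMDiffAt_iff_contDiffAt_comp_symm]
  refine (hg x₀).congr_of_eventuallyEq ?_
  filter_upwards [extChartAt_target_mem_nhds (I := I) x₀] with y hy
  have hp : (extChartAt I x₀).symm y ∈ (chartAt H x₀).source := by
    rw [← extChartAt_source (I := I)]; exact (extChartAt I x₀).map_target hy
  have h2 := TangentBundle.symmL_trivializationAt (I := I) hp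
  rw [I.range_eq_univ, mfderivWithin_univ, (extChartAt I x₀).right_inv hy] at h2
  refine ContinuousLinearMap.ext fun v => ContinuousLinearMap.ext fun w => ?_
  simp only [Function.comp_apply]
  rw [inCoordinates_apply_eq₂ (by simpa using hp) (by simpa using hp) (by simp)]
  have hs : ∀ v : F, (trivializationAt F (TangentSpace I) x₀).symm ((extChartAt I x₀).symm y) v =
      mfderiv 𝓘(ℝ, F) I (extChartAt I x₀).symm y v := fun v =>
    (Trivialization.symmL_apply (R := ℝ) _ (by simpa using hp) v).symm.trans
      (DFunLike.congr_fun h2 v)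
  rw [hs, hs]
  simp only [Trivial.fiberBundle_trivializationAt', Trivial.linearMapAt_trivialization,
    LinearMap.id_coe, id_eq]
  rfl

/-- Positive definite forms on a finite-dimensional space have bounded unit balls. -/
theorem IsPosForm.isVonNBounded {V : Type*} [NormedAddCommGroup V] [NormedSpace ℝ V]
    [FiniteDimensional ℝ V] {G : V →L[ℝ] V →L[ℝ] ℝ} (hG : IsPosForm G) :
    Bornology.IsVonNBounded ℝ {v : V | G v v < 1} := by
  rw [NormedSpace.isVonNBounded_iff]
  by_cases hV : Subsingleton V
  · exact (Set.toFinite _).isBounded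
  rw [not_subsingleton_iff_nontrivial] at hV
  have hcont : Continuous fun v : V => G v v := by fun_prop
  obtain ⟨v₀, hv₀, hmin⟩ := (isCompact_sphere (0 : V) 1).exists_isMinOn
    (NormedSpace.sphere_nonempty.2 zero_le_one) hcont.continuousOn
  have hv₀' : v₀ ≠ 0 := fun h => by simp [h] at hv₀
  have hc := hG.pos v₀ hv₀'
  refine (Metric.isBounded_iff_subset_closedBall 0).2 ⟨1 / G v₀ v₀ + 1, fun v hv => ?_⟩
  rw [mem_closedBall_zero_iff]
  by_contra! hlt
  have hpos : 0 < 1 / G v₀ v₀ := by positivity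
  have hn : 0 < ‖v‖ := by linarith
  have h1 : G v₀ v₀ ≤ G (‖v‖⁻¹ • v) (‖v‖⁻¹ • v) := hmin (by
    simp [norm_smul, hn.ne'])
  simp only [map_smul, smul_apply, smul_eq_mul] at h1
  have h2 : G v v < 1 := hv
  have h3 : G v₀ v₀ * (‖v‖ * ‖v‖) ≤ G v v := by
    have := mul_le_mul_of_nonneg_right h1 (mul_nonneg hn.le hn.le)
    refine this.trans (le_of_eq ?_)
    field_simp
  have h4 : 1 < G v₀ v₀ * ‖v‖ := by
    have : G v₀ v₀ * (1 / G v₀ v₀) = 1 := by field_simp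
    nlinarith
  nlinarith

/-- A smooth Riemannian metric, from a field of positive definite forms which is smooth in charts. -/
noncomputable def RiemMetric.ofSmooth [FiniteDimensional ℝ F]
    (g : ∀ x : M, TangentSpace I x →L[ℝ] TangentSpace I x →L[ℝ] ℝ)
    (hpos : ∀ x, IsPosForm (V := F) (g x))
    (hg : ∀ x, ContDiffAt ℝ ∞ (bilInChart I g x) (extChartAt I x x)) : RiemMetric I M where
  inner := g
  symm x := (hpos x).symm
  pos x := (hpos x).pos
  isVonNBounded x := (hpos x).isVonNBounded
  contMDiff := isSmoothBil_of_contDiffAt I g hg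

theorem vfInChart_apply_end (A : ∀ x : M, TangentSpace I x →L[ℝ] TangentSpace I x)
    (X : ∀ x : M, TangentSpace I x) {x₀ : M} {y : F} (hy : y ∈ (extChartAt I x₀).target) :
    vfInChart I (fun x => A x (X x)) x₀ y = endInChart I A x₀ y (vfInChart I X x₀ y) := by
  have h := mfderiv_symm_mfderiv I hy (X ((extChartAt I x₀).symm y))
  exact congrArg (fun v => mfderiv I 𝓘(ℝ, F) (extChartAt I x₀) ((extChartAt I x₀).symm y)
    (A ((extChartAt I x₀).symm y) v)) h.symm

theorem vfInChart_self (X : ∀ x : M, TangentSpace I x) (x : M) :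
    vfInChart I X x (extChartAt I x x) = X x := by
  have : ∀ p, p = x → mfderiv I 𝓘(ℝ, F) (extChartAt I x) p (X p) = X x := by
    rintro p rfl
    exact mfderiv_extChartAt_self_apply I p _
  exact this _ (extChartAt_to_inv x)

theorem endInChart_self (A : ∀ x : M, TangentSpace I x →L[ℝ] TangentSpace I x) (x : M) (v : F) :
    endInChart I A x (extChartAt I x x) v = A x v := by
  have h1 : ∀ p, p = x → ∀ w : F,
      mfderiv I 𝓘(ℝ, F) (extChartAt I x) p (A p w) = A x w := by
    rintro p rfl w
    exact mfderiv_extChartAt_self_apply I p _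
  refine (h1 _ (extChartAt_to_inv x) _).trans ?_
  exact congrArg (A x) (mfderiv_extChartAt_symm_self_apply I x v)

theorem bilInChart_self (g : ∀ x : M, TangentSpace I x →L[ℝ] TangentSpace I x →L[ℝ] ℝ) (x : M)
    (v w : F) : bilInChart I g x (extChartAt I x x) v w = g x v w := by
  have h1 : ∀ p, p = x → ∀ v w : F, (g p v : F → ℝ) w = g x v w := by
    rintro p rfl v w; rfl
  rw [bilInChart_apply]
  refine (h1 _ (extChartAt_to_inv x) _ _).trans ?_
  have e1 := mfderiv_extChartAt_symm_self_apply I x v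
  have e2 := mfderiv_extChartAt_symm_self_apply I x w
  exact congrArg₂ (fun a b : F => g x a b) e1 e2

/-- The Lie bracket of vector fields, in the preferred chart. -/
theorem mlieBracket_eq_lieBracket [FiniteDimensional ℝ F] (X Y : ∀ x : M, TangentSpace I x) (x : M) :
    VectorField.mlieBracket I X Y x =
      VectorField.lieBracket ℝ (vfInChart I X x) (vfInChart I Y x) (extChartAt I x x) := by
  have h : ∀ X : ∀ x : M, TangentSpace I x,
      VectorField.mpullbackWithin 𝓘(ℝ, F) I (extChartAt I x).symm X (range I)
        =ᶠ[𝓝 (extChartAt I x x)] vfInChart I X x := fun X => by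
    filter_upwards [extChartAt_target_mem_nhds (I := I) x] with y hy
    rw [VectorField.mpullbackWithin_apply, I.range_eq_univ, mfderivWithin_univ]
    have h1 : (mfderiv 𝓘(ℝ, F) I (extChartAt I x).symm y).inverse =
        mfderiv I 𝓘(ℝ, F) (extChartAt I x) ((extChartAt I x).symm y) := by
      refine ContinuousLinearMap.inverse_eq ?_ ?_
      · exact ContinuousLinearMap.ext fun v => mfderiv_symm_mfderiv I hy v
      · exact ContinuousLinearMap.ext fun v => mfderiv_mfderiv_symm I hy v
    rw [h1]
    rfl
  have h2 : (mfderiv I 𝓘(ℝ, F) (extChartAt I x) x).inverse = ContinuousLinearMap.id ℝ F := by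
    rw [mfderiv_extChartAt_self]
    exact ContinuousLinearMap.inverse_id
  refine (DFunLike.congr_fun h2 _).trans ?_
  rw [preimage_univ, univ_inter, I.range_eq_univ]
  rw [I.range_eq_univ] at h
  have e : VectorField.lieBracket ℝ (E := F) _ _ (extChartAt I x x) = _ :=
    Filter.EventuallyEq.lieBracket_vectorField_eq (h X) (h Y)
  exact (congrFun (VectorField.lieBracketWithin_univ (𝕜 := ℝ) (E := F)) _).trans e

/-- The bracket `[A, A]`, in the preferred chart. -/
theorem nijenhuis_eq [FiniteDimensional ℝ F]
    {A : ∀ x : M, TangentSpace I x →L[ℝ] TangentSpace I x} {X Y : ∀ x : M, TangentSpace I x} {x : M}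
    (hA : DifferentiableAt ℝ (endInChart I A x) (extChartAt I x x))
    (hX : DifferentiableAt ℝ (vfInChart I X x) (extChartAt I x x))
    (hY : DifferentiableAt ℝ (vfInChart I Y x) (extChartAt I x x)) (a : F →L[ℝ] F)
    (ha : ∀ v, a v = A x v) (D : F →L[ℝ] F →L[ℝ] F)
    (hD : D = fderiv ℝ (endInChart I A x) (extChartAt I x x)) (v w : F) (hv : v = X x)
    (hw : w = Y x) :
    nijenhuis I A X Y x = (2 : ℝ) • (D (a v) w - D (a w) v - a (D v w) + a (D w v)) := by
  have hAX : ∀ X : ∀ x : M, TangentSpace I x, vfInChart I (fun x => A x (X x)) x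
      =ᶠ[𝓝 (extChartAt I x x)] fun y => endInChart I A x y (vfInChart I X x y) := fun X => by
    filter_upwards [extChartAt_target_mem_nhds (I := I) x] with y hy
    exact vfInChart_apply_end I A X hy
  have hd : ∀ {X : ∀ x : M, TangentSpace I x}, DifferentiableAt ℝ (vfInChart I X x) (extChartAt I x x) →
      ∀ u, fderiv ℝ (vfInChart I (fun x => A x (X x)) x) (extChartAt I x x) u =
        D u (X x) + a (fderiv ℝ (vfInChart I X x) (extChartAt I x x) u) := fun {X} hX u => by
    rw [(hAX X).fderiv_eq, fderiv_clm_apply hA hX, ← hD]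
    simp only [add_apply, ContinuousLinearMap.comp_apply, ContinuousLinearMap.flip_apply]
    rw [endInChart_self, ha, vfInChart_self]
    exact add_comm (G := F) _ _
  have hval : ∀ X : ∀ x : M, TangentSpace I x, vfInChart I X x (extChartAt I x x) = X x :=
    fun X => vfInChart_self I X x
  obtain ⟨B, hB⟩ : ∃ B : (∀ x : M, TangentSpace I x) → (∀ x : M, TangentSpace I x) → F,
      ∀ X Y, B X Y = VectorField.mlieBracket I X Y x := ⟨_, fun _ _ => rfl⟩
  have hL : ∀ X Y : ∀ x : M, TangentSpace I x, ∀ v w : F, v = X x → w = Y x → B X Y = fderiv ℝ (vfInChart I Y x) (extChartAt I x x) v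
        - fderiv ℝ (vfInChart I X x) (extChartAt I x x) w := by
    rintro X Y v w rfl rfl
    rw [hB, mlieBracket_eq_lieBracket]
    simp only [VectorField.lieBracket, hval]
  have h0 : nijenhuis I A X Y x = (2 : ℝ) •
      (B (fun x => A x (X x)) (fun x => A x (Y x)) + a (a (B X Y)) - a (B (fun x => A x (X x)) Y)
        - a (B X (fun x => A x (Y x)))) := by
    rw [ha, ha, ha, ha, hB, hB, hB, hB]; rfl
  have hav : a v = A x (X x) := by rw [ha, hv]
  have haw : a w = A x (Y x) := by rw [ha, hw]
  rw [h0, hL _ _ _ _ hav haw, hL _ _ _ _ hv hw, hL _ _ _ _ hav hw, hL _ _ _ _ hv haw, hd hX, hd hX,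
    hd hY, hd hY, ← hv, ← hw]
  simp only [map_sub, map_add]
  congr 1
  abel

/-- A vector field which is constant in charts, along which the chart expressions of a metric are
constant, is a Killing vector field. -/
theorem RiemMetric.isKilling_of_const [FiniteDimensional ℝ F] (g : RiemMetric I M)
    (ξ : ∀ x : M, TangentSpace I x)
    (hξ : ∀ x, ∃ c : F, vfInChart I ξ x =ᶠ[𝓝 (extChartAt I x x)] fun _ => c)
    (hg : ∀ x, DifferentiableAt ℝ (bilInChart I g.inner x) (extChartAt I x x))
    (hgξ : ∀ x, ∀ v : F, v = ξ x →
      fderiv ℝ (bilInChart I g.inner x) (extChartAt I x x) v = 0) : g.IsKilling ξ := by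
  intro X Y hX hY x
  rw [isSmoothVF_iff] at hX hY
  have hX' := (hX x).differentiableAt (by simp)
  have hY' := (hY x).differentiableAt (by simp)
  have hval : ∀ X : ∀ x : M, TangentSpace I x, vfInChart I X x (extChartAt I x x) = X x :=
    fun X => vfInChart_self I X x
  obtain ⟨c, hc⟩ := hξ x
  have hc0 : c = ξ x := by rw [← hval ξ]; exact hc.self_of_nhds.symm
  have hloc : (fun y => g.inner y (X y) (Y y)) ∘ (extChartAt I x).symm =ᶠ[𝓝 (extChartAt I x x)]
      fun y => bilInChart I g.inner x y (vfInChart I X x y) (vfInChart I Y x y) := by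
    filter_upwards [extChartAt_target_mem_nhds (I := I) x] with y hy
    have e1 := mfderiv_symm_mfderiv I hy (X ((extChartAt I x).symm y))
    have e2 := mfderiv_symm_mfderiv I hy (Y ((extChartAt I x).symm y))
    rw [bilInChart_apply]
    exact (congrArg₂ (fun a b => g.inner ((extChartAt I x).symm y) a b) e1 e2).symm
  have hd : DifferentiableAt ℝ
      (fun y => bilInChart I g.inner x y (vfInChart I X x y) (vfInChart I Y x y))
      (extChartAt I x x) := ((hg x).clm_apply hX').clm_apply hY'
  have hmd : MDifferentiableAt I 𝓘(ℝ, ℝ) (fun y => g.inner y (X y) (Y y)) x := by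
    have h1 : MDifferentiableAt I 𝓘(ℝ, ℝ)
        ((fun y => bilInChart I g.inner x y (vfInChart I X x y) (vfInChart I Y x y)) ∘
          extChartAt I x) x :=
      MDifferentiableAt.comp x (I' := 𝓘(ℝ, F)) hd.mdifferentiableAt
        (mdifferentiableAt_extChartAt' I (mem_extChartAt_source x))
    refine h1.congr_of_eventuallyEq ?_
    have h2 := (continuousAt_extChartAt (I := I) x).tendsto.eventually hloc
    filter_upwards [extChartAt_source_mem_nhds (I := I) x, h2] with p hp hp2
    refine Eq.trans ?_ hp2
    exact (congrArg (fun y => g.inner y (X y) (Y y)) ((extChartAt I x).left_inv hp)).symm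
  have hbr : ∀ X : ∀ x : M, TangentSpace I x, VectorField.mlieBracket I ξ X x =
      fderiv ℝ (vfInChart I X x) (extChartAt I x x) c := fun X => by
    rw [mlieBracket_eq_lieBracket]
    simp only [VectorField.lieBracket, hval]
    rw [hc.fderiv_eq, ← hc0, fderiv_fun_const]
    exact sub_zero (G := F) _
  have hmain : ∀ v : F, v = ξ x → ∀ a b : F, a = X x → b = Y x →
      fderiv ℝ ((fun y => g.inner y (X y) (Y y)) ∘ (extChartAt I x).symm) (extChartAt I x x) v =
      bilInChart I g.inner x (extChartAt I x x)
          (fderiv ℝ (vfInChart I X x) (extChartAt I x x) v) b +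
        bilInChart I g.inner x (extChartAt I x x) a
          (fderiv ℝ (vfInChart I Y x) (extChartAt I x x) v) := by
    rintro v hv a b rfl rfl
    rw [hloc.fderiv_eq, fderiv_clm_apply ((hg x).clm_apply hX') hY', fderiv_clm_apply (hg x) hX']
    simp only [add_apply, ContinuousLinearMap.comp_apply, ContinuousLinearMap.flip_apply]
    rw [hgξ x v hv, hval, hval]
    have key : ∀ p q r : ℝ, r = 0 → p + (q + r) = q + p := fun p q r hr => by rw [hr]; ring
    exact key _ _ _ rfl
  refine (mfderiv_eq_fderiv_comp_symm I hmd _).trans ?_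
  refine (hmain _ rfl _ _ rfl rfl).trans ?_
  have hbr' : ∀ X : ∀ x : M, TangentSpace I x, fderiv ℝ (vfInChart I X x) (extChartAt I x x)
      (vfInChart I ξ x (extChartAt I x x)) = VectorField.mlieBracket I ξ X x := fun X => by
    rw [hbr, hc.self_of_nhds]
  rw [hval] at hbr'
  exact congrArg₂ (· + ·)
    ((bilInChart_self I _ x _ _).trans (congrArg (fun a : F => g.inner x a (Y x)) (hbr' X)))
    ((bilInChart_self I _ x _ _).trans (congrArg (fun a : F => g.inner x (X x) a) (hbr' Y)))

end TensorCharts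

/-! ### The unit sphere of a hyperhermitian cone -/

section Reduction

variable {V : Type*} [NormedAddCommGroup V] [NormedSpace ℝ V]
  {W : Type*} [NormedAddCommGroup W] [NormedSpace ℝ W]

/-- A hyperhermitian structure `(K, J)` on a vector space, with a unit vector `ε` dual to `τ`: the
tangent space of a hyperhermitian cone at a point of the unit sphere, the Euler vector and `dt`. -/
structure IsHyperhermitianCone (K : V →L[ℝ] V →L[ℝ] ℝ) (J : Fin 3 → V →L[ℝ] V) (τ : V →L[ℝ] ℝ)
    (ε : V) : Prop where
  pos : IsPosForm K
  J_J_self : ∀ α x, J α (J α x) = -x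
  J_J : ∀ α x, J α (J (α + 1) x) = J (α + 2) x
  J_J' : ∀ α x, -J (α + 1) (J α x) = J (α + 2) x
  K_J : ∀ α x y, K (J α x) (J α y) = K x y
  K_ε : ∀ x, K ε x = τ x
  τ_ε : τ ε = 1

/-- The tangent space `W` of the unit sphere of the cone: `i` is the derivative of the inclusion and
`p` is the derivative of the radial projection. -/
structure IsSphere (τ : V →L[ℝ] ℝ) (ε : V) (i : W →L[ℝ] V) (p : V →L[ℝ] W) : Prop where
  p_i : ∀ x, p (i x) = x
  i_p : ∀ y, i (p y) = y - τ y • ε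
  τ_i : ∀ x, τ (i x) = 0

namespace IsHyperhermitianCone

variable {K : V →L[ℝ] V →L[ℝ] ℝ} {J : Fin 3 → V →L[ℝ] V} {τ : V →L[ℝ] ℝ} {ε : V}
  (h : IsHyperhermitianCone K J τ ε)

include h in
theorem K_J_left (α : Fin 3) (x y : V) : K (J α x) y = -K x (J α y) := by
  rw [← h.K_J α x, h.J_J_self, map_neg, neg_neg]

include h in
/-- The vectors `J_α ε` are tangent to the sphere. -/
theorem τ_J_ε (α : Fin 3) : τ (J α ε) = 0 := by
  have h1 := h.K_J_left α ε ε
  rw [h.pos.symm, h.K_ε] at h1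
  linarith

variable {i : W →L[ℝ] V} {p : V →L[ℝ] W} (s : IsSphere τ ε i p)
include h s

/-- The tangent space of the unit sphere of a hyperhermitian cone has an almost contact metric
3-structure, given by `Φ_α = p J_α i`, `ξ_α = p J_α ε` and `η_α = -τ J_α i`. -/
theorem isAlmostContactMetric3 {g : W →ₗ[ℝ] W →ₗ[ℝ] ℝ} {Φ : Fin 3 → W →ₗ[ℝ] W} {ξ : Fin 3 → W}
    {η : Fin 3 → W →ₗ[ℝ] ℝ} (hg : ∀ x y, g x y = K (i x) (i y))
    (hΦ : ∀ α x, Φ α x = p (J α (i x))) (hξ : ∀ α, ξ α = p (J α ε))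
    (hη : ∀ α x, η α x = -τ (J α (i x))) : IsAlmostContactMetric3 g Φ ξ η := by
  have inj : ∀ {x y : W}, i x = i y → x = y := fun {x y} hxy => by rw [← s.p_i x, hxy, s.p_i]
  have iΦ : ∀ α x, i (Φ α x) = J α (i x) + η α x • ε := fun α x => by
    rw [hΦ, s.i_p, hη]; module
  have iξ : ∀ α, i (ξ α) = J α ε := fun α => by
    rw [hξ, s.i_p, h.τ_J_ε, zero_smul, sub_zero]
  have Kη : ∀ α x, K ε (J α (i x)) = -η α x := fun α x => by rw [h.K_ε, hη, neg_neg]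
  have Kη' : ∀ α x, K (J α (i x)) ε = -η α x := fun α x => by rw [h.pos.symm, Kη]
  have Kε : K ε ε = 1 := by rw [h.K_ε, h.τ_ε]
  have hJε : ∀ α β, η α (ξ β) = -τ (J α (J β ε)) := fun α β => by rw [hη, iξ]
  refine ⟨fun α => ⟨fun x y => ?_, fun x hx => ?_, fun x => ?_, ?_, fun x => ?_, fun x y => ?_⟩,
    fun α x => ?_, fun α x => ?_, fun α => ?_, fun α => ?_⟩
  · rw [hg, hg, h.pos.symm]
  · rw [hg]
    exact h.pos.pos _ fun h0 => hx (inj (by rw [h0, map_zero]))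
  · apply inj
    rw [iΦ, map_add, map_neg, map_smul, iξ, iΦ, map_add, map_smul, h.J_J_self, hη α (Φ α x), iΦ,
      map_add, map_add, map_smul, map_smul, h.J_J_self, map_neg, s.τ_i, h.τ_J_ε]
    simp
  · rw [hJε, h.J_J_self, map_neg, h.τ_ε, neg_neg]
  · rw [hg, iξ, h.K_J_left, Kη, neg_neg]
  · rw [hg, hg, iΦ, iΦ]
    simp only [map_add, map_smul, add_apply, smul_apply, smul_eq_mul, h.K_J, Kη, Kη', Kε]
    ring
  · apply inj
    rw [map_sub, map_smul, iξ, iΦ, iΦ, iΦ, map_add, map_smul, h.J_J, hη α (Φ (α + 1) x), iΦ,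
      map_add, map_add, map_smul, map_smul, h.J_J, h.τ_J_ε, hη (α + 2)]
    module
  · apply inj
    rw [map_add, map_neg, map_smul, iξ, iΦ, iΦ, iΦ, map_add, map_smul, hη (α + 1) (Φ α x), iΦ,
      map_add, map_add, map_smul, map_smul, h.τ_J_ε, hη (α + 2), ← h.J_J', map_neg]
    module
  · apply inj
    rw [iΦ, iξ, iξ, hJε, h.J_J, h.τ_J_ε]; simp
  · apply inj
    rw [map_neg, iΦ, iξ, iξ, hJε, ← h.J_J', neg_add]
    have := h.τ_J_ε (α + 2)
    rw [← h.J_J', map_neg, neg_eq_zero] at this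
    rw [this]; simp

theorem η_Φ {Φ : Fin 3 → W →L[ℝ] W} {η : Fin 3 → W →L[ℝ] ℝ} (hΦ : ∀ α x, Φ α x = p (J α (i x)))
    (hη : ∀ α x, η α x = -τ (J α (i x))) (α : Fin 3) (x : W) :
    η α (Φ (α + 1) x) = η (α + 2) x ∧ -η (α + 1) (Φ α x) = η (α + 2) x := by
  have iΦ : ∀ α x, i (Φ α x) = J α (i x) + η α x • ε := fun α x => by
    rw [hΦ, s.i_p, hη]; module
  constructor
  · rw [hη α, iΦ, map_add, map_add, map_smul, map_smul, h.J_J, h.τ_J_ε, hη (α + 2)]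
    simp
  · rw [hη (α + 1), iΦ, map_add, map_add, map_smul, map_smul, h.τ_J_ε, hη (α + 2), ← h.J_J',
      map_neg]
    simp

end IsHyperhermitianCone

end Reduction

namespace SymplecticData

variable {V : Type*} [NormedAddCommGroup V] [NormedSpace ℝ V] [FiniteDimensional ℝ V]
  {W : Type*} [NormedAddCommGroup W] [NormedSpace ℝ W] [FiniteDimensional ℝ W]

/-- The three almost complex structures. -/
noncomputable def J₃ (d : SymplecticData V) : Fin 3 → V →L[ℝ] V := ![d.J, d.J₂, d.J ∘L d.J₂]

namespace Good

variable {d : SymplecticData V} (h : d.Good)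
include h

theorem J_J_self₃ (α : Fin 3) (x : V) : d.J₃ α (d.J₃ α x) = -x := by
  fin_cases α
  · exact h.J_J x
  · exact h.J₂_J₂ x
  · change d.J (d.J₂ (d.J (d.J₂ x))) = -x
    rw [h.J₂_J, map_neg, h.J_J, h.J₂_J₂, neg_neg]

theorem J_J₃ (α : Fin 3) (x : V) : d.J₃ α (d.J₃ (α + 1) x) = d.J₃ (α + 2) x := by
  fin_cases α
  · rfl
  · change d.J₂ (d.J (d.J₂ x)) = d.J x
    rw [h.J₂_J, h.J₂_J₂, map_neg, neg_neg]
  · change d.J (d.J₂ (d.J x)) = d.J₂ x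
    rw [h.J₂_J, map_neg, h.J_J, neg_neg]

theorem J_J₃' (α : Fin 3) (x : V) : -d.J₃ (α + 1) (d.J₃ α x) = d.J₃ (α + 2) x := by
  fin_cases α
  · change -d.J₂ (d.J x) = d.J (d.J₂ x)
    rw [h.J₂_J, neg_neg]
  · change -d.J (d.J₂ (d.J₂ x)) = d.J x
    rw [h.J₂_J₂, map_neg, neg_neg]
  · change -d.J (d.J (d.J₂ x)) = d.J₂ x
    rw [h.J_J, neg_neg]

theorem metric_J₃ (α : Fin 3) (x y : V) : d.metric (d.J₃ α x) (d.J₃ α y) = d.metric x y := by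
  fin_cases α
  · exact h.metric_J x y
  · exact h.metric_J₂_J₂ x y
  · exact (h.metric_J _ _).trans (h.metric_J₂_J₂ x y)

/-- At the points with `r = 1`, the Euler vector is dual to `τ` for the metric. -/
theorem isHyperhermitianCone (hr : d.r = 1) :
    IsHyperhermitianCone d.metric d.J₃ d.τ d.eps where
  pos := h.metric_pos
  J_J_self := h.J_J_self₃
  J_J := h.J_J₃
  J_J' := h.J_J₃'
  K_J := h.metric_J₃
  K_ε x := by rw [h.metric_eps, hr, one_mul]
  τ_ε := h.τ_eps

/-- Since the Euler vector is dual to `r τ` for the metric and `w(ε, ·) = β`, the form `τ ∘ J₂` is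
determined by `β`. -/
theorem τ_J₂ (x : V) : d.r * d.τ (d.J₂ x) = -d.β x := by
  have h1 := h.metric_eps (d.J₂ x)
  have h2 := h.metric_J₂_J₂ d.eps (d.J₂ x)
  rw [h.J₂_J₂, map_neg, h.metric_J₂, h.w_eps] at h2
  linarith

theorem τ_J_J₂ (x : V) : d.r * d.τ (d.J (d.J₂ x)) = d.β (d.J x) := by
  have h1 := h.τ_J₂ (d.J x)
  rw [h.J₂_J, map_neg] at h1
  linarith

theorem metric_J_J₂ (x y : V) : d.metric (d.J (d.J₂ x)) y = -d.w (d.J x) y := by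
  rw [← h.metric_J₂, h.J₂_J, form_neg_left, neg_neg]

end Good

/-- The three structures are invariant under dilations. -/
theorem IsPullback.map_J₃ {d' : SymplecticData W} {d : SymplecticData V} {L : W ≃L[ℝ] V} {s : ℝ}
    (p : d'.IsPullback d L s s 0) (h : d.Good) (h' : d'.Good) (α : Fin 3) (x : W) :
    L (d'.J₃ α x) = d.J₃ α (L x) := by
  have h2 : ∀ x, L (d'.J₂ x) = d.J₂ (L x) := fun x => by
    have := p.map_J₂ h h' x
    rw [zero_smul, add_zero] at this
    exact smul_right_injective V p.s_pos.ne' this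
  fin_cases α
  · exact p.J_eq x
  · exact h2 x
  · exact (p.J_eq _).trans (congrArg _ (h2 x))

/-- The pullback of the data under a linear isomorphism. -/
noncomputable def pull (d : SymplecticData V) (L : W ≃L[ℝ] V) : SymplecticData W where
  r := d.r
  τ := d.τ ∘L (L : W →L[ℝ] V)
  β := d.β ∘L (L : W →L[ℝ] V)
  w := formPull d.w (L : W →L[ℝ] V)
  k := formPull d.k (L : W →L[ℝ] V)
  J := (L.symm : V →L[ℝ] W) ∘L d.J ∘L (L : W →L[ℝ] V)

theorem isPullback_pull (d : SymplecticData V) (L : W ≃L[ℝ] V) :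
    (d.pull L).IsPullback d L 1 1 0 where
  s_pos := one_pos
  sq := by norm_num
  r_eq := (one_mul _).symm
  τ_eq x := rfl
  w_eq x y := by rw [one_mul, zero_mul, add_zero]; rfl
  β_eq x := by rw [one_mul, zero_mul, add_zero]; rfl
  k_eq x y := rfl
  J_eq x := L.apply_symm_apply _

theorem Good.pull {d : SymplecticData V} (h : d.Good) (L : W ≃L[ℝ] V) : (d.pull L).Good := by
  have hJ : ∀ x, L ((d.pull L).J x) = d.J (L x) := fun x => L.apply_symm_apply _
  have hw : ∀ x y, (d.pull L).w x y = d.w (L x) (L y) := fun x y => rfl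
  have hk : ∀ x y, (d.pull L).k x y = d.k (L x) (L y) := fun x y => rfl
  have hτ : ∀ x, (d.pull L).τ x = d.τ (L x) := fun x => rfl
  have nondeg : ∀ x, (∀ y, (d.pull L).w x y = 0) → x = 0 := fun x hx => by
    have := h.nondeg (L x) fun y => by
      rw [← L.apply_symm_apply y, ← hw, hx]
    exact L.map_eq_zero_iff.1 this
  have heps : L (d.pull L).eps = d.eps := by
    refine h.w_ext fun y => ?_
    have h1 : (d.pull L).w (d.pull L).eps = (d.pull L).β :=
      (isInvertible_of_nondegenerate nondeg).self_apply_inverse _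
    have h2 := DFunLike.congr_fun h1 (L.symm y)
    rw [hw, L.apply_symm_apply] at h2
    rw [h2, h.w_eps]
    exact congrArg d.β (L.apply_symm_apply y)
  refine ⟨h.r_pos, fun x => L.injective ?_, fun x y => h.alt _ _, nondeg, fun x y => ?_, ?_, ?_,
    fun x y => h.k_symm _ _, fun x => h.k_nonneg _, fun x y => ?_, fun x hx => ?_⟩
  · rw [hJ, hJ, h.J_J, map_neg]
  · rw [hw, hJ, hJ, h.w_J, hw]
  · rw [hτ, heps, h.τ_eps]
  · rw [hτ, hJ, heps, h.τ_J_eps]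
  · rw [hk, hJ, hJ, h.k_J, hk]
  · obtain ⟨a, b, hab⟩ := h.k_ker _ hx
    refine ⟨a, b, L.injective ?_⟩
    rw [map_add, map_smul, map_smul, hJ, heps]
    exact hab

theorem pull_metric {d : SymplecticData V} (h : d.Good) (L : W ≃L[ℝ] V) :
    (d.pull L).metric = formPull d.metric (L : W →L[ℝ] V) := by
  refine ContinuousLinearMap.ext fun x => ContinuousLinearMap.ext fun y => ?_
  rw [(d.isPullback_pull L).metric_eq h (h.pull L), one_mul]; rfl

theorem pull_J₃ {d : SymplecticData V} (h : d.Good) (L : W ≃L[ℝ] V) (α : Fin 3) :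
    (d.pull L).J₃ α = (L.symm : V →L[ℝ] W) ∘L d.J₃ α ∘L (L : W →L[ℝ] V) := by
  refine ContinuousLinearMap.ext fun x => L.injective ?_
  rw [(d.isPullback_pull L).map_J₃ h (h.pull L)]
  exact (L.apply_symm_apply _).symm

theorem SmoothAt.J₃ {X : Type*} [NormedAddCommGroup X] [NormedSpace ℝ X] {d : X → SymplecticData V}
    {x : X} (h : SmoothAt d x) (α : Fin 3) : ContDiffAt ℝ ∞ (fun y => (d y).J₃ α) x := by
  fin_cases α
  · exact h.J
  · exact h.J₂
  · exact h.J.clm_comp h.J₂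

end SymplecticData

/-! ### Maps of manifolds in charts -/

section MapsInCharts

variable {𝕜 : Type*} [NontriviallyNormedField 𝕜]
  {F : Type*} [NormedAddCommGroup F] [NormedSpace 𝕜 F]
  {H : Type*} [TopologicalSpace H] (I : ModelWithCorners 𝕜 F H) [I.Boundaryless]
  {M : Type*} [TopologicalSpace M] [ChartedSpace H M]
  {F' : Type*} [NormedAddCommGroup F'] [NormedSpace 𝕜 F']
  {H' : Type*} [TopologicalSpace H'] (J : ModelWithCorners 𝕜 F' H') [J.Boundaryless]
  {N : Type*} [TopologicalSpace N] [ChartedSpace H' N]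

theorem fderiv_chart_comp_apply [IsManifold I 1 M] [IsManifold J 1 N] {f : N → M} {x₀ : N} {y₀ : M}
    {y : F'} (hy : y ∈ (extChartAt J x₀).target)
    (hfy : f ((extChartAt J x₀).symm y) ∈ (extChartAt I y₀).source)
    (hf : MDifferentiableAt J I f ((extChartAt J x₀).symm y)) (v : F') :
    fderiv 𝕜 (extChartAt I y₀ ∘ f ∘ (extChartAt J x₀).symm) y v =
      mfderiv I 𝓘(𝕜, F) (extChartAt I y₀) (f ((extChartAt J x₀).symm y))
        (mfderiv J I f ((extChartAt J x₀).symm y)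
          (mfderiv 𝓘(𝕜, F') J (extChartAt J x₀).symm y v)) := by
  have h1 : mfderiv 𝓘(𝕜, F') 𝓘(𝕜, F) (extChartAt I y₀ ∘ f ∘ (extChartAt J x₀).symm) y =
      (mfderiv I 𝓘(𝕜, F) (extChartAt I y₀) (f ((extChartAt J x₀).symm y))).comp
        ((mfderiv J I f ((extChartAt J x₀).symm y)).comp
          (mfderiv 𝓘(𝕜, F') J (extChartAt J x₀).symm y)) := by
    rw [mfderiv_comp y (mdifferentiableAt_extChartAt' I hfy)
      (hf.comp y (mdifferentiableAt_extChartAt_symm J hy)),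
      mfderiv_comp y hf (mdifferentiableAt_extChartAt_symm J hy)]
    rfl
  rw [mfderiv_eq_fderiv] at h1
  exact DFunLike.congr_fun h1 v

theorem fderiv_chart_comp_mfderiv [IsManifold I 1 M] [IsManifold J 1 N] {f : N → M} {x₀ p : N}
    {y₀ : M} (hp : p ∈ (extChartAt J x₀).source) (hfp : f p ∈ (extChartAt I y₀).source)
    (hf : MDifferentiableAt J I f p) (v : F') :
    fderiv 𝕜 (extChartAt I y₀ ∘ f ∘ (extChartAt J x₀).symm) (extChartAt J x₀ p)
      (mfderiv J 𝓘(𝕜, F') (extChartAt J x₀) p v) =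
      mfderiv I 𝓘(𝕜, F) (extChartAt I y₀) (f p) (mfderiv J I f p v) := by
  have hpp := (extChartAt J x₀).left_inv hp
  refine (fderiv_chart_comp_apply I J ((extChartAt J x₀).map_source hp) (by rwa [hpp])
    (by rwa [hpp]) _).trans ?_
  have e : ∀ q, q = p → ∀ u : F', u = v →
      (mfderiv I 𝓘(𝕜, F) (extChartAt I y₀) (f q) (mfderiv J I f q u) : F) =
      mfderiv I 𝓘(𝕜, F) (extChartAt I y₀) (f p) (mfderiv J I f p v) := by
    rintro q rfl u rfl; rfl
  exact e _ hpp _ (mfderiv_symm_mfderiv' J hp v)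

theorem contDiffAt_chart_comp {r : ℕ∞ω} [IsManifold I r M] [IsManifold J r N] {f : N → M} {x₀ : N}
    {y₀ : M} {y : F'} (hy : y ∈ (extChartAt J x₀).target)
    (hfy : f ((extChartAt J x₀).symm y) ∈ (extChartAt I y₀).source)
    (hf : ContMDiffAt J I r f ((extChartAt J x₀).symm y)) :
    ContDiffAt 𝕜 r (extChartAt I y₀ ∘ f ∘ (extChartAt J x₀).symm) y := by
  have h1 : ContMDiffAt 𝓘(𝕜, F') J r (extChartAt J x₀).symm y :=
    (contMDiffOn_extChartAt_symm (n := r) x₀).contMDiffAt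
      ((isOpen_extChartAt_target x₀).mem_nhds hy)
  have h2 : ContMDiffAt I 𝓘(𝕜, F) r (extChartAt I y₀) (f ((extChartAt J x₀).symm y)) :=
    contMDiffAt_extChartAt' (by rwa [extChartAt_source] at hfy)
  exact (h2.comp y (hf.comp y h1)).contDiffAt

end MapsInCharts

/-! ### Smoothness of tensor fields induced by maps and retractions -/

section TensorMaps

variable {F : Type*} [NormedAddCommGroup F] [NormedSpace ℝ F]
  {H : Type*} [TopologicalSpace H] (I : ModelWithCorners ℝ F H) [I.Boundaryless]
  {M : Type*} [TopologicalSpace M] [ChartedSpace H M] [IsManifold I ∞ M]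

theorem vfInChart_extChartAt (X : ∀ x : M, TangentSpace I x) {x₀ p : M}
    (hp : p ∈ (extChartAt I x₀).source) :
    vfInChart I X x₀ (extChartAt I x₀ p) = mfderiv I 𝓘(ℝ, F) (extChartAt I x₀) p (X p) := by
  have e : ∀ q, q = p → (mfderiv I 𝓘(ℝ, F) (extChartAt I x₀) q (X q) : F) =
      mfderiv I 𝓘(ℝ, F) (extChartAt I x₀) p (X p) := by
    rintro q rfl; rfl
  exact e _ ((extChartAt I x₀).left_inv hp)

theorem endInChart_extChartAt (A : ∀ x : M, TangentSpace I x →L[ℝ] TangentSpace I x) {x₀ p : M}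
    (hp : p ∈ (extChartAt I x₀).source) (v : F) :
    endInChart I A x₀ (extChartAt I x₀ p) (mfderiv I 𝓘(ℝ, F) (extChartAt I x₀) p v) =
      mfderiv I 𝓘(ℝ, F) (extChartAt I x₀) p (A p v) := by
  have e : ∀ q, q = p → ∀ u : F, u = v → (mfderiv I 𝓘(ℝ, F) (extChartAt I x₀) q (A q u) : F) =
      mfderiv I 𝓘(ℝ, F) (extChartAt I x₀) p (A p v) := by
    rintro q rfl u rfl; rfl
  exact e _ ((extChartAt I x₀).left_inv hp) _ (mfderiv_symm_mfderiv' I hp v)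

theorem bilInChart_extChartAt (K : ∀ x : M, TangentSpace I x →L[ℝ] TangentSpace I x →L[ℝ] ℝ)
    {x₀ p : M} (hp : p ∈ (extChartAt I x₀).source) (v w : F) :
    bilInChart I K x₀ (extChartAt I x₀ p) (mfderiv I 𝓘(ℝ, F) (extChartAt I x₀) p v)
      (mfderiv I 𝓘(ℝ, F) (extChartAt I x₀) p w) = K p v w := by
  have e : ∀ q, q = p → ∀ u u' : F, u = v → u' = w → (K q u : F → ℝ) u' = K p v w := by
    rintro q rfl u u' rfl rfl; rfl
  exact e _ ((extChartAt I x₀).left_inv hp) _ _ (mfderiv_symm_mfderiv' I hp v)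
    (mfderiv_symm_mfderiv' I hp w)

omit [I.Boundaryless] [IsManifold I ∞ M] in
theorem covectorInChart_apply (a : ∀ x : M, TangentSpace I x →L[ℝ] ℝ) (x₀ : M) (y v : F) :
    covectorInChart I a x₀ y v =
      a ((extChartAt I x₀).symm y) (mfderiv 𝓘(ℝ, F) I (extChartAt I x₀).symm y v) := rfl

theorem covectorInChart_extChartAt (a : ∀ x : M, TangentSpace I x →L[ℝ] ℝ) {x₀ p : M}
    (hp : p ∈ (extChartAt I x₀).source) (v : F) :
    covectorInChart I a x₀ (extChartAt I x₀ p) (mfderiv I 𝓘(ℝ, F) (extChartAt I x₀) p v) =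
      a p v := by
  have e : ∀ q, q = p → ∀ u : F, u = v → (a q : F → ℝ) u = a p v := by
    rintro q rfl u rfl; rfl
  exact e _ ((extChartAt I x₀).left_inv hp) _ (mfderiv_symm_mfderiv' I hp v)

variable {F' : Type*} [NormedAddCommGroup F'] [NormedSpace ℝ F']
  {H' : Type*} [TopologicalSpace H'] (J : ModelWithCorners ℝ F' H') [J.Boundaryless]
  {N : Type*} [TopologicalSpace N] [ChartedSpace H' N] [IsManifold J ∞ N]
  {f : N → M} {g : M → N}

theorem eventually_mem_chart_source (hf : ContMDiff J I ∞ f) (x₀ : N) :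
    ∀ᶠ y in 𝓝 (extChartAt J x₀ x₀), y ∈ (extChartAt J x₀).target ∧
      f ((extChartAt J x₀).symm y) ∈ (extChartAt I (f x₀)).source := by
  refine Filter.Eventually.and (extChartAt_target_mem_nhds (I := J) x₀) ?_
  have h1 : ContinuousAt (f ∘ (extChartAt J x₀).symm) (extChartAt J x₀ x₀) :=
    hf.continuous.continuousAt.comp (continuousAt_extChartAt_symm x₀)
  refine h1.eventually_mem ?_
  rw [Function.comp_apply, extChartAt_to_inv]
  exact extChartAt_source_mem_nhds (I := I) _

theorem contDiffAt_chart_comp_self (hf : ContMDiff J I ∞ f) (x₀ : N) :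
    ContDiffAt ℝ ∞ (extChartAt I (f x₀) ∘ f ∘ (extChartAt J x₀).symm) (extChartAt J x₀ x₀) :=
  contDiffAt_chart_comp I J (eventually_mem_chart_source I J hf x₀).self_of_nhds.1
    (eventually_mem_chart_source I J hf x₀).self_of_nhds.2 (hf _)

theorem chart_comp_self (x₀ : N) :
    (extChartAt I (f x₀) ∘ f ∘ (extChartAt J x₀).symm) (extChartAt J x₀ x₀) =
      extChartAt I (f x₀) (f x₀) := by
  simp only [Function.comp_apply, extChartAt_to_inv]

set_option synthInstance.maxHeartbeats 200000 in
/-- Pullbacks of smooth bilinear forms are smooth. -/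
theorem contDiffAt_bilInChart_pullback (hf : ContMDiff J I ∞ f)
    {K : ∀ x : M, TangentSpace I x →L[ℝ] TangentSpace I x →L[ℝ] ℝ} {x₀ : N}
    (hK : ContDiffAt ℝ ∞ (bilInChart I K (f x₀)) (extChartAt I (f x₀) (f x₀)))
    {k : ∀ x : N, TangentSpace J x →L[ℝ] TangentSpace J x →L[ℝ] ℝ}
    (hk : ∀ x v w, k x v w = K (f x) (mfderiv J I f x v) (mfderiv J I f x w)) :
    ContDiffAt ℝ ∞ (bilInChart J k x₀) (extChartAt J x₀ x₀) := by
  have hF := contDiffAt_chart_comp_self I J hf x₀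
  have hF0 := chart_comp_self I J (f := f) x₀
  have h0 : ContDiffAt ℝ ∞ (fun y =>
      bilInChart I K (f x₀) ((extChartAt I (f x₀) ∘ f ∘ (extChartAt J x₀).symm) y))
      (extChartAt J x₀ x₀) := by
    rw [← hF0] at hK
    exact ContDiffAt.comp (extChartAt J x₀ x₀) hK hF
  have h1 := h0.formPull (hF.fderiv_right (m := ∞) (by simp))
  refine h1.congr_of_eventuallyEq ?_
  filter_upwards [eventually_mem_chart_source I J hf x₀] with y hy
  refine ContinuousLinearMap.ext fun v => ContinuousLinearMap.ext fun w => ?_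
  rw [bilInChart_apply, hk, formPull_apply,
    fderiv_chart_comp_apply I J hy.1 hy.2 ((hf _).mdifferentiableAt (by simp)),
    fderiv_chart_comp_apply I J hy.1 hy.2 ((hf _).mdifferentiableAt (by simp))]
  exact (bilInChart_extChartAt I K hy.2 _ _).symm

/-- Pullbacks of smooth covector fields are smooth. -/
theorem contDiffAt_covectorInChart_pullback (hf : ContMDiff J I ∞ f)
    {a : ∀ x : M, TangentSpace I x →L[ℝ] ℝ} {x₀ : N} {y : F'}
    (hy : y ∈ (extChartAt J x₀).target)
    (ha : ∀ x, ContDiffAt ℝ ∞ (covectorInChart I a x) (extChartAt I x x))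
    {b : ∀ x : N, TangentSpace J x →L[ℝ] ℝ}
    (hb : ∀ x v, b x v = a (f x) (mfderiv J I f x v)) :
    ContDiffAt ℝ ∞ (covectorInChart J b x₀) y := by
  obtain ⟨p, hp⟩ : ∃ p, p = f ((extChartAt J x₀).symm y) := ⟨_, rfl⟩
  have hps : f ((extChartAt J x₀).symm y) ∈ (extChartAt I p).source := by
    rw [hp]; exact mem_extChartAt_source _
  have hF : ContDiffAt ℝ ∞ (extChartAt I p ∘ f ∘ (extChartAt J x₀).symm) y :=
    contDiffAt_chart_comp I J hy hps (hf _)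
  have h0 : ContDiffAt ℝ ∞ (fun y =>
      covectorInChart I a p ((extChartAt I p ∘ f ∘ (extChartAt J x₀).symm) y)) y := by
    have h2 : ContDiffAt ℝ ∞ (covectorInChart I a p)
        ((extChartAt I p ∘ f ∘ (extChartAt J x₀).symm) y) := by
      simp only [Function.comp_apply, ← hp]; exact ha p
    exact ContDiffAt.comp y h2 hF
  have h1 := h0.clm_comp (hF.fderiv_right (m := ∞) (by simp))
  refine h1.congr_of_eventuallyEq ?_
  have hev : ∀ᶠ z in 𝓝 y, z ∈ (extChartAt J x₀).target ∧
      f ((extChartAt J x₀).symm z) ∈ (extChartAt I p).source := by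
    refine Filter.Eventually.and ((isOpen_extChartAt_target x₀).mem_nhds hy) ?_
    have h1 : ContinuousAt (f ∘ (extChartAt J x₀).symm) y :=
      hf.continuous.continuousAt.comp (continuousAt_extChartAt_symm'' hy)
    exact h1.eventually_mem ((isOpen_extChartAt_source p).mem_nhds hps)
  filter_upwards [hev] with z hz
  refine ContinuousLinearMap.ext fun v => ?_
  rw [covectorInChart_apply, hb, ContinuousLinearMap.comp_apply,
    fderiv_chart_comp_apply I J hz.1 hz.2 ((hf _).mdifferentiableAt (by simp))]
  exact (covectorInChart_extChartAt I a hz.2 _).symm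

variable (hf : ContMDiff J I ∞ f) (hg : ContMDiff I J ∞ g) (hgf : ∀ x, g (f x) = x)
include hf hg hgf

theorem contDiffAt_chart_comp_retract (x₀ : N) :
    ContDiffAt ℝ ∞ (extChartAt J x₀ ∘ g ∘ (extChartAt I (f x₀)).symm)
      ((extChartAt I (f x₀) ∘ f ∘ (extChartAt J x₀).symm) (extChartAt J x₀ x₀)) := by
  have := contDiffAt_chart_comp_self J I hg (f x₀)
  rwa [hgf, ← chart_comp_self I J (f := f) x₀] at this

omit [J.Boundaryless] [IsManifold J ∞ N] hf hg in
theorem mfderiv_chart_retract (x₀ x : N) (u : F') :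
    (mfderiv J 𝓘(ℝ, F') (extChartAt J x₀) (g (f x)) u : F') =
      mfderiv J 𝓘(ℝ, F') (extChartAt J x₀) x u := by
  have e : ∀ z, z = x → (mfderiv J 𝓘(ℝ, F') (extChartAt J x₀) z u : F') =
      mfderiv J 𝓘(ℝ, F') (extChartAt J x₀) x u := by
    rintro z rfl; rfl
  exact e _ (hgf x)

/-- The push forward of a vector field along a retraction is smooth. -/
theorem contDiffAt_vfInChart_retract {X : ∀ x : M, TangentSpace I x} {x₀ : N}
    (hX : ContDiffAt ℝ ∞ (vfInChart I X (f x₀)) (extChartAt I (f x₀) (f x₀)))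
    {Y : ∀ x : N, TangentSpace J x}
    (hY : ∀ x, Y x = (mfderiv I J g (f x) (X (f x)) : F')) :
    ContDiffAt ℝ ∞ (vfInChart J Y x₀) (extChartAt J x₀ x₀) := by
  have hF := contDiffAt_chart_comp_self I J hf x₀
  have hG := contDiffAt_chart_comp_retract I J hf hg hgf x₀
  rw [← chart_comp_self I J (f := f) x₀] at hX
  have h2 := ContDiffAt.comp (extChartAt J x₀ x₀) hX hF
  have h3 := ContDiffAt.comp (extChartAt J x₀ x₀) (hG.fderiv_right (m := ∞) (by simp)) hF
  refine (h3.clm_apply h2).congr_of_eventuallyEq ?_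
  filter_upwards [eventually_mem_chart_source I J hf x₀] with y hy
  have hgs : g (f ((extChartAt J x₀).symm y)) ∈ (extChartAt J x₀).source := by
    rw [hgf]; exact (extChartAt J x₀).map_target hy.1
  have e1 := vfInChart_extChartAt I X hy.2
  have e2 := fderiv_chart_comp_mfderiv J I hy.2 hgs ((hg _).mdifferentiableAt (by simp))
    (X (f ((extChartAt J x₀).symm y)))
  have e3 := mfderiv_chart_retract J hgf x₀ ((extChartAt J x₀).symm y)
    (Y ((extChartAt J x₀).symm y))
  refine e3.symm.trans ((congrArg (fun u : F' =>
    (mfderiv J 𝓘(ℝ, F') (extChartAt J x₀) (g (f ((extChartAt J x₀).symm y))) u : F')) (hY _)).trans ?_)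
  refine e2.symm.trans ?_
  exact congrArg (fderiv ℝ (extChartAt J x₀ ∘ g ∘ (extChartAt I (f x₀)).symm) _) e1.symm

/-- The endomorphism field induced along a retraction is smooth. -/
theorem contDiffAt_endInChart_retract {A : ∀ x : M, TangentSpace I x →L[ℝ] TangentSpace I x} {x₀ : N}
    (hA : ContDiffAt ℝ ∞ (endInChart I A (f x₀)) (extChartAt I (f x₀) (f x₀)))
    {B : ∀ x : N, TangentSpace J x →L[ℝ] TangentSpace J x}
    (hB : ∀ x v, B x v = (mfderiv I J g (f x) (A (f x) (mfderiv J I f x v)) : F')) :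
    ContDiffAt ℝ ∞ (endInChart J B x₀) (extChartAt J x₀ x₀) := by
  have hF := contDiffAt_chart_comp_self I J hf x₀
  have hG := contDiffAt_chart_comp_retract I J hf hg hgf x₀
  rw [← chart_comp_self I J (f := f) x₀] at hA
  have h2 := ContDiffAt.comp (extChartAt J x₀ x₀) hA hF
  have h3 := ContDiffAt.comp (extChartAt J x₀ x₀) (hG.fderiv_right (m := ∞) (by simp)) hF
  refine (h3.clm_comp (h2.clm_comp (hF.fderiv_right (m := ∞) (by simp)))).congr_of_eventuallyEq ?_
  filter_upwards [eventually_mem_chart_source I J hf x₀] with y hy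
  have hgs : g (f ((extChartAt J x₀).symm y)) ∈ (extChartAt J x₀).source := by
    rw [hgf]; exact (extChartAt J x₀).map_target hy.1
  refine ContinuousLinearMap.ext fun v => ?_
  obtain ⟨w, hw⟩ : ∃ w : F', w = mfderiv 𝓘(ℝ, F') J (extChartAt J x₀).symm y v := ⟨_, rfl⟩
  obtain ⟨x, hx⟩ : ∃ x, x = (extChartAt J x₀).symm y := ⟨_, rfl⟩
  have e1 := fderiv_chart_comp_apply I J hy.1 hy.2 ((hf _).mdifferentiableAt (by simp)) v
  have e2 := endInChart_extChartAt I A hy.2 (mfderiv J I f ((extChartAt J x₀).symm y) w)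
  have e3 := fderiv_chart_comp_mfderiv J I hy.2 hgs ((hg _).mdifferentiableAt (by simp))
    (A _ (mfderiv J I f ((extChartAt J x₀).symm y) w))
  have e4 := mfderiv_chart_retract J hgf x₀ ((extChartAt J x₀).symm y)
    (B ((extChartAt J x₀).symm y) w)
  rw [ContinuousLinearMap.comp_apply, ContinuousLinearMap.comp_apply, e1]
  rw [hw] at e2 e3 e4
  refine (Eq.trans ?_ e4.symm).trans ((congrArg (fun u : F' =>
    (mfderiv J 𝓘(ℝ, F') (extChartAt J x₀) (g (f ((extChartAt J x₀).symm y))) u : F')) (hB _ _)).trans ?_)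
  · rfl
  refine e3.symm.trans ?_
  exact congrArg (fderiv ℝ (extChartAt J x₀ ∘ g ∘ (extChartAt I (f x₀)).symm) _) e2.symm

end TensorMaps

/-! ### The real manifold underlying a complex manifold -/

section Realification

variable {F : Type*} [NormedAddCommGroup F] [NormedSpace ℂ F] {H : Type*} [TopologicalSpace H]
  {F' : Type*} [NormedAddCommGroup F'] [NormedSpace ℂ F'] {H' : Type*} [TopologicalSpace H']
  {M : Type*} [TopologicalSpace M] [ChartedSpace H M]
  {N : Type*} [TopologicalSpace N] [ChartedSpace H' N]

/-- The real model `IR` underlies the complex model `IC`: both have the same charts. -/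
structure IsRealification (IC : ModelWithCorners ℂ F H) (IR : ModelWithCorners ℝ F H) : Prop where
  toPartialEquiv_eq : IC.toPartialEquiv = IR.toPartialEquiv

theorem isRealification_self : IsRealification 𝓘(ℂ, F) 𝓘(ℝ, F) := ⟨rfl⟩

theorem isRealification_model (E : Type*) [NormedAddCommGroup E] [NormedSpace ℂ E] :
    IsRealification (modelC E) (modelR E) := ⟨rfl⟩

namespace IsRealification

variable {IC : ModelWithCorners ℂ F H} {IR : ModelWithCorners ℝ F H} (hI : IsRealification IC IR)
  {JC : ModelWithCorners ℂ F' H'} {JR : ModelWithCorners ℝ F' H'} (hJ : IsRealification JC JR)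
include hI

theorem coe_eq : (IC : H → F) = IR := congrArg PartialEquiv.toFun hI.toPartialEquiv_eq

theorem coe_symm_eq : (IC.symm : F → H) = IR.symm := congrArg PartialEquiv.invFun hI.toPartialEquiv_eq

theorem extChartAt_eq (x : M) : extChartAt IC x = extChartAt IR x := by
  unfold extChartAt OpenPartialHomeomorph.extend
  rw [hI.toPartialEquiv_eq]

theorem isManifold [IsManifold IC ω M] : IsManifold IR ∞ M := by
  refine isManifold_of_contDiffOn IR ∞ M fun e e' he he' => ?_
  have h := ((contDiffGroupoid ω IC).compatible he he').1
  have h2 : ContDiffOn ℂ ω (IC ∘ (e.symm ≫ₕ e') ∘ IC.symm)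
    (IC.symm ⁻¹' (e.symm ≫ₕ e').source ∩ range IC) := h
  rw [hI.coe_eq, hI.coe_symm_eq] at h2
  exact (h2.restrict_scalars ℝ).of_le le_top

include hJ

/-- A complex derivative, with scalars restricted, is a real derivative, since the charts agree. -/
theorem hasMFDerivAt {f : M → N} {x : M} {f' : F →L[ℂ] F'} (h : HasMFDerivAt IC JC f x f') :
    HasMFDerivAt IR JR f x (f'.restrictScalars ℝ : F →L[ℝ] F') := by
  refine ⟨h.1, ?_⟩
  have h2 : HasFDerivWithinAt (writtenInExtChartAt IC JC x f) f' (range IC) (extChartAt IC x x) := h.2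
  unfold writtenInExtChartAt at h2 ⊢
  rw [hI.extChartAt_eq, hJ.extChartAt_eq, hI.coe_eq] at h2
  exact h2.restrictScalars ℝ

theorem mfderiv_apply {f : M → N} {x : M} (h : MDifferentiableAt IC JC f x) (v : F) :
    (mfderiv IR JR f x v : F') = mfderiv IC JC f x v := by
  rw [(hI.hasMFDerivAt hJ h.hasMFDerivAt).mfderiv]; rfl

theorem contMDiffAt {r : ℕ∞ω} {f : M → N} {x : M} (h : ContMDiffAt IC JC r f x) :
    ContMDiffAt IR JR r f x := by
  rw [contMDiffAt_iff] at h ⊢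
  refine ⟨h.1, ?_⟩
  have h2 := h.2
  rw [hI.extChartAt_eq, hJ.extChartAt_eq, hI.coe_eq] at h2
  exact h2.restrict_scalars ℝ

omit hJ

variable [IC.Boundaryless] [IR.Boundaryless] [IsManifold IC 1 M]

theorem formInChart_reForm {k : ℕ} (α : ∀ x : M, TangentSpace IC x [⋀^Fin k]→L[ℂ] ℂ) {x₀ : M} {y : F}
    (hy : y ∈ (extChartAt IC x₀).target) :
    formInChart IR (fun x => reForm F k (α x)) x₀ y = reForm F k (formInChart IC α x₀ y) := by
  ext v
  have h1 := fun v => isRealification_self.mfderiv_apply hI (mdifferentiableAt_extChartAt_symm IC hy) v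
  rw [hI.extChartAt_eq] at h1
  refine congrArg Complex.re ?_
  have e : ∀ p q : M, p = q → ∀ u w : Fin k → F, u = w → α p u = α q w := by
    rintro p q rfl u w rfl; rfl
  refine e _ _ (by rw [hI.extChartAt_eq]) _ _ (funext fun i => ?_)
  refine (h1 (v i)).trans ?_
  rw [hI.extChartAt_eq]
  rfl

theorem extDerivForm_reForm {k : ℕ} (α : ∀ x : M, TangentSpace IC x [⋀^Fin k]→L[ℂ] ℂ) {x : M}
    (hα : DifferentiableAt ℂ (formInChart IC α x) (extChartAt IC x x)) :
    extDerivForm IR (fun x => reForm F k (α x)) x = reForm F (k + 1) (extDerivForm IC α x) := by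
  have h1 : formInChart IR (fun x => reForm F k (α x)) x =ᶠ[𝓝 (extChartAt IC x x)]
      fun y => reForm F k (formInChart IC α x y) := by
    filter_upwards [extChartAt_target_mem_nhds (I := IC) x] with y hy
    exact hI.formInChart_reForm α hy
  have h2 := extDeriv_reForm hα
  rw [← h1.extDeriv_eq] at h2
  have h3 := fun v => hI.mfderiv_apply isRealification_self
    (mdifferentiableAt_extChartAt' IC (mem_extChartAt_source (I := IC) x)) v
  rw [hI.extChartAt_eq] at h2 h3
  ext v
  refine (congrArg (fun β : F [⋀^Fin (k + 1)]→L[ℝ] ℝ => β fun i =>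
    (mfderiv IR 𝓘(ℝ, F) (extChartAt IR x) x (v i) : F)) h2).trans ?_
  refine congrArg Complex.re ?_
  unfold extDerivForm
  rw [hI.extChartAt_eq]
  exact congrArg (extDeriv (formInChart IC α x) (extChartAt IR x x)) (funext fun i => h3 (v i))

theorem isSmoothFormOn_reForm {k : ℕ} {α : ∀ x : M, TangentSpace IC x [⋀^Fin k]→L[ℂ] ℂ}
    (hα : IsSmoothFormOn IC ω α univ) : IsSmoothFormOn IR ∞ (fun x => reForm F k (α x)) univ := by
  rw [isSmoothFormOn_univ_iff] at hα
  refine (isSmoothFormOn_univ_iff IR).2 fun x₀ y hy => ?_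
  rw [← hI.extChartAt_eq] at hy
  have h1 : formInChart IR (fun x => reForm F k (α x)) x₀ =ᶠ[𝓝 y]
      fun y => reForm F k (formInChart IC α x₀ y) := by
    filter_upwards [(isOpen_extChartAt_target x₀).mem_nhds hy] with y hy
    exact hI.formInChart_reForm α hy
  refine ContDiffAt.congr_of_eventuallyEq ?_ h1
  exact (reForm F k).contDiff.contDiffAt.comp y (((hα x₀ y hy).restrict_scalars ℝ).of_le le_top)

end IsRealification

end Realification

/-! ### The total space of `L^×` as a principal bundle -/

section TotalSpace

universe w

variable {n : ℕ} {E : Type*} [NormedAddCommGroup E] [NormedSpace ℂ E]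
  {Z : Type*} [TopologicalSpace Z] [ChartedSpace E Z]

namespace ComplexContactStructure

variable (C : ComplexContactStructure.{w} n E Z)

/-- The index of the distinguished set `U_i` which contains the base point of `u`. -/
noncomputable def idx (u : C.UZ) : C.ι := C.core.indexAt (C.proj u)

theorem proj_mem_idx (u : C.UZ) : C.proj u ∈ C.U (C.idx u) := C.core.mem_baseSet_at _

theorem proj_smul (c : ℂˣ) (u : C.UZ) : C.proj (c • u) = C.proj u := rfl

theorem z_eq (i : C.ι) (u : C.UZ) :
    C.z i u = C.f (C.idx u) i (C.proj u) * C.fibreCoord u.1 := rfl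

theorem z_smul (i : C.ι) (c : ℂˣ) (u : C.UZ) : C.z i (c • u) = c * C.z i u := by
  rw [z_eq, z_eq]
  change C.f (C.idx u) i (C.proj u) * ((c : ℂ) * C.fibreCoord u.1) = _
  ring

theorem fibreCoord_ne_zero (u : C.UZ) : C.fibreCoord u.1 ≠ 0 := u.2

theorem z_ne_zero {i : C.ι} {u : C.UZ} (hu : C.proj u ∈ C.U i) : C.z i u ≠ 0 :=
  mul_ne_zero (C.f_ne_zero _ _ _ ⟨C.proj_mem_idx u, hu⟩) (C.fibreCoord_ne_zero u)

theorem z_idx (u : C.UZ) : C.z (C.idx u) u = C.fibreCoord u.1 := by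
  rw [z_eq, C.f_self (C.proj_mem_idx u), one_mul]

theorem z_trans {i j : C.ι} {u : C.UZ} (hi : C.proj u ∈ C.U i) (hj : C.proj u ∈ C.U j) :
    C.z j u = C.f i j (C.proj u) * C.z i u := by
  rw [z_eq, z_eq, ← C.f_mul (C.proj_mem_idx u) hi hj]; ring

/-- The point of `L^×` over `x ∈ U_i` with fibre coordinate `z_i = ζ`. -/
noncomputable def point (i : C.ι) (x : Z) (hx : x ∈ C.U i) (ζ : ℂ) (hζ : ζ ≠ 0) : C.UZ :=
  ⟨⟨x, id (α := ℂ) ((C.f (C.core.indexAt x) i x)⁻¹ * ζ)⟩,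
    mul_ne_zero (M₀ := ℂ) (inv_ne_zero (C.f_ne_zero _ _ _ ⟨C.core.mem_baseSet_at x, hx⟩)) hζ⟩

theorem proj_point (i : C.ι) (x : Z) (hx : x ∈ C.U i) (ζ : ℂ) (hζ : ζ ≠ 0) :
    C.proj (C.point i x hx ζ hζ) = x := rfl

theorem z_point (i : C.ι) (x : Z) (hx : x ∈ C.U i) (ζ : ℂ) (hζ : ζ ≠ 0) :
    C.z i (C.point i x hx ζ hζ) = ζ :=
  mul_inv_cancel_left₀ (C.f_ne_zero _ _ _ ⟨C.core.mem_baseSet_at x, hx⟩) ζ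

theorem ext_z {i : C.ι} {u v : C.UZ} (hu : C.proj u ∈ C.U i) (h : C.proj u = C.proj v)
    (hz : C.z i u = C.z i v) : u = v := by
  obtain ⟨⟨x, a⟩, ha⟩ := u
  obtain ⟨⟨y, b⟩, hb⟩ := v
  obtain rfl : x = y := h
  have hab : a = b :=
    mul_left_cancel₀ (M₀ := ℂ) (C.f_ne_zero _ _ _ ⟨C.core.mem_baseSet_at x, hu⟩) hz
  subst hab
  rfl

theorem eq_smul_of_proj_eq {i : C.ι} {u v : C.UZ} (hu : C.proj u ∈ C.U i)
    (h : C.proj u = C.proj v) (c : ℂˣ) (hc : C.z i v = c * C.z i u) : v = c • u :=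
  C.ext_z (i := i) (h ▸ hu) h.symm (by rw [hc, z_smul])

section Charts

variable {𝕜 : Type*} [NontriviallyNormedField 𝕜] [NormedSpace 𝕜 E] [NormedAlgebra 𝕜 ℂ]

theorem extChartAt_apply (u v : C.UZ) :
    extChartAt (𝓘(𝕜, E).prod 𝓘(𝕜, ℂ)) u v =
      (extChartAt 𝓘(𝕜, E) (C.proj u) (C.proj v), C.z (C.idx u) v) := rfl

theorem mem_extChartAt_source_iff (u v : C.UZ) :
    v ∈ (extChartAt (𝓘(𝕜, E).prod 𝓘(𝕜, ℂ)) u).source ↔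
      C.proj v ∈ (extChartAt 𝓘(𝕜, E) (C.proj u)).source ∧ C.proj v ∈ C.U (C.idx u) := by
  rw [extChartAt_source, extChartAt_source, TopologicalSpace.Opens.chartAt_eq,
    OpenPartialHomeomorph.subtypeRestr_source, FiberBundle.chartedSpace_chartAt]
  simp only [mfld_simps, mem_preimage]
  exact (and_congr (Trivialization.mem_source _) Iff.rfl).trans and_comm

theorem mem_extChartAt_target_iff (u : C.UZ) (y : E × ℂ) :
    y ∈ (extChartAt (𝓘(𝕜, E).prod 𝓘(𝕜, ℂ)) u).target ↔
      y.1 ∈ (extChartAt 𝓘(𝕜, E) (C.proj u)).target ∧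
        (extChartAt 𝓘(𝕜, E) (C.proj u)).symm y.1 ∈ C.U (C.idx u) ∧ y.2 ≠ 0 := by
  constructor
  · intro hy
    have hs := (extChartAt (𝓘(𝕜, E).prod 𝓘(𝕜, ℂ)) u).map_target hy
    have he := (extChartAt (𝓘(𝕜, E).prod 𝓘(𝕜, ℂ)) u).right_inv hy
    rw [mem_extChartAt_source_iff] at hs
    rw [extChartAt_apply] at he
    rw [← he]
    refine ⟨(extChartAt _ _).map_source hs.1, ?_, C.z_ne_zero hs.2⟩
    rw [(extChartAt _ _).left_inv hs.1]
    exact hs.2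
  · rintro ⟨h1, h2, h3⟩
    have : y = extChartAt (𝓘(𝕜, E).prod 𝓘(𝕜, ℂ)) u (C.point _ _ h2 y.2 h3) := by
      rw [extChartAt_apply, proj_point, z_point, (extChartAt _ _).right_inv h1]
    rw [this]
    refine (extChartAt _ _).map_source ((C.mem_extChartAt_source_iff u _).2 ⟨?_, h2⟩)
    exact (extChartAt _ _).map_target h1

theorem proj_extChartAt_symm {u : C.UZ} {y : E × ℂ}
    (hy : y ∈ (extChartAt (𝓘(𝕜, E).prod 𝓘(𝕜, ℂ)) u).target) :
    C.proj ((extChartAt (𝓘(𝕜, E).prod 𝓘(𝕜, ℂ)) u).symm y) =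
      (extChartAt 𝓘(𝕜, E) (C.proj u)).symm y.1 := by
  have hs := (extChartAt (𝓘(𝕜, E).prod 𝓘(𝕜, ℂ)) u).map_target hy
  have he := (extChartAt (𝓘(𝕜, E).prod 𝓘(𝕜, ℂ)) u).right_inv hy
  rw [mem_extChartAt_source_iff] at hs
  rw [extChartAt_apply] at he
  conv_rhs => rw [← he]
  exact ((extChartAt _ _).left_inv hs.1).symm

theorem z_extChartAt_symm {u : C.UZ} {y : E × ℂ}
    (hy : y ∈ (extChartAt (𝓘(𝕜, E).prod 𝓘(𝕜, ℂ)) u).target) :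
    C.z (C.idx u) ((extChartAt (𝓘(𝕜, E).prod 𝓘(𝕜, ℂ)) u).symm y) = y.2 := by
  have he := (extChartAt (𝓘(𝕜, E).prod 𝓘(𝕜, ℂ)) u).right_inv hy
  exact congrArg Prod.snd he

theorem smul_mem_target {u : C.UZ} {y : E × ℂ} (c : ℂˣ)
    (hy : y ∈ (extChartAt (𝓘(𝕜, E).prod 𝓘(𝕜, ℂ)) u).target) :
    (y.1, (c : ℂ) * y.2) ∈ (extChartAt (𝓘(𝕜, E).prod 𝓘(𝕜, ℂ)) u).target := by
  rw [mem_extChartAt_target_iff] at hy ⊢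
  exact ⟨hy.1, hy.2.1, mul_ne_zero c.ne_zero hy.2.2⟩

/-- In the charts of `L^×`, the action multiplies the fibre coordinate. -/
theorem smul_extChartAt_symm {u : C.UZ} {y : E × ℂ} (c : ℂˣ)
    (hy : y ∈ (extChartAt (𝓘(𝕜, E).prod 𝓘(𝕜, ℂ)) u).target) :
    c • (extChartAt (𝓘(𝕜, E).prod 𝓘(𝕜, ℂ)) u).symm y =
      (extChartAt (𝓘(𝕜, E).prod 𝓘(𝕜, ℂ)) u).symm (y.1, (c : ℂ) * y.2) := by
  have hy' := C.smul_mem_target c hy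
  symm
  refine C.eq_smul_of_proj_eq (i := C.idx u) ?_ ?_ c ?_
  · rw [C.proj_extChartAt_symm hy]
    exact ((C.mem_extChartAt_target_iff u y).1 hy).2.1
  · rw [C.proj_extChartAt_symm hy, C.proj_extChartAt_symm hy']
  · rw [C.z_extChartAt_symm hy, C.z_extChartAt_symm hy']

section Maps

variable {F : Type*} [NormedAddCommGroup F] [NormedSpace 𝕜 F]
  {H : Type*} [TopologicalSpace H] {I : ModelWithCorners 𝕜 F H}
  {M : Type*} [TopologicalSpace M] [ChartedSpace H M] {r : ℕ∞ω}

/-- A map to `L^×` is of class `C^r` if its composition with the projection and its fibre coordinate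
are. -/
theorem contMDiffAt_iff_proj_z {φ : M → C.UZ} {x : M} :
    ContMDiffAt I (𝓘(𝕜, E).prod 𝓘(𝕜, ℂ)) r φ x ↔
      ContMDiffAt I 𝓘(𝕜, E) r (fun m => C.proj (φ m)) x ∧
        ContMDiffAt I 𝓘(𝕜, ℂ) r (fun m => C.z (C.idx (φ x)) (φ m)) x := by
  have h1 := Bundle.contMDiffAt_totalSpace (n := r) (IM := I) (IB := 𝓘(𝕜, E)) (F := ℂ) (E := C.L)
    (f := fun m => (φ m).1) (x₀ := x)
  refine Iff.trans ?_ h1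
  rw [contMDiffAt_iff_target (f := φ), contMDiffAt_iff_target (f := fun m => (φ m).1)]
  refine and_congr ?_ Iff.rfl
  exact Topology.IsInducing.subtypeVal.continuousAt_iff

theorem contMDiff_proj : ContMDiff (𝓘(𝕜, E).prod 𝓘(𝕜, ℂ)) 𝓘(𝕜, E) r C.proj :=
  fun _ => (C.contMDiffAt_iff_proj_z.1 contMDiffAt_id).1

theorem contMDiffAt_smul {c : M → ℂˣ} {φ : M → C.UZ} {x : M}
    (hc : ContMDiffAt I 𝓘(𝕜, ℂ) r (fun m => (c m : ℂ)) x)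
    (hφ : ContMDiffAt I (𝓘(𝕜, E).prod 𝓘(𝕜, ℂ)) r φ x)  :
    ContMDiffAt I (𝓘(𝕜, E).prod 𝓘(𝕜, ℂ)) r (fun m => c m • φ m) x := by
  rw [contMDiffAt_iff_proj_z] at hφ ⊢
  refine ⟨hφ.1, ?_⟩
  simp only [z_smul]
  have := (contDiff_mul (𝕜 := 𝕜) (𝔸 := ℂ) (n := r)).contMDiff.contMDiffAt.comp x (hc.prodMk_space hφ.2)
  exact this

end Maps

end Charts


theorem isOpen_preimage_U (i : C.ι) : IsOpen (C.proj ⁻¹' C.U i) :=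
  (C.isOpen_U i).preimage
    (C.contMDiff_proj (𝕜 := ℂ) (r := 0)).continuous

theorem contMDiffAt_f {i j : C.ι} {x : Z} (hi : x ∈ C.U i) (hj : x ∈ C.U j) :
    ContMDiffAt 𝓘(ℂ, E) 𝓘(ℂ, ℂ) ω (C.f i j) x :=
  (C.holomorphic_f i j).contMDiffAt
    (((C.isOpen_U i).inter (C.isOpen_U j)).mem_nhds ⟨hi, hj⟩)

/-- The fibre coordinates are holomorphic. -/
theorem contMDiffAt_z {i : C.ι} {u : C.UZ} (hu : C.proj u ∈ C.U i) :
    ContMDiffAt (modelC E) 𝓘(ℂ, ℂ) ω (C.z i) u := by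
  have h1 : ContMDiffAt (modelC E) 𝓘(ℂ, ℂ) ω
      (fun v => C.f (C.idx u) i (C.proj v) * C.z (C.idx u) v) u :=
    ((C.contMDiffAt_f (C.proj_mem_idx u) hu).comp u (C.contMDiff_proj u)).mul
      (C.contMDiffAt_iff_proj_z.1 contMDiffAt_id).2
  refine h1.congr_of_eventuallyEq ?_
  filter_upwards [(C.isOpen_preimage_U i).mem_nhds hu,
    (C.isOpen_preimage_U (C.idx u)).mem_nhds (C.proj_mem_idx u)] with v hv hv'
  exact C.z_trans hv' hv

open Classical in
/-- The section of `L^×` over `U_i` with `z_i = 1` (with irrelevant values outside of `U_i`). -/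
noncomputable def sec (i : C.ι) (x : Z) : C.UZ :=
  if hx : x ∈ C.U i then C.point i x hx 1 one_ne_zero
  else C.point (C.core.indexAt x) x (C.core.mem_baseSet_at x) 1 one_ne_zero

theorem proj_sec (i : C.ι) (x : Z) : C.proj (C.sec i x) = x := by
  unfold sec; split_ifs <;> rfl

theorem z_sec {i : C.ι} {x : Z} (hx : x ∈ C.U i) : C.z i (C.sec i x) = 1 := by
  unfold sec; rw [dif_pos hx, z_point]

theorem contMDiffAt_sec {i : C.ι} {x : Z} (hx : x ∈ C.U i) :
    ContMDiffAt 𝓘(ℂ, E) (modelC E) ω (C.sec i) x := by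
  rw [contMDiffAt_iff_proj_z]
  have hj : x ∈ C.U (C.idx (C.sec i x)) := by
    have := C.proj_mem_idx (C.sec i x)
    rwa [proj_sec] at this
  refine ⟨by simp only [proj_sec]; exact contMDiffAt_id,
    (C.contMDiffAt_f hx hj).congr_of_eventuallyEq ?_⟩
  filter_upwards [(C.isOpen_U i).mem_nhds hx, (C.isOpen_U _).mem_nhds hj] with y hy hy'
  rw [C.z_trans (i := i) (by rwa [proj_sec]) (by rwa [proj_sec]), proj_sec, C.z_sec hy, mul_one]

theorem contMDiffAt_units {𝕜 : Type*} [NontriviallyNormedField 𝕜] [NormedAlgebra 𝕜 ℂ]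
    {F : Type*} [NormedAddCommGroup F] [NormedSpace 𝕜 F]
    {H : Type*} [TopologicalSpace H] {I : ModelWithCorners 𝕜 F H}
    {M : Type*} [TopologicalSpace M] [ChartedSpace H M] {r : ℕ∞ω} {φ : M → ℂˣ} {x : M}
    (h : ContMDiffAt I 𝓘(𝕜, ℂ) r (fun m => (φ m : ℂ)) x) : ContMDiffAt I 𝓘(𝕜, ℂ) r φ x := by
  rw [contMDiffAt_iff_target]
  exact ⟨Units.isOpenEmbedding_val.isInducing.continuousAt_iff.2 h.continuousAt, h⟩

theorem smul_sec_eq {i : C.ι} {u : C.UZ} (hu : C.proj u ∈ C.U i) (c : ℂˣ) (hc : C.z i u = c) :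
    c • C.sec i (C.proj u) = u := by
  refine C.ext_z (i := i) ?_ ?_ ?_
  · rwa [proj_smul, proj_sec]
  · rw [proj_smul, proj_sec]
  · rw [z_smul, C.z_sec hu, mul_one, hc]

open Classical in
/-- The fibre coordinate `z_i` as an element of `ℂ^×` (with irrelevant values outside of `U_i`). -/
noncomputable def zUnit (i : C.ι) (u : C.UZ) : ℂˣ :=
  if hu : C.z i u = 0 then 1 else Units.mk0 _ hu

theorem coe_zUnit {i : C.ι} {u : C.UZ} (hu : C.proj u ∈ C.U i) : (C.zUnit i u : ℂ) = C.z i u := by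
  unfold zUnit; rw [dif_neg (C.z_ne_zero hu)]; rfl

theorem contMDiffAt_zUnit {i : C.ι} {u : C.UZ} (hu : C.proj u ∈ C.U i) :
    ContMDiffAt (modelC E) 𝓘(ℂ, ℂ) ω (C.zUnit i) u := by
  refine contMDiffAt_units ((C.contMDiffAt_z hu).congr_of_eventuallyEq ?_)
  filter_upwards [(C.isOpen_preimage_U i).mem_nhds hu] with v hv
  exact C.coe_zUnit hv

/-- `L^×` is a holomorphic principal bundle. -/
theorem isPrincipalBundle_proj :
    IsPrincipalBundle 𝓘(ℂ, ℂ) (modelC E) 𝓘(ℂ, E) ω ℂˣ C.proj := by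
  refine ⟨fun x => C.contMDiffAt_smul (Units.contMDiff_val.comp contMDiff_fst x) contMDiffAt_snd,
    C.contMDiff_proj, fun b => ?_⟩
  obtain ⟨i, hi⟩ := C.cover b
  have hs : ∀ p : Z × ℂˣ, p.1 ∈ C.U i → ContMDiffAt (𝓘(ℂ, E).prod 𝓘(ℂ, ℂ)) (modelC E) ω
      (fun p : Z × ℂˣ => p.2 • C.sec i p.1) p := fun p hp =>
    C.contMDiffAt_smul (Units.contMDiff_val.comp contMDiff_snd p)
      (ContMDiffAt.comp p (C.contMDiffAt_sec hp) contMDiffAt_fst)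
  have he : ∀ u, C.proj u ∈ C.U i → ContMDiffAt (modelC E) (𝓘(ℂ, E).prod 𝓘(ℂ, ℂ)) ω
      (fun u => (C.proj u, C.zUnit i u)) u := fun u hu =>
    (C.contMDiff_proj u).prodMk (C.contMDiffAt_zUnit hu)
  let e : OpenPartialHomeomorph C.UZ (Z × ℂˣ) :=
    { toFun := fun u => (C.proj u, C.zUnit i u)
      invFun := fun p => p.2 • C.sec i p.1
      source := C.proj ⁻¹' C.U i
      target := C.U i ×ˢ univ
      map_source' := fun u hu => ⟨hu, mem_univ _⟩
      map_target' := fun p hp => by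
        rw [mem_preimage, proj_smul, proj_sec]; exact hp.1
      left_inv' := fun u hu => C.smul_sec_eq hu _ (C.coe_zUnit hu).symm
      right_inv' := fun p hp => by
        have h1 : C.proj (p.2 • C.sec i p.1) = p.1 := by rw [proj_smul, proj_sec]
        refine Prod.ext h1 (Units.ext ?_)
        rw [C.coe_zUnit (by rw [h1]; exact hp.1), z_smul, C.z_sec hp.1, mul_one]
      open_source := C.isOpen_preimage_U i
      open_target := (C.isOpen_U i).prod isOpen_univ
      continuousOn_toFun := fun u hu => (he u hu).continuousAt.continuousWithinAt
      continuousOn_invFun := fun p hp => (hs p hp.1).continuousAt.continuousWithinAt }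
  refine ⟨C.U i, e, C.isOpen_U i, hi, rfl, rfl, fun u hu => (he u hu).contMDiffWithinAt,
    fun p hp => (hs p hp.1).contMDiffWithinAt, fun u hu => ⟨rfl, fun c => ?_⟩⟩
  refine Prod.ext rfl (Units.ext ?_)
  change (C.zUnit i (c • u) : ℂ) = c * C.zUnit i u
  rw [C.coe_zUnit (u := c • u) hu, C.coe_zUnit hu, z_smul]

end ComplexContactStructure

end TotalSpace

/-! ### The exterior derivative of `1`-forms at a point -/

section DOne

variable {𝕜 : Type*} [RCLike 𝕜]
  {F : Type*} [NormedAddCommGroup F] [NormedSpace 𝕜 F] [FiniteDimensional 𝕜 F]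
  {H : Type*} [TopologicalSpace H] (I : ModelWithCorners 𝕜 F H) [I.Boundaryless]
  {M : Type*} [TopologicalSpace M] [ChartedSpace H M] [IsManifold I 1 M]

theorem covectorInChart_self (a : ∀ x : M, TangentSpace I x →L[𝕜] 𝕜) (x : M) (v : F) :
    covectorInChart I a x (extChartAt I x x) v = a x v :=
  formInChart_self_apply I (oneForm I a) x (fun _ => v)

theorem dOne_eq_fderiv {a : ∀ x : M, TangentSpace I x →L[𝕜] 𝕜} {x : M}
    (ha : DifferentiableAt 𝕜 (covectorInChart I a x) (extChartAt I x x)) (v w : F) :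
    dOne I a x v w = fderiv 𝕜 (covectorInChart I a x) (extChartAt I x x) v w
      - fderiv 𝕜 (covectorInChart I a x) (extChartAt I x x) w v := by
  rw [← extDeriv_oneFormCLM ha]
  unfold dOne extDerivForm
  rw [formInChart_oneForm]
  refine congrArg (extDeriv (fun y => oneFormCLM 𝕜 F (covectorInChart I a x y)) (extChartAt I x x)) ?_
  funext i
  have := mfderiv_extChartAt_self_apply I x
  fin_cases i
  · exact this v
  · exact this w

end DOne

/-! ### The holomorphic symplectic form `dϑ` -/

section Contact

universe w

variable {n : ℕ} {E : Type*} [NormedAddCommGroup E] [NormedSpace ℂ E]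
  {Z : Type*} [TopologicalSpace Z] [ChartedSpace E Z] [IsManifold 𝓘(ℂ, E) ω Z]

namespace ComplexContactStructure

variable (C : ComplexContactStructure.{w} n E Z)

theorem mfderiv_proj_mfderiv_symm {u : C.UZ} {y : E × ℂ} (hy : y ∈ (extChartAt (modelC E) u).target)
    (v : E × ℂ) :
    (mfderiv (modelC E) 𝓘(ℂ, E) C.proj ((extChartAt (modelC E) u).symm y)
      (mfderiv 𝓘(ℂ, E × ℂ) (modelC E) (extChartAt (modelC E) u).symm y v) : E) =
      mfderiv 𝓘(ℂ, E) 𝓘(ℂ, E) (extChartAt 𝓘(ℂ, E) (C.proj u)).symm y.1 v.1 := by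
  have h1 : mfderiv 𝓘(ℂ, E × ℂ) 𝓘(ℂ, E) (C.proj ∘ (extChartAt (modelC E) u).symm) y =
      (mfderiv (modelC E) 𝓘(ℂ, E) C.proj ((extChartAt (modelC E) u).symm y)).comp
        (mfderiv 𝓘(ℂ, E × ℂ) (modelC E) (extChartAt (modelC E) u).symm y) :=
    mfderiv_comp y ((C.contMDiff_proj (𝕜 := ℂ) (r := 1) _).mdifferentiableAt (by simp))
      (mdifferentiableAt_extChartAt_symm (modelC E) hy)
  have hy1 : y.1 ∈ (extChartAt 𝓘(ℂ, E) (C.proj u)).target :=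
    ((C.mem_extChartAt_target_iff u y).1 hy).1
  have h2 : mfderiv 𝓘(ℂ, E × ℂ) 𝓘(ℂ, E) ((extChartAt 𝓘(ℂ, E) (C.proj u)).symm ∘ Prod.fst) y =
      (mfderiv 𝓘(ℂ, E) 𝓘(ℂ, E) (extChartAt 𝓘(ℂ, E) (C.proj u)).symm y.1).comp
        (mfderiv 𝓘(ℂ, E × ℂ) 𝓘(ℂ, E) Prod.fst y) :=
    mfderiv_comp y (mdifferentiableAt_extChartAt_symm 𝓘(ℂ, E) hy1)
      (differentiableAt_fst.mdifferentiableAt)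
  have h3 : C.proj ∘ (extChartAt (modelC E) u).symm =ᶠ[𝓝 y]
      (extChartAt 𝓘(ℂ, E) (C.proj u)).symm ∘ Prod.fst := by
    filter_upwards [(isOpen_extChartAt_target (I := modelC E) u).mem_nhds hy] with z hz
    exact C.proj_extChartAt_symm hz
  refine (DFunLike.congr_fun h1 v).symm.trans ?_
  rw [h3.mfderiv_eq, h2]
  rw [mfderiv_eq_fderiv, fderiv_fst]
  rfl

/-- The projection is linear in the holomorphic charts. -/
theorem mfderiv_proj (u : C.UZ) (v : E × ℂ) :
    (mfderiv (modelC E) 𝓘(ℂ, E) C.proj u v : E) = v.1 := by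
  have h := C.mfderiv_proj_mfderiv_symm (mem_extChartAt_target (I := modelC E) u) v
  have e : ∀ p, p = u → ∀ a : E × ℂ, a = v →
      (mfderiv (modelC E) 𝓘(ℂ, E) C.proj p a : E) = mfderiv (modelC E) 𝓘(ℂ, E) C.proj u v := by
    rintro p rfl a rfl; rfl
  rw [e _ (extChartAt_to_inv u) _ (mfderiv_extChartAt_symm_self_apply (modelC E) u v)] at h
  exact h.trans (mfderiv_extChartAt_symm_self_apply 𝓘(ℂ, E) (C.proj u) v.1)

/-- The expression `z_i θ_i` of `ϑ` in the holomorphic charts. -/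
theorem covectorInChart_vartheta {u : C.UZ} {y : E × ℂ}
    (hy : y ∈ (extChartAt (modelC E) u).target) :
    covectorInChart (modelC E) C.vartheta u y =
      y.2 • (covectorInChart 𝓘(ℂ, E) (C.θ (C.idx u)) (C.proj u) y.1).comp
        (ContinuousLinearMap.fst ℂ E ℂ) := by
  have hy' := (C.mem_extChartAt_target_iff u y).1 hy
  have hp := C.proj_extChartAt_symm hy
  refine ContinuousLinearMap.ext fun v => ?_
  have hm : C.proj ((extChartAt (modelC E) u).symm y) ∈ C.U (C.idx u) := by
    rw [hp]; exact hy'.2.1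
  have h1 := C.vartheta_eq (C.idx u) ((extChartAt (modelC E) u).symm y) hm
    (mfderiv 𝓘(ℂ, E × ℂ) (modelC E) (extChartAt (modelC E) u).symm y v)
  rw [C.z_extChartAt_symm hy] at h1
  refine h1.trans (congrArg (y.2 * ·) ?_)
  have e : ∀ p q : Z, p = q → ∀ a b : E, a = b → C.θ (C.idx u) p a = C.θ (C.idx u) q b := by
    rintro p q rfl a b rfl; rfl
  exact e _ _ hp _ _ (C.mfderiv_proj_mfderiv_symm hy v)

variable [FiniteDimensional ℂ E]

theorem contDiffAt_covectorInChart_θ {u : C.UZ} {y : E × ℂ}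
    (hy : y ∈ (extChartAt (modelC E) u).target) :
    ContDiffAt ℂ ω (covectorInChart 𝓘(ℂ, E) (C.θ (C.idx u)) (C.proj u)) y.1 := by
  have hy' := (C.mem_extChartAt_target_iff u y).1 hy
  exact (contDiffAt_formInChart_oneForm 𝓘(ℂ, E)).1
    ((C.holomorphic_θ (C.idx u)).contDiffAt 𝓘(ℂ, E) (C.isOpen_U _) hy'.1 hy'.2.1)

theorem contDiffAt_covectorInChart_vartheta {u : C.UZ} {y : E × ℂ}
    (hy : y ∈ (extChartAt (modelC E) u).target) :
    ContDiffAt ℂ ω (covectorInChart (modelC E) C.vartheta u) y := by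
  have h1 : ContDiffAt ℂ ω (fun y : E × ℂ => y.2 •
      (covectorInChart 𝓘(ℂ, E) (C.θ (C.idx u)) (C.proj u) y.1).comp
        (ContinuousLinearMap.fst ℂ E ℂ)) y :=
    contDiffAt_snd.smul ((ContDiffAt.comp y (C.contDiffAt_covectorInChart_θ hy)
      contDiffAt_fst).clm_comp contDiffAt_const)
  refine h1.congr_of_eventuallyEq ?_
  filter_upwards [(isOpen_extChartAt_target (I := modelC E) u).mem_nhds hy] with z hz
  exact C.covectorInChart_vartheta hz

theorem isSmoothFormOn_vartheta : IsSmoothFormOn (modelC E) ω (oneForm (modelC E) C.vartheta) univ :=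
  (isSmoothFormOn_univ_iff (modelC E)).2 fun _ _ hy =>
    (contDiffAt_formInChart_oneForm (modelC E)).2 (C.contDiffAt_covectorInChart_vartheta hy)

/-- The holomorphic symplectic form `Υ = dϑ`. -/
noncomputable def upsilon (u : C.UZ) : TangentSpace (modelC E) u [⋀^Fin 2]→L[ℂ] ℂ :=
  extDerivForm (modelC E) (oneForm (modelC E) C.vartheta) u

theorem isSmoothFormOn_upsilon : IsSmoothFormOn (modelC E) ω C.upsilon univ :=
  C.isSmoothFormOn_vartheta.extDerivForm (modelC E)
    (by rw [minSmoothness_of_isRCLikeNormedField]; exact le_top) le_top isOpen_univ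

/-- In the holomorphic charts, `Υ = dz_i ∧ θ_i + z_i dθ_i`. -/
theorem upsilon_apply (u : C.UZ) (v w : E × ℂ) :
    C.upsilon u ![v, w] = v.2 * C.θ (C.idx u) (C.proj u) w.1 - w.2 * C.θ (C.idx u) (C.proj u) v.1
      + C.fibreCoord u.1 * dOne 𝓘(ℂ, E) (C.θ (C.idx u)) (C.proj u) v.1 w.1 := by
  have hy := mem_extChartAt_target (I := modelC E) u
  have hz : (extChartAt (modelC E) u u).2 = C.fibreCoord u.1 := C.z_idx u
  have h1 : (extChartAt (modelC E) u u).1 = extChartAt 𝓘(ℂ, E) (C.proj u) (C.proj u) := rfl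
  have hθ := (C.contDiffAt_covectorInChart_θ hy).differentiableAt (by simp)
  have hϑ := (C.contDiffAt_covectorInChart_vartheta hy).differentiableAt (by simp)
  have hev : covectorInChart (modelC E) C.vartheta u =ᶠ[𝓝 (extChartAt (modelC E) u u)]
      fun y : E × ℂ => y.2 • (covectorInChart 𝓘(ℂ, E) (C.θ (C.idx u)) (C.proj u) y.1).comp
        (ContinuousLinearMap.fst ℂ E ℂ) := by
    filter_upwards [(isOpen_extChartAt_target (I := modelC E) u).mem_nhds hy] with z hz
    exact C.covectorInChart_vartheta hz
  have hd : ∀ v w : E × ℂ, fderiv ℂ (covectorInChart (modelC E) C.vartheta u)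
      (extChartAt (modelC E) u u) v w =
      v.2 * C.θ (C.idx u) (C.proj u) w.1 + C.fibreCoord u.1 *
        fderiv ℂ (covectorInChart 𝓘(ℂ, E) (C.θ (C.idx u)) (C.proj u))
          (extChartAt 𝓘(ℂ, E) (C.proj u) (C.proj u)) v.1 w.1 := by
    intro v w
    have hc : HasFDerivAt (fun y : E × ℂ => y.2 *
        covectorInChart 𝓘(ℂ, E) (C.θ (C.idx u)) (C.proj u) y.1 w.1) _ (extChartAt (modelC E) u u) :=
      hasFDerivAt_snd.mul ((hθ.hasFDerivAt.comp _ hasFDerivAt_fst).clm_apply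
        (hasFDerivAt_const w.1 _))
    have hc2 : HasFDerivAt (fun y => covectorInChart (modelC E) C.vartheta u y w) _
        (extChartAt (modelC E) u u) := hϑ.hasFDerivAt.clm_apply (hasFDerivAt_const w _)
    have hc3 := hc2.congr_of_eventuallyEq (f₁ := fun y : E × ℂ => y.2 *
        covectorInChart 𝓘(ℂ, E) (C.θ (C.idx u)) (C.proj u) y.1 w.1)
        (hev.mono fun y hy => (DFunLike.congr_fun hy w).symm)
    have := DFunLike.congr_fun (hc3.unique hc) v
    simp only [add_apply, ContinuousLinearMap.comp_apply, ContinuousLinearMap.flip_apply,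
      smul_apply, zero_apply, map_zero, zero_add, smul_eq_mul, ContinuousLinearMap.coe_fst',
      ContinuousLinearMap.coe_snd'] at this
    rw [h1, covectorInChart_self, hz] at this
    rw [this]
    ring
  refine (dOne_eq_fderiv (modelC E) hϑ v w).trans ?_
  rw [hd, hd, dOne_eq_fderiv 𝓘(ℂ, E) hθ]
  ring

/-- A vector in the kernel of `dz_i ∧ θ_i + z_i dθ_i` has a horizontal part in the kernel of `θ_i`, on
which `dθ_i` is a multiple of `θ_i`; it vanishes by the contact condition. -/
theorem upsilon_nondegenerate (hE : Module.finrank ℂ E = 2 * n + 1) (u : C.UZ) (v : E × ℂ)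
    (hv : ∀ w : E × ℂ, C.upsilon u ![v, w] = 0) : v = 0 := by
  have hz := C.fibreCoord_ne_zero u
  have hθ := (C.contDiffAt_covectorInChart_θ
    (mem_extChartAt_target (I := modelC E) u)).differentiableAt (by simp)
  obtain ⟨D, hD⟩ : ∃ D : E →L[ℂ] E →L[ℂ] ℂ,
      ∀ v w, dOne 𝓘(ℂ, E) (C.θ (C.idx u)) (C.proj u) v w = D v w - D w v :=
    ⟨_, dOne_eq_fderiv 𝓘(ℂ, E) hθ⟩
  obtain ⟨η, hη⟩ : ∃ η : E →L[ℂ] ℂ, η = C.θ (C.idx u) (C.proj u) :=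
    ⟨_, rfl⟩
  have hU : ∀ w : E × ℂ, C.upsilon u ![v, w] = v.2 * η w.1 - w.2 * η v.1
      + C.fibreCoord u.1 * (D v.1 w.1 - D w.1 v.1) := fun w => by
    refine (C.upsilon_apply u v w).trans ?_
    subst hη
    exact congrArg (fun t => v.2 * (C.θ (C.idx u) (C.proj u) : E →L[ℂ] ℂ) w.1 -
      w.2 * (C.θ (C.idx u) (C.proj u) : E →L[ℂ] ℂ) v.1 + C.fibreCoord u.1 * t) (hD v.1 w.1)
  -- the pairing with the vertical vector
  have h1 : η v.1 = 0 := by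
    have := (hU (0, 1)).symm.trans (hv _)
    simpa using this
  -- the pairings with the horizontal vectors
  have h2 : ∀ a, v.2 * η a + C.fibreCoord u.1 * (D v.1 a - D a v.1) = 0 := fun a => by
    have := (hU (a, 0)).symm.trans (hv _)
    simpa using this
  have hc := C.contact (C.idx u) (C.proj u) (C.proj_mem_idx u)
  have hv1 : v.1 = 0 := by
    refine eq_zero_of_wedgePow_ne_zero hE (η : E →ₗ[ℂ] ℂ) (LinearMap.mk₂ ℂ (fun v w => D v w - D w v) ?_ ?_ ?_ ?_)
      (fun x y => ?_) (m := n) ?_ h1 (c := -(v.2 / C.fibreCoord u.1)) (fun y => ?_)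
    · intro a b c; simp only [map_add, add_apply]; ring
    · intro a b c; simp only [map_smul, smul_apply, smul_eq_mul]; ring
    · intro a b c; simp only [map_add, add_apply]; ring
    · intro a b c; simp only [map_smul, smul_apply, smul_eq_mul]; ring
    · simp only [LinearMap.mk₂_apply]; ring
    · have hDf : (fun x y : E => D x y - D y x) =
          (dOne 𝓘(ℂ, E) (C.θ (C.idx u)) (C.proj u) : E → E → ℂ) :=
        funext fun a => funext fun b => (hD a b).symm
      change wedgePow η (fun x y : E => D x y - D y x) n ≠ 0
      rw [hDf, hη]
      exact hc
    · simp only [LinearMap.mk₂_apply]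
      field_simp
      linear_combination h2 y
  have hv2 : v.2 = 0 := by
    obtain ⟨a, ha⟩ := C.exists_θ_ne_zero (C.proj_mem_idx u)
    have := h2 a
    rw [hv1] at this
    rw [show D 0 a = 0 by rw [map_zero]; rfl, map_zero, sub_zero, mul_zero, add_zero, hη] at this
    exact (mul_eq_zero.1 this).resolve_right ha
  exact Prod.ext hv1 hv2

theorem isSymplecticForm_upsilon (hE : Module.finrank ℂ E = 2 * n + 1) :
    IsSymplecticForm (modelC E) ω C.upsilon where
  smooth := C.isSmoothFormOn_upsilon
  closed x := C.isSmoothFormOn_vartheta.extDerivForm_extDerivForm (modelC E)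
    (by rw [minSmoothness_of_isRCLikeNormedField]; exact le_top) isOpen_univ (mem_univ x)
  nondegenerate u v hv := C.upsilon_nondegenerate hE u v hv

/-- In the holomorphic charts, `ϑ = z_i θ_i`. -/
theorem vartheta_apply (u : C.UZ) (v : E × ℂ) :
    C.vartheta u v = C.fibreCoord u.1 * C.θ (C.idx u) (C.proj u) v.1 :=
  congrArg (fun a : E => C.fibreCoord u.1 * C.θ (C.idx u) (C.proj u) a) (C.mfderiv_proj u v)

end ComplexContactStructure

end Contact

/-! ### Existence of Hermitian metrics -/

section Metrics

universe w

variable {n : ℕ} {E : Type*} [NormedAddCommGroup E] [NormedSpace ℂ E] [FiniteDimensional ℂ E]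
  {Z : Type*} [TopologicalSpace Z] [T2Space Z] [SecondCountableTopology Z]
  [ChartedSpace E Z] [IsManifold 𝓘(ℂ, E) ω Z]

namespace ComplexContactStructure

variable (C : ComplexContactStructure.{w} n E Z)

/-- Hermitian structures on `L` exist, by a partition of unity. -/
theorem nonempty_hermitianMetric : Nonempty C.HermitianMetric := by
  have : FiniteDimensional ℝ E := FiniteDimensional.complexToReal E
  have : IsManifold 𝓘(ℝ, E) ∞ Z := (isRealification_self (F := E)).isManifold
  have : LocallyCompactSpace Z := ChartedSpace.locallyCompactSpace E Z
  obtain ⟨ρ, hρ⟩ := SmoothPartitionOfUnity.exists_isSubordinate 𝓘(ℝ, E) (isClosed_univ (X := Z))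
    C.U C.isOpen_U (fun x _ => mem_iUnion.2 (C.cover x))
  have hU : ∀ {i x}, ρ i x ≠ 0 → x ∈ C.U i := fun {i x} h =>
    hρ i (subset_tsupport _ (Function.mem_support.2 h))
  have hf : ∀ {i j x}, x ∈ C.U i → x ∈ C.U j → 0 < ‖C.f i j x‖ ^ 2 := fun {i j x} hi hj =>
    pow_pos (norm_pos_iff.2 (C.f_ne_zero i j x ⟨hi, hj⟩)) 2
  -- the Hermitian form on the fibre over `x`, in the coordinate of the trivialization chosen at `x`,
  -- is the weighted sum of the forms `|z_i|²`
  obtain ⟨lam, hlam⟩ : ∃ lam : Z → ℝ,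
      ∀ x, lam x = ∑ᶠ i, ρ i x • ‖C.f (C.core.indexAt x) i x‖ ^ 2 := ⟨_, fun _ => rfl⟩
  have hpos : ∀ x, 0 < lam x := fun x => by
    rw [hlam]
    exact ρ.finsum_smul_mem_convex (t := Ioi (0 : ℝ)) (g := fun i x => ‖C.f (C.core.indexAt x) i x‖ ^ 2)
      (mem_univ x) (fun i hi => hf (C.core.mem_baseSet_at x) (hU hi)) (convex_Ioi 0)
  have hform : ∀ l : ℝ, ∃ b : ℂ →ₗ⋆[ℂ] ℂ →ₗ[ℂ] ℂ, ∀ v w, b v w = conj v * w * (l : ℂ) := fun l =>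
    ⟨LinearMap.mk₂'ₛₗ (starRingEnd ℂ) (RingHom.id ℂ) (fun v w : ℂ => conj v * w * (l : ℂ))
      (fun a b c => by rw [map_add]; ring) (fun a b c => by simp only [smul_eq_mul, map_mul]; ring)
      (fun a b c => by ring) (fun a b c => by simp only [smul_eq_mul, RingHom.id_apply]; ring),
      fun _ _ => rfl⟩
  choose b hb using hform
  have hsymm : ∀ (l : ℝ) (v w : ℂ), conj (b l v w) = b l w v := fun l v w => by
    rw [hb, hb]
    simp only [map_mul, Complex.conj_conj, Complex.conj_ofReal]
    ring
  have hbpos : ∀ l : ℝ, 0 < l → ∀ v : ℂ, v ≠ 0 → 0 < (b l v v).re := fun l hl v hv => by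
    rw [hb, Complex.conj_mul', ← Complex.ofReal_pow, ← Complex.ofReal_mul, Complex.ofReal_re]
    exact mul_pos (pow_pos (norm_pos_iff.2 hv) 2) hl
  refine ⟨⟨fun x => b (lam x), fun x => hsymm (lam x), fun x => hbpos (lam x) (hpos x), ?_⟩⟩
  · have hN : ∀ p : C.TotL, (conj (C.fibreCoord p) * C.fibreCoord p * (lam p.1 : ℂ)).re =
        ‖C.fibreCoord p‖ ^ 2 * lam p.1 := fun p => by
      rw [Complex.conj_mul', ← Complex.ofReal_pow, ← Complex.ofReal_mul, Complex.ofReal_re]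
    intro p₀
    obtain ⟨j, hj⟩ : ∃ j, j = C.core.indexAt p₀.1 := ⟨_, rfl⟩
    have hj0 : p₀.1 ∈ C.U j := by rw [hj]; exact C.core.mem_baseSet_at _
    have hz := Bundle.contMDiffAt_totalSpace.1
      (contMDiffAt_id (I := modelR E) (M := C.TotL) (n := ∞) (x := p₀))
    have hμ : ContMDiffAt 𝓘(ℝ, E) 𝓘(ℝ, ℝ) ∞ (fun x => ∑ᶠ i, ρ i x • ‖C.f j i x‖ ^ 2) p₀.1 := by
      refine ρ.contMDiffAt_finsum fun i hi => ?_
      have h1 := (isRealification_self (F := E)).contMDiffAt (isRealification_self (F := ℂ))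
        (C.contMDiffAt_f hj0 (hρ i hi))
      have h2 : ContDiff ℝ ∞ (fun z : ℂ => ‖z‖ ^ 2) := contDiff_norm_sq ℝ
      exact h2.contMDiff.contMDiffAt.comp p₀.1 (h1.of_le le_top)
    have h3 : ContMDiffAt (modelR E) 𝓘(ℝ, ℝ) ∞ (fun p : C.TotL =>
        ‖(C.core.localTriv j p).2‖ ^ 2 * ∑ᶠ i, ρ i p.1 • ‖C.f j i p.1‖ ^ 2) p₀ := by
      have h2 : ContDiff ℝ ∞ (fun z : ℂ => ‖z‖ ^ 2) := contDiff_norm_sq ℝ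
      subst hj
      exact (h2.contMDiff.contMDiffAt.comp p₀ hz.2).mul (hμ.comp p₀ hz.1)
    refine h3.congr_of_eventuallyEq ?_
    have hopen : ∀ᶠ p : C.TotL in 𝓝 p₀, p.1 ∈ C.U j :=
      hz.1.continuousAt.eventually_mem ((C.isOpen_U j).mem_nhds hj0)
    filter_upwards [hopen] with p hp
    refine (congrArg Complex.re (hb _ p.2 p.2)).trans ((hN p).trans ?_)
    rw [hlam, ← smul_eq_mul, ← smul_eq_mul, smul_finsum, smul_finsum]
    refine finsum_congr fun i => ?_
    by_cases h0 : ρ i p.1 = 0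
    · simp [h0]
    have hi := hU h0
    rw [C.localTriv_snd, ← C.f_mul (C.core.mem_baseSet_at p.1) hp hi]
    simp only [norm_mul, smul_eq_mul]
    ring

end ComplexContactStructure

variable (E) in
omit [NormedSpace ℂ E] [FiniteDimensional ℂ E] in
/-- The sum of an inner product and its transform under `√-1` is Hermitian. -/
theorem exists_hermitianForm [NormedSpace ℂ E] [FiniteDimensional ℂ E] :
    ∃ b : E →L[ℝ] E →L[ℝ] ℝ, IsPosForm b ∧
    ∀ x y, b (Complex.I • x) (Complex.I • y) = b x y := by
  have : FiniteDimensional ℝ E := FiniteDimensional.complexToReal E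
  obtain ⟨e⟩ : Nonempty (E ≃L[ℝ] EuclideanSpace ℝ (Fin (Module.finrank ℝ E))) :=
    ⟨ContinuousLinearEquiv.ofFinrankEq (by simp)⟩
  obtain ⟨j, hj⟩ : ∃ j : E →L[ℝ] E, ∀ x, j x = Complex.I • x :=
    ⟨Complex.I • ContinuousLinearMap.id ℝ E, fun _ => rfl⟩
  obtain ⟨b, hb⟩ : ∃ b : E →L[ℝ] E →L[ℝ] ℝ, ∀ x y, b x y = inner ℝ (e x) (e y) +
      inner ℝ (e (j x)) (e (j y)) :=
    ⟨formPull (innerSL ℝ) (e : E →L[ℝ] EuclideanSpace ℝ (Fin (Module.finrank ℝ E))) +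
      formPull (innerSL ℝ) ((e : E →L[ℝ] EuclideanSpace ℝ (Fin (Module.finrank ℝ E))) ∘L j),
      fun x y => by
        simp only [add_apply, formPull_apply, ContinuousLinearMap.comp_apply]
        rfl⟩
  have hjj : ∀ x, j (j x) = -x := fun x => by
    rw [hj, hj, smul_smul, Complex.I_mul_I, neg_one_smul]
  refine ⟨b, ⟨fun x y => ?_, fun x hx => ?_⟩, fun x y => ?_⟩
  · rw [hb, hb, real_inner_comm, real_inner_comm (e (j y))]
  · rw [hb]
    have h1 : 0 < inner ℝ (e x) (e x) := real_inner_self_pos.2 (by simpa using hx)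
    have h2 : 0 ≤ inner ℝ (e (j x)) (e (j x)) := real_inner_self_nonneg
    linarith
  · rw [← hj, ← hj, hb, hb, hjj, hjj, map_neg, map_neg, inner_neg_neg, add_comm]

variable (E Z) in
/-- A complex manifold has a Hermitian metric, by a partition of unity. -/
theorem exists_hermitianMetric :
    ∃ k : ∀ x : Z, TangentSpace 𝓘(ℝ, E) x →L[ℝ] TangentSpace 𝓘(ℝ, E) x →L[ℝ] ℝ,
      (∀ x, IsPosForm (V := E) (k x)) ∧
      (∀ x, ∀ v w : E, (k x : E →L[ℝ] E →L[ℝ] ℝ) (Complex.I • v) (Complex.I • w) = k x v w) ∧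
      ∀ x, ContDiffAt ℝ ∞ (bilInChart 𝓘(ℝ, E) k x) (extChartAt 𝓘(ℝ, E) x x) := by
  have : FiniteDimensional ℝ E := FiniteDimensional.complexToReal E
  have : IsManifold 𝓘(ℝ, E) ∞ Z := (isRealification_self (F := E)).isManifold
  have : LocallyCompactSpace Z := ChartedSpace.locallyCompactSpace E Z
  obtain ⟨ρ, hρ⟩ := SmoothPartitionOfUnity.exists_isSubordinate_chartAt_source 𝓘(ℝ, E) Z
  obtain ⟨b, hb, hbJ⟩ := exists_hermitianForm E
  have hsrc : ∀ {i x : Z}, ρ i x ≠ 0 → x ∈ (extChartAt 𝓘(ℝ, E) i).source := fun {i x} h => by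
    rw [extChartAt_source]
    exact hρ i (subset_tsupport _ (Function.mem_support.2 h))
  obtain ⟨L, hL⟩ : ∃ L : Z → Z → E →L[ℝ] E,
      ∀ i x, L i x = mfderiv 𝓘(ℝ, E) 𝓘(ℝ, E) (extChartAt 𝓘(ℝ, E) i) x := ⟨_, fun _ _ => rfl⟩
  have hLJ : ∀ {i x}, x ∈ (extChartAt 𝓘(ℝ, E) i).source → ∀ v,
      L i x (Complex.I • v) = Complex.I • L i x v := by
    intro i x hx v
    have h1 := fun v => (isRealification_self (F := E)).mfderiv_apply (isRealification_self (F := E))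
      (mdifferentiableAt_extChartAt' 𝓘(ℂ, E) (x₀ := i) (p := x) hx) v
    obtain ⟨A, hA⟩ : ∃ A : E →L[ℂ] E, ∀ v, L i x v = A v :=
      ⟨mfderiv 𝓘(ℂ, E) 𝓘(ℂ, E) (extChartAt 𝓘(ℂ, E) i) x, fun v => by rw [hL]; exact h1 v⟩
    rw [hA, hA, map_smul]
  have hLinj : ∀ {i x}, x ∈ (extChartAt 𝓘(ℝ, E) i).source → ∀ v, L i x v = 0 → v = 0 := by
    intro i x hx v hv
    have h1 := mfderiv_symm_mfderiv' 𝓘(ℝ, E) hx v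
    rw [hL] at hv
    refine h1.symm.trans ((congrArg _ hv).trans ?_)
    exact map_zero (mfderiv 𝓘(ℝ, E) 𝓘(ℝ, E) (extChartAt 𝓘(ℝ, E) i).symm (extChartAt 𝓘(ℝ, E) i x))
  have hconv : Convex ℝ {G : E →L[ℝ] E →L[ℝ] ℝ | IsPosForm G ∧
      ∀ v w, G (Complex.I • v) (Complex.I • w) = G v w} := by
    rintro G ⟨hG, hGJ⟩ G' ⟨hG', hGJ'⟩ s t hs ht hst
    refine ⟨⟨fun x y => ?_, fun x hx => ?_⟩, fun v w => ?_⟩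
    · change s * G x y + t * G' x y = s * G y x + t * G' y x
      rw [hG.symm, hG'.symm]
    · change 0 < s * G x x + t * G' x x
      have h1 := hG.pos x hx
      have h2 := hG'.pos x hx
      rcases hs.eq_or_lt with rfl | hs
      · rw [zero_add] at hst; rw [hst]; linarith
      · have := mul_pos hs h1
        have := mul_nonneg ht h2.le
        linarith
    · change s * G _ _ + t * G' _ _ = s * G v w + t * G' v w
      rw [hGJ, hGJ']
  obtain ⟨k, hk⟩ : ∃ k : Z → E →L[ℝ] E →L[ℝ] ℝ, ∀ x, k x = ∑ᶠ i, ρ i x • formPull b (L i x) :=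
    ⟨_, fun _ => rfl⟩
  have hmem : ∀ x, k x ∈ {G : E →L[ℝ] E →L[ℝ] ℝ | IsPosForm G ∧
      ∀ v w, G (Complex.I • v) (Complex.I • w) = G v w} := fun x => by
    rw [hk]
    refine ρ.finsum_smul_mem_convex (g := fun i x => formPull b (L i x)) (mem_univ x)
      (fun i hi => ⟨⟨fun v w => ?_, fun v hv => ?_⟩, fun v w => ?_⟩) hconv
    · simp only [formPull_apply]; exact hb.symm _ _
    · simp only [formPull_apply]; exact hb.pos _ fun h => hv (hLinj (hsrc hi) v h)
    · simp only [formPull_apply, hLJ (hsrc hi), hbJ]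
  -- evaluation commutes with the locally finite sums
  have hev : ∀ (x : Z) (G : Z → E →L[ℝ] E →L[ℝ] ℝ) (v w : E),
      (∑ᶠ i, ρ i x • G i) v w = ∑ᶠ i, ρ i x • G i v w := fun x G v w => by
    have hfin : (Function.support fun i => ρ i x).Finite := ρ.locallyFinite.point_finite x
    rw [finsum_eq_sum_of_support_subset (s := hfin.toFinset) _ fun i hi => ?_,
      finsum_eq_sum_of_support_subset (s := hfin.toFinset) _ fun i hi => ?_]
    · simp
    · simp only [Finite.coe_toFinset, Function.mem_support] at hi ⊢
      refine fun h => hi ?_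
      rw [h, zero_smul]
    · simp only [Finite.coe_toFinset, Function.mem_support] at hi ⊢
      refine fun h => hi ?_
      rw [h]
      exact ContinuousLinearMap.ext fun v => ContinuousLinearMap.ext fun w => zero_mul _
  refine ⟨k, fun x => (hmem x).1, fun x => (hmem x).2, fun x₀ => ?_⟩
  -- the components of the metric in the chart at `x₀`: the forms are pulled back under transition maps
  have hsm : ContMDiffAt 𝓘(ℝ, E) 𝓘(ℝ, E →L[ℝ] E →L[ℝ] ℝ) ∞
      (fun x => ∑ᶠ i, ρ i x • formPull b (fderiv ℝ
        (extChartAt 𝓘(ℝ, E) i ∘ id ∘ (extChartAt 𝓘(ℝ, E) x₀).symm) (extChartAt 𝓘(ℝ, E) x₀ x))) x₀ := by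
    refine ρ.contMDiffAt_finsum fun i hi => ?_
    have hxi : x₀ ∈ (extChartAt 𝓘(ℝ, E) i).source := by
      rw [extChartAt_source]; exact hρ i hi
    have h1 : ContDiffAt ℝ ∞ (extChartAt 𝓘(ℝ, E) i ∘ id ∘ (extChartAt 𝓘(ℝ, E) x₀).symm)
        (extChartAt 𝓘(ℝ, E) x₀ x₀) :=
      contDiffAt_chart_comp 𝓘(ℝ, E) 𝓘(ℝ, E) (mem_extChartAt_target x₀)
        (by rw [extChartAt_to_inv]; exact hxi) contMDiffAt_id
    have h2 := ContDiffAt.formPull (f := fun _ => b) contDiffAt_const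
      (h1.fderiv_right (m := ∞) (by simp))
    exact ContMDiffAt.comp x₀ h2.contMDiffAt contMDiffAt_extChartAt
  rw [contMDiffAt_iff_contDiffAt_comp_symm] at hsm
  refine hsm.congr_of_eventuallyEq ?_
  filter_upwards [extChartAt_target_mem_nhds (I := 𝓘(ℝ, E)) x₀] with y hy
  refine (ContinuousLinearMap.ext fun v => ContinuousLinearMap.ext fun w => ?_)
  obtain ⟨p, hp⟩ : ∃ p, p = (extChartAt 𝓘(ℝ, E) x₀).symm y := ⟨_, rfl⟩
  obtain ⟨A, hA⟩ : ∃ A : E →L[ℝ] E, A = mfderiv 𝓘(ℝ, E) 𝓘(ℝ, E) (extChartAt 𝓘(ℝ, E) x₀).symm y :=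
    ⟨_, rfl⟩
  have hb1 : bilInChart 𝓘(ℝ, E) k x₀ y v w = k p (A v) (A w) := by
    subst hp hA
    exact bilInChart_apply ..
  have hb2 : ∀ i, ρ i p ≠ 0 → ∀ v, fderiv ℝ (extChartAt 𝓘(ℝ, E) i ∘ id ∘
      (extChartAt 𝓘(ℝ, E) x₀).symm) y v = L i p (A v) := fun i hi v => by
    subst hp hA
    rw [hL]
    refine (fderiv_chart_comp_apply 𝓘(ℝ, E) 𝓘(ℝ, E) hy (hsrc hi) mdifferentiableAt_id v).trans ?_
    rw [mfderiv_id]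
    rfl
  rw [hb1, hk, hev]
  refine Eq.trans ?_ (hev _ _ v w).symm
  simp only [← hp]
  refine finsum_congr fun i => ?_
  by_cases h0 : ρ i p = 0
  · rw [h0, zero_smul, zero_smul]
  · have hy' : extChartAt 𝓘(ℝ, E) x₀ p = y := by rw [hp, PartialEquiv.right_inv _ hy]
    rw [formPull_apply, formPull_apply, hy', hb2 i h0, hb2 i h0]

end Metrics

/-! ### Forms of degree two as bilinear forms -/

section TwoForms

variable {F : Type*} [NormedAddCommGroup F] [NormedSpace ℝ F]

/-- An alternating `2`-form as a bilinear form. -/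
noncomputable def twoForm (α : F [⋀^Fin 2]→L[ℝ] ℝ) : F →L[ℝ] F →L[ℝ] ℝ :=
  ((continuousMultilinearCurryFin1 ℝ F ℝ).toContinuousLinearEquiv : _ →L[ℝ] F →L[ℝ] ℝ) ∘L
    α.toContinuousMultilinearMap.curryLeft

theorem twoForm_apply (α : F [⋀^Fin 2]→L[ℝ] ℝ) (v w : F) : twoForm α v w = α ![v, w] := by
  change α (Fin.cons v (Fin.snoc 0 w)) = α ![v, w]
  congr 1
  funext i
  fin_cases i <;> rfl

theorem alternating_swap {𝕜 F V : Type*} [NontriviallyNormedField 𝕜] [NormedAddCommGroup F]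
    [NormedSpace 𝕜 F] [NormedAddCommGroup V] [NormedSpace 𝕜 V] (α : F [⋀^Fin 2]→L[𝕜] V)
    (v w : F) : α ![v, w] = -α ![w, v] := by
  have h := α.toAlternatingMap.map_swap ![v, w] (i := 0) (j := 1) (by decide)
  have h2 : ![v, w] ∘ Equiv.swap (0 : Fin 2) 1 = ![w, v] := by
    funext i; fin_cases i <;> simp
  rw [h2] at h
  change α ![w, v] = -α ![v, w] at h
  rw [h, neg_neg]

theorem alternating_smul_left {F : Type*} [NormedAddCommGroup F] [NormedSpace ℂ F]
    (α : F [⋀^Fin 2]→L[ℂ] ℂ) (c : ℂ) (v w : F) : α ![c • v, w] = c * α ![v, w] := by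
  have h := α.toAlternatingMap.map_update_smul ![v, w] 0 c v
  have h1 : ∀ a, Function.update ![v, w] 0 a = ![a, w] := fun a => by
    funext i; fin_cases i <;> simp
  rw [h1, h1] at h
  exact h

end TwoForms

/-! ### The data of a Hermitian metric on `L^×` -/

section RealData

universe w

variable {n : ℕ} {E : Type*} [NormedAddCommGroup E] [NormedSpace ℂ E]
  {Z : Type*} [TopologicalSpace Z] [ChartedSpace E Z] [IsManifold 𝓘(ℂ, E) ω Z]

namespace ComplexContactStructure

variable (C : ComplexContactStructure.{w} n E Z)

theorem upsilon_swap (u : C.UZ) (v w : E × ℂ) : C.upsilon u ![v, w] = -C.upsilon u ![w, v] :=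
  alternating_swap (C.upsilon u : (E × ℂ) [⋀^Fin 2]→L[ℂ] ℂ) v w

theorem upsilon_smul_left (u : C.UZ) (c : ℂ) (v w : E × ℂ) :
    C.upsilon u ![c • v, w] = c * C.upsilon u ![v, w] :=
  alternating_smul_left (C.upsilon u : (E × ℂ) [⋀^Fin 2]→L[ℂ] ℂ) c v w

theorem upsilon_smul_right (u : C.UZ) (c : ℂ) (v w : E × ℂ) :
    C.upsilon u ![v, c • w] = c * C.upsilon u ![v, w] := by
  rw [upsilon_swap, upsilon_smul_left, upsilon_swap C u w v, mul_neg, neg_neg]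

theorem mfderiv_proj_real (u : C.UZ) (v : E × ℂ) :
    (mfderiv (modelR E) 𝓘(ℝ, E) C.proj u v : E) = v.1 :=
  ((isRealification_model E).mfderiv_apply (isRealification_self (F := E))
    ((C.contMDiff_proj (𝕜 := ℂ) (r := 1) u).mdifferentiableAt (by simp)) v).trans (C.mfderiv_proj u v)

namespace HermitianMetric

variable {C} (h : C.HermitianMetric)

theorem contMDiff_norm_sq : ContMDiff (modelR E) 𝓘(ℝ, ℝ) ∞ (fun u : C.UZ => h.norm u ^ 2) := by
  have h1 : ContMDiff (modelR E) (modelR E) ∞ (Subtype.val : C.UZ → C.TotL) := contMDiff_subtype_val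
  refine (h.smooth.comp h1).congr fun u => ?_
  exact Real.sq_sqrt (h.pos _ _ u.2).le

theorem contMDiff_t : ContMDiff (modelR E) 𝓘(ℝ, ℝ) ∞ h.t := fun u => by
  have h1 : ContDiffAt ℝ ∞ (fun x : ℝ => 1 / 2 * Real.log x) (h.norm u ^ 2) :=
    contDiffAt_const.mul (Real.contDiffAt_log.2 (pow_pos (h.norm_pos u) 2).ne')
  refine (ContMDiffAt.comp u h1.contMDiffAt (h.contMDiff_norm_sq u)).congr_of_eventuallyEq
    (Filter.Eventually.of_forall fun v => ?_)
  simp only [Function.comp_apply, t, Real.log_pow]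
  push_cast; ring

theorem exp_t (u : C.UZ) : Real.exp (h.t u) = h.norm u := Real.exp_log (h.norm_pos u)

theorem t_smul (c : ℂˣ) (u : C.UZ) : h.t (c • u) = Real.log ‖(c : ℂ)‖ + h.t u := by
  rw [t, norm_smul, Real.log_mul (by simp) (h.norm_pos u).ne']; rfl

/-- The function `t` in the chart at `u`. -/
noncomputable def tInChart (u : C.UZ) : E × ℂ → ℝ := h.t ∘ (extChartAt (modelR E) u).symm

theorem contDiffAt_tInChart {u : C.UZ} {y : E × ℂ} (hy : y ∈ (extChartAt (modelR E) u).target) :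
    ContDiffAt ℝ ∞ (h.tInChart u) y := by
  have := ContMDiffAt.comp y (h.contMDiff_t _) ((contMDiffOn_extChartAt_symm (n := ∞) u).contMDiffAt
    ((isOpen_extChartAt_target u).mem_nhds hy))
  exact this.contDiffAt

theorem dt_apply (u : C.UZ) (v : E × ℂ) :
    h.dt u v = fderiv ℝ (h.tInChart u) (extChartAt (modelR E) u u) v :=
  mfderiv_eq_fderiv_comp_symm (modelR E) ((h.contMDiff_t u).mdifferentiableAt (by simp)) v

theorem tInChart_smul {u : C.UZ} {y : E × ℂ} (hy : y ∈ (extChartAt (modelR E) u).target) (c : ℂˣ) :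
    h.tInChart u (y.1, c * y.2) = Real.log ‖(c : ℂ)‖ + h.tInChart u y := by
  simp only [tInChart, Function.comp_apply]
  rw [← h.t_smul, ← C.smul_extChartAt_symm c hy]

/-- `dt` vanishes on `√-1` times the Euler field, and equals `1` on the latter. -/
theorem fderiv_tInChart_fibre {u : C.UZ} {y : E × ℂ} (hy : y ∈ (extChartAt (modelR E) u).target)
    (a : ℂ) : fderiv ℝ (h.tInChart u) y (0, a * y.2) = a.re := by
  have h1 : HasDerivAt (fun s : ℝ => (y.1, Complex.exp (s * a) * y.2)) ((0 : E), a * y.2) 0 := by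
    have h2 : HasDerivAt (fun s : ℝ => Complex.exp (s * a)) a 0 := by
      have h3 : HasDerivAt (fun s : ℝ => (s : ℂ) * a) (1 * a) 0 :=
        (HasDerivAt.ofReal_comp (hasDerivAt_id (0 : ℝ))).mul_const a
      have := h3.cexp
      simpa using this
    exact (hasDerivAt_const 0 y.1).prodMk (h2.mul_const y.2)
  have h0 : (y.1, Complex.exp (((0 : ℝ) : ℂ) * a) * y.2) = y := by simp
  have hd : HasFDerivAt (h.tInChart u) (fderiv ℝ (h.tInChart u) y)
      (y.1, Complex.exp (((0 : ℝ) : ℂ) * a) * y.2) := by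
    rw [h0]
    exact ((h.contDiffAt_tInChart hy).differentiableAt (by simp)).hasFDerivAt
  have h4 := hd.comp_hasDerivAt (0 : ℝ) h1
  have h5 : HasDerivAt (fun s : ℝ => s * a.re + h.tInChart u y) (1 * a.re) 0 :=
    ((hasDerivAt_id (0 : ℝ)).mul_const a.re).add_const _
  rw [one_mul] at h5
  refine h4.unique (h5.congr_of_eventuallyEq (Filter.Eventually.of_forall fun s => ?_))
  have := h.tInChart_smul hy (Units.mk0 _ (Complex.exp_ne_zero (s * a)))
  refine this.trans ?_
  simp [Complex.norm_exp]

theorem dt_fibre (u : C.UZ) (a : ℂ) : h.dt u ((0, a * C.fibreCoord u.1) : E × ℂ) = a.re := by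
  rw [dt_apply]
  have := h.fderiv_tInChart_fibre (mem_extChartAt_target (I := modelR E) u) a
  rwa [show (extChartAt (modelR E) u u).2 = C.fibreCoord u.1 from C.z_idx u] at this

/-- The form `dt` is invariant under the action of `ℂ^×`. -/
theorem dt_smul (c : ℂˣ) (u : C.UZ) (v : E × ℂ) : h.dt (c • u) (v.1, c * v.2) = h.dt u v := by
  have hy := mem_extChartAt_target (I := modelR E) u
  have hy' := mem_extChartAt_target (I := modelR E) (c • u)
  have he : extChartAt (modelR E) (c • u) (c • u) =
      ((extChartAt (modelR E) u u).1, (c : ℂ) * (extChartAt (modelR E) u u).2) :=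
    Prod.ext rfl (C.z_smul _ _ _)
  have hL : HasFDerivAt (fun y : E × ℂ => (y.1, (c : ℂ) * y.2))
      ((ContinuousLinearMap.fst ℝ E ℂ).prod ((c : ℂ) • ContinuousLinearMap.snd ℝ E ℂ))
      (extChartAt (modelR E) u u) :=
    hasFDerivAt_fst.prodMk (hasFDerivAt_snd.const_mul (c : ℂ))
  have h1 := ((h.contDiffAt_tInChart hy').differentiableAt (by simp)).hasFDerivAt
  rw [he] at h1
  have h2 := HasFDerivAt.comp (f := fun y : E × ℂ => (y.1, (c : ℂ) * y.2))
    (extChartAt (modelR E) u u) h1 hL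
  have h3 := ((h.contDiffAt_tInChart hy).differentiableAt (by simp)).hasFDerivAt.const_add
    (Real.log ‖(c : ℂ)‖)
  have h4 : h.tInChart (c • u) ∘ (fun y : E × ℂ => (y.1, (c : ℂ) * y.2))
      =ᶠ[𝓝 (extChartAt (modelR E) u u)] fun y => Real.log ‖(c : ℂ)‖ + h.tInChart u y := by
    filter_upwards [(isOpen_extChartAt_target u).mem_nhds hy] with y hy
    exact h.tInChart_smul hy c
  have h5 := DFunLike.congr_fun (h2.unique (h3.congr_of_eventuallyEq h4)) v
  rw [dt_apply, dt_apply, ← h5, he]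
  rfl

section Data

variable (k : Z → E →L[ℝ] E →L[ℝ] ℝ)

/-- The data at `u ∈ L^×` which determine the hyperhermitian structure. The form `k` on `Z` is an
auxiliary Hermitian metric. -/
noncomputable def data (u : C.UZ) : SymplecticData (E × ℂ) where
  r := h.norm u
  τ := h.dt u
  β := Complex.reCLM ∘L (C.vartheta u : (E × ℂ) →L[ℂ] ℂ).restrictScalars ℝ
  w := twoForm (reForm (E × ℂ) 2 (C.upsilon u))
  k := formPull (k (C.proj u)) (ContinuousLinearMap.fst ℝ E ℂ)
  J := Complex.I • ContinuousLinearMap.id ℝ (E × ℂ)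

theorem data_r (u : C.UZ) : (h.data k u).r = h.norm u := rfl
theorem data_τ (u : C.UZ) (v : E × ℂ) : (h.data k u).τ v = h.dt u v := rfl
theorem data_β (u : C.UZ) (v : E × ℂ) : (h.data k u).β v = (C.vartheta u v).re := rfl
theorem data_w (u : C.UZ) (v w : E × ℂ) : (h.data k u).w v w = (C.upsilon u ![v, w]).re :=
  twoForm_apply _ v w
theorem data_k (u : C.UZ) (v w : E × ℂ) : (h.data k u).k v w = k (C.proj u) v.1 w.1 := rfl
theorem data_J (u : C.UZ) (v : E × ℂ) : (h.data k u).J v = Complex.I • v := rfl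

theorem data_J_J (u : C.UZ) (v : E × ℂ) : (h.data k u).J ((h.data k u).J v) = -v := by
  rw [data_J, data_J, smul_smul, Complex.I_mul_I, neg_one_smul]

variable [FiniteDimensional ℂ E] (hE : Module.finrank ℂ E = 2 * n + 1)
include hE

/-- The real part of a nondegenerate complex form is nondegenerate. -/
theorem data_nondeg (u : C.UZ) (v : E × ℂ) (hv : ∀ w, (h.data k u).w v w = 0) : v = 0 := by
  refine C.upsilon_nondegenerate hE u v fun w => Complex.ext (by simpa [data_w] using hv w) ?_
  have h1 := hv (Complex.I • w)
  rw [data_w, upsilon_smul_right] at h1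
  simpa using h1

/-- The vector dual to `Re ϑ` is the Euler field of the fibres of `L^×`, since
`dϑ(z ∂/∂z, ·) = z θ = ϑ`. -/
theorem data_eps (u : C.UZ) : (h.data k u).eps = (0, C.fibreCoord u.1) := by
  have : FiniteDimensional ℝ E := FiniteDimensional.complexToReal E
  have hi := isInvertible_of_nondegenerate (h.data_nondeg k hE u)
  have h1 : (h.data k u).β = (h.data k u).w (0, C.fibreCoord u.1) := by
    refine ContinuousLinearMap.ext fun v => ?_
    obtain ⟨D, hD⟩ : ∃ D : E →L[ℂ] E →L[ℂ] ℂ,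
        ∀ v w, dOne 𝓘(ℂ, E) (C.θ (C.idx u)) (C.proj u) v w = D v w - D w v :=
      ⟨_, dOne_eq_fderiv 𝓘(ℂ, E) ((C.contDiffAt_covectorInChart_θ
        (mem_extChartAt_target (I := modelC E) u)).differentiableAt (by simp))⟩
    have h2 := C.upsilon_apply u (0, C.fibreCoord u.1) v
    have h3 : dOne 𝓘(ℂ, E) (C.θ (C.idx u)) (C.proj u) (0 : E) v.1 = 0 := by
      have h5 : ∀ w : E, D 0 w - D w 0 = 0 := fun w => by
        rw [map_zero, map_zero, zero_apply, sub_zero]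
      exact (hD 0 v.1).trans (h5 v.1)
    have h4 : C.θ (C.idx u) (C.proj u) (0 : E) = 0 := map_zero _
    rw [data_β, data_w, C.vartheta_apply u v]
    refine congrArg Complex.re (Eq.trans ?_ h2.symm)
    refine Eq.trans ?_ (congrArg₂ (fun a b => C.fibreCoord u.1 * C.θ (C.idx u) (C.proj u) v.1 -
      v.2 * a + C.fibreCoord u.1 * b) h4.symm h3.symm)
    ring
  rw [SymplecticData.eps, h1]
  exact hi.inverse_apply_self _

variable {k} (hk : ∀ x, IsPosForm (k x))
  (hkJ : ∀ x v w, k x (Complex.I • v) (Complex.I • w) = k x v w)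
include hk hkJ

theorem data_good (u : C.UZ) : (h.data k u).Good where
  r_pos := h.norm_pos u
  J_J := h.data_J_J k u
  alt v w := by
    rw [data_w, data_w, upsilon_swap, neg_re]
  nondeg := h.data_nondeg k hE u
  w_J v w := by
    rw [data_w, data_w, data_J, data_J, upsilon_smul_left, upsilon_smul_right, ← mul_assoc,
      Complex.I_mul_I, neg_one_mul, neg_re]
  τ_eps := by
    have := h.dt_fibre u 1
    rwa [one_mul, ← h.data_eps k hE] at this
  τ_J_eps := by
    have := h.dt_fibre u Complex.I
    rw [data_eps h k hE, data_J, data_τ]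
    simpa using this
  k_symm v w := (hk _).symm _ _
  k_nonneg v := by
    rcases eq_or_ne v.1 0 with h0 | h0
    · rw [data_k, h0]; simp
    · exact ((hk _).pos _ h0).le
  k_J v w := hkJ _ _ _
  k_ker v hv := by
    have h0 : v.1 = 0 := by
      by_contra h0
      exact ((hk _).pos _ h0).ne' hv
    refine ⟨(v.2 / C.fibreCoord u.1).re, (v.2 / C.fibreCoord u.1).im, ?_⟩
    rw [data_eps h k hE, data_J]
    refine Prod.ext (by simp [h0]) ?_
    have h1 : v.2 = (((v.2 / C.fibreCoord u.1).re : ℂ) + (v.2 / C.fibreCoord u.1).im * Complex.I) *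
        C.fibreCoord u.1 := by
      rw [Complex.re_add_im, div_mul_cancel₀ _ (C.fibreCoord_ne_zero u)]
    refine h1.trans ?_
    simp only [Prod.snd_add, Prod.smul_snd, Complex.real_smul, smul_eq_mul]
    ring

end Data

/-- The action of `c` on the fibres of `L^×`, in the charts. -/
noncomputable def _root_.fibreScaling (E : Type*) [NormedAddCommGroup E] [NormedSpace ℝ E] (c : ℂˣ) :
    (E × ℂ) ≃L[ℝ] (E × ℂ) :=
  ContinuousLinearEquiv.equivOfInverse
    ((ContinuousLinearMap.fst ℝ E ℂ).prod ((c : ℂ) • ContinuousLinearMap.snd ℝ E ℂ))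
    ((ContinuousLinearMap.fst ℝ E ℂ).prod (((c⁻¹ : ℂˣ) : ℂ) • ContinuousLinearMap.snd ℝ E ℂ))
    (fun v => Prod.ext rfl (c.inv_mul_cancel_left v.2)) (fun v => Prod.ext rfl (c.mul_inv_cancel_left v.2))

theorem _root_.fibreScaling_apply (c : ℂˣ) (v : E × ℂ) :
    fibreScaling E c v = (v.1, (c : ℂ) * v.2) := rfl

/-- The behaviour of the data under the action of `ℂ^×`: `dt` is invariant, while `ϑ` and `dϑ` are
homogeneous of degree one over `ℂ`. -/
theorem isPullback_data [FiniteDimensional ℂ E] (k : Z → E →L[ℝ] E →L[ℝ] ℝ) (c : ℂˣ) (u : C.UZ) :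
    (h.data k u).IsPullback (h.data k (c • u)) (fibreScaling E c) ‖((c⁻¹ : ℂˣ) : ℂ)‖
      ((c⁻¹ : ℂˣ) : ℂ).re ((c⁻¹ : ℂˣ) : ℂ).im where
  s_pos := norm_pos_iff.2 (Units.ne_zero _)
  sq := by rw [← Complex.normSq_eq_norm_sq, Complex.normSq_apply]; ring
  r_eq := by
    rw [data_r, data_r, norm_smul, ← mul_assoc, ← _root_.norm_mul, Units.inv_mul, norm_one, one_mul]
  τ_eq v := (h.dt_smul c u v).symm
  w_eq v w := by
    have h1 : C.upsilon (c • u) ![fibreScaling E c v, fibreScaling E c w] =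
        c * C.upsilon u ![v, w] := by
      refine (C.upsilon_apply (c • u) (fibreScaling E c v) (fibreScaling E c w)).trans
        (Eq.trans ?_ (congrArg ((c : ℂ) * ·) (C.upsilon_apply u v w)).symm)
      change (c : ℂ) * v.2 * C.θ (C.idx u) (C.proj u) w.1 -
        (c : ℂ) * w.2 * C.θ (C.idx u) (C.proj u) v.1 + (c : ℂ) * C.fibreCoord u.1 *
          dOne 𝓘(ℂ, E) (C.θ (C.idx u)) (C.proj u) v.1 w.1 = _
      ring
    have h2 : C.upsilon u ![v, w] = ((c⁻¹ : ℂˣ) : ℂ) *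
        C.upsilon (c • u) ![fibreScaling E c v, fibreScaling E c w] := by
      rw [h1, Units.inv_mul_cancel_left]
    rw [data_w, data_w, data_w, data_J, upsilon_smul_left, h2]
    simp only [Complex.mul_re, Complex.I_re, Complex.I_im]
    ring
  β_eq v := by
    have h1 : C.vartheta (c • u) (fibreScaling E c v) = c * C.vartheta u v := by
      refine (C.vartheta_apply (c • u) (fibreScaling E c v)).trans
        (Eq.trans ?_ (congrArg ((c : ℂ) * ·) (C.vartheta_apply u v)).symm)
      change (c : ℂ) * C.fibreCoord u.1 * C.θ (C.idx u) (C.proj u) v.1 = _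
      ring
    have h2 : C.vartheta u v = ((c⁻¹ : ℂˣ) : ℂ) * C.vartheta (c • u) (fibreScaling E c v) := by
      rw [h1, Units.inv_mul_cancel_left]
    have h3 : C.vartheta (c • u) (Complex.I • fibreScaling E c v) =
        Complex.I * C.vartheta (c • u) (fibreScaling E c v) :=
      map_smul (C.vartheta (c • u) : (E × ℂ) →L[ℂ] ℂ) _ _
    rw [data_β, data_β, data_β, data_J, h3, h2]
    simp only [Complex.mul_re, Complex.I_re, Complex.I_im]
    ring
  k_eq v w := rfl
  J_eq v := Prod.ext rfl (by
    rw [data_J, data_J, fibreScaling_apply, fibreScaling_apply, Prod.smul_snd, Prod.smul_snd]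
    exact mul_left_comm _ _ _)

end HermitianMetric

end ComplexContactStructure

end RealData

/-! ### The hyperhermitian structure of `L^×` -/

section ChartFrame

variable {𝕜 : Type*} [NontriviallyNormedField 𝕜]
  {F : Type*} [NormedAddCommGroup F] [NormedSpace 𝕜 F]
  {H : Type*} [TopologicalSpace H] (I : ModelWithCorners 𝕜 F H) [I.Boundaryless]
  {M : Type*} [TopologicalSpace M] [ChartedSpace H M] [IsManifold I 1 M]

/-- The derivative of the inverse of a chart, as a linear isomorphism. -/
theorem exists_chartFrame {x₀ : M} {y : F} (hy : y ∈ (extChartAt I x₀).target) :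
    ∃ L : F ≃L[𝕜] F, (L : F →L[𝕜] F) = mfderiv 𝓘(𝕜, F) I (extChartAt I x₀).symm y ∧
      (L.symm : F →L[𝕜] F) = mfderiv I 𝓘(𝕜, F) (extChartAt I x₀) ((extChartAt I x₀).symm y) :=
  ⟨ContinuousLinearEquiv.equivOfInverse
    (mfderiv 𝓘(𝕜, F) I (extChartAt I x₀).symm y)
    (mfderiv I 𝓘(𝕜, F) (extChartAt I x₀) ((extChartAt I x₀).symm y) : F →L[𝕜] F)
    (mfderiv_mfderiv_symm I hy) (mfderiv_symm_mfderiv I hy), rfl, rfl⟩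

end ChartFrame

section SmoothData

universe w

variable {n : ℕ} {E : Type*} [NormedAddCommGroup E] [NormedSpace ℂ E] [FiniteDimensional ℂ E]
  {Z : Type*} [TopologicalSpace Z] [ChartedSpace E Z] [IsManifold 𝓘(ℂ, E) ω Z]

namespace ComplexContactStructure.HermitianMetric

variable {C : ComplexContactStructure.{w} n E Z} (h : C.HermitianMetric)
  (k : Z → E →L[ℝ] E →L[ℝ] ℝ)

/-- The data in the chart at `u`. -/
noncomputable def dataInChart (u : C.UZ) (y : E × ℂ) : SymplecticData (E × ℂ) where
  r := Real.exp (h.tInChart u y)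
  τ := fderiv ℝ (h.tInChart u) y
  β := covectorInChart (modelR E) (fun v => (h.data k v).β) u y
  w := twoForm (formInChart (modelR E) (fun v => reForm (E × ℂ) 2 (C.upsilon v)) u y)
  k := bilInChart (modelR E) (fun v => (h.data k v).k) u y
  J := Complex.I • ContinuousLinearMap.id ℝ (E × ℂ)

omit [FiniteDimensional ℂ E] in
theorem _root_.ComplexContactStructure.mfderiv_extChartAt_symm_complex (C : ComplexContactStructure.{w} n E Z)
    {u : C.UZ} {y : E × ℂ} (hy : y ∈ (extChartAt (modelR E) u).target) :
    ∃ A : (E × ℂ) →L[ℂ] (E × ℂ), ∀ v : E × ℂ,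
      (mfderiv 𝓘(ℝ, E × ℂ) (modelR E) (extChartAt (modelR E) u).symm y v : E × ℂ) = A v :=
  ⟨mfderiv 𝓘(ℂ, E × ℂ) (modelC E) (extChartAt (modelC E) u).symm y,
    (isRealification_self (F := E × ℂ)).mfderiv_apply (isRealification_model E)
      (mdifferentiableAt_extChartAt_symm (modelC E) (x₀ := u) (y := y) hy)⟩

/-- The data in the chart are the pullbacks of the data at the points of `L^×`. -/
theorem dataInChart_eq {u : C.UZ} {y : E × ℂ} (hy : y ∈ (extChartAt (modelR E) u).target) :
    ∃ L : (E × ℂ) ≃L[ℝ] (E × ℂ),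
      (L : (E × ℂ) →L[ℝ] (E × ℂ)) =
        mfderiv 𝓘(ℝ, E × ℂ) (modelR E) (extChartAt (modelR E) u).symm y ∧
      (L.symm : (E × ℂ) →L[ℝ] (E × ℂ)) =
        mfderiv (modelR E) 𝓘(ℝ, E × ℂ) (extChartAt (modelR E) u) ((extChartAt (modelR E) u).symm y) ∧
      h.dataInChart k u y = (h.data k ((extChartAt (modelR E) u).symm y)).pull L := by
  obtain ⟨L, hL, hL'⟩ := exists_chartFrame (modelR E) hy
  refine ⟨L, hL, hL', ?_⟩
  unfold dataInChart SymplecticData.pull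
  rw [SymplecticData.mk.injEq]
  refine ⟨h.exp_t _, ?_, ?_, ?_, ?_, ?_⟩
  · have h1 : mfderiv 𝓘(ℝ, E × ℂ) 𝓘(ℝ, ℝ) (h.t ∘ (extChartAt (modelR E) u).symm) y = _ :=
      mfderiv_comp y ((h.contMDiff_t _).mdifferentiableAt (by simp))
        (mdifferentiableAt_extChartAt_symm (modelR E) hy)
    rw [mfderiv_eq_fderiv] at h1
    rw [hL]
    exact h1
  · rw [hL]; rfl
  · refine ContinuousLinearMap.ext fun v => ContinuousLinearMap.ext fun w => ?_
    rw [twoForm_apply, formPull_apply, hL, data_w]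
    refine congrArg Complex.re (congrArg (C.upsilon _) ?_)
    funext i
    fin_cases i <;> rfl
  · rw [hL]; rfl
  · refine ContinuousLinearMap.ext fun v => L.injective ?_
    refine Eq.trans ?_ (L.apply_symm_apply _).symm
    obtain ⟨A, hA⟩ := C.mfderiv_extChartAt_symm_complex hy
    have h1 : ∀ v, L v = A v := fun v => (DFunLike.congr_fun hL v).trans (hA v)
    refine (h1 _).trans ((map_smul A _ _).trans ?_)
    exact congrArg (Complex.I • ·) (h1 v).symm

theorem endInChart_J₃ (hd : ∀ v : C.UZ, (h.data k v).Good) (α : Fin 3) {u : C.UZ} {y : E × ℂ}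
    (hy : y ∈ (extChartAt (modelR E) u).target) :
    endInChart (modelR E) (fun v => (h.data k v).J₃ α) u y = (h.dataInChart k u y).J₃ α := by
  have : FiniteDimensional ℝ E := FiniteDimensional.complexToReal E
  obtain ⟨L, hL, hL', h1⟩ := h.dataInChart_eq k hy
  rw [h1, SymplecticData.pull_J₃ (hd _), hL, hL']
  rfl

variable (hE : Module.finrank ℂ E = 2 * n + 1) {k} (hk : ∀ x, IsPosForm (k x))
  (hkJ : ∀ x v w, k x (Complex.I • v) (Complex.I • w) = k x v w)
  (hks : ∀ x, ContDiffAt ℝ ∞ (bilInChart 𝓘(ℝ, E) k x) (extChartAt 𝓘(ℝ, E) x x))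
include hE hk hkJ hks

theorem smoothAt_dataInChart (u : C.UZ) :
    SymplecticData.SmoothAt (h.dataInChart k u) (extChartAt (modelR E) u u) := by
  have : FiniteDimensional ℝ E := FiniteDimensional.complexToReal E
  have : IsManifold 𝓘(ℝ, E) ∞ Z := (isRealification_self (F := E)).isManifold
  have hy := mem_extChartAt_target (I := modelR E) u
  have ht := h.contDiffAt_tInChart hy
  refine ⟨Real.contDiff_exp.contDiffAt.comp _ ht, ht.fderiv_right (m := ∞) (by simp), ?_, ?_, ?_,
    contDiffAt_const, ?_⟩
  · have h1 : IsSmoothFormOn (modelR E) ∞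
        (fun v => reForm (E × ℂ) 1 (oneForm (modelC E) C.vartheta v)) univ :=
      (isRealification_model E).isSmoothFormOn_reForm C.isSmoothFormOn_vartheta
    exact (contDiffAt_formInChart_oneForm (modelR E) (α := fun v => (h.data k v).β)).1
      (h1.contDiffAt_self (modelR E) isOpen_univ (mem_univ u))
  · have h1 : IsSmoothFormOn (modelR E) ∞ (fun v => reForm (E × ℂ) 2 (C.upsilon v)) univ :=
      (isRealification_model E).isSmoothFormOn_reForm C.isSmoothFormOn_upsilon
    have h2 := h1.contDiffAt_self (modelR E) isOpen_univ (mem_univ u)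
    refine contDiffAt_clm_apply fun v => contDiffAt_clm_apply fun w => ?_
    have h3 : ContDiff ℝ ∞ (fun α : (E × ℂ) [⋀^Fin 2]→L[ℝ] ℝ => α ![v, w]) :=
      (ContinuousAlternatingMap.apply ℝ (E × ℂ) ℝ ![v, w]).contDiff
    exact (h3.contDiffAt.comp _ h2).congr_of_eventuallyEq
      (Filter.Eventually.of_forall fun y => twoForm_apply _ v w)
  · have hp : ∀ (v : C.UZ) (a b : E × ℂ), (h.data k v).k a b =
        k (C.proj v) (mfderiv (modelR E) 𝓘(ℝ, E) C.proj v a : E)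
          (mfderiv (modelR E) 𝓘(ℝ, E) C.proj v b : E) := fun v a b =>
      congrArg₂ (fun a b : E => k (C.proj v) a b) (C.mfderiv_proj_real v a).symm
        (C.mfderiv_proj_real v b).symm
    exact contDiffAt_bilInChart_pullback 𝓘(ℝ, E) (modelR E) (f := C.proj) (K := k)
      C.contMDiff_proj (x₀ := u) (hks (C.proj u)) (k := fun v => (h.data k v).k) hp
  · filter_upwards [extChartAt_target_mem_nhds (I := modelR E) u] with y hy
    obtain ⟨L, -, -, hL⟩ := h.dataInChart_eq k hy
    rw [hL]
    exact (h.data_good hE hk hkJ _).pull L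

theorem contDiffAt_bilInChart_metric (u : C.UZ) : ContDiffAt ℝ ∞
    (bilInChart (modelR E) (fun v => (h.data k v).metric) u) (extChartAt (modelR E) u u) := by
  refine (h.smoothAt_dataInChart hE hk hkJ hks u).metric.congr_of_eventuallyEq ?_
  filter_upwards [extChartAt_target_mem_nhds (I := modelR E) u] with y hy
  obtain ⟨L, hL, -, hd⟩ := h.dataInChart_eq k hy
  rw [hd, SymplecticData.pull_metric (h.data_good hE hk hkJ _), hL]
  rfl

theorem contDiffAt_endInChart_J₃ (α : Fin 3) (u : C.UZ) : ContDiffAt ℝ ∞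
    (endInChart (modelR E) (fun v => (h.data k v).J₃ α) u) (extChartAt (modelR E) u u) := by
  refine ((h.smoothAt_dataInChart hE hk hkJ hks u).J₃ α).congr_of_eventuallyEq ?_
  filter_upwards [extChartAt_target_mem_nhds (I := modelR E) u] with y hy
  exact h.endInChart_J₃ k (h.data_good hE hk hkJ) α hy

/-- The hyperhermitian structure on `L^×`. -/
noncomputable def hyperhermitian : AlmostHyperhermitianStructure (modelR E) C.UZ :=
  have : FiniteDimensional ℝ E := FiniteDimensional.complexToReal E
  { g := RiemMetric.ofSmooth (modelR E) (fun v => (h.data k v).metric)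
      (fun v => (h.data_good hE hk hkJ v).metric_pos) (h.contDiffAt_bilInChart_metric hE hk hkJ hks)
    J := fun α v => (h.data k v).J₃ α
    smooth_J := fun α => (isSmoothEnd_iff (modelR E) _).2 (h.contDiffAt_endInChart_J₃ hE hk hkJ hks α)
    J_J_self := fun α v => (h.data_good hE hk hkJ v).J_J_self₃ α
    J_J := fun α v => (h.data_good hE hk hkJ v).J_J₃ α
    J_J' := fun α v => (h.data_good hE hk hkJ v).J_J₃' α
    g_J := fun α v => (h.data_good hE hk hkJ v).metric_J₃ α }

/-- In holomorphic charts the complex structure is the constant `√-1`. -/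
theorem nijenhuis_hyperhermitian_zero (X Y : ∀ u : C.UZ, TangentSpace (modelR E) u)
    (hX : IsSmoothVF (modelR E) X) (hY : IsSmoothVF (modelR E) Y) (u : C.UZ) :
    nijenhuis (modelR E) ((h.hyperhermitian hE hk hkJ hks).J 0) X Y u = 0 := by
  have : FiniteDimensional ℝ E := FiniteDimensional.complexToReal E
  have hJ : endInChart (modelR E) ((h.hyperhermitian hE hk hkJ hks).J 0) u
      =ᶠ[𝓝 (extChartAt (modelR E) u u)] fun _ => Complex.I • ContinuousLinearMap.id ℝ (E × ℂ) := by
    filter_upwards [extChartAt_target_mem_nhds (I := modelR E) u] with y hy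
    exact h.endInChart_J₃ k (h.data_good hE hk hkJ) 0 hy
  have h0 : ∀ (a : (E × ℂ) →L[ℝ] (E × ℂ)) (v w : E × ℂ), (2 : ℝ) •
      ((0 : (E × ℂ) →L[ℝ] (E × ℂ) →L[ℝ] (E × ℂ)) (a v) w
        - (0 : (E × ℂ) →L[ℝ] (E × ℂ) →L[ℝ] (E × ℂ)) (a w) v
        - a ((0 : (E × ℂ) →L[ℝ] (E × ℂ) →L[ℝ] (E × ℂ)) v w)
        + a ((0 : (E × ℂ) →L[ℝ] (E × ℂ) →L[ℝ] (E × ℂ)) w v)) = 0 := fun a v w => by simp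
  exact (nijenhuis_eq (modelR E) ((differentiableAt_const _).congr_of_eventuallyEq hJ)
    (((isSmoothVF_iff (modelR E) X).1 hX u).differentiableAt (by simp))
    (((isSmoothVF_iff (modelR E) Y).1 hY u).differentiableAt (by simp))
    ((h.hyperhermitian hE hk hkJ hks).J 0 u) (fun _ => rfl) 0
    (by rw [hJ.fderiv_eq, fderiv_const_apply]) _ _ rfl rfl).trans (h0 _ _ _)

end ComplexContactStructure.HermitianMetric

end SmoothData

/-! ### Real parts of holomorphic symplectic forms -/

section SymplecticForms

variable {F : Type*} [NormedAddCommGroup F] [NormedSpace ℂ F] {H : Type*} [TopologicalSpace H]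
  {M : Type*} [TopologicalSpace M] [ChartedSpace H M]
  {IC : ModelWithCorners ℂ F H} {IR : ModelWithCorners ℝ F H}
  [IC.Boundaryless] [IR.Boundaryless] [IsManifold IC ω M]

omit [IC.Boundaryless] [IsManifold IC ω M] in
theorem formInChart_const_smul {j : ℕ} (c : ℂ)
    (α : ∀ x : M, TangentSpace IC x [⋀^Fin j]→L[ℂ] ℂ) (x₀ : M) :
    formInChart IC (fun x => c • α x) x₀ = c • formInChart IC α x₀ :=
  funext fun _ => ContinuousAlternatingMap.ext fun _ => rfl

omit [IC.Boundaryless] [IsManifold IC ω M] in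
theorem extDerivForm_const_smul {j : ℕ} (c : ℂ)
    (α : ∀ x : M, TangentSpace IC x [⋀^Fin j]→L[ℂ] ℂ) (x : M)
    (v : Fin (j + 1) → F) :
    extDerivForm IC (fun x => c • α x) x v = c * extDerivForm IC α x v := by
  unfold extDerivForm
  rw [formInChart_const_smul, extDeriv_smul]
  rfl

theorem IsSymplecticForm.const_smul {α : ∀ x : M, TangentSpace IC x [⋀^Fin 2]→L[ℂ] ℂ}
    (hα : IsSymplecticForm IC ω α) {c : ℂ} (hc : c ≠ 0) :
    IsSymplecticForm IC ω (fun x => c • α x) := by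
  refine ⟨fun x₀ => ?_, fun x => ?_, fun x X hX => ?_⟩
  · rw [formInChart_const_smul]
    exact (hα.smooth x₀).const_smul c
  · refine ContinuousAlternatingMap.ext fun v => ?_
    refine (extDerivForm_const_smul c α x v).trans ?_
    rw [hα.closed]
    exact mul_zero c
  · exact hα.nondegenerate x X fun Y =>
      (mul_eq_zero.1 ((hX Y : c * α x ![X, Y] = 0))).resolve_left hc

/-- The real part of a holomorphic symplectic form is a symplectic form. -/
theorem IsRealification.isSymplecticForm_reForm (hI : IsRealification IC IR)
    {α : ∀ x : M, TangentSpace IC x [⋀^Fin 2]→L[ℂ] ℂ} (hα : IsSymplecticForm IC ω α) :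
    IsSymplecticForm IR ∞ (fun x => reForm F 2 (α x)) where
  smooth := hI.isSmoothFormOn_reForm hα.smooth
  closed x := by
    rw [hI.extDerivForm_reForm α ((hα.smooth.contDiffAt_self IC isOpen_univ
        (mem_univ x)).differentiableAt (by simp)), hα.closed]
    exact map_zero _
  nondegenerate x X hX := by
    refine hα.nondegenerate x X fun Y => Complex.ext (hX Y) ?_
    have h1 : ∀ (a : F [⋀^Fin 2]→L[ℂ] ℂ) (X Y : F), (∀ Y : F, (a ![X, Y]).re = 0) →
        (a ![X, Y]).im = 0 := fun a X Y ha => by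
      have := ha (Complex.I • Y)
      rw [alternating_swap, alternating_smul_left, alternating_swap a Y] at this
      simpa using this
    exact h1 (α x) X Y hX

end SymplecticForms

/-! ### Charts of the unit circle bundle -/

section CircleBundle

universe w

variable {n : ℕ} {E : Type*} [NormedAddCommGroup E] [NormedSpace ℂ E]
  {Z : Type*} [TopologicalSpace Z] [ChartedSpace E Z] [IsManifold 𝓘(ℂ, E) ω Z]

/-- A real linear isomorphism of the model of `Q` with `E × ℝ`. -/
noncomputable def realCoord (hE : Module.finrank ℂ E = 2 * n + 1) :
    EuclideanSpace ℝ (Fin (4 * n + 3)) ≃L[ℝ] E × ℝ :=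
  have : FiniteDimensional ℂ E := Module.finite_of_finrank_pos (by omega)
  have : FiniteDimensional ℝ E := FiniteDimensional.complexToReal E
  ContinuousLinearEquiv.ofFinrankEq (by
    rw [finrank_euclideanSpace_fin, Module.finrank_prod, finrank_real_of_complex, hE,
      Module.finrank_self]
    ring)

namespace ComplexContactStructure.HermitianMetric

variable {C : ComplexContactStructure.{w} n E Z} (h : C.HermitianMetric)

theorem continuous_incl : Continuous h.incl := continuous_subtype_val

theorem incl_injective : Function.Injective h.incl := Subtype.val_injective

theorem incl_normalize (u : C.UZ) : h.incl (h.normalize u) =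
    Units.mk0 ((h.norm u)⁻¹ : ℂ) (inv_ne_zero (by exact_mod_cast (h.norm_pos u).ne')) • u := rfl

theorem norm_incl (q : h.Q) : h.norm (h.incl q) = 1 := q.2

theorem normalize_eq_iff {u : C.UZ} {q : h.Q} (c : ℂˣ) {r : ℝ} (hr : 0 < r) (hc : (c : ℂ) = r)
    (hu : u = c • h.incl q) : h.normalize u = q := by
  subst hu
  apply h.incl_injective
  have h1 : h.norm (c • h.incl q) = r := by
    rw [norm_smul, norm_incl, hc, Complex.norm_real, Real.norm_of_nonneg hr.le, mul_one]
  rw [incl_normalize, smul_smul]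
  refine (congrArg (· • h.incl q) (Units.ext ?_)).trans (one_smul _ _)
  rw [Units.val_mul, Units.val_mk0, h1, hc, Units.val_one, inv_mul_cancel₀]
  exact_mod_cast hr.ne'

theorem normalize_incl (q : h.Q) : h.normalize (h.incl q) = q :=
  h.normalize_eq_iff 1 one_pos (by simp) (one_smul _ _).symm

theorem eq_smul_incl_normalize (u : C.UZ) : ∃ c : ℂˣ, (c : ℂ) = h.norm u ∧
    u = c • h.incl (h.normalize u) := by
  have h0 : (h.norm u : ℂ) ≠ 0 := by exact_mod_cast (h.norm_pos u).ne'
  refine ⟨Units.mk0 _ h0, rfl, ?_⟩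
  rw [incl_normalize, smul_smul]
  refine (one_smul ℂˣ u).symm.trans (congrArg (· • u) (Units.ext ?_))
  simp [h0]

theorem normalize_smul (c : ℂˣ) {r : ℝ} (hr : 0 < r) (hc : (c : ℂ) = r) (u : C.UZ) :
    h.normalize (c • u) = h.normalize u := by
  obtain ⟨d, hd, hu⟩ := h.eq_smul_incl_normalize u
  refine h.normalize_eq_iff (c * d) (mul_pos hr (h.norm_pos u)) ?_ ?_
  · rw [Units.val_mul, hc, hd]; push_cast; rfl
  · rw [mul_smul, ← hu]

theorem contMDiff_norm : ContMDiff (modelR E) 𝓘(ℝ, ℝ) ∞ h.norm :=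
  (Real.contDiff_exp.contMDiff.comp h.contMDiff_t).congr fun u => (h.exp_t u).symm

theorem contMDiff_incl_normalize :
    ContMDiff (modelR E) (modelR E) ∞ (fun u => h.incl (h.normalize u)) := fun u => by
  refine C.contMDiffAt_smul ?_ contMDiffAt_id
  have h1 : ContDiffAt ℝ ∞ (fun x : ℝ => ((x⁻¹ : ℝ) : ℂ)) (h.norm u) :=
    Complex.ofRealCLM.contDiff.contDiffAt.comp _ (contDiffAt_inv ℝ (h.norm_pos u).ne')
  refine (ContMDiffAt.comp u h1.contMDiffAt (h.contMDiff_norm u)).congr_of_eventuallyEq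
    (Filter.Eventually.of_forall fun v => ?_)
  simp

theorem continuous_normalize : Continuous h.normalize :=
  Topology.IsInducing.subtypeVal.continuous_iff.2 h.contMDiff_incl_normalize.continuous

variable (hE : Module.finrank ℂ E = 2 * n + 1)

/-- The chart of `Q` around `q`, as a map from the model of `Tot(L)`: it replaces the fibre coordinate
by its argument. -/
noncomputable def toQModel (q : h.Q) (y : E × ℂ) : EuclideanSpace ℝ (Fin (4 * n + 3)) :=
  (realCoord hE).symm (y.1, (y.2 / C.fibreCoord (h.incl q).1).arg)

/-- The inverse of the chart of `Q` around `q`, as a map to the model of `Tot(L)`. -/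
noncomputable def ofQModel (q : h.Q) (v : EuclideanSpace ℝ (Fin (4 * n + 3))) : E × ℂ :=
  ((realCoord hE v).1, Complex.exp ((realCoord hE v).2 * Complex.I) * C.fibreCoord (h.incl q).1)

/-- The source of the chart of `Q` around `q`, in the model of `Tot(L)`. -/
def qSource (q : h.Q) : Set (E × ℂ) :=
  (extChartAt (modelR E) (h.incl q)).target ∩ {y | y.2 / C.fibreCoord (h.incl q).1 ∈ slitPlane}

/-- The target of the chart of `Q` around `q`. -/
def qTarget (q : h.Q) : Set (EuclideanSpace ℝ (Fin (4 * n + 3))) :=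
  {v | ((realCoord hE v).1, C.fibreCoord (h.incl q).1) ∈ (extChartAt (modelR E) (h.incl q)).target ∧
    (realCoord hE v).2 ∈ Ioo (-Real.pi) Real.pi}

theorem contDiff_ofQModel (q : h.Q) : ContDiff ℝ ∞ (h.ofQModel hE q) := by
  have h1 := (realCoord hE).contDiff (n := ∞)
  have h2 : ContDiff ℝ ∞ (fun v => Complex.exp ((realCoord hE v).2 * Complex.I)) :=
    ((Complex.ofRealCLM.contDiff.comp h1.snd).mul contDiff_const).cexp
  exact h1.fst.prodMk (h2.mul contDiff_const)

theorem contDiffAt_toQModel {q : h.Q} {y : E × ℂ} (hy : y ∈ h.qSource q) :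
    ContDiffAt ℝ ∞ (h.toQModel hE q) y := by
  have h1 : ContDiffAt ℝ ∞ Complex.log (y.2 / C.fibreCoord (h.incl q).1) :=
    (Complex.contDiffAt_log hy.2).restrict_scalars ℝ
  have h2 : ContDiffAt ℝ ∞ (fun y : E × ℂ => y.2 / C.fibreCoord (h.incl q).1) y :=
    contDiffAt_snd.div_const _
  have h3 := ContDiffAt.comp y h1 h2
  have h4 : ContDiffAt ℝ ∞ (fun y : E × ℂ => (y.2 / C.fibreCoord (h.incl q).1).arg) y :=
    (Complex.imCLM.contDiff.contDiffAt.comp y h3).congr_of_eventuallyEq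
      (Filter.Eventually.of_forall fun y => (Complex.log_im _).symm)
  exact (realCoord hE).symm.contDiff.contDiffAt.comp y (contDiffAt_fst.prodMk h4)

theorem arg_ofQModel {q : h.Q} {v : EuclideanSpace ℝ (Fin (4 * n + 3))} (hv : v ∈ h.qTarget hE q) :
    ((h.ofQModel hE q v).2 / C.fibreCoord (h.incl q).1).arg = (realCoord hE v).2 := by
  have h0 := C.fibreCoord_ne_zero (h.incl q)
  rw [ofQModel, mul_div_cancel_right₀ _ h0, ← Complex.log_im, Complex.log_exp]
  · simp
  · simpa using hv.2.1
  · simpa using hv.2.2.le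

theorem toQModel_ofQModel {q : h.Q} {v : EuclideanSpace ℝ (Fin (4 * n + 3))}
    (hv : v ∈ h.qTarget hE q) : h.toQModel hE q (h.ofQModel hE q v) = v := by
  unfold toQModel
  rw [h.arg_ofQModel hE hv]
  exact (realCoord hE).symm_apply_apply v

theorem ofQModel_mem {q : h.Q} {v : EuclideanSpace ℝ (Fin (4 * n + 3))} (hv : v ∈ h.qTarget hE q) :
    h.ofQModel hE q v ∈ h.qSource q := by
  refine ⟨C.smul_mem_target (Units.mk0 _ (Complex.exp_ne_zero _)) hv.1, ?_⟩
  rw [mem_ofPred_eq, Complex.mem_slitPlane_iff_arg, h.arg_ofQModel hE hv]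
  exact ⟨hv.2.2.ne, div_ne_zero (mul_ne_zero (Complex.exp_ne_zero _) (C.fibreCoord_ne_zero _))
    (C.fibreCoord_ne_zero _)⟩

theorem toQModel_smul (q : h.Q) {r : ℝ} (hr : 0 < r) (y : E × ℂ) :
    h.toQModel hE q (y.1, r * y.2) = h.toQModel hE q y := by
  unfold toQModel
  rw [mul_div_assoc, Complex.arg_real_mul _ hr]

theorem toQModel_mem {q : h.Q} {y : E × ℂ} (hy : y ∈ h.qSource q) :
    h.toQModel hE q y ∈ h.qTarget hE q := by
  unfold toQModel qTarget
  rw [mem_ofPred_eq, (realCoord hE).apply_symm_apply]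
  have h1 := (Complex.mem_slitPlane_iff_arg.1 hy.2).1
  have h2 := (C.mem_extChartAt_target_iff _ _).1 hy.1
  exact ⟨(C.mem_extChartAt_target_iff _ _).2 ⟨h2.1, h2.2.1, C.fibreCoord_ne_zero _⟩,
    Complex.neg_pi_lt_arg _, lt_of_le_of_ne (Complex.arg_le_pi _) h1⟩

theorem ofQModel_toQModel (q : h.Q) {y : E × ℂ} (hy : y.2 ≠ 0) :
    ∃ r : ℝ, 0 < r ∧ h.ofQModel hE q (h.toQModel hE q y) = (y.1, r * y.2) := by
  have h0 := C.fibreCoord_ne_zero (h.incl q)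
  obtain ⟨a, ha⟩ : ∃ a, a = y.2 / C.fibreCoord (h.incl q).1 := ⟨_, rfl⟩
  have ha0 : a ≠ 0 := by rw [ha]; exact div_ne_zero hy h0
  have ha1 : (‖a‖ : ℂ) ≠ 0 := by simpa using ha0
  refine ⟨‖a‖⁻¹, inv_pos.2 (norm_pos_iff.2 ha0), ?_⟩
  unfold ofQModel toQModel
  rw [(realCoord hE).apply_symm_apply, ← ha]
  refine Prod.ext rfl ?_
  have h1 : y.2 = ‖a‖ * Complex.exp (a.arg * Complex.I) * C.fibreCoord (h.incl q).1 := by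
    rw [Complex.norm_mul_exp_arg_mul_I, ha, div_mul_cancel₀ _ h0]
  change Complex.exp (a.arg * Complex.I) * C.fibreCoord (h.incl q).1 = _
  conv_rhs => rw [h1]
  push_cast
  field_simp

theorem isOpen_qSource (q : h.Q) : IsOpen ((extChartAt (modelR E) (h.incl q)).source ∩
    extChartAt (modelR E) (h.incl q) ⁻¹' {y | y.2 / C.fibreCoord (h.incl q).1 ∈ slitPlane}) :=
  (continuousOn_extChartAt _).isOpen_inter_preimage (isOpen_extChartAt_source _)
    (Complex.isOpen_slitPlane.preimage (by fun_prop))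

theorem isOpen_qTarget (q : h.Q) : IsOpen (h.qTarget hE q) := by
  have h1 : Continuous fun v => realCoord hE v := (realCoord hE).continuous
  exact ((isOpen_extChartAt_target (I := modelR E) (h.incl q)).preimage
    (h1.fst.prodMk continuous_const)).inter (isOpen_Ioo.preimage h1.snd)

/-- In the chart of `L^×`, the normalization multiplies the fibre coordinate by a positive number. -/
theorem incl_normalize_extChartAt_symm {q : h.Q} {y : E × ℂ}
    (hy : y ∈ (extChartAt (modelR E) (h.incl q)).target) :
    ∃ r : ℝ, 0 < r ∧ (y.1, (r : ℂ) * y.2) ∈ (extChartAt (modelR E) (h.incl q)).target ∧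
      h.incl (h.normalize ((extChartAt (modelR E) (h.incl q)).symm y)) =
        (extChartAt (modelR E) (h.incl q)).symm (y.1, r * y.2) := by
  obtain ⟨r, hr⟩ : ∃ r, r = (h.norm ((extChartAt (modelR E) (h.incl q)).symm y))⁻¹ := ⟨_, rfl⟩
  have hr0 : 0 < r := hr ▸ inv_pos.2 (h.norm_pos _)
  have hr1 : (r : ℂ) ≠ 0 := by exact_mod_cast hr0.ne'
  refine ⟨r, hr0, C.smul_mem_target (Units.mk0 _ hr1) hy, ?_⟩
  refine Eq.trans ?_ (C.smul_extChartAt_symm (Units.mk0 _ hr1) hy)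
  rw [incl_normalize]
  refine congrArg (· • _) (Units.ext ?_)
  rw [Units.val_mk0, Units.val_mk0, hr, Complex.ofReal_inv]

theorem normalize_extChartAt_symm_smul {q : h.Q} {y : E × ℂ}
    (hy : y ∈ (extChartAt (modelR E) (h.incl q)).target) {r : ℝ} (hr : 0 < r) :
    h.normalize ((extChartAt (modelR E) (h.incl q)).symm (y.1, r * y.2)) =
      h.normalize ((extChartAt (modelR E) (h.incl q)).symm y) := by
  have hr1 : (r : ℂ) ≠ 0 := by exact_mod_cast hr.ne'
  exact (congrArg h.normalize (C.smul_extChartAt_symm (Units.mk0 _ hr1) hy).symm).trans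
    (h.normalize_smul _ hr rfl _)

theorem div_mem_slitPlane {r : ℝ} (hr : 0 < r) {a b : ℂ} (h : a / b ∈ slitPlane) :
    r * a / b ∈ slitPlane := by
  rw [Complex.mem_slitPlane_iff_arg] at h ⊢
  rw [mul_div_assoc, Complex.arg_real_mul _ hr]
  exact ⟨h.1, mul_ne_zero (by exact_mod_cast hr.ne') h.2⟩

/-- The chart of `Q` around `q`. -/
noncomputable def chartQ (q : h.Q) :
    OpenPartialHomeomorph h.Q (EuclideanSpace ℝ (Fin (4 * n + 3))) where
  toFun q' := h.toQModel hE q (extChartAt (modelR E) (h.incl q) (h.incl q'))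
  invFun v := h.normalize ((extChartAt (modelR E) (h.incl q)).symm (h.ofQModel hE q v))
  source := h.incl ⁻¹' ((extChartAt (modelR E) (h.incl q)).source ∩
    extChartAt (modelR E) (h.incl q) ⁻¹' {y | y.2 / C.fibreCoord (h.incl q).1 ∈ slitPlane})
  target := h.qTarget hE q
  map_source' q' hq' := h.toQModel_mem hE ⟨(extChartAt _ _).map_source hq'.1, hq'.2⟩
  map_target' v hv := by
    have hm := h.ofQModel_mem hE hv
    obtain ⟨r, hr, hrt, hN⟩ := h.incl_normalize_extChartAt_symm hm.1
    rw [mem_preimage, hN]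
    refine ⟨(extChartAt _ _).map_target hrt, ?_⟩
    rw [mem_preimage, (extChartAt _ _).right_inv hrt]
    exact div_mem_slitPlane hr hm.2
  left_inv' q' hq' := by
    have ht := (extChartAt (modelR E) (h.incl q)).map_source hq'.1
    obtain ⟨r, hr, he⟩ := h.ofQModel_toQModel hE q ((C.mem_extChartAt_target_iff _ _).1 ht).2.2
    rw [he, h.normalize_extChartAt_symm_smul ht hr, (extChartAt _ _).left_inv hq'.1,
      h.normalize_incl]
  right_inv' v hv := by
    have hm := h.ofQModel_mem hE hv
    obtain ⟨r, hr, hrt, hN⟩ := h.incl_normalize_extChartAt_symm hm.1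
    rw [hN, (extChartAt _ _).right_inv hrt, h.toQModel_smul hE q hr, h.toQModel_ofQModel hE hv]
  open_source := (h.isOpen_qSource q).preimage h.continuous_incl
  open_target := h.isOpen_qTarget hE q
  continuousOn_toFun := fun q' hq' => by
    have h1 := (h.contDiffAt_toQModel hE (q := q)
      ⟨(extChartAt _ _).map_source hq'.1, hq'.2⟩).continuousAt
    have h2 := continuousAt_extChartAt' (I := modelR E) (x := h.incl q) (x' := h.incl q')
      hq'.1
    have h3 := ContinuousAt.comp (x := q') (f := h.incl) h2 h.continuous_incl.continuousAt
    exact (ContinuousAt.comp (x := q') (g := h.toQModel hE q)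
      (f := extChartAt (modelR E) (h.incl q) ∘ h.incl) h1 h3).continuousWithinAt
  continuousOn_invFun := fun v hv => by
    have h2 := continuousAt_extChartAt_symm'' (I := modelR E) (h.ofQModel_mem hE hv).1
    exact (h.continuous_normalize.continuousAt.comp
      (h2.comp (h.contDiff_ofQModel hE q).continuous.continuousAt)).continuousWithinAt

end ComplexContactStructure.HermitianMetric

end CircleBundle

/-! ### The smooth structure of the unit circle bundle -/

section CircleBundleManifold

universe w

variable {n : ℕ} {E : Type*} [NormedAddCommGroup E] [NormedSpace ℂ E]
  {Z : Type*} [TopologicalSpace Z] [ChartedSpace E Z] [IsManifold 𝓘(ℂ, E) ω Z]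

namespace ComplexContactStructure.HermitianMetric

variable {C : ComplexContactStructure.{w} n E Z} (h : C.HermitianMetric)
  (hE : Module.finrank ℂ E = 2 * n + 1)

theorem mem_chartQ_source (q : h.Q) : q ∈ (h.chartQ hE q).source := by
  refine ⟨mem_extChartAt_source _, ?_⟩
  have h1 : (extChartAt (modelR E) (h.incl q) (h.incl q)).2 = C.fibreCoord (h.incl q).1 := C.z_idx _
  rw [mem_preimage, mem_ofPred_eq, h1, div_self (C.fibreCoord_ne_zero _)]
  exact Complex.one_mem_slitPlane

/-- The smooth structure of `Q`. -/
@[reducible]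
noncomputable def chartedSpaceQ : ChartedSpace (EuclideanSpace ℝ (Fin (4 * n + 3))) h.Q where
  atlas := range (h.chartQ hE)
  chartAt := h.chartQ hE
  mem_chart_source := h.mem_chartQ_source hE
  chart_mem_atlas := mem_range_self

theorem contMDiffAt_toQModel_extChartAt {q : h.Q} {u : C.UZ}
    (hu : u ∈ (extChartAt (modelR E) (h.incl q)).source ∩
      extChartAt (modelR E) (h.incl q) ⁻¹' {y | y.2 / C.fibreCoord (h.incl q).1 ∈ slitPlane}) :
    ContMDiffAt (modelR E) (𝓡 (4 * n + 3)) ∞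
      (fun u => h.toQModel hE q (extChartAt (modelR E) (h.incl q) u)) u := by
  have h1 : ContMDiffAt (modelR E) 𝓘(ℝ, E × ℂ) ∞ (extChartAt (modelR E) (h.incl q)) u :=
    contMDiffAt_extChartAt' (by rw [← extChartAt_source (modelR E)]; exact hu.1)
  exact ContMDiffAt.comp u (g := h.toQModel hE q) (f := extChartAt (modelR E) (h.incl q))
    (h.contDiffAt_toQModel hE (q := q)
    ⟨(extChartAt _ _).map_source hu.1, hu.2⟩).contMDiffAt h1

theorem contMDiffAt_extChartAt_symm_ofQModel {q : h.Q} {v : EuclideanSpace ℝ (Fin (4 * n + 3))}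
    (hv : v ∈ h.qTarget hE q) :
    ContMDiffAt (𝓡 (4 * n + 3)) (modelR E) ∞
      (fun v => (extChartAt (modelR E) (h.incl q)).symm (h.ofQModel hE q v)) v :=
  ContMDiffAt.comp v ((contMDiffOn_extChartAt_symm (n := ∞) (h.incl q)).contMDiffAt
    ((isOpen_extChartAt_target _).mem_nhds (h.ofQModel_mem hE hv).1))
    (h.contDiff_ofQModel hE q).contDiffAt.contMDiffAt

/-- The smooth structure of `Q`: the inclusion and the radial projection are smooth, and the latter
replaces in the charts the fibre coordinate by its argument. -/
theorem exists_chartedSpace :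
    ∃ (_ : ChartedSpace (EuclideanSpace ℝ (Fin (4 * n + 3))) h.Q)
      (_ : IsManifold (𝓡 (4 * n + 3)) ∞ h.Q),
      ContMDiff (𝓡 (4 * n + 3)) (modelR E) ∞ h.incl ∧
      ContMDiff (modelR E) (𝓡 (4 * n + 3)) ∞ h.normalize ∧
      ∀ (q : h.Q) (u : C.UZ), extChartAt (𝓡 (4 * n + 3)) q (h.normalize u) =
        h.toQModel hE q (extChartAt (modelR E) (h.incl q) u) := by
  have hsym : ∀ (q : h.Q) (v), v ∈ h.qTarget hE q → ContMDiffAt (𝓡 (4 * n + 3)) (modelR E) ∞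
      (fun v => h.incl ((h.chartQ hE q).symm v)) v := fun q v hv =>
    ContMDiffAt.comp v (g := fun u => h.incl (h.normalize u))
      (f := fun v => (extChartAt (modelR E) (h.incl q)).symm (h.ofQModel hE q v))
      (h.contMDiff_incl_normalize _) (h.contMDiffAt_extChartAt_symm_ofQModel hE hv)
  let _ := h.chartedSpaceQ hE
  have hM : IsManifold (𝓡 (4 * n + 3)) ∞ h.Q := by
    refine isManifold_of_contDiffOn (𝓡 (4 * n + 3)) ∞ h.Q fun e e' he he' => ?_
    obtain ⟨q, rfl⟩ := he
    obtain ⟨q', rfl⟩ := he'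
    intro v hv
    simp only [mfld_simps] at hv
    have h1 := h.contMDiffAt_toQModel_extChartAt hE (q := q') hv.2
    exact (ContMDiffAt.comp v h1 (hsym q v hv.1)).contDiffAt.contDiffWithinAt
  refine ⟨inferInstance, hM, fun q => ?_, fun u => ?_, fun q u => ?_⟩
  · have h1 := h.mem_chartQ_source hE q
    have h2 : ContMDiffAt (𝓡 (4 * n + 3)) (𝓡 (4 * n + 3)) ∞ (chartAt _ q) q := contMDiffAt_extChartAt
    refine (ContMDiffAt.comp q (hsym q _ ((h.chartQ hE q).map_source h1)) h2).congr_of_eventuallyEq ?_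
    filter_upwards [(h.chartQ hE q).open_source.mem_nhds h1] with q' hq'
    exact congrArg h.incl ((h.chartQ hE q).left_inv hq').symm
  · rw [contMDiffAt_iff_target]
    refine ⟨h.continuous_normalize.continuousAt, ?_⟩
    exact ContMDiffAt.comp u (f := fun u => h.incl (h.normalize u))
      (h.contMDiffAt_toQModel_extChartAt hE (h.mem_chartQ_source hE (h.normalize u))) (h.contMDiff_incl_normalize u)
  · have h1 : extChartAt (𝓡 (4 * n + 3)) q (h.normalize u) =
      h.toQModel hE q (extChartAt (modelR E) (h.incl q) (h.incl (h.normalize u))) := rfl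
    rw [h1, incl_normalize, C.extChartAt_apply, C.extChartAt_apply, C.proj_smul, C.z_smul,
      ← h.toQModel_smul hE q (inv_pos.2 (h.norm_pos u)) (extChartAt 𝓘(ℝ, E) _ _, C.z _ u)]
    simp

end ComplexContactStructure.HermitianMetric

end CircleBundleManifold

/-! ### Polar coordinates and the principal circle bundle -/

section Phase

/-- The phase `z / |z|` of a complex number. -/
noncomputable def phase (z : ℂ) : Circle := Circle.exp z.arg

theorem norm_mul_phase (z : ℂ) : ‖z‖ * (phase z : ℂ) = z := by
  rw [phase, Circle.coe_exp, Complex.norm_mul_exp_arg_mul_I]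

theorem phase_eq_of_mul {z : ℂ} {c : Circle} {r : ℝ} (hr : 0 < r) (h : r * (c : ℂ) = z) :
    phase z = c := by
  rw [phase, ← h, Complex.arg_real_mul _ hr, Circle.exp_arg]

theorem phase_mul {z w : ℂ} (hz : z ≠ 0) (hw : w ≠ 0) : phase (z * w) = phase z * phase w := by
  refine phase_eq_of_mul (mul_pos (norm_pos_iff.2 hz) (norm_pos_iff.2 hw)) ?_
  rw [Circle.coe_mul]
  push_cast
  rw [mul_mul_mul_comm, norm_mul_phase, norm_mul_phase]

theorem phase_coe (c : Circle) : phase c = c := phase_eq_of_mul one_pos (by simp)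

theorem contMDiffAt_phase {z : ℂ} (hz : z ≠ 0) : ContMDiffAt 𝓘(ℝ, ℂ) (𝓡 1) ∞ phase z := by
  have h1 : ContDiffAt ℝ ∞ (fun w : ℂ => (w / z).arg) z := by
    have h2 : ContDiffAt ℝ ∞ Complex.log (z / z) := by
      rw [div_self hz]
      exact (Complex.contDiffAt_log Complex.one_mem_slitPlane).restrict_scalars ℝ
    have h3 := ContDiffAt.comp z (f := fun w : ℂ => w / z) h2 (contDiffAt_id.div_const z)
    exact (Complex.imCLM.contDiff.contDiffAt.comp z h3).congr_of_eventuallyEq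
      (Filter.Eventually.of_forall fun y => (Complex.log_im _).symm)
  have h4 : ContMDiffAt 𝓘(ℝ, ℂ) (𝓡 1) ∞ (fun w : ℂ => phase z * Circle.exp (w / z).arg) z :=
    contMDiffAt_const.mul (contMDiff_circleExp.contMDiffAt.comp z h1.contMDiffAt)
  refine h4.congr_of_eventuallyEq ?_
  filter_upwards [isOpen_ne.mem_nhds hz] with w hw
  change phase w = phase z * phase (w / z)
  rw [← phase_mul hz (div_ne_zero hw hz), mul_div_cancel₀ _ hz]

end Phase

section CircleBundleManifold

universe w

variable {n : ℕ} {E : Type*} [NormedAddCommGroup E] [NormedSpace ℂ E]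
  {Z : Type*} [TopologicalSpace Z] [ChartedSpace E Z] [IsManifold 𝓘(ℂ, E) ω Z]

namespace ComplexContactStructure.HermitianMetric

variable {C : ComplexContactStructure.{w} n E Z} (h : C.HermitianMetric)

theorem incl_smul (c : Circle) (q : h.Q) : h.incl (c • q) = Circle.toUnits c • h.incl q := rfl

/-- The fibres of `Q` are the orbits of the circle. -/
theorem projQ_eq_iff (q q' : h.Q) : h.projQ q = h.projQ q' ↔ ∃ s : ℝ, Circle.exp s • q = q' := by
  constructor
  · intro hq
    have hz := C.z_ne_zero (C.proj_mem_idx (h.incl q))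
    have hz' : C.z (C.idx (h.incl q)) (h.incl q') ≠ 0 := C.z_ne_zero (by
      have := C.proj_mem_idx (h.incl q)
      rwa [show C.proj (h.incl q) = C.proj (h.incl q') from hq] at this)
    obtain ⟨c, hc⟩ : ∃ c : ℂˣ, (c : ℂ) = C.z (C.idx (h.incl q)) (h.incl q') /
      C.z (C.idx (h.incl q)) (h.incl q) := ⟨Units.mk0 _ (div_ne_zero hz' hz), rfl⟩
    have h1 : h.incl q' = c • h.incl q :=
      C.eq_smul_of_proj_eq (C.proj_mem_idx _) hq c (by rw [hc, div_mul_cancel₀ _ hz])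
    have h2 : ‖(c : ℂ)‖ = 1 := by
      have := h.norm_smul c (h.incl q)
      rw [← h1, norm_incl, norm_incl, mul_one] at this
      exact this.symm
    refine ⟨(c : ℂ).arg, h.incl_injective ?_⟩
    rw [incl_smul, h1]
    refine congrArg (· • h.incl q) (Units.ext ?_)
    have h3 := norm_mul_phase c
    rw [h2, Complex.ofReal_one, one_mul] at h3
    exact h3
  · rintro ⟨s, rfl⟩
    rfl

variable {m : ℕ} [ChartedSpace (EuclideanSpace ℝ (Fin m)) h.Q]
  (hi : ContMDiff (𝓡 m) (modelR E) ∞ h.incl) (hN : ContMDiff (modelR E) (𝓡 m) ∞ h.normalize)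
include hi hN

/-- Polar coordinates on `L^×`. -/
theorem exists_diffeomorph :
    ∃ Ψ : Diffeomorph (modelR E) ((𝓡 m).prod 𝓘(ℝ, ℝ)) C.UZ (h.Q × ℝ) ∞,
        ∀ u, Ψ u = (h.normalize u, h.t u) := by
  have hexp : ∀ s : ℝ, ((Real.exp s : ℝ) : ℂ) ≠ 0 := fun s => by exact_mod_cast (Real.exp_pos s).ne'
  refine ⟨{ toFun := fun u => (h.normalize u, h.t u)
            invFun := fun p => Units.mk0 _ (hexp p.2) • h.incl p.1
            left_inv := fun u => ?_
            right_inv := fun p => ?_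
            contMDiff_toFun := hN.prodMk h.contMDiff_t
            contMDiff_invFun := fun p => ?_ }, fun u => rfl⟩
  · obtain ⟨c, hc, hu⟩ := h.eq_smul_incl_normalize u
    refine Eq.trans (congrArg (· • h.incl (h.normalize u)) (Units.ext ?_)) hu.symm
    rw [hc, Units.val_mk0, exp_t]
  · refine Prod.ext ?_ ?_
    · exact (h.normalize_smul (Units.mk0 _ (hexp p.2)) (Real.exp_pos p.2) rfl _).trans
        (h.normalize_incl _)
    · change h.t (Units.mk0 _ (hexp p.2) • h.incl p.1) = p.2
      rw [t_smul, t, norm_incl, Real.log_one, add_zero, Units.val_mk0, Complex.norm_real,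
        Real.norm_of_nonneg (Real.exp_pos _).le, Real.log_exp]
  · refine C.contMDiffAt_smul ?_ (hi.comp contMDiff_fst p)
    have h1 : ContDiff ℝ ∞ (fun x : ℝ => ((Real.exp x : ℝ) : ℂ)) :=
      Complex.ofRealCLM.contDiff.comp Real.contDiff_exp
    exact (h1.contMDiff.comp contMDiff_snd) p

omit hi in
theorem contMDiffAt_smul_circle {F : Type*} [NormedAddCommGroup F] [NormedSpace ℝ F]
    {H : Type*} [TopologicalSpace H] {I : ModelWithCorners ℝ F H}
    {M : Type*} [TopologicalSpace M] [ChartedSpace H M] {c : M → Circle} {φ : M → C.UZ} {x : M}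
    (hc : ContMDiffAt I (𝓡 1) ∞ c x) (hφ : ContMDiffAt I (modelR E) ∞ φ x) :
    ContMDiffAt I (𝓡 m) ∞ (fun x => h.normalize (Circle.toUnits (c x) • φ x)) x := by
  refine ContMDiffAt.comp x (hN _) (C.contMDiffAt_smul ?_ hφ)
  have : Fact (Module.finrank ℝ ℂ = 1 + 1) := finrank_real_complex_fact'
  have h1 : ContMDiff (𝓡 1) 𝓘(ℝ, ℂ) ∞ (fun c : Circle => (c : ℂ)) := contMDiff_coe_sphere
  exact ContMDiffAt.comp x (g := fun c : Circle => (c : ℂ)) (h1 _) hc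

/-- `Q` is a smooth principal circle bundle. -/
theorem isPrincipalBundle_projQ :
    IsPrincipalBundle (𝓡 1) (𝓡 m) 𝓘(ℝ, E) ∞ Circle h.projQ := by
  have hproj : ContMDiff (𝓡 m) 𝓘(ℝ, E) ∞ h.projQ := C.contMDiff_proj.comp hi
  refine ⟨fun x => ?_, hproj, fun b => ?_⟩
  · refine (h.contMDiffAt_smul_circle hN contMDiffAt_fst
      (hi.comp contMDiff_snd x)).congr_of_eventuallyEq (Filter.Eventually.of_forall fun y => ?_)
    exact (h.normalize_incl (y.1 • y.2)).symm
  obtain ⟨i, hbi⟩ := C.cover b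
  have hs : ∀ p : Z × Circle, p.1 ∈ C.U i → ContMDiffAt (𝓘(ℝ, E).prod (𝓡 1)) (𝓡 m) ∞
      (fun p : Z × Circle => h.normalize (Circle.toUnits p.2 • C.sec i p.1)) p := fun p hp =>
    h.contMDiffAt_smul_circle hN contMDiffAt_snd
      (ContMDiffAt.comp p ((isRealification_self (F := E)).contMDiffAt (isRealification_model E)
        ((C.contMDiffAt_sec hp).of_le le_top)) contMDiffAt_fst)
  have he : ∀ q, h.projQ q ∈ C.U i → ContMDiffAt (𝓡 m) (𝓘(ℝ, E).prod (𝓡 1)) ∞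
      (fun q => (h.projQ q, phase (C.z i (h.incl q)))) q := fun q hq => by
    refine (hproj q).prodMk (ContMDiffAt.comp q (g := phase) (f := fun q => C.z i (h.incl q))
      (contMDiffAt_phase (C.z_ne_zero hq)) ?_)
    exact ContMDiffAt.comp q (g := C.z i) ((isRealification_model E).contMDiffAt (isRealification_self (F := ℂ))
      ((C.contMDiffAt_z hq).of_le le_top)) (hi q)
  -- the local trivialization `q ↦ (π(q), z_i(q) / |z_i(q)|)`
  let e : OpenPartialHomeomorph h.Q (Z × Circle) :=
    { toFun := fun q => (h.projQ q, phase (C.z i (h.incl q)))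
      invFun := fun p => h.normalize (Circle.toUnits p.2 • C.sec i p.1)
      source := h.projQ ⁻¹' C.U i
      target := C.U i ×ˢ univ
      map_source' := fun u hu => ⟨hu, mem_univ _⟩
      map_target' := fun p hp => by
        change C.proj (C.sec i p.1) ∈ C.U i
        rw [C.proj_sec]; exact hp.1
      left_inv' := fun q hq => by
        have h0 := C.z_ne_zero (u := h.incl q) hq
        have h1 : ((‖C.z i (h.incl q)‖⁻¹ : ℝ) : ℂ) ≠ 0 := by simpa using h0
        obtain ⟨d, hd⟩ : ∃ d : ℂˣ, (d : ℂ) = ((‖C.z i (h.incl q)‖⁻¹ : ℝ) : ℂ) :=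
          ⟨Units.mk0 _ h1, rfl⟩
        refine h.normalize_eq_iff d (inv_pos.2 (norm_pos_iff.2 h0)) hd ?_
        have h2 := C.smul_sec_eq (u := h.incl q) hq (Units.mk0 _ h0) rfl
        refine Eq.trans ?_ (congrArg (d • ·) h2)
        rw [smul_smul]
        refine congrArg (· • C.sec i (C.proj (h.incl q))) (Units.ext ?_)
        change (phase (C.z i (h.incl q)) : ℂ) = d * C.z i (h.incl q)
        have h3 : (‖C.z i (h.incl q)‖ : ℂ) ≠ 0 := by simpa using h0
        rw [hd, Complex.ofReal_inv, eq_inv_mul_iff_mul_eq₀ h3]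
        exact norm_mul_phase _
      right_inv' := fun p hp => by
        have h1 : h.projQ (h.normalize (Circle.toUnits p.2 • C.sec i p.1)) = p.1 := C.proj_sec _ _
        refine Prod.ext h1 ?_
        refine phase_eq_of_mul (inv_pos.2 (h.norm_pos (Circle.toUnits p.2 • C.sec i p.1))) ?_
        rw [incl_normalize, C.z_smul, C.z_smul, C.z_sec hp.1, mul_one]
        simp
      open_source := (C.isOpen_U i).preimage hproj.continuous
      open_target := (C.isOpen_U i).prod isOpen_univ
      continuousOn_toFun := fun q hq => (he q hq).continuousAt.continuousWithinAt
      continuousOn_invFun := fun p hp => (hs p hp.1).continuousAt.continuousWithinAt }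
  refine ⟨C.U i, e, C.isOpen_U i, hbi, rfl, rfl, fun u hu => (he u hu).contMDiffWithinAt,
    fun p hp => (hs p hp.1).contMDiffWithinAt, fun q hq => ⟨rfl, fun c => ?_⟩⟩
  refine Prod.ext rfl ?_
  change phase (C.z i (h.incl (c • q))) = c * phase (C.z i (h.incl q))
  rw [incl_smul, C.z_smul, phase_mul (Units.ne_zero _) (C.z_ne_zero hq)]
  exact congrArg (· * _) (phase_coe c)

end ComplexContactStructure.HermitianMetric

end CircleBundleManifold

/-! ### Derivatives of the action along the fibres -/

section ChartDerivatives

variable {𝕜 : Type*} [NontriviallyNormedField 𝕜]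
  {F : Type*} [NormedAddCommGroup F] [NormedSpace 𝕜 F]
  {H : Type*} [TopologicalSpace H] {I : ModelWithCorners 𝕜 F H}
  {M : Type*} [TopologicalSpace M] [ChartedSpace H M]
  {F' : Type*} [NormedAddCommGroup F'] [NormedSpace 𝕜 F']
  {H' : Type*} [TopologicalSpace H'] {J : ModelWithCorners 𝕜 F' H'} [J.Boundaryless]
  {N : Type*} [TopologicalSpace N] [ChartedSpace H' N]

/-- The derivative of a map is the one of its expression in the preferred charts. -/
theorem hasMFDerivAt_of_hasFDerivAt_chart {f : N → M} {x : N} {f' : F' →L[𝕜] F}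
    (hc : ContinuousAt f x) {G : F' → F}
    (hG : extChartAt I (f x) ∘ f ∘ (extChartAt J x).symm =ᶠ[𝓝 (extChartAt J x x)] G)
    (h : HasFDerivAt G f' (extChartAt J x x)) :
    HasMFDerivAt J I f x f' := by
  exact ⟨hc, (h.congr_of_eventuallyEq hG).hasFDerivWithinAt⟩

end ChartDerivatives

section Derivatives

universe w

variable {n : ℕ} {E : Type*} [NormedAddCommGroup E] [NormedSpace ℂ E]
  {Z : Type*} [TopologicalSpace Z] [ChartedSpace E Z] [IsManifold 𝓘(ℂ, E) ω Z]

namespace ComplexContactStructure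

variable (C : ComplexContactStructure.{w} n E Z)

theorem contMDiff_const_smul (c : ℂˣ) : ContMDiff (modelR E) (modelR E) ∞ (fun u : C.UZ => c • u) :=
  fun _ => C.contMDiffAt_smul contMDiffAt_const contMDiffAt_id

theorem hasMFDerivAt_smul (c : ℂˣ) (u : C.UZ) :
    HasMFDerivAt (modelR E) (modelR E) (fun u : C.UZ => c • u) u
      (fibreScaling E c : (E × ℂ) →L[ℝ] (E × ℂ)) := by
  refine hasMFDerivAt_of_hasFDerivAt_chart (C.contMDiff_const_smul c).continuous.continuousAt
    (G := fibreScaling E c) ?_ (fibreScaling E c).hasFDerivAt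
  filter_upwards [extChartAt_target_mem_nhds (I := modelR E) u] with y hy
  have hy' := C.smul_mem_target c hy
  have h1 := (extChartAt (modelR E) u).right_inv hy'
  rw [← C.smul_extChartAt_symm c hy] at h1
  exact h1

/-- The velocity of the curve `s ↦ exp (s a) u` at `s = 0`. -/
theorem hasMFDerivAt_exp_smul (a : ℂ) (u : C.UZ) :
    HasMFDerivAt 𝓘(ℝ, ℝ) (modelR E)
      (fun s : ℝ => Units.mk0 _ (Complex.exp_ne_zero (s * a)) • u) 0
      ((1 : ℝ →L[ℝ] ℝ).smulRight ((0, a * C.fibreCoord u.1) : E × ℂ)) := by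
  have hexp : ContDiff ℝ ∞ (fun s : ℝ => Complex.exp (s * a)) :=
    (Complex.ofRealCLM.contDiff.mul contDiff_const).cexp
  have hc : ContMDiff 𝓘(ℝ, ℝ) (modelR E) ∞
      (fun s : ℝ => Units.mk0 _ (Complex.exp_ne_zero (s * a)) • u) := fun s =>
    C.contMDiffAt_smul hexp.contMDiff.contMDiffAt contMDiffAt_const
  refine hasMFDerivAt_of_hasFDerivAt_chart hc.continuous.continuousAt
    (G := fun s : ℝ => (extChartAt 𝓘(ℝ, E) (C.proj u) (C.proj u),
      Complex.exp (s * a) * C.fibreCoord u.1)) (Filter.Eventually.of_forall fun s => ?_) ?_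
  · have h1 := C.z_smul (C.idx u) (Units.mk0 _ (Complex.exp_ne_zero (s * a))) u
    rw [C.z_idx] at h1
    exact Prod.ext rfl h1
  · have h2 : HasDerivAt (fun s : ℝ => Complex.exp (s * a)) a 0 := by
      have h3 : HasDerivAt (fun s : ℝ => (s : ℂ) * a) (1 * a) 0 :=
        (HasDerivAt.ofReal_comp (hasDerivAt_id (0 : ℝ))).mul_const a
      have := h3.cexp
      simpa using this
    exact ((hasDerivAt_const (0 : ℝ) (extChartAt 𝓘(ℝ, E) (C.proj u) (C.proj u))).prodMk
      (h2.mul_const (C.fibreCoord u.1))).hasFDerivAt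

/-- The fields `a ε` are linear in every chart. -/
theorem mfderiv_extChartAt_fibre (a : ℂ) {u₀ u : C.UZ} (hu : u ∈ (extChartAt (modelR E) u₀).source) :
    (mfderiv (modelR E) 𝓘(ℝ, E × ℂ) (extChartAt (modelR E) u₀) u
      ((0, a * C.fibreCoord u.1) : E × ℂ) : E × ℂ) = (0, a * (extChartAt (modelR E) u₀ u).2) := by
  have h1 := C.hasMFDerivAt_exp_smul a u
  have e0 : Units.mk0 _ (Complex.exp_ne_zero (((0 : ℝ) : ℂ) * a)) • u = u := by
    refine (congrArg (· • u) (Units.ext ?_)).trans (one_smul ℂˣ u)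
    simp
  obtain ⟨A, hA⟩ : ∃ A : (E × ℂ) →L[ℝ] (E × ℂ),
      A = mfderiv (modelR E) 𝓘(ℝ, E × ℂ) (extChartAt (modelR E) u₀) u := ⟨_, rfl⟩
  have h2 : ∀ v : C.UZ, v = u →
      HasMFDerivAt (modelR E) 𝓘(ℝ, E × ℂ) (extChartAt (modelR E) u₀) v A := by
    rintro v rfl
    rw [hA]
    exact (mdifferentiableAt_extChartAt' (modelR E) hu).hasMFDerivAt
  have h4 : HasDerivAt (fun s : ℝ => Complex.exp (s * a)) a 0 := by
    have h3 : HasDerivAt (fun s : ℝ => (s : ℂ) * a) (1 * a) 0 :=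
      (HasDerivAt.ofReal_comp (hasDerivAt_id (0 : ℝ))).mul_const a
    have := h3.cexp
    simpa using this
  have h5 := ((hasDerivAt_const (0 : ℝ) (extChartAt 𝓘(ℝ, E) (C.proj u₀) (C.proj u))).prodMk
    (h4.mul_const (C.z (C.idx u₀) u))).hasFDerivAt
  have h6 : (extChartAt (modelR E) u₀ ∘ fun s : ℝ => Units.mk0 _ (Complex.exp_ne_zero (s * a)) • u) =
      fun s : ℝ => (extChartAt 𝓘(ℝ, E) (C.proj u₀) (C.proj u),
        Complex.exp (s * a) * C.z (C.idx u₀) u) :=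
    funext fun s => Prod.ext rfl (C.z_smul _ _ _)
  have h3 : HasFDerivAt (fun s : ℝ => (extChartAt 𝓘(ℝ, E) (C.proj u₀) (C.proj u),
      Complex.exp (s * a) * C.z (C.idx u₀) u))
      (A ∘L (1 : ℝ →L[ℝ] ℝ).smulRight ((0, a * C.fibreCoord u.1) : E × ℂ)) 0 := by
    rw [← h6]
    exact (HasMFDerivAt.comp (0 : ℝ) (h2 _ e0) h1).hasFDerivAt
  have h7 := DFunLike.congr_fun (h3.unique h5) (1 : ℝ)
  have h8 : A (0, a * C.fibreCoord u.1) = (0, a * C.z (C.idx u₀) u) := by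
    simpa using h7
  rw [hA] at h8
  exact h8

end ComplexContactStructure

end Derivatives

/-! ### Tangent spaces of the unit circle bundle -/

section SphereTangent

universe w

variable {n : ℕ} {E : Type*} [NormedAddCommGroup E] [NormedSpace ℂ E]
  {Z : Type*} [TopologicalSpace Z] [ChartedSpace E Z] [IsManifold 𝓘(ℂ, E) ω Z]

namespace ComplexContactStructure.HermitianMetric

variable {C : ComplexContactStructure.{w} n E Z} (h : C.HermitianMetric)

/-- The derivative of `u ↦ u / ‖u‖`: the radial component `dt · ε` is removed, and the rest is scaled by
`‖u‖⁻¹` along the fibre. -/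
theorem hasMFDerivAt_incl_normalize (u : C.UZ) : ∃ L : (E × ℂ) →L[ℝ] (E × ℂ),
    HasMFDerivAt (modelR E) (modelR E) (fun u => h.incl (h.normalize u)) u L ∧
      ∀ v, L v = (v.1, (h.norm u : ℂ)⁻¹ * (v.2 - h.dt u v * C.fibreCoord u.1)) := by
  have hy := mem_extChartAt_target (I := modelR E) u
  have ht := ((h.contDiffAt_tInChart hy).differentiableAt (by simp)).hasFDerivAt
  have h0 : h.tInChart u (extChartAt (modelR E) u u) = h.t u :=
    congrArg h.t ((extChartAt (modelR E) u).left_inv (mem_extChartAt_source u))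
  have h1 : HasFDerivAt (fun y => ((Real.exp (-h.tInChart u y) : ℝ) : ℂ))
      (Complex.ofRealCLM ∘L (Real.exp (-h.tInChart u (extChartAt (modelR E) u u)) •
        -fderiv ℝ (h.tInChart u) (extChartAt (modelR E) u u))) (extChartAt (modelR E) u u) :=
    Complex.ofRealCLM.hasFDerivAt.comp _ ht.neg.exp
  have h2 := (hasFDerivAt_fst (𝕜 := ℝ) (p := extChartAt (modelR E) u u)).prodMk
    (h1.mul (hasFDerivAt_snd (𝕜 := ℝ) (p := extChartAt (modelR E) u u)))
  refine ⟨_, hasMFDerivAt_of_hasFDerivAt_chart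
    h.contMDiff_incl_normalize.continuous.continuousAt
    (G := fun y : E × ℂ => (y.1, ((Real.exp (-h.tInChart u y) : ℝ) : ℂ) * y.2)) ?_ h2, fun v => ?_⟩
  · filter_upwards [extChartAt_target_mem_nhds (I := modelR E) u] with y hy
    have hr : ∀ v : C.UZ, (h.norm v : ℂ)⁻¹ = ((Real.exp (-h.t v) : ℝ) : ℂ) := fun v => by
      rw [Real.exp_neg, exp_t, Complex.ofReal_inv]
    have h2 : ∀ v : C.UZ, h.incl (h.normalize v) =
        Units.mk0 ((Real.exp (-h.t v) : ℝ) : ℂ) (by exact_mod_cast (Real.exp_pos _).ne') • v :=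
      fun v => (h.incl_normalize v).trans (congrArg (· • v) (Units.ext (hr v)))
    have hne : ((Real.exp (-h.tInChart u y) : ℝ) : ℂ) ≠ 0 := by exact_mod_cast (Real.exp_pos _).ne'
    have h3 := (extChartAt (modelR E) u).right_inv (C.smul_mem_target (Units.mk0 _ hne) hy)
    rw [← C.smul_extChartAt_symm (Units.mk0 _ hne) hy] at h3
    exact (congrArg (extChartAt (modelR E) u) (h2 _)).trans h3
  · have h4 : (extChartAt (modelR E) u u).2 = C.fibreCoord u.1 := C.z_idx u
    refine Prod.ext rfl ?_
    have h5 := h.dt_apply u v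
    simp only [ContinuousLinearMap.prod_apply, add_apply, smul_apply, neg_apply,
      ContinuousLinearMap.coe_comp, Function.comp_apply, ContinuousLinearMap.coe_snd', h0, h4,
      Complex.ofRealCLM_apply, smul_eq_mul, Real.exp_neg, exp_t]
    rw [← h5]
    push_cast
    ring

theorem fibreCoord_incl_normalize (u : C.UZ) :
    C.fibreCoord (h.incl (h.normalize u)).1 = (h.norm u : ℂ)⁻¹ * C.fibreCoord u.1 := rfl

variable {m : ℕ} [ChartedSpace (EuclideanSpace ℝ (Fin m)) h.Q]

/-- The derivative of the inclusion of `Q`. -/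
noncomputable def inclD (q : h.Q) : EuclideanSpace ℝ (Fin m) →L[ℝ] E × ℂ :=
  mfderiv (𝓡 m) (modelR E) h.incl q

/-- The derivative of the radial projection onto `Q`. -/
noncomputable def normD (u : C.UZ) : E × ℂ →L[ℝ] EuclideanSpace ℝ (Fin m) :=
  mfderiv (modelR E) (𝓡 m) h.normalize u

variable
  (hi : ContMDiff (𝓡 m) (modelR E) ∞ h.incl) (hN : ContMDiff (modelR E) (𝓡 m) ∞ h.normalize)

include hi in
theorem hasMFDerivAt_incl (q : h.Q) : HasMFDerivAt (𝓡 m) (modelR E) h.incl q (h.inclD q) :=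
  ((hi q).mdifferentiableAt (by simp)).hasMFDerivAt

include hN in
theorem hasMFDerivAt_normalize (u : C.UZ) :
    HasMFDerivAt (modelR E) (𝓡 m) h.normalize u (h.normD u) :=
  ((hN u).mdifferentiableAt (by simp)).hasMFDerivAt

include hi in
/-- The function `t` vanishes on `Q`. -/
theorem dt_inclD (q : h.Q) (x : EuclideanSpace ℝ (Fin m)) : h.dt (h.incl q) (h.inclD q x) = 0 := by
  have h1 : HasMFDerivAt (modelR E) 𝓘(ℝ, ℝ) h.t (h.incl q) (h.dt (h.incl q)) :=
    ((h.contMDiff_t _).mdifferentiableAt (by simp)).hasMFDerivAt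
  have h2 := HasMFDerivAt.comp q h1 (h.hasMFDerivAt_incl hi q)
  have h3 : h.t ∘ h.incl = fun _ => (0 : ℝ) := funext fun q => by
    rw [Function.comp_apply, t, norm_incl, Real.log_one]
  rw [h3] at h2
  have h4 : (h.dt (h.incl q) ∘L h.inclD q : EuclideanSpace ℝ (Fin m) →L[ℝ] ℝ) = 0 :=
    hasMFDerivAt_unique h2 (hasMFDerivAt_const _ _)
  exact DFunLike.congr_fun h4 x

include hi hN

theorem normD_inclD (q : h.Q) (x : EuclideanSpace ℝ (Fin m)) :
    h.normD (h.incl q) (h.inclD q x) = x := by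
  have h2 := HasMFDerivAt.comp q (h.hasMFDerivAt_normalize hN (h.incl q)) (h.hasMFDerivAt_incl hi q)
  have h3 : h.normalize ∘ h.incl = id := funext h.normalize_incl
  rw [h3] at h2
  have h4 : (h.normD (h.incl q) ∘L h.inclD q : EuclideanSpace ℝ (Fin m) →L[ℝ] _) =
      ContinuousLinearMap.id ℝ _ := hasMFDerivAt_unique h2 (hasMFDerivAt_id _)
  exact DFunLike.congr_fun h4 x

theorem inclD_injective (q : h.Q) : Function.Injective (h.inclD (m := m) q) :=
  Function.LeftInverse.injective (h.normD_inclD hi hN q)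

/-- The derivative of `u ↦ u / ‖u‖`. -/
theorem inclD_normD {q : h.Q} {u : C.UZ} (hq : h.normalize u = q) (v : E × ℂ) :
    h.inclD (m := m) q (h.normD u v) =
      (v.1, (h.norm u : ℂ)⁻¹ * (v.2 - h.dt u v * C.fibreCoord u.1)) := by
  subst hq
  have h1 := HasMFDerivAt.comp u (h.hasMFDerivAt_incl hi (h.normalize u))
    (h.hasMFDerivAt_normalize hN u)
  obtain ⟨L, hL, hLv⟩ := h.hasMFDerivAt_incl_normalize u
  have h2 : (h.inclD (m := m) (h.normalize u) ∘L h.normD u : (E × ℂ) →L[ℝ] (E × ℂ)) = L :=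
    hasMFDerivAt_unique h1 hL
  exact (DFunLike.congr_fun h2 v).trans (hLv v)

/-- The tangent space of `Q`, with the derivatives of the inclusion and of the radial projection, is the
kernel of `dt`. -/
theorem isSphere [FiniteDimensional ℂ E] (k : Z → E →L[ℝ] E →L[ℝ] ℝ)
    (hE : Module.finrank ℂ E = 2 * n + 1) (q : h.Q) :
    IsSphere (h.data k (h.incl q)).τ (h.data k (h.incl q)).eps (h.inclD (m := m) q)
      (h.normD (h.incl q)) where
  p_i := h.normD_inclD hi hN q
  i_p v := by
    rw [h.inclD_normD hi hN (h.normalize_incl q), h.data_eps k hE, norm_incl]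
    refine Prod.ext (by simp) ?_
    simp [data_τ]
  τ_i := h.dt_inclD hi q

end ComplexContactStructure.HermitianMetric

end SphereTangent

/-! ### The almost contact metric 3-structure -/

section ContactStructure

universe w

variable {n : ℕ} {E : Type*} [NormedAddCommGroup E] [NormedSpace ℂ E]
  {Z : Type*} [TopologicalSpace Z] [ChartedSpace E Z] [IsManifold 𝓘(ℂ, E) ω Z]

namespace ComplexContactStructure.HermitianMetric

variable {C : ComplexContactStructure.{w} n E Z} (h : C.HermitianMetric)
  [FiniteDimensional ℂ E] (k : Z → E →L[ℝ] E →L[ℝ] ℝ) {m : ℕ} [ChartedSpace (EuclideanSpace ℝ (Fin m)) h.Q]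

/-- The endomorphisms `Φ_α` of the tangent spaces of `Q`, by projection of `J_α` along the Euler field. The
index `α` runs over `0, 1, 2`. -/
noncomputable def contactΦ (α : Fin 3) (q : h.Q) :
    EuclideanSpace ℝ (Fin m) →L[ℝ] EuclideanSpace ℝ (Fin m) :=
  h.normD (h.incl q) ∘L (h.data k (h.incl q)).J₃ α ∘L h.inclD q

/-- The vector fields `ξ_α`, the tangent vectors `J_α ε` of `Q`. -/
noncomputable def contactξ (α : Fin 3) (q : h.Q) : EuclideanSpace ℝ (Fin m) :=
  h.normD (h.incl q) ((h.data k (h.incl q)).J₃ α (h.data k (h.incl q)).eps)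

/-- The forms `η_α = -dt ∘ J_α` on `Q`. -/
noncomputable def contactη (α : Fin 3) (q : h.Q) : EuclideanSpace ℝ (Fin m) →L[ℝ] ℝ :=
  -((h.data k (h.incl q)).τ ∘L (h.data k (h.incl q)).J₃ α ∘L h.inclD q)

/-- The Riemannian metric of `Q`, the restriction of the metric of `L^×`. -/
noncomputable def contactg (q : h.Q) :
    EuclideanSpace ℝ (Fin m) →L[ℝ] EuclideanSpace ℝ (Fin m) →L[ℝ] ℝ :=
  formPull (h.data k (h.incl q)).metric (h.inclD q)

variable {k} (hE : Module.finrank ℂ E = 2 * n + 1)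
  (hk : ∀ x, IsPosForm (k x))
  (hkJ : ∀ x v w, k x (Complex.I • v) (Complex.I • w) = k x v w)
include hE hk hkJ

theorem isHyperhermitianCone_data (q : h.Q) :
    IsHyperhermitianCone (h.data k (h.incl q)).metric (h.data k (h.incl q)).J₃
      (h.data k (h.incl q)).τ (h.data k (h.incl q)).eps :=
  have : FiniteDimensional ℝ E := FiniteDimensional.complexToReal E
  (h.data_good hE hk hkJ (h.incl q)).isHyperhermitianCone (h.norm_incl q)

variable (hi : ContMDiff (𝓡 m) (modelR E) ∞ h.incl) (hN : ContMDiff (modelR E) (𝓡 m) ∞ h.normalize)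
include hi hN

theorem isAlmostContactMetric3 (q : h.Q) : IsAlmostContactMetric3
    ((LinearMap.mk₂ ℝ (fun x y => h.contactg (m := m) k q x y) (fun _ _ _ => by simp)
      (fun _ _ _ => by simp) (fun _ _ _ => by simp) (fun _ _ _ => by simp)))
    (fun α => (h.contactΦ (m := m) k α q : _ →ₗ[ℝ] _)) (fun α => h.contactξ (m := m) k α q)
    (fun α => (h.contactη (m := m) k α q : _ →ₗ[ℝ] _)) :=
  (h.isHyperhermitianCone_data hE hk hkJ q).isAlmostContactMetric3 (h.isSphere hi hN k hE q)
    (fun _ _ => rfl) (fun _ _ => rfl) (fun _ => rfl) (fun _ _ => rfl)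

variable (hks : ∀ x, ContDiffAt ℝ ∞ (bilInChart 𝓘(ℝ, E) k x) (extChartAt 𝓘(ℝ, E) x x))
include hks

omit hi hN in
theorem contDiffAt_vfInChart_J₃_eps (α : Fin 3) (u : C.UZ) : ContDiffAt ℝ ∞
    (vfInChart (modelR E) (fun v => ((h.data k v).J₃ α (h.data k v).eps : E × ℂ)) u)
    (extChartAt (modelR E) u u) := by
  refine ((h.contDiffAt_endInChart_J₃ hE hk hkJ hks α u).clm_apply
    (g := fun y : E × ℂ => ((0 : E), y.2)) (contDiffAt_const.prodMk contDiffAt_snd)).congr_of_eventuallyEq ?_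
  filter_upwards [extChartAt_target_mem_nhds (I := modelR E) u] with y hy
  refine (vfInChart_apply_end (modelR E) (fun v => (h.data k v).J₃ α)
    (fun v => (h.data k v).eps) hy).trans ?_
  refine congrArg (endInChart (modelR E) (fun v => (h.data k v).J₃ α) u y) ?_
  have h1 := C.mfderiv_extChartAt_fibre 1 ((extChartAt (modelR E) u).map_target hy)
  rw [one_mul, one_mul, (extChartAt (modelR E) u).right_inv hy] at h1
  refine Eq.trans ?_ h1
  exact congrArg (fun v : E × ℂ => (mfderiv (modelR E) 𝓘(ℝ, E × ℂ) (extChartAt (modelR E) u)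
    ((extChartAt (modelR E) u).symm y) v : E × ℂ)) (h.data_eps k hE _)

omit hi hN in
theorem contDiffAt_covectorInChart_τ_J₃ (α : Fin 3) (u : C.UZ) : ContDiffAt ℝ ∞
    (covectorInChart (modelR E) (fun v => -((h.data k v).τ ∘L (h.data k v).J₃ α)) u)
    (extChartAt (modelR E) u u) := by
  have : FiniteDimensional ℝ E := FiniteDimensional.complexToReal E
  have hd := h.smoothAt_dataInChart hE hk hkJ hks u
  refine (hd.τ.clm_comp (hd.J₃ α)).neg.congr_of_eventuallyEq ?_
  filter_upwards [extChartAt_target_mem_nhds (I := modelR E) u] with y hy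
  obtain ⟨L, hL, -, h1⟩ := h.dataInChart_eq k hy
  rw [h1, SymplecticData.pull_J₃ (h.data_good hE hk hkJ _)]
  refine ContinuousLinearMap.ext fun v => ?_
  have h2 : (mfderiv 𝓘(ℝ, E × ℂ) (modelR E) (extChartAt (modelR E) u).symm y v : E × ℂ) = L v :=
    (DFunLike.congr_fun hL v).symm
  have h3 := L.apply_symm_apply ((h.data k ((extChartAt (modelR E) u).symm y)).J₃ α (L v))
  refine congrArg (fun x => -x) (congrArg (h.data k ((extChartAt (modelR E) u).symm y)).τ
    (Eq.trans ?_ h3.symm))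
  exact congrArg ((h.data k ((extChartAt (modelR E) u).symm y)).J₃ α) h2

variable [IsManifold (𝓡 m) ∞ h.Q]

omit hN in
theorem contDiffAt_bilInChart_contactg (q : h.Q) :
    ContDiffAt ℝ ∞ (bilInChart (𝓡 m) (h.contactg k) q) (extChartAt (𝓡 m) q q) :=
  contDiffAt_bilInChart_pullback (modelR E) (𝓡 m) hi
    (h.contDiffAt_bilInChart_metric hE hk hkJ hks _) fun _ _ _ => rfl

theorem contDiffAt_endInChart_contactΦ (α : Fin 3) (q : h.Q) :
    ContDiffAt ℝ ∞ (endInChart (𝓡 m) (h.contactΦ k α) q) (extChartAt (𝓡 m) q q) :=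
  contDiffAt_endInChart_retract (modelR E) (𝓡 m) hi hN h.normalize_incl
    (h.contDiffAt_endInChart_J₃ hE hk hkJ hks α _) fun _ _ => rfl

theorem contDiffAt_vfInChart_contactξ (α : Fin 3) (q : h.Q) :
    ContDiffAt ℝ ∞ (vfInChart (𝓡 m) (h.contactξ k α) q) (extChartAt (𝓡 m) q q) :=
  contDiffAt_vfInChart_retract (modelR E) (𝓡 m) hi hN h.normalize_incl
    (h.contDiffAt_vfInChart_J₃_eps hE hk hkJ hks α _) fun _ => rfl

omit hN in
theorem contDiffAt_covectorInChart_contactη (α : Fin 3) {q : h.Q} {y : EuclideanSpace ℝ (Fin m)}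
    (hy : y ∈ (extChartAt (𝓡 m) q).target) :
    ContDiffAt ℝ ∞ (covectorInChart (𝓡 m) (h.contactη k α) q) y :=
  contDiffAt_covectorInChart_pullback (modelR E) (𝓡 m) hi hy
    (h.contDiffAt_covectorInChart_τ_J₃ hE hk hkJ hks α) fun _ _ => rfl

/-- The almost contact metric 3-structure of `Q`. -/
noncomputable def contactStructure : AlmostContactMetric3Structure (𝓡 m) h.Q :=
  have hc := h.isAlmostContactMetric3 hE hk hkJ hi hN
  have hη := fun q => (h.isHyperhermitianCone_data hE hk hkJ q).η_Φ (h.isSphere hi hN k hE q)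
    (Φ := fun α => h.contactΦ k α q) (η := fun α => h.contactη k α q) (fun _ _ => rfl)
    (fun _ _ => rfl)
  { g := RiemMetric.ofSmooth (𝓡 m) (h.contactg k)
      (fun q => ⟨((hc q).acm 0).symm, ((hc q).acm 0).pos⟩)
      (h.contDiffAt_bilInChart_contactg hE hk hkJ hi hks)
    Φ := h.contactΦ k
    ξ := h.contactξ k
    η := h.contactη k
    smooth_Φ := fun α => (isSmoothEnd_iff (𝓡 m) _).2
      (h.contDiffAt_endInChart_contactΦ hE hk hkJ hi hN hks α)
    smooth_ξ := fun α => (isSmoothVF_iff (𝓡 m) _).2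
      (h.contDiffAt_vfInChart_contactξ hE hk hkJ hi hN hks α)
    smooth_η := fun α => (isSmoothFormOn_univ_iff (𝓡 m)).2 fun q y hy =>
      (contDiffAt_formInChart_oneForm (𝓡 m) (α := h.contactη k α)).2
        (h.contDiffAt_covectorInChart_contactη hE hk hkJ hi hks α hy)
    η_ξ := fun α q => ((hc q).acm α).η_ξ
    Φ_Φ_self := fun α q => ((hc q).acm α).Φ_Φ
    Φ_Φ := fun α q => (hc q).Φ_Φ α
    Φ_Φ' := fun α q => (hc q).Φ_Φ' α
    Φ_ξ := fun α q => (hc q).Φ_ξ α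
    Φ_ξ' := fun α q => (hc q).Φ_ξ' α
    η_Φ := fun α q X => (hη q α X).1
    η_Φ' := fun α q X => (hη q α X).2
    g_ξ := fun α q => ((hc q).acm α).g_ξ
    g_Φ := fun α q => ((hc q).acm α).g_Φ }

end ComplexContactStructure.HermitianMetric

end ContactStructure

/-! ### Contact metric structures -/

section ContactMetric

universe w

variable {n : ℕ} {E : Type*} [NormedAddCommGroup E] [NormedSpace ℂ E]
  {Z : Type*} [TopologicalSpace Z] [ChartedSpace E Z] [IsManifold 𝓘(ℂ, E) ω Z]

namespace ComplexContactStructure.HermitianMetric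

variable {C : ComplexContactStructure.{w} n E Z} (h : C.HermitianMetric)
  [FiniteDimensional ℂ E] {k : Z → E →L[ℝ] E →L[ℝ] ℝ} {m : ℕ}
  [ChartedSpace (EuclideanSpace ℝ (Fin m)) h.Q]

/-- The exterior derivative of a component of the restriction of `ϑ` to `Q`. -/
theorem dOne_re_vartheta [IsManifold (𝓡 m) ∞ h.Q] (hi : ContMDiff (𝓡 m) (modelR E) ∞ h.incl)
    (c : ℂ) {η : ∀ q : h.Q, TangentSpace (𝓡 m) q →L[ℝ] ℝ}
    (hη : ∀ (q : h.Q) (x : EuclideanSpace ℝ (Fin m)),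
      η q x = (c * C.vartheta (h.incl q) (h.inclD q x)).re) (q : h.Q)
    (x y : EuclideanSpace ℝ (Fin m)) :
    dOne (𝓡 m) η q x y = (c * C.upsilon (h.incl q) ![h.inclD q x, h.inclD q y]).re := by
  obtain ⟨α, hα⟩ : ∃ α : ∀ u : C.UZ, TangentSpace (modelC E) u [⋀^Fin 1]→L[ℂ] ℂ,
    α = fun u => c • oneForm (modelC E) C.vartheta u := ⟨_, rfl⟩
  have hs : IsSmoothFormOn (modelC E) ω α univ := fun u => by
    rw [hα, formInChart_const_smul]
    exact (C.isSmoothFormOn_vartheta u).const_smul c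
  have h1 : oneForm (𝓡 m) η =
      pullbackForm (modelR E) (𝓡 m) h.incl (fun u => reForm (E × ℂ) 1 (α u)) := by
    funext q
    refine ContinuousAlternatingMap.ext fun v => ?_
    subst hα
    exact hη q (v 0)
  have h2 : DifferentiableAt ℝ
      (formInChart (modelR E) (fun u => reForm (E × ℂ) 1 (α u)) (h.incl q))
      (extChartAt (modelR E) (h.incl q) (h.incl q)) :=
    (((isRealification_model E).isSmoothFormOn_reForm hs).contDiffAt_self (modelR E) isOpen_univ
      (mem_univ _)).differentiableAt (by simp)
  have h3 := extDerivForm_pullbackForm (modelR E) (𝓡 m) (r := ∞)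
    (by rw [minSmoothness_of_isRCLikeNormedField]; exact WithTop.coe_le_coe.2 le_top)
    (fun u => reForm (E × ℂ) 1 (α u)) (hi q) h2
  have h4 := (isRealification_model E).extDerivForm_reForm α (x := h.incl q)
    ((hs.contDiffAt_self (modelC E) isOpen_univ (mem_univ _)).differentiableAt (by simp))
  unfold dOne
  rw [h1, h3]
  have h5 : (fun i => mfderiv (𝓡 m) (modelR E) h.incl q ((![x, y] : Fin 2 → _) i)) =
      ![h.inclD q x, h.inclD q y] := by
    funext i; fin_cases i <;> rfl
  refine (congrArg (extDerivForm (modelR E) (fun u => reForm (E × ℂ) 1 (α u)) (h.incl q)) h5).trans ?_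
  refine (DFunLike.congr_fun h4 _).trans ?_
  rw [hα]
  exact congrArg Complex.re (extDerivForm_const_smul c _ _ _)

variable (hE : Module.finrank ℂ E = 2 * n + 1) (hk : ∀ x, IsPosForm (k x))
  (hkJ : ∀ x v w, k x (Complex.I • v) (Complex.I • w) = k x v w)
include hE hk hkJ

/-- The second contact form is the real part of `ϑ` on `Q`. -/
theorem contactη_one (q : h.Q) (x : EuclideanSpace ℝ (Fin m)) :
    h.contactη k 1 q x = (1 * C.vartheta (h.incl q) (h.inclD q x)).re := by
  have h1 := (h.data_good hE hk hkJ (h.incl q)).τ_J₂ (h.inclD q x)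
  rw [data_r, norm_incl, one_mul, data_β] at h1
  rw [one_mul]
  exact (congrArg (fun a : ℝ => -a) h1).trans (neg_neg _)

/-- The third contact form is the imaginary part `Re (-√-1 ϑ)` of `ϑ` on `Q`. -/
theorem contactη_two (q : h.Q) (x : EuclideanSpace ℝ (Fin m)) :
    h.contactη k 2 q x = (-Complex.I * C.vartheta (h.incl q) (h.inclD q x)).re := by
  have h1 := (h.data_good hE hk hkJ (h.incl q)).τ_J_J₂ (h.inclD q x)
  have h2 : C.vartheta (h.incl q) (Complex.I • h.inclD q x) =
        Complex.I * C.vartheta (h.incl q) (h.inclD q x) :=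
      map_smul (C.vartheta (h.incl q) : (E × ℂ) →L[ℂ] ℂ) _ _
  rw [data_r, norm_incl, one_mul] at h1
  rw [neg_mul, Complex.neg_re]
  exact congrArg (fun a : ℝ => -a) (h1.trans (congrArg Complex.re h2))

variable (hi : ContMDiff (𝓡 m) (modelR E) ∞ h.incl) (hN : ContMDiff (modelR E) (𝓡 m) ∞ h.normalize)
include hi hN

omit hk hkJ in
theorem inclD_contactΦ (α : Fin 3) (q : h.Q) (x : EuclideanSpace ℝ (Fin m)) :
    h.inclD q (h.contactΦ k α q x) = (h.data k (h.incl q)).J₃ α (h.inclD q x) +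
      h.contactη k α q x • (h.data k (h.incl q)).eps := by
  refine ((h.isSphere hi hN k hE q).i_p _).trans ?_
  rw [sub_eq_add_neg, ← neg_smul]
  rfl

/-- The fundamental forms of `Q` are the restrictions of those of `L^×`, because the Euler field is normal
to `Q`. -/
theorem contactg_contactΦ (α : Fin 3) (q : h.Q) (x y : EuclideanSpace ℝ (Fin m)) :
    h.contactg k q (h.contactΦ k α q x) y =
      (h.data k (h.incl q)).metric ((h.data k (h.incl q)).J₃ α (h.inclD q x)) (h.inclD q y) := by
  have h2 := (h.isHyperhermitianCone_data hE hk hkJ q).K_ε (h.inclD q y)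
  rw [(h.isSphere hi hN k hE q).τ_i] at h2
  change (h.data k (h.incl q)).metric (h.inclD q (h.contactΦ k α q x)) (h.inclD q y) = _
  rw [h.inclD_contactΦ hE hi hN, map_add, map_smul, add_apply, smul_apply, h2, smul_zero,
    add_zero]

variable [IsManifold (𝓡 m) ∞ h.Q]

theorem dOne_contactη_one (q : h.Q) (x y : EuclideanSpace ℝ (Fin m)) :
    dOne (𝓡 m) (h.contactη k 1) q x y = h.contactg k q (h.contactΦ k 1 q x) y := by
  rw [h.contactg_contactΦ hE hk hkJ hi hN]
  refine (h.dOne_re_vartheta hi 1 (h.contactη_one hE hk hkJ) q x y).trans ?_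
  refine Eq.trans ?_ ((h.data_good hE hk hkJ (h.incl q)).metric_J₂ _ _).symm
  rw [data_w, one_mul]

theorem dOne_contactη_two (q : h.Q) (x y : EuclideanSpace ℝ (Fin m)) :
    dOne (𝓡 m) (h.contactη k 2) q x y = h.contactg k q (h.contactΦ k 2 q x) y := by
  rw [h.contactg_contactΦ hE hk hkJ hi hN]
  refine (h.dOne_re_vartheta hi (-Complex.I) (h.contactη_two hE hk hkJ) q x y).trans ?_
  refine Eq.trans ?_ ((h.data_good hE hk hkJ (h.incl q)).metric_J_J₂ _ _).symm
  rw [data_w, data_J, upsilon_smul_left, neg_mul, neg_re]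

variable (hks : ∀ x, ContDiffAt ℝ ∞ (bilInChart 𝓘(ℝ, E) k x) (extChartAt 𝓘(ℝ, E) x x))

theorem isContactMetric_one {N : ℕ} (hm : m = 2 * N + 1) :
    (h.contactStructure hE hk hkJ hi hN hks).IsContactMetric N 1 := by
  refine ⟨fun q => ?_, h.dOne_contactη_one hE hk hkJ hi hN⟩
  have h1 := ((h.isAlmostContactMetric3 hE hk hkJ hi hN q).acm 1).wedgePow_ne_zero
    (finrank_euclideanSpace_fin.trans hm)
  have h2 : dOne (𝓡 m) (h.contactη k 1) q = fun x y => h.contactg k q (h.contactΦ k 1 q x) y :=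
    funext fun x => funext fun y => h.dOne_contactη_one hE hk hkJ hi hN q x y
  change wedgePow (h.contactη k 1 q) (dOne (𝓡 m) (h.contactη k 1) q) N ≠ 0
  rw [h2]
  exact h1

theorem isContactMetric_two {N : ℕ} (hm : m = 2 * N + 1) :
    (h.contactStructure hE hk hkJ hi hN hks).IsContactMetric N 2 := by
  refine ⟨fun q => ?_, h.dOne_contactη_two hE hk hkJ hi hN⟩
  have h1 := ((h.isAlmostContactMetric3 hE hk hkJ hi hN q).acm 2).wedgePow_ne_zero
    (finrank_euclideanSpace_fin.trans hm)
  have h2 : dOne (𝓡 m) (h.contactη k 2) q = fun x y => h.contactg k q (h.contactΦ k 2 q x) y :=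
    funext fun x => funext fun y => h.dOne_contactη_two hE hk hkJ hi hN q x y
  change wedgePow (h.contactη k 2 q) (dOne (𝓡 m) (h.contactη k 2) q) N ≠ 0
  rw [h2]
  exact h1

/-- The two volume forms agree at each point, by the rotation of the almost contact metric
3-structure. -/
theorem wedgePow_contactη {N : ℕ} (hm : m = 2 * N + 1) (q : h.Q) :
    wedgePow (h.contactη k 1 q) (dOne (𝓡 m) (h.contactη k 1) q) N =
      wedgePow (h.contactη k 2 q) (dOne (𝓡 m) (h.contactη k 2) q) N := by
  have h1 := (h.isAlmostContactMetric3 hE hk hkJ hi hN q).wedgePow_eq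
    (finrank_euclideanSpace_fin.trans hm)
  have h2 : dOne (𝓡 m) (h.contactη k 1) q = fun x y => h.contactg k q (h.contactΦ k 1 q x) y :=
    funext fun x => funext fun y => h.dOne_contactη_one hE hk hkJ hi hN q x y
  have h3 : dOne (𝓡 m) (h.contactη k 2) q = fun x y => h.contactg k q (h.contactΦ k 2 q x) y :=
    funext fun x => funext fun y => h.dOne_contactη_two hE hk hkJ hi hN q x y
  rw [h2, h3]
  exact h1

omit hi hN [IsManifold (𝓡 m) ∞ h.Q] in
theorem contactη_add_I_mul (q : h.Q) (x : EuclideanSpace ℝ (Fin m)) :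
    (h.contactη k 1 q x : ℂ) + Complex.I * (h.contactη k 2 q x : ℂ) =
      C.vartheta (h.incl q) (h.inclD q x) := by
  rw [h.contactη_one hE hk hkJ, h.contactη_two hE hk hkJ]
  apply Complex.ext <;> simp

end ComplexContactStructure.HermitianMetric

end ContactMetric

/-! ### The hyperhermitian structure in polar coordinates -/

section PolarCoordinates

universe w

variable {n : ℕ} {E : Type*} [NormedAddCommGroup E] [NormedSpace ℂ E]
  {Z : Type*} [TopologicalSpace Z] [ChartedSpace E Z] [IsManifold 𝓘(ℂ, E) ω Z]

namespace ComplexContactStructure.HermitianMetric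

variable {C : ComplexContactStructure.{w} n E Z} (h : C.HermitianMetric)
  [FiniteDimensional ℂ E] {k : Z → E →L[ℝ] E →L[ℝ] ℝ} {m : ℕ}
  [ChartedSpace (EuclideanSpace ℝ (Fin m)) h.Q]
  (hE : Module.finrank ℂ E = 2 * n + 1) (hk : ∀ x, IsPosForm (k x))
  (hkJ : ∀ x v w, k x (Complex.I • v) (Complex.I • w) = k x v w)
  (hi : ContMDiff (𝓡 m) (modelR E) ∞ h.incl) (hN : ContMDiff (modelR E) (𝓡 m) ∞ h.normalize)

section

include hE hi hN

/-- The derivative of the action of `‖u‖⁻¹`, in terms of the decomposition of the tangent vectors of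
`L^×` in polar coordinates; the data at `u / ‖u‖` correspond under it to those at `u`, up to the
dilation by `‖u‖`. -/
theorem exists_isPullback_normalize (u : C.UZ) : ∃ L : (E × ℂ) ≃L[ℝ] (E × ℂ),
    (h.data k u).IsPullback (h.data k (h.incl (h.normalize u))) L (h.norm u) (h.norm u) 0 ∧
      ∀ v, L v = h.inclD (m := m) (h.normalize u) (h.normD u v) +
        h.dt u v • (h.data k (h.incl (h.normalize u))).eps := by
  obtain ⟨c, hc, hcu⟩ : ∃ c : ℂˣ, (c : ℂ) = (h.norm u : ℂ)⁻¹ ∧ h.incl (h.normalize u) = c • u :=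
    ⟨_, rfl, h.incl_normalize u⟩
  have hc' : ((c⁻¹ : ℂˣ) : ℂ) = h.norm u := by rw [Units.val_inv_eq_inv_val, hc, inv_inv]
  refine ⟨fibreScaling E c, ?_, fun v => ?_⟩
  · have h1 := h.isPullback_data k c u
    rw [hc', Complex.norm_real, Complex.ofReal_re, Complex.ofReal_im,
      Real.norm_of_nonneg (h.norm_pos u).le] at h1
    rw [hcu]
    exact h1
  · rw [h.inclD_normD hi hN rfl, h.data_eps k hE, fibreScaling_apply, hc]
    refine Prod.ext (by simp) ?_
    simp only [Prod.snd_add, Prod.smul_snd, fibreCoord_incl_normalize, Complex.real_smul]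
    ring

include hk hkJ

/-- The `d/dt`-component of `J_α v`, where `v = X + dt(v) d/dt`, is `-η_α(X)`. -/
theorem dt_J₃ (α : Fin 3) (u : C.UZ) (v : E × ℂ) :
    h.dt u ((h.data k u).J₃ α v) = -h.contactη (m := m) k α (h.normalize u) (h.normD u v) := by
  have : FiniteDimensional ℝ E := FiniteDimensional.complexToReal E
  obtain ⟨L, hL, hLv⟩ := h.exists_isPullback_normalize (k := k) hE hi hN u
  have h1 := hL.τ_eq ((h.data k u).J₃ α v)
  rw [hL.map_J₃ (h.data_good hE hk hkJ _) (h.data_good hE hk hkJ _), hLv, map_add, map_smul,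
    map_add, map_smul, (h.isHyperhermitianCone_data hE hk hkJ (h.normalize u)).τ_J_ε, smul_zero,
    add_zero] at h1
  exact h1.trans (neg_neg _).symm

/-- The `Q`-component of `J_α v`, where `v = X + dt(v) d/dt`, is `Φ_α X + dt(v) ξ_α`. -/
theorem normD_J₃ (α : Fin 3) (u : C.UZ) (v : E × ℂ) :
    h.normD u ((h.data k u).J₃ α v) = h.contactΦ (m := m) k α (h.normalize u) (h.normD u v) +
      h.dt u v • h.contactξ k α (h.normalize u) := by
  have : FiniteDimensional ℝ E := FiniteDimensional.complexToReal E
  apply h.inclD_injective hi hN (h.normalize u)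
  obtain ⟨L, hL, hLv⟩ := h.exists_isPullback_normalize (k := k) hE hi hN u
  have h1 := hLv ((h.data k u).J₃ α v)
  rw [hL.map_J₃ (h.data_good hE hk hkJ _) (h.data_good hE hk hkJ _), hLv, map_add, map_smul,
    h.dt_J₃ hE hk hkJ hi hN] at h1
  have h2 : h.inclD (m := m) (h.normalize u) (h.contactξ k α (h.normalize u)) =
      (h.data k (h.incl (h.normalize u))).J₃ α (h.data k (h.incl (h.normalize u))).eps := by
    refine ((h.isSphere hi hN k hE (h.normalize u)).i_p _).trans ?_
    rw [(h.isHyperhermitianCone_data hE hk hkJ (h.normalize u)).τ_J_ε, zero_smul, sub_zero]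
  have e : ∀ r : ℝ, h.inclD (m := m) (h.normalize u) (h.contactΦ (m := m) k α (h.normalize u)
      (h.normD u v) + r • h.contactξ k α (h.normalize u)) =
      h.inclD (m := m) (h.normalize u) (h.contactΦ (m := m) k α (h.normalize u)
      (h.normD u v)) + r • h.inclD (m := m) (h.normalize u) (h.contactξ k α (h.normalize u)) :=
    fun r => by rw [map_add, map_smul]
  refine Eq.trans ?_ (e (h.dt u v)).symm
  rw [h2, h.inclD_contactΦ hE hi hN]
  rw [neg_smul, ← sub_eq_add_neg] at h1
  have h3 := eq_add_of_sub_eq h1.symm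
  refine h3.trans ?_
  abel

/-- In polar coordinates the metric is `e^t (g_Q + dt ⊗ dt)`. -/
theorem metric_eq_exp_mul (u : C.UZ) (v w : E × ℂ) : (h.data k u).metric v w = Real.exp (h.t u) *
    (h.contactg (m := m) k (h.normalize u) (h.normD u v) (h.normD u w) + h.dt u v * h.dt u w) := by
  have : FiniteDimensional ℝ E := FiniteDimensional.complexToReal E
  obtain ⟨L, hL, hLv⟩ := h.exists_isPullback_normalize (k := k) hE hi hN u
  have hs := h.isSphere hi hN k hE (h.normalize u)
  have hc := h.isHyperhermitianCone_data hE hk hkJ (h.normalize u)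
  rw [hL.metric_eq (h.data_good hE hk hkJ _) (h.data_good hE hk hkJ _), h.exp_t, hLv, hLv]
  have e : ∀ (K : (E × ℂ) →L[ℝ] (E × ℂ) →L[ℝ] ℝ) (x y ε : E × ℂ) (a b : ℝ), K ε ε = 1 →
      K ε y = 0 → K x ε = 0 → K (x + a • ε) (y + b • ε) = K x y + a * b := by
    intro K x y ε a b h1 h2 h3
    simp [h1, h2, h3]
  rw [e]
  · rfl
  · rw [hc.K_ε, hc.τ_ε]
  · rw [hc.K_ε, hs.τ_i]
  · rw [hc.pos.symm, hc.K_ε, hs.τ_i]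

end

/-- The velocity of the orbits of the circle. -/
theorem hasMFDerivAt_incl_exp_smul (q : h.Q) (s : ℝ) :
    HasMFDerivAt 𝓘(ℝ, ℝ) (modelR E) (fun s : ℝ => h.incl (Circle.exp s • q)) s
      ((1 : ℝ →L[ℝ] ℝ).smulRight
        ((0, Complex.I * C.fibreCoord (h.incl (Circle.exp s • q)).1) : E × ℂ)) := by
  have h1 := C.hasMFDerivAt_exp_smul Complex.I (h.incl (Circle.exp s • q))
  have h2 : HasMFDerivAt 𝓘(ℝ, ℝ) 𝓘(ℝ, ℝ) (fun r : ℝ => r - s) s (ContinuousLinearMap.id ℝ ℝ) :=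
    ((hasFDerivAt_id s).sub_const s).hasMFDerivAt
  have h3 : (fun s : ℝ => h.incl (Circle.exp s • q)) =
      (fun r : ℝ => Units.mk0 _ (Complex.exp_ne_zero (r * Complex.I)) •
        h.incl (Circle.exp s • q)) ∘ fun r : ℝ => r - s := by
    funext r
    rw [Function.comp_apply, incl_smul, incl_smul, smul_smul]
    refine congrArg (· • h.incl q) (Units.ext ?_)
    rw [Units.val_mul, Units.val_mk0, Circle.toUnits_apply, Circle.toUnits_apply, Units.val_mk0,
      Units.val_mk0, Circle.coe_exp, Circle.coe_exp, ← Complex.exp_add]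
    congr 1
    push_cast
    ring
  have h4 : ∀ t : ℝ, t = 0 → HasMFDerivAt 𝓘(ℝ, ℝ) (modelR E)
      (fun r : ℝ => Units.mk0 _ (Complex.exp_ne_zero (r * Complex.I)) • h.incl (Circle.exp s • q)) t
      ((1 : ℝ →L[ℝ] ℝ).smulRight
        ((0, Complex.I * C.fibreCoord (h.incl (Circle.exp s • q)).1) : E × ℂ)) := by
    rintro t rfl; exact h1
  rw [h3]
  exact HasMFDerivAt.comp s (f := fun r : ℝ => r - s) (h4 _ (sub_self s)) h2

include hE hN in
/-- The flow of the Reeb field is the action of the circle. -/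
theorem isMIntegralCurve_exp_smul (q : h.Q) :
    IsMIntegralCurve (I := 𝓡 m) (fun s : ℝ => Circle.exp s • q) (h.contactξ k 0) := by
  intro s
  have h1 := HasMFDerivAt.comp s (h.hasMFDerivAt_normalize hN (h.incl (Circle.exp s • q)))
    (h.hasMFDerivAt_incl_exp_smul q s)
  have h2 : h.normalize ∘ (fun s : ℝ => h.incl (Circle.exp s • q)) = fun s : ℝ => Circle.exp s • q :=
    funext fun s => h.normalize_incl _
  rw [h2] at h1
  have h3 : ∀ p, p = Circle.exp s • q → h.normD (m := m) (h.incl (Circle.exp s • q))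
        (0, Complex.I * C.fibreCoord (h.incl (Circle.exp s • q)).1) = h.contactξ k 0 p := by
    rintro p rfl
    refine congrArg (h.normD (h.incl (Circle.exp s • q))) ?_
    change _ = (h.data k (h.incl (Circle.exp s • q))).J (h.data k (h.incl (Circle.exp s • q))).eps
    rw [h.data_eps k hE, data_J]
    exact Prod.ext (by simp) rfl
  obtain ⟨A, hA⟩ : ∃ A : ℝ →L[ℝ] EuclideanSpace ℝ (Fin m), A = h.normD (h.incl (Circle.exp s • q)) ∘L
    (1 : ℝ →L[ℝ] ℝ).smulRight
        ((0, Complex.I * C.fibreCoord (h.incl (Circle.exp s • q)).1) : E × ℂ) := ⟨_, rfl⟩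
  have h5 : A = (1 : ℝ →L[ℝ] ℝ).smulRight (h.contactξ k 0 (Circle.exp s • q)) := by
    refine ContinuousLinearMap.ext fun r => ?_
    rw [← h3 _ rfl, hA]
    simp only [ContinuousLinearMap.comp_apply, ContinuousLinearMap.smulRight_apply, map_smul]
  exact h5 ▸ hA ▸ h1

end ComplexContactStructure.HermitianMetric

end PolarCoordinates

/-! ### The Reeb field is a Killing vector field -/

theorem fderiv_apply_eq_zero_of_eventually_const {F G : Type*} [NormedAddCommGroup F]
    [NormedSpace ℝ F] [NormedAddCommGroup G] [NormedSpace ℝ G] {f : F → G} {x v : F}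
    (hf : DifferentiableAt ℝ f x) (h : ∀ᶠ s : ℝ in 𝓝 0, f (x + s • v) = f x) :
    fderiv ℝ f x v = 0 := by
  have h1 : HasDerivAt (fun s : ℝ => x + s • v) v 0 := by
    simpa using ((hasDerivAt_id (0 : ℝ)).smul_const v).const_add x
  have e0 : x + (0 : ℝ) • v = x := by simp
  have h2 := hf.hasFDerivAt
  rw [← e0] at h2
  have h3 := h2.comp_hasDerivAt (0 : ℝ) h1
  rw [e0] at h3
  exact h3.unique ((hasDerivAt_const (0 : ℝ) (f x)).congr_of_eventuallyEq h)

section Translations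

variable {F : Type*} [NormedAddCommGroup F] [NormedSpace ℝ F]
  {H : Type*} [TopologicalSpace H] (I : ModelWithCorners ℝ F H) [I.Boundaryless]
  {M : Type*} [TopologicalSpace M] [ChartedSpace H M] [IsManifold I ∞ M]

/-- The components of an invariant bilinear form are unchanged under maps which are translations
in a chart. -/
theorem bilInChart_add_of_invariant {g : ∀ x : M, TangentSpace I x →L[ℝ] TangentSpace I x →L[ℝ] ℝ}
    {A : M → M} {x : M} {c : F} (hA : MDifferentiableAt I I A x)
    (hg : ∀ v w, g (A x) (mfderiv I I A x v) (mfderiv I I A x w) = g x v w)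
    (hAx : A x ∈ (extChartAt I x).source)
    (hc : extChartAt I x ∘ A ∘ (extChartAt I x).symm =ᶠ[𝓝 (extChartAt I x x)] fun y => y + c) :
    bilInChart I g x (extChartAt I x x + c) = bilInChart I g x (extChartAt I x x) := by
  have hx := mem_extChartAt_source (I := I) x
  have : IsManifold I 1 M := IsManifold.of_le (n := ∞) (by simp)
  have h1 : extChartAt I x (A x) = extChartAt I x x + c := by
    have := hc.self_of_nhds
    rwa [Function.comp_apply, Function.comp_apply, (extChartAt I x).left_inv hx] at this
  have h2 : ∀ v : F, (mfderiv I 𝓘(ℝ, F) (extChartAt I x) (A x) (mfderiv I I A x v) : F) = v := by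
    intro v
    have h3 := fderiv_chart_comp_mfderiv I I hx hAx hA v
    rw [hc.fderiv_eq, fderiv_add_const, fderiv_id'] at h3
    exact h3.symm.trans (mfderiv_extChartAt_self_apply I x v)
  refine ContinuousLinearMap.ext fun v => ContinuousLinearMap.ext fun w => ?_
  have h4 := bilInChart_extChartAt I g hAx (mfderiv I I A x v) (mfderiv I I A x w)
  have e : ∀ a b a' b' : F, a = a' → b = b' → bilInChart I g x (extChartAt I x (A x)) a b =
      bilInChart I g x (extChartAt I x (A x)) a' b' := by rintro a b _ _ rfl rfl; rfl
  rw [← h1]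
  exact (e _ _ _ _ (h2 v) (h2 w)).symm.trans (h4.trans ((hg v w).trans (bilInChart_self I g x v w).symm))

set_option synthInstance.maxHeartbeats 200000 in
/-- A vector field which is constant in charts and along which the chart expressions of a metric are
invariant is a Killing vector field. -/
theorem RiemMetric.isKilling_of_eventually_const [FiniteDimensional ℝ F] (g : RiemMetric I M)
    (ξ : ∀ x : M, TangentSpace I x)
    (hξ : ∀ x, ∃ c : F, vfInChart I ξ x =ᶠ[𝓝 (extChartAt I x x)] fun _ => c)
    (hg : ∀ x, ContDiffAt ℝ ∞ (bilInChart I g.inner x) (extChartAt I x x))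
    (hgξ : ∀ x, ∀ v : F, v = ξ x → ∀ᶠ s : ℝ in 𝓝 0,
      bilInChart I g.inner x (extChartAt I x x + s • v) =
        bilInChart I g.inner x (extChartAt I x x)) : g.IsKilling ξ :=
  g.isKilling_of_const I ξ hξ (fun x => (hg x).differentiableAt (by simp)) fun x v hv =>
    fderiv_apply_eq_zero_of_eventually_const ((hg x).differentiableAt (by simp)) (hgξ x v hv)

end Translations

/-- On the right half plane, small rotations translate the argument. -/
theorem arg_exp_mul {w : ℂ} (hw : 0 < w.re) {s : ℝ} (hs : |s| < Real.pi / 2) :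
    (Complex.exp (s * Complex.I) * w).arg = w.arg + s := by
  have hw0 : w ≠ 0 := by rintro rfl; simp at hw
  have h1 := abs_lt.1 (Complex.abs_arg_lt_pi_div_two_iff.2 (Or.inl hw))
  have h2 := abs_lt.1 hs
  have h3 : (Complex.exp (s * Complex.I)).arg = s := by
    rw [Complex.arg_exp_mul_I, toIocMod_eq_self]
    constructor <;> linarith
  rw [Complex.arg_mul (Complex.exp_ne_zero _) hw0, h3, add_comm]
  rw [h3]
  constructor <;> linarith

theorem eventually_abs_lt : ∀ᶠ s : ℝ in 𝓝 0, |s| < Real.pi / 2 := by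
  have h1 : ContinuousAt (fun s : ℝ => |s|) 0 := continuous_abs.continuousAt
  refine h1.eventually (gt_mem_nhds ?_)
  simpa using Real.pi_pos

section Killing

universe w

variable {n : ℕ} {E : Type*} [NormedAddCommGroup E] [NormedSpace ℂ E]
  {Z : Type*} [TopologicalSpace Z] [ChartedSpace E Z] [IsManifold 𝓘(ℂ, E) ω Z]

namespace ComplexContactStructure.HermitianMetric

variable {C : ComplexContactStructure.{w} n E Z} (h : C.HermitianMetric)

section Invariance

variable [FiniteDimensional ℂ E] {k : Z → E →L[ℝ] E →L[ℝ] ℝ} {m : ℕ}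
  [ChartedSpace (EuclideanSpace ℝ (Fin m)) h.Q]
  (hE : Module.finrank ℂ E = 2 * n + 1) (hk : ∀ x, IsPosForm (k x))
  (hkJ : ∀ x v w, k x (Complex.I • v) (Complex.I • w) = k x v w)
  (hi : ContMDiff (𝓡 m) (modelR E) ∞ h.incl) (hN : ContMDiff (modelR E) (𝓡 m) ∞ h.normalize)

include hi hN in
omit [FiniteDimensional ℂ E] in
theorem contMDiff_const_smul_circle (c : Circle) :
    ContMDiff (𝓡 m) (𝓡 m) ∞ (fun q : h.Q => c • q) := fun q =>
  (h.contMDiffAt_smul_circle hN contMDiffAt_const (hi q)).congr_of_eventuallyEq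
    (Filter.Eventually.of_forall fun q => (h.normalize_incl (c • q)).symm)

include hE hk hkJ hi hN in
/-- The circle acts by isometries. -/
theorem contactg_smul (c : Circle) (q : h.Q) (x y : EuclideanSpace ℝ (Fin m)) :
    h.contactg k (c • q) (mfderiv (𝓡 m) (𝓡 m) (fun q : h.Q => c • q) q x : EuclideanSpace ℝ (Fin m))
      (mfderiv (𝓡 m) (𝓡 m) (fun q : h.Q => c • q) q y : EuclideanSpace ℝ (Fin m)) =
      h.contactg k q x y := by
  have : FiniteDimensional ℝ E := FiniteDimensional.complexToReal E
  have hA : HasMFDerivAt (𝓡 m) (𝓡 m) (fun q : h.Q => c • q) q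
      (mfderiv (𝓡 m) (𝓡 m) (fun q : h.Q => c • q) q) :=
    ((h.contMDiff_const_smul_circle hi hN c q).mdifferentiableAt (by simp)).hasMFDerivAt
  have h1 := HasMFDerivAt.comp q (h.hasMFDerivAt_incl hi (c • q)) hA
  have h2 := HasMFDerivAt.comp q (C.hasMFDerivAt_smul (Circle.toUnits c) (h.incl q))
    (h.hasMFDerivAt_incl hi q)
  have h3 : ∀ x : EuclideanSpace ℝ (Fin m), h.inclD (c • q)
      (mfderiv (𝓡 m) (𝓡 m) (fun q : h.Q => c • q) q x : EuclideanSpace ℝ (Fin m)) =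
      fibreScaling E (Circle.toUnits c) (h.inclD q x) := fun x =>
    DFunLike.congr_fun (hasMFDerivAt_unique h1 h2) x
  change (h.data k (h.incl (c • q))).metric (h.inclD (c • q) _) (h.inclD (c • q) _) = _
  rw [h3, h3]
  have h4 := (h.isPullback_data k (Circle.toUnits c) (h.incl q)).metric_eq
    (h.data_good hE hk hkJ _) (h.data_good hE hk hkJ _) (h.inclD q x) (h.inclD q y)
  have h5 : ‖(((Circle.toUnits c)⁻¹ : ℂˣ) : ℂ)‖ = 1 := by
    rw [Units.val_inv_eq_inv_val, norm_inv, Circle.toUnits_apply, Units.val_mk0, Circle.norm_coe,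
      inv_one]
  rw [h5, one_mul] at h4
  exact h4.symm

end Invariance

variable [ChartedSpace (EuclideanSpace ℝ (Fin (4 * n + 3))) h.Q]
  (hE : Module.finrank ℂ E = 2 * n + 1)
  (hκ : ∀ (q : h.Q) (u : C.UZ), extChartAt (𝓡 (4 * n + 3)) q (h.normalize u) =
        h.toQModel hE q (extChartAt (modelR E) (h.incl q) u))
include hκ

/-- In the charts of `Q` the circle acts by translations. -/
theorem extChartAt_exp_smul {q₀ q : h.Q} {s : ℝ} (hs : |s| < Real.pi / 2)
    (hq : 0 < ((extChartAt (modelR E) (h.incl q₀) (h.incl q)).2 /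
      C.fibreCoord (h.incl q₀).1).re) :
    extChartAt (𝓡 (4 * n + 3)) q₀ (Circle.exp s • q) =
      extChartAt (𝓡 (4 * n + 3)) q₀ q + s • (realCoord hE).symm (0, 1) := by
  have h1 := hκ q₀ (h.incl (Circle.exp s • q))
  have h2 := hκ q₀ (h.incl q)
  rw [normalize_incl] at h1 h2
  have h3 : (extChartAt (modelR E) (h.incl q₀) (h.incl (Circle.exp s • q))) =
      ((extChartAt (modelR E) (h.incl q₀) (h.incl q)).1,
        Complex.exp (s * Complex.I) * (extChartAt (modelR E) (h.incl q₀) (h.incl q)).2) :=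
    Prod.ext rfl ((C.z_smul _ _ _).trans (by rw [Circle.toUnits_apply, Units.val_mk0, Circle.coe_exp]; rfl))
  rw [h1, h2, h3, toQModel, toQModel, ← map_smul, ← map_add]
  refine congrArg _ (Prod.ext (by simp) ?_)
  simp only [mul_div_assoc]
  rw [arg_exp_mul hq hs]
  simp

omit [ChartedSpace (EuclideanSpace ℝ (Fin (4 * n + 3))) h.Q] hκ in
/-- Near `q₀`, the fibre coordinate relative to `q₀` has positive real part, so that the argument is far
from its cut. -/
theorem eventually_re_pos (q₀ : h.Q) :
    ∀ᶠ q in 𝓝 q₀, 0 < ((extChartAt (modelR E) (h.incl q₀) (h.incl q)).2 /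
      C.fibreCoord (h.incl q₀).1).re := by
  have h1 : ContinuousAt (fun q => ((extChartAt (modelR E) (h.incl q₀) (h.incl q)).2 /
      C.fibreCoord (h.incl q₀).1).re) q₀ :=
    Complex.continuous_re.continuousAt.comp (((continuous_snd.continuousAt.comp
      (ContinuousAt.comp (f := h.incl) (continuousAt_extChartAt (h.incl q₀)) h.continuous_incl.continuousAt))).div_const _)
  refine h1.eventually (lt_mem_nhds ?_)
  beta_reduce
  rw [show (extChartAt (modelR E) (h.incl q₀) (h.incl q₀)).2 = C.fibreCoord (h.incl q₀).1 from
    C.z_idx _, div_self (C.fibreCoord_ne_zero _)]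
  exact one_pos

variable [FiniteDimensional ℂ E] {k : Z → E →L[ℝ] E →L[ℝ] ℝ} (hk : ∀ x, IsPosForm (k x))
  (hkJ : ∀ x v w, k x (Complex.I • v) (Complex.I • w) = k x v w)
  (hi : ContMDiff (𝓡 (4 * n + 3)) (modelR E) ∞ h.incl)
  (hN : ContMDiff (modelR E) (𝓡 (4 * n + 3)) ∞ h.normalize)
  [IsManifold (𝓡 (4 * n + 3)) ∞ h.Q]

include hN in
/-- The Reeb field is constant in the charts of `Q`. -/
theorem vfInChart_contactξ_zero (q₀ : h.Q) : vfInChart (𝓡 (4 * n + 3)) (h.contactξ k 0) q₀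
    =ᶠ[𝓝 (extChartAt (𝓡 (4 * n + 3)) q₀ q₀)] fun _ => (realCoord hE).symm (0, 1) := by
  have : IsManifold (𝓡 (4 * n + 3)) 1 h.Q := IsManifold.of_le (n := ∞) (by simp)
  have h1 := (continuousAt_extChartAt_symm (I := 𝓡 (4 * n + 3)) q₀).tendsto.eventually (by
    rw [(extChartAt (𝓡 (4 * n + 3)) q₀).left_inv (mem_extChartAt_source q₀)]
    exact h.eventually_re_pos q₀)
  filter_upwards [extChartAt_target_mem_nhds (I := 𝓡 (4 * n + 3)) q₀, h1] with y hy hre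
  obtain ⟨p, hp⟩ : ∃ p, p = (extChartAt (𝓡 (4 * n + 3)) q₀).symm y := ⟨_, rfl⟩
  have hps : p ∈ (extChartAt (𝓡 (4 * n + 3)) q₀).source := hp ▸ (extChartAt _ q₀).map_target hy
  rw [← hp] at hre
  obtain ⟨A, hA⟩ : ∃ A : EuclideanSpace ℝ (Fin (4 * n + 3)) →L[ℝ] EuclideanSpace ℝ (Fin (4 * n + 3)),
      A = mfderiv (𝓡 (4 * n + 3)) 𝓘(ℝ, EuclideanSpace ℝ (Fin (4 * n + 3))) (extChartAt (𝓡 (4 * n + 3)) q₀) p := ⟨_, rfl⟩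
  obtain ⟨x, hx⟩ : ∃ x : EuclideanSpace ℝ (Fin (4 * n + 3)), x = h.contactξ k 0 p := ⟨_, rfl⟩
  have e0 : Circle.exp 0 • p = p := by rw [Circle.exp_zero, one_smul]
  have h2 : ∀ p', p' = p → HasMFDerivAt (𝓡 (4 * n + 3))
      𝓘(ℝ, EuclideanSpace ℝ (Fin (4 * n + 3)))
      (extChartAt (𝓡 (4 * n + 3)) q₀) p' A := by
    rintro _ rfl
    rw [hA]
    exact (mdifferentiableAt_extChartAt' (𝓡 (4 * n + 3)) hps).hasMFDerivAt
  have h3 : HasMFDerivAt 𝓘(ℝ, ℝ) (𝓡 (4 * n + 3)) (fun s : ℝ => Circle.exp s • p) 0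
      ((1 : ℝ →L[ℝ] ℝ).smulRight x) := by
    have h4 := h.isMIntegralCurve_exp_smul (k := k) hE hN p 0
    have h5 : ∀ p', p' = p → (h.contactξ k 0 p' : EuclideanSpace ℝ (Fin (4 * n + 3))) = x := by
      rintro _ rfl; exact hx.symm
    have h6 : ((1 : ℝ →L[ℝ] ℝ).smulRight (h.contactξ k 0 (Circle.exp 0 • p) :
        EuclideanSpace ℝ (Fin (4 * n + 3)))) = (1 : ℝ →L[ℝ] ℝ).smulRight x := by
      rw [h5 _ e0]
    exact h6 ▸ h4
  -- the velocity of the orbit of `p` in the chart at `q₀`, computed in two ways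
  have h4 : HasFDerivAt (fun s : ℝ => extChartAt (𝓡 (4 * n + 3)) q₀ (Circle.exp s • p))
      (A ∘L (1 : ℝ →L[ℝ] ℝ).smulRight x) 0 :=
    (HasMFDerivAt.comp (0 : ℝ) (h2 _ e0) h3).hasFDerivAt
  have h5 : HasFDerivAt (fun s : ℝ => extChartAt (𝓡 (4 * n + 3)) q₀ p +
      s • (realCoord hE).symm (0, 1)) ((1 : ℝ →L[ℝ] ℝ).smulRight ((realCoord hE).symm (0, 1))) 0 :=
    ((hasFDerivAt_id (0 : ℝ)).smul_const _).const_add _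
  have h6 := DFunLike.congr_fun (h4.unique (h5.congr_of_eventuallyEq ?_)) (1 : ℝ)
  · have h7 : A x = (realCoord hE).symm (0, 1) := by simpa using h6
    rw [hA, hx, hp] at h7
    exact h7
  · filter_upwards [eventually_abs_lt] with s hs
    exact h.extChartAt_exp_smul hE hκ hs hre

include hk hkJ in
/-- The flow of the Reeb field is by translations in charts, and these are isometries. -/
theorem isKilling_contactξ_zero
    (hks : ∀ x, ContDiffAt ℝ ∞ (bilInChart 𝓘(ℝ, E) k x) (extChartAt 𝓘(ℝ, E) x x)) :
    (h.contactStructure hE hk hkJ hi hN hks).g.IsKilling (h.contactξ k 0) := by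
  refine RiemMetric.isKilling_of_eventually_const (𝓡 (4 * n + 3)) _ _
    (fun q => ⟨_, h.vfInChart_contactξ_zero hE hκ hN q⟩)
    (h.contDiffAt_bilInChart_contactg hE hk hkJ hi hks) fun q v hv => ?_
  have hv' : v = (realCoord hE).symm (0, 1) :=
    hv.trans ((vfInChart_self (𝓡 (4 * n + 3)) (h.contactξ k 0) q).symm.trans
      (h.vfInChart_contactξ_zero hE hκ hN q).self_of_nhds)
  have hcurve : ContinuousAt (fun s : ℝ => Circle.exp s • q) 0 :=
    (h.isMIntegralCurve_exp_smul (k := k) hE hN q 0).continuousAt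
  have hsrc : ∀ᶠ s : ℝ in 𝓝 0, Circle.exp s • q ∈ (extChartAt (𝓡 (4 * n + 3)) q).source := by
    refine hcurve.eventually_mem ?_
    rw [Circle.exp_zero, one_smul]
    exact extChartAt_source_mem_nhds q
  filter_upwards [eventually_abs_lt, hsrc] with s hs hqs
  refine bilInChart_add_of_invariant (𝓡 (4 * n + 3)) (A := fun q : h.Q => Circle.exp s • q)
    ((h.contMDiff_const_smul_circle hi hN _ q).mdifferentiableAt (by simp))
    (h.contactg_smul hE hk hkJ hi hN _ q) hqs ?_
  have h4 := (continuousAt_extChartAt_symm (I := 𝓡 (4 * n + 3)) q).tendsto.eventually (by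
    rw [(extChartAt (𝓡 (4 * n + 3)) q).left_inv (mem_extChartAt_source q)]
    exact h.eventually_re_pos q)
  filter_upwards [extChartAt_target_mem_nhds (I := 𝓡 (4 * n + 3)) q, h4] with y hy hre
  have h5 := h.extChartAt_exp_smul hE hκ hs hre
  rw [(extChartAt (𝓡 (4 * n + 3)) q).right_inv hy, ← hv'] at h5
  exact h5

end ComplexContactStructure.HermitianMetric

end Killing

/-! ### Normality of real hypersurfaces -/

section NormalityOfImmersions

variable {V : Type*} [NormedAddCommGroup V] [NormedSpace ℝ V]
  {W : Type*} [NormedAddCommGroup W] [NormedSpace ℝ W]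

/-- The derivative of the equation `dG ∘ A = j dG + η e(G)`, which defines the structure `(A, η)` induced
by the complex structure `j` on the hypersurface `G`, with the transversal field `e`. -/
theorem fderiv_structure_eq {G : V → W} {A : V → V →L[ℝ] V} {η : V → V →L[ℝ] ℝ} {y : V}
    {j e : W →L[ℝ] W} (hG : ContDiffAt ℝ 2 G y) (hA : DifferentiableAt ℝ A y)
    (hη : DifferentiableAt ℝ η y)
    (h : ∀ᶠ z in 𝓝 y, ∀ v, fderiv ℝ G z (A z v) = j (fderiv ℝ G z v) + η z v • e (G z)) (u v : V) :
    fderiv ℝ G y (fderiv ℝ A y u v) = j (fderiv ℝ (fderiv ℝ G) y u v)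
      + fderiv ℝ η y u v • e (G y) + η y v • e (fderiv ℝ G y u)
      - fderiv ℝ (fderiv ℝ G) y u (A y v) := by
  have hD : HasFDerivAt (fderiv ℝ G) (fderiv ℝ (fderiv ℝ G) y) y :=
    ((hG.fderiv_right (m := 1) (by norm_num)).differentiableAt (by simp)).hasFDerivAt
  have hG' : HasFDerivAt G (fderiv ℝ G y) y := (hG.differentiableAt (by simp)).hasFDerivAt
  have h1 := hD.clm_apply (hA.hasFDerivAt.clm_apply (hasFDerivAt_const v y))
  have h2 := (j.hasFDerivAt.comp y (hD.clm_apply (hasFDerivAt_const v y))).add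
    ((hη.hasFDerivAt.clm_apply (hasFDerivAt_const v y)).smul (e.hasFDerivAt.comp y hG'))
  have h3 := h1.unique (h2.congr_of_eventuallyEq (h.mono fun z hz => hz v))
  have h4 := DFunLike.congr_fun h3 u
  simp only [add_apply, ContinuousLinearMap.comp_apply, ContinuousLinearMap.flip_apply, zero_apply,
    map_zero, smul_apply, ContinuousLinearMap.smulRight_apply, zero_add, Function.comp_apply] at h4
  rw [eq_sub_iff_add_eq, h4]
  abel

/-- The bracket `[A, A]` for the structure induced on a real hypersurface `G` of a complex vector
space by the transversal linear field `e`: the second derivatives of `G` cancel, and up to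
multiples of `e` there remains `-dη` times the field `j e`. -/
theorem exists_fderiv_nijenhuis_eq {G : V → W} {A : V → V →L[ℝ] V} {η : V → V →L[ℝ] ℝ} {y : V}
    {j e : W →L[ℝ] W} (hj : ∀ x, j (j x) = -x) (hje : ∀ x, j (e x) = e (j x))
    (hG : ContDiffAt ℝ 2 G y) (hA : DifferentiableAt ℝ A y) (hη : DifferentiableAt ℝ η y)
    (h : ∀ᶠ z in 𝓝 y, ∀ v, fderiv ℝ G z (A z v) = j (fderiv ℝ G z v) + η z v • e (G z)) (v w : V) :
    ∃ r : ℝ, fderiv ℝ G y (fderiv ℝ A y (A y v) w - fderiv ℝ A y (A y w) v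
        - A y (fderiv ℝ A y v w) + A y (fderiv ℝ A y w v))
      + (fderiv ℝ η y v w - fderiv ℝ η y w v) • j (e (G y)) = r • e (G y) := by
  have hs := hG.isSymmSndFDerivAt (by rw [minSmoothness_of_isRCLikeNormedField])
  have h0 := h.self_of_nhds
  have key := fderiv_structure_eq hG hA hη h
  refine ⟨fderiv ℝ η y (A y v) w - fderiv ℝ η y (A y w) v -
    η y (fderiv ℝ A y v w) + η y (fderiv ℝ A y w v), ?_⟩
  rw [map_add, map_sub, map_sub, h0 (fderiv ℝ A y v w), h0 (fderiv ℝ A y w v), key, key, key, key,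
    h0 v, h0 w, hs.eq (A y w) (A y v), hs.eq w v, hs.eq v (A y w), hs.eq w (A y v)]
  simp only [map_add, map_sub, map_smul, hj, hje, hs.eq v (A y w), hs.eq w (A y v)]
  module

variable {H : Type*} [TopologicalSpace H] (I : ModelWithCorners ℝ V H) [I.Boundaryless]
  {M : Type*} [TopologicalSpace M] [ChartedSpace H M] [IsManifold I ∞ M]

set_option synthInstance.maxHeartbeats 200000 in
/-- Normality of the almost contact structure `(A, ξ, η)` induced on a real hypersurface of a complex
vector space by a transversal linear field `e`. -/
theorem nijenhuis_add_dOne_smul_eq_zero [FiniteDimensional ℝ V]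
    {A : ∀ x : M, TangentSpace I x →L[ℝ] TangentSpace I x} {η : ∀ x : M, TangentSpace I x →L[ℝ] ℝ}
    {ξ X Y : ∀ x : M, TangentSpace I x} {x : M} {G : V → W} {j e : W →L[ℝ] W}
    (hX : IsSmoothVF I X) (hY : IsSmoothVF I Y)
    (hA : ContDiffAt ℝ ∞ (endInChart I A x) (extChartAt I x x))
    (hη : ContDiffAt ℝ ∞ (covectorInChart I η x) (extChartAt I x x))
    (hG : ContDiffAt ℝ ∞ G (extChartAt I x x))
    (hj : ∀ x, j (j x) = -x) (hje : ∀ x, j (e x) = e (j x))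
    (h : ∀ᶠ z in 𝓝 (extChartAt I x x), ∀ v, fderiv ℝ G z (endInChart I A x z v) =
      j (fderiv ℝ G z v) + covectorInChart I η x z v • e (G z))
    (hξ : fderiv ℝ G (extChartAt I x x) (ξ x) = j (e (G (extChartAt I x x))))
    (hinj : Function.Injective (fderiv ℝ G (extChartAt I x x))) {τ : W →L[ℝ] ℝ}
    (hτ : ∀ v, τ (fderiv ℝ G (extChartAt I x x) v) = 0)
    (hτe : τ (e (G (extChartAt I x x))) ≠ 0)
    (hτje : τ (j (e (G (extChartAt I x x)))) = 0) :
    nijenhuis I A X Y x + (2 * dOne I η x (X x) (Y x)) • ξ x = 0 := by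
  have hdA := hA.differentiableAt (by simp)
  have hdη := hη.differentiableAt (by simp)
  obtain ⟨a, ha⟩ : ∃ a : V →L[ℝ] V, a = endInChart I A x (extChartAt I x x) := ⟨_, rfl⟩
  obtain ⟨D, hD⟩ : ∃ D : V →L[ℝ] V →L[ℝ] V, D = fderiv ℝ (endInChart I A x) (extChartAt I x x) :=
    ⟨_, rfl⟩
  obtain ⟨v, hv⟩ : ∃ v : V, v = X x := ⟨_, rfl⟩
  obtain ⟨w, hw⟩ : ∃ w : V, w = Y x := ⟨_, rfl⟩
  obtain ⟨c, hc⟩ : ∃ c : V, c = ξ x := ⟨_, rfl⟩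
  have h1 := nijenhuis_eq I hdA (((isSmoothVF_iff I X).1 hX x).differentiableAt (by simp))
    (((isSmoothVF_iff I Y).1 hY x).differentiableAt (by simp)) a
    (fun v => by rw [ha]; exact endInChart_self I A x v) D hD v w hv hw
  obtain ⟨r, hr⟩ := exists_fderiv_nijenhuis_eq hj hje (hG.of_le (WithTop.coe_le_coe.2 le_top)) hdA
    hdη h v w
  have h2 := dOne_eq_fderiv I hdη v w
  rw [← ha, ← hD, ← h2, ← hξ] at hr
  -- the transversal component: `τ` vanishes on the tangent space and on `j e`, but not on `e`
  have hr0 : r = 0 := by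
    have h3 := congrArg τ hr
    rw [map_add, map_smul, map_smul, hτ, hξ, hτje, smul_zero, add_zero] at h3
    exact (smul_eq_zero.1 h3.symm).resolve_right hτe
  rw [hr0, zero_smul] at hr
  have h4 : D (a v) w - D (a w) v - a (D v w) + a (D w v) + dOne I η x v w • c = 0 := by
    apply hinj
    rw [map_add, map_smul, map_zero, hc]
    exact hr
  have h5 : (2 : ℝ) • (D (a v) w - D (a w) v - a (D v w) + a (D w v)) +
      (2 * dOne I η x v w) • c = 0 := by
    rw [mul_smul, ← smul_add, h4, smul_zero]
  have h6 : ∀ z : V, z = (2 : ℝ) • (D (a v) w - D (a w) v - a (D v w) + a (D w v)) →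
      z + (2 * dOne I η x v w) • c = 0 := by rintro _ rfl; exact h5
  subst hv hw hc
  exact h6 _ h1

end NormalityOfImmersions

/-! ### Normality of the unit circle bundle -/

section Normality

universe w

variable {n : ℕ} {E : Type*} [NormedAddCommGroup E] [NormedSpace ℂ E]
  {Z : Type*} [TopologicalSpace Z] [ChartedSpace E Z] [IsManifold 𝓘(ℂ, E) ω Z]

theorem ComplexContactStructure.mfderiv_extChartAt_complex (C : ComplexContactStructure.{w} n E Z)
    {u₀ u : C.UZ} (hu : u ∈ (extChartAt (modelR E) u₀).source) :
    ∃ A : (E × ℂ) →L[ℂ] (E × ℂ), ∀ v : E × ℂ,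
      (mfderiv (modelR E) 𝓘(ℝ, E × ℂ) (extChartAt (modelR E) u₀) u v : E × ℂ) = A v :=
  ⟨mfderiv (modelC E) 𝓘(ℂ, E × ℂ) (extChartAt (modelC E) u₀) u,
    (isRealification_model E).mfderiv_apply (isRealification_self (F := E × ℂ))
      (mdifferentiableAt_extChartAt' (modelC E) (x₀ := u₀) (p := u) hu)⟩

namespace ComplexContactStructure.HermitianMetric

variable {C : ComplexContactStructure.{w} n E Z} (h : C.HermitianMetric)
  [FiniteDimensional ℂ E] {k : Z → E →L[ℝ] E →L[ℝ] ℝ} {m : ℕ}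
  [ChartedSpace (EuclideanSpace ℝ (Fin m)) h.Q]
  (hE : Module.finrank ℂ E = 2 * n + 1) (hk : ∀ x, IsPosForm (k x))
  (hkJ : ∀ x v w, k x (Complex.I • v) (Complex.I • w) = k x v w)
  (hi : ContMDiff (𝓡 m) (modelR E) ∞ h.incl) (hN : ContMDiff (modelR E) (𝓡 m) ∞ h.normalize)
  [IsManifold (𝓡 m) ∞ h.Q]

include hi in
omit [FiniteDimensional ℂ E] in
theorem fderiv_chart_incl (q : h.Q) (v : EuclideanSpace ℝ (Fin m)) :
    fderiv ℝ (extChartAt (modelR E) (h.incl q) ∘ h.incl ∘ (extChartAt (𝓡 m) q).symm)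
      (extChartAt (𝓡 m) q q) v = h.inclD q v := by
  have : IsManifold (𝓡 m) 1 h.Q := IsManifold.of_le (n := ∞) (by simp)
  have : IsManifold (modelR E) 1 C.UZ := IsManifold.of_le (n := ∞) (by simp)
  have h1 := fderiv_chart_comp_mfderiv (modelR E) (𝓡 m) (f := h.incl)
    (mem_extChartAt_source (I := 𝓡 m) q) (mem_extChartAt_source (I := modelR E) (h.incl q))
    ((hi q).mdifferentiableAt (by simp)) v
  have h2 : (mfderiv (𝓡 m) 𝓘(ℝ, EuclideanSpace ℝ (Fin m)) (extChartAt (𝓡 m) q) q v :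
    EuclideanSpace ℝ (Fin m)) = v := mfderiv_extChartAt_self_apply (𝓡 m) q v
  refine (congrArg _ h2.symm).trans (h1.trans ?_)
  exact mfderiv_extChartAt_self_apply (modelR E) (h.incl q) (h.inclD q v)

include hE hi hN in
/-- In charts, the inclusion of `Q` intertwines `Φ₁` and `√-1` modulo the Euler field. -/
theorem eventually_fderiv_chart_incl (q : h.Q) : ∀ᶠ y in 𝓝 (extChartAt (𝓡 m) q q),
    ∀ v, fderiv ℝ (extChartAt (modelR E) (h.incl q) ∘ h.incl ∘ (extChartAt (𝓡 m) q).symm) y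
        (endInChart (𝓡 m) (h.contactΦ k 0) q y v) =
      Complex.I • fderiv ℝ (extChartAt (modelR E) (h.incl q) ∘ h.incl ∘ (extChartAt (𝓡 m) q).symm) y v
        + covectorInChart (𝓡 m) (h.contactη k 0) q y v •
          ((0, ((extChartAt (modelR E) (h.incl q) ∘ h.incl ∘ (extChartAt (𝓡 m) q).symm) y).2) : E × ℂ) := by
  have : IsManifold (𝓡 m) 1 h.Q := IsManifold.of_le (n := ∞) (by simp)
  have : IsManifold (modelR E) 1 C.UZ := IsManifold.of_le (n := ∞) (by simp)
  filter_upwards [eventually_mem_chart_source (modelR E) (𝓡 m) hi q] with y hy v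
  have hd := (hi ((extChartAt (𝓡 m) q).symm y)).mdifferentiableAt (by simp)
  have h1 := fderiv_chart_comp_apply (modelR E) (𝓡 m) hy.1 hy.2 hd v
  have h2 := fderiv_chart_comp_apply (modelR E) (𝓡 m) hy.1 hy.2 hd
    (endInChart (𝓡 m) (h.contactΦ k 0) q y v)
  obtain ⟨A, hA⟩ := C.mfderiv_extChartAt_complex hy.2
  have h3 := C.mfderiv_extChartAt_fibre 1 hy.2
  rw [one_mul, one_mul, hA] at h3
  obtain ⟨w, hw⟩ : ∃ w : EuclideanSpace ℝ (Fin m), w = mfderiv 𝓘(ℝ, EuclideanSpace ℝ (Fin m)) (𝓡 m)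
    (extChartAt (𝓡 m) q).symm y v := ⟨_, rfl⟩
  obtain ⟨p, hp⟩ : ∃ p, p = (extChartAt (𝓡 m) q).symm y := ⟨_, rfl⟩
  have h4 : (mfderiv 𝓘(ℝ, EuclideanSpace ℝ (Fin m)) (𝓡 m) (extChartAt (𝓡 m) q).symm y
      (endInChart (𝓡 m) (h.contactΦ k 0) q y v) : EuclideanSpace ℝ (Fin m)) =
      h.contactΦ k 0 ((extChartAt (𝓡 m) q).symm y) w := by
    rw [hw]
    exact mfderiv_symm_mfderiv (𝓡 m) hy.1 _
  have h5 : fderiv ℝ (extChartAt (modelR E) (h.incl q) ∘ h.incl ∘ (extChartAt (𝓡 m) q).symm) y v =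
      A (h.inclD ((extChartAt (𝓡 m) q).symm y) w) := by
    rw [hw]
    exact h1.trans (hA _)
  have h6 : fderiv ℝ (extChartAt (modelR E) (h.incl q) ∘ h.incl ∘ (extChartAt (𝓡 m) q).symm) y
        (endInChart (𝓡 m) (h.contactΦ k 0) q y v) =
      A (h.inclD ((extChartAt (𝓡 m) q).symm y)
        (h.contactΦ k 0 ((extChartAt (𝓡 m) q).symm y) w)) := by
    rw [← h4]
    exact h2.trans (hA _)
  have h7 : covectorInChart (𝓡 m) (h.contactη k 0) q y v =
    h.contactη k 0 ((extChartAt (𝓡 m) q).symm y) w := by rw [hw]; rfl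
  have h8 : A (h.data k (h.incl ((extChartAt (𝓡 m) q).symm y))).eps =
      (0, ((extChartAt (modelR E) (h.incl q) ∘ h.incl ∘ (extChartAt (𝓡 m) q).symm) y).2) := by
    rw [h.data_eps k hE]
    exact h3
  have e : ∀ (a b : E × ℂ) (r : ℝ), A (Complex.I • a + r • b) = Complex.I • A a + r • A b := by
    intro a b r
    have h9 : A (r • b) = r • A b := (A.restrictScalars ℝ).map_smul r b
    rw [map_add, map_smul, h9]
  rw [h6, h5, h7, ← h8, h.inclD_contactΦ hE hi hN, ← e]
  rfl

include hE hk hkJ hi hN in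
/-- In a holomorphic chart of `L^×`, the circle bundle is a real hypersurface of `E × ℂ`, and the Euler
field is the linear field `(x, ζ) ↦ (0, ζ)`. -/
theorem isNormal_contactStructure
    (hks : ∀ x, ContDiffAt ℝ ∞ (bilInChart 𝓘(ℝ, E) k x) (extChartAt 𝓘(ℝ, E) x x)) :
    (h.contactStructure hE hk hkJ hi hN hks).IsNormal 0 := by
  intro X Y hX hY q
  have hs := h.isSphere hi hN k hE q
  have hc := h.isHyperhermitianCone_data hE hk hkJ q
  have he : (extChartAt (modelR E) (h.incl q) ∘ h.incl ∘ (extChartAt (𝓡 m) q).symm)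
      (extChartAt (𝓡 m) q q) = extChartAt (modelR E) (h.incl q) (h.incl q) :=
    chart_comp_self (modelR E) (𝓡 m) q
  have he2 : (ContinuousLinearMap.inr ℝ E ℂ ∘L ContinuousLinearMap.snd ℝ E ℂ)
      ((extChartAt (modelR E) (h.incl q) ∘ h.incl ∘ (extChartAt (𝓡 m) q).symm)
      (extChartAt (𝓡 m) q q)) = (h.data k (h.incl q)).eps := by
    rw [he, h.data_eps k hE]
    exact Prod.ext rfl (C.z_idx (h.incl q))
  refine nijenhuis_add_dOne_smul_eq_zero (𝓡 m) (A := h.contactΦ k 0) (η := h.contactη k 0)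
    (ξ := h.contactξ k 0)
    (G := extChartAt (modelR E) (h.incl q) ∘ h.incl ∘ (extChartAt (𝓡 m) q).symm)
    (j := (h.data k (h.incl q)).J)
    (e := ContinuousLinearMap.inr ℝ E ℂ ∘L ContinuousLinearMap.snd ℝ E ℂ)
    (τ := (h.data k (h.incl q)).τ) hX hY
    (h.contDiffAt_endInChart_contactΦ hE hk hkJ hi hN hks 0 q)
    (h.contDiffAt_covectorInChart_contactη hE hk hkJ hi hks 0 (mem_extChartAt_target q))
    (contDiffAt_chart_comp_self (modelR E) (𝓡 m) hi q) (h.data_J_J k _)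
    (fun x => Prod.ext (smul_zero _) rfl)
    (h.eventually_fderiv_chart_incl hE hi hN q) ?_ ?_ (fun v => ?_) ?_ ?_
  · rw [he2]
    refine (h.fderiv_chart_incl hi q _).trans ?_
    refine (hs.i_p _).trans ?_
    rw [hc.τ_J_ε, zero_smul, sub_zero]
    rfl
  · intro v w hvw
    refine h.inclD_injective hi hN q ?_
    rw [← h.fderiv_chart_incl hi, ← h.fderiv_chart_incl hi]
    exact hvw
  · rw [h.fderiv_chart_incl hi]
    exact hs.τ_i v
  · rw [he2, hc.τ_ε]
    exact one_ne_zero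
  · rw [he2]
    exact hc.τ_J_ε 0

end ComplexContactStructure.HermitianMetric

end Normality

/-! ### The fundamental forms and the theorem -/

section Assembly

universe w

variable {n : ℕ} {E : Type*} [NormedAddCommGroup E] [NormedSpace ℂ E] [FiniteDimensional ℂ E]
  {Z : Type*} [TopologicalSpace Z] [ChartedSpace E Z] [IsManifold 𝓘(ℂ, E) ω Z]

namespace ComplexContactStructure.HermitianMetric

variable {C : ComplexContactStructure.{w} n E Z} (h : C.HermitianMetric)
  {k : Z → E →L[ℝ] E →L[ℝ] ℝ} (hE : Module.finrank ℂ E = 2 * n + 1) (hk : ∀ x, IsPosForm (k x))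
  (hkJ : ∀ x v w, k x (Complex.I • v) (Complex.I • w) = k x v w)
include hE hk hkJ

/-- The fundamental form of the second almost complex structure is the real part of `dϑ`. -/
theorem metric_J₃_one (u : C.UZ) (v w : E × ℂ) :
    (h.data k u).metric ((h.data k u).J₃ 1 v) w = (C.upsilon u ![v, w]).re :=
  ((h.data_good hE hk hkJ u).metric_J₂ v w).trans (h.data_w k u v w)

/-- The fundamental form of the third almost complex structure is the imaginary part of `dϑ`. -/
theorem metric_J₃_two (u : C.UZ) (v w : E × ℂ) :
    (h.data k u).metric ((h.data k u).J₃ 2 v) w = (-Complex.I * C.upsilon u ![v, w]).re := by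
  refine ((h.data_good hE hk hkJ u).metric_J_J₂ v w).trans ?_
  rw [h.data_w, h.data_J, C.upsilon_smul_left, ← Complex.neg_re, ← neg_mul]

end ComplexContactStructure.HermitianMetric

end Assembly

theorem corollary4 {n : ℕ} (hn : 1 ≤ n)
    {E : Type*} [NormedAddCommGroup E] [NormedSpace ℂ E] (hE : Module.finrank ℂ E = 2 * n + 1)
    {Z : Type*} [TopologicalSpace Z] [T2Space Z] [SecondCountableTopology Z]
    [ChartedSpace E Z] [IsManifold 𝓘(ℂ, E) ω Z]
    (C : ComplexContactStructure n E Z) :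
    -- `𝓤(Z) = Tot(L^×)` is a holomorphic principal `ℂ^×`-bundle over `Z`
    IsPrincipalBundle 𝓘(ℂ, ℂ) (modelC E) 𝓘(ℂ, E) ω ℂˣ C.proj ∧
    -- `L` has Hermitian structures; let `h` be any of them, with unit circle bundle `Q = Q(L)`
    Nonempty C.HermitianMetric ∧
    ∀ h : C.HermitianMetric,
      -- `Q` is a smooth manifold, such that `u ↦ (u / ‖u‖, log ‖u‖)` is a diffeomorphism
      -- from `𝓤(Z)` to `Q × ℝ`, and `Q` is a principal `U(1)`-bundle over `Z`
      ∃ (_ : ChartedSpace (EuclideanSpace ℝ (Fin (4 * n + 3))) h.Q)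
        (_ : IsManifold (𝓡 (4 * n + 3)) ∞ h.Q),
      (∃ Ψ : Diffeomorph (modelR E) ((𝓡 (4 * n + 3)).prod 𝓘(ℝ, ℝ)) C.UZ (h.Q × ℝ) ∞,
        ∀ u, Ψ u = (h.normalize u, h.t u)) ∧
      IsPrincipalBundle (𝓡 1) (𝓡 (4 * n + 3)) 𝓘(ℝ, E) ∞ Circle h.projQ ∧
      -- an almost contact metric 3-structure on `Q`
      ∃ S : AlmostContactMetric3Structure (𝓡 (4 * n + 3)) h.Q,
        -- `(Φ_1, ξ_1, η_1)` is normal, `Z` is the space of leaves of `ξ_1` (whose flow is the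
        -- action of `U(1)`), and `ξ_1` is Killing
        S.IsNormal 0 ∧
        (∀ q : h.Q, IsMIntegralCurve (fun s : ℝ => Circle.exp s • q) (S.ξ 0)) ∧
        (∀ q q' : h.Q, h.projQ q = h.projQ q' ↔ ∃ s : ℝ, Circle.exp s • q = q') ∧
        S.g.IsKilling (S.ξ 0) ∧
        -- `η_2`, `η_3` are contact forms which define the same volume form, and
        -- `(g_Q, Φ_α, ξ_α, η_α)`, `α = 2, 3`, are contact metric structures
        S.IsContactMetric (2 * n + 1) 1 ∧
        S.IsContactMetric (2 * n + 1) 2 ∧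
        (∀ q : h.Q,
          wedgePow (S.η 1 q) (dOne (𝓡 (4 * n + 3)) (S.η 1) q) (2 * n + 1) =
            wedgePow (S.η 2 q) (dOne (𝓡 (4 * n + 3)) (S.η 2) q) (2 * n + 1)) ∧
        -- `η_2` and `η_3` are the real and imaginary parts of the restriction of `ϑ` to `Q`
        (∀ (q : h.Q) (X : TangentSpace (𝓡 (4 * n + 3)) q),
          (S.η 1 q X : ℂ) + Complex.I * (S.η 2 q X : ℂ) =
            C.vartheta (h.incl q) (mfderiv (𝓡 (4 * n + 3)) (modelR E) h.incl q X)) ∧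
        -- an almost hyperhermitian structure on `𝓤(Z)`, which corresponds on `Q × ℝ` to
        -- `I_α X = Φ_α X - η_α(X) d/dt`, `I_α (d/dt) = ξ_α`, `g = e^t (g_Q + dt ⊗ dt)`
        ∃ T : AlmostHyperhermitianStructure (modelR E) C.UZ,
          (∀ (α : Fin 3) (u : C.UZ) (X : TangentSpace (modelR E) u),
            mfderiv (modelR E) (𝓡 (4 * n + 3)) h.normalize u (T.J α u X) =
                S.Φ α (h.normalize u) (mfderiv (modelR E) (𝓡 (4 * n + 3)) h.normalize u X) +
                  h.dt u X • S.ξ α (h.normalize u) ∧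
            h.dt u (T.J α u X) =
                -S.η α (h.normalize u)
                  (mfderiv (modelR E) (𝓡 (4 * n + 3)) h.normalize u X)) ∧
          (∀ (u : C.UZ) (X Y : TangentSpace (modelR E) u),
            T.g.inner u X Y = Real.exp (h.t u) *
              (S.g.inner (h.normalize u)
                  (mfderiv (modelR E) (𝓡 (4 * n + 3)) h.normalize u X)
                  (mfderiv (modelR E) (𝓡 (4 * n + 3)) h.normalize u Y) +
                h.dt u X * h.dt u Y)) ∧
          -- `I_1` is the natural complex structure and `[I_1, I_1] = 0`
          (∀ u : C.UZ, T.J 0 u = C.naturalJ u) ∧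
          (∀ X Y : ∀ u : C.UZ, TangentSpace (modelR E) u, IsSmoothVF (modelR E) X →
            IsSmoothVF (modelR E) Y → ∀ u, nijenhuis (modelR E) (T.J 0) X Y u = 0) ∧
          -- `ω_2`, `ω_3` are symplectic, `Υ = ω_2 + √-1 ω_3 = dϑ` is a holomorphic symplectic form
          (∃ ω₂ ω₃ : ∀ u : C.UZ, TangentSpace (modelR E) u [⋀^Fin 2]→L[ℝ] ℝ,
            (∀ u X Y, ω₂ u ![X, Y] = T.g.inner u (T.J 1 u X) Y) ∧
            (∀ u X Y, ω₃ u ![X, Y] = T.g.inner u (T.J 2 u X) Y) ∧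
            IsSymplecticForm (modelR E) ∞ ω₂ ∧
            IsSymplecticForm (modelR E) ∞ ω₃ ∧
            ∃ Υ : ∀ u : C.UZ, TangentSpace (modelC E) u [⋀^Fin 2]→L[ℂ] ℂ,
              IsSymplecticForm (modelC E) ω Υ ∧
              (∀ u, Υ u = extDerivForm (modelC E) (oneForm (modelC E) C.vartheta) u) ∧
              ∀ (u : C.UZ) (X Y : TangentSpace (modelR E) u),
                Υ u ![X, Y] = (ω₂ u ![X, Y] : ℂ) + Complex.I * (ω₃ u ![X, Y] : ℂ)) := by
  have : FiniteDimensional ℂ E := Module.finite_of_finrank_pos (by omega)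
  have : FiniteDimensional ℝ E := FiniteDimensional.complexToReal E
  refine ⟨C.isPrincipalBundle_proj, C.nonempty_hermitianMetric, fun h => ?_⟩
  obtain ⟨k, hk, hkJ, hks⟩ := exists_hermitianMetric E Z
  obtain ⟨cs, hm, hi, hN, hκ⟩ := h.exists_chartedSpace hE
  have hdim : 4 * n + 3 = 2 * (2 * n + 1) + 1 := by ring
  refine ⟨cs, hm, h.exists_diffeomorph hi hN, h.isPrincipalBundle_projQ hi hN,
    h.contactStructure hE hk hkJ hi hN hks, h.isNormal_contactStructure hE hk hkJ hi hN hks,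
    h.isMIntegralCurve_exp_smul hE hN, h.projQ_eq_iff,
    h.isKilling_contactξ_zero hE hκ hk hkJ hi hN hks,
    h.isContactMetric_one hE hk hkJ hi hN hks hdim,
    h.isContactMetric_two hE hk hkJ hi hN hks hdim,
    h.wedgePow_contactη hE hk hkJ hi hN hdim, h.contactη_add_I_mul hE hk hkJ,
    h.hyperhermitian hE hk hkJ hks,
    fun α u X => ⟨h.normD_J₃ hE hk hkJ hi hN α u X, h.dt_J₃ hE hk hkJ hi hN α u X⟩,
    h.metric_eq_exp_mul hE hk hkJ hi hN, fun u => rfl,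
    h.nijenhuis_hyperhermitian_zero hE hk hkJ hks, ?_⟩
  have hΥ := C.isSymplecticForm_upsilon hE
  refine ⟨fun u => reForm (E × ℂ) 2 (C.upsilon u),
    fun u => reForm (E × ℂ) 2 ((-Complex.I) • C.upsilon u), fun u X Y => ?_, fun u X Y => ?_,
    (isRealification_model E).isSymplecticForm_reForm hΥ,
    (isRealification_model E).isSymplecticForm_reForm
      (hΥ.const_smul (neg_ne_zero.2 Complex.I_ne_zero)),
    C.upsilon, hΥ, fun u => rfl, fun u X Y => ?_⟩
  · exact (h.metric_J₃_one hE hk hkJ u X Y).symm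
  · exact (h.metric_J₃_two hE hk hkJ u X Y).symm
  · have e : ∀ z : ℂ, z = (z.re : ℂ) + Complex.I * (((-Complex.I) * z).re : ℂ) := fun z => by
      apply Complex.ext <;> simp
    exact e _
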